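/- **Definitions.** Let $T$ be a string of length $n$ over a linearly ordered alphabet, with positions numbered $0,\dots,n-1$. An *LZ-like encoding* of $T$ cuts $T$ into consecutive phrases, each encoded either as $(1,c)$, where $c$ is the single symbol of the phrase, or as $(\ell,s)$ with $\ell\ge 2$, where the phrase $T[b..b+\ell)$ starts at position $b$ and its source $s<b$ is a previous occurrence of it, $T[s..s+\ell)=T[b..b+\ell)$ (the two may overlap). The *height* of a position is $0$ in a phrase $(1,c)$, and $\mathrm{height}(b+k)=\mathrm{height}\bigl(s+(k \bmod (b-s))\bigr)+1$ for $0\le k<\ell$ in a phrase $(\ell,s)$ starting at $b$. The encoding is *$h$-bounded* if all heights are at most $h$. Given the phrases for $T[0..b)$, a previous occurrence $s<b$ of $T[b..b+\ell)$ *satisfies the height constraint* if $\mathrm{height}\bigl(s+(k\bmod (b-s))\bigr)+1\le h$ for all $0\le k<\ell$. The *LZHB3 encoding* of $T$ with height bound $h$ is built greedily from left to right: the phrase starting at $b$ has the largest length $\ell$ such that, for all $1\le \ell'\le \ell$, some previous occurrence of $T[b..b+\ell')$ satisfies the height constraint, and its source is the leftmost occurrence of $T[b..b+\ell)$ that satisfies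 the height constraint; if $\ell\le 1$, the phrase is $(1,T[b])$. **Theorem.** For every constant $h\ge 0$ there are a program for the word RAM described below and a constant $C$, both independent of the alphabet and of the string, such that for every string $T$ of length $n$ with $\sigma$ distinct symbols over any linearly ordered alphabet the program halts on $T$ and outputs the LZHB3 encoding of $T$ with height bound $h$, which is an $h$-bounded LZ-like encoding of $T$. It does so on-line, in $O(n\log\sigma)$ time and $O(n)$ space. Precisely: * each phrase is output when at most one symbol beyond its end has been received; * the number of steps is at most $C\,\bigl(n(\lfloor\log_2\sigma\rfloor+1)+1\bigr)$ (with $\log_2 0$ read as $0$); * the number of memory words used (all memory up to the highest address accessed, and the text) is at most $C(n+1)$, and all numbers assigned are at most $C(n+1)$, so that words have $O(\log n)$ bits. **Machine.** The word RAM has finitely many registers and an indirectly addressed memory, all holding natural numbers and initially $0$; constants, addition, truncated subtraction, multiplication, load, store, comparison of registers, branching and loops. It receives the input symbols one at a time from left to right and is told when the input has ended; a received symbol stays available at its position, and symbols can only be compared with each other (for order or equality) and output. Every instruction and every test takes one step. -/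

import Mathlib

universe u

namespace LZHB

/-! ### LZ-like encodings, referencing heights, and the greedy rule LZHB3

Positions of a string are numbered from `0`. -/

/-- A phrase of an LZ-like encoding: `lit c` is the pair `(1, c)`, and `copy len src` is the pair
`(len, src)` for a phrase of length `len` whose source is the position `src`. -/
inductive Phrase (α : Type u) where
  | lit (c : α) : Phrase α
  | copy (len src : ℕ) : Phrase α

/-- The number of symbols that a phrase stands for. -/
def Phrase.len {α : Type u} : Phrase α → ℕ
  | .lit _ => 1
  | .copy l _ => l

/-- The number of symbols that an encoding stands for. -/
def coveredLen {α : Type u} (E : List (Phrase α)) : ℕ := (E.map Phrase.len).sum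

/-- `l` symbols can be read from position `b` of `T` on, and `s < b` is a previous occurrence of
the substring that they form. The two occurrences may overlap (self-reference). -/
def IsPrevOcc {α : Type u} (T : List α) (b l s : ℕ) : Prop :=
  b + l ≤ T.length ∧ s < b ∧ ∀ k < l, T[s + k]? = T[b + k]?

/-- The phrase `p` can start at position `b` of `T`: it is the single symbol there, or it has length
at least `2` and its source is a previous occurrence. -/
def IsPhraseAt {α : Type u} (T : List α) (b : ℕ) : Phrase α → Prop
  | .lit c => T[b]? = some c
  | .copy l s => 2 ≤ l ∧ IsPrevOcc T b l s

/-- `E` is an LZ-like encoding of `T`. -/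
def IsLZEncoding {α : Type u} (T : List α) (E : List (Phrase α)) : Prop :=
  coveredLen E = T.length ∧
    ∀ (j : ℕ) (p : Phrase α), E[j]? = some p → IsPhraseAt T (coveredLen (E.take j)) p

/-- From the heights `H` of the positions before a phrase, the heights up to the end of that phrase.
With `b = H.length` the starting position, the `k`-th position of the phrase `(l, s)` refers to
position `s + k mod (b - s)`, and its height is one more than the height there. -/
def extendHeights {α : Type u} (H : List ℕ) : Phrase α → List ℕ
  | .lit _ => H ++ [0]
  | .copy l s => H ++ (List.range l).map fun k => H.getD (s + k % (H.length - s)) 0 + 1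

/-- The heights in the referencing forest of all positions of the encoded string. -/
def heights {α : Type u} (E : List (Phrase α)) : List ℕ := E.foldl extendHeights []

/-- The encoding is `h`-bounded. -/
def IsBounded {α : Type u} (h : ℕ) (E : List (Phrase α)) : Prop := ∀ x ∈ heights E, x ≤ h

/-- With `H` the heights of the positions before `b = H.length`: the position `s` is a previous
occurrence of the length-`l` substring of `T` at `b`, and referring to it gives heights at
most `h`. -/
def Admissible {α : Type u} (h : ℕ) (T : List α) (H : List ℕ) (l s : ℕ) : Prop :=
  IsPrevOcc T H.length l s ∧ ∀ k < l, H.getD (s + k % (H.length - s)) 0 + 1 ≤ h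

/-- `p` is the phrase that the rule LZHB3 selects at position `H.length` of `T`. Let `l` be the
largest length such that for all `1 ≤ l' ≤ l` the length-`l'` substring there has a previous
occurrence satisfying the height constraint. If `l ≤ 1`, the phrase is the single symbol there;
otherwise it has length `l` and its source is the leftmost occurrence that satisfies the height
constraint. -/
def IsNextPhrase {α : Type u} (h : ℕ) (T : List α) (H : List ℕ) (p : Phrase α) : Prop :=
  ∃ l : ℕ, IsGreatest {m | ∀ l', 1 ≤ l' → l' ≤ m → ∃ s, Admissible h T H l' s} l ∧
    match p with
    | .lit c => l ≤ 1 ∧ T[H.length]? = some c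
    | .copy m s => 2 ≤ l ∧ m = l ∧ IsLeast {s' | Admissible h T H l s'} s

/-- `E` is the LZHB3 encoding of `T` with height bound `h`. -/
def IsLZHB3 {α : Type u} (h : ℕ) (T : List α) (E : List (Phrase α)) : Prop :=
  coveredLen E = T.length ∧
    ∀ (j : ℕ) (p : Phrase α), E[j]? = some p → IsNextPhrase h T (heights (E.take j)) p

/-! ### A word RAM with one-way input over a general ordered alphabet

The machine has registers (finitely many are named by a program) and one memory with indirect
addressing, both holding numbers. Input symbols are received one at a time; a received symbol
stays available at its position in the text, and symbols can only be compared with each other (and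
copied to the output). Every instruction and every test costs one step. -/

/-- The arithmetic operations; subtraction is truncated at `0`. -/
inductive Arith where
  | add | sub | mul

/-- The result of an arithmetic operation. -/
def Arith.eval : Arith → ℕ → ℕ → ℕ
  | .add, x, y => x + y
  | .sub, x, y => x - y
  | .mul, x, y => x * y

/-- Tests. `lt a b` and `eq a b` compare the contents of the registers `a` and `b`; `symLt a b` and
`symEq a b` compare the symbols at the two text positions that these registers contain. -/
inductive Test where
  | lt (a b : ℕ)
  | eq (a b : ℕ)
  | symLt (a b : ℕ)
  | symEq (a b : ℕ)

/-- Programs. Arguments `a b d` are names of registers. -/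
inductive Prog where
  /-- register `d` becomes the constant `c` -/
  | const (d c : ℕ)
  /-- register `d` becomes the result of the operation `o` on the registers `a` and `b` -/
  | arith (o : Arith) (d a b : ℕ)
  /-- register `d` becomes the content of the memory cell whose address is in register `a` -/
  | load (d a : ℕ)
  /-- the memory cell whose address is in register `a` becomes the content of register `b` -/
  | store (a b : ℕ)
  /-- receive the next input symbol if there is one; register `d` tells whether there was -/
  | read (d : ℕ)
  /-- output the phrase `(1, c)`, for `c` the symbol at the text position in register `a` -/
  | outLit (a : ℕ)
  /-- output the phrase `(len, src)`, for `len` in register `a` and `src` in register `b` -/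
  | outCopy (a b : ℕ)
  | seq (P Q : Prog)
  | cond (c : Test) (P Q : Prog)
  | loop (c : Test) (P : Prog)

/-- States of the machine on an input over `α`. The fields `top` and `peak` are bookkeeping that no
instruction can consult. -/
structure State (α : Type u) where
  /-- contents of the registers -/
  reg : ℕ → ℕ
  /-- contents of the memory -/
  mem : ℕ → ℕ
  /-- the input symbols received so far -/
  text : List α
  /-- the input symbols not yet received -/
  rest : List α
  /-- the output so far, each phrase with the number of symbols received when it was output -/
  out : List (Phrase α × ℕ)
  /-- all memory addresses accessed so far are smaller than `top` -/
  top : ℕ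
  /-- all numbers assigned so far are at most `peak` -/
  peak : ℕ

namespace State

variable {α : Type u}

/-- The initial state on input `T`. -/
def init (T : List α) : State α where
  reg := fun _ => 0
  mem := fun _ => 0
  text := []
  rest := T
  out := []
  top := 0
  peak := 0

/-- Assign the number `v` to register `d`. -/
def setReg (s : State α) (d v : ℕ) : State α :=
  { s with reg := Function.update s.reg d v, peak := max s.peak v }

/-- Record an access to the memory cell with address `x`. -/
def touch (s : State α) (x : ℕ) : State α := { s with top := max s.top (x + 1) }

/-- Write `v` to the memory cell with address `x`. -/
def write (s : State α) (x v : ℕ) : State α :=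
  { s.touch x with mem := Function.update s.mem x v, peak := max s.peak v }

/-- Receive the next input symbol, if there is one, and report in register `d`. -/
def receive (s : State α) (d : ℕ) : State α :=
  match s.rest with
  | [] => s.setReg d 0
  | c :: r => { s.setReg d 1 with text := s.text ++ [c], rest := r }

/-- Append a phrase to the output. -/
def emit (s : State α) (p : Phrase α) : State α := { s with out := s.out ++ [(p, s.text.length)] }

/-- The number of words used: the memory up to the highest address accessed, and the text. -/
def space (s : State α) : ℕ := s.top + s.text.length

/-- The phrases that have been output. -/
def output (s : State α) : List (Phrase α) := s.out.map Prod.fst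

/-- Every phrase was output when at most one symbol behind its end had been received. -/
def OnLine (s : State α) : Prop :=
  ∀ (j : ℕ) (p : Phrase α) (m : ℕ), s.out[j]? = some (p, m) →
    m ≤ coveredLen (s.output.take (j + 1)) + 1

end State

/-- The truth of a test. A comparison that involves a position not yet received fails. -/
def Test.Holds {α : Type u} [LinearOrder α] (s : State α) : Test → Prop
  | .lt a b => s.reg a < s.reg b
  | .eq a b => s.reg a = s.reg b
  | .symLt a b => ∃ x y, s.text[s.reg a]? = some x ∧ s.text[s.reg b]? = some y ∧ x < y
  | .symEq a b => ∃ x y, s.text[s.reg a]? = some x ∧ s.text[s.reg b]? = some y ∧ x = y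

/-- `Exec P s s' t`: started in the state `s`, the program `P` halts in the state `s'` after exactly
`t` steps. -/
inductive Exec {α : Type u} [LinearOrder α] : Prog → State α → State α → ℕ → Prop where
  | const (d c : ℕ) (s : State α) : Exec (.const d c) s (s.setReg d c) 1
  | arith (o : Arith) (d a b : ℕ) (s : State α) :
      Exec (.arith o d a b) s (s.setReg d (o.eval (s.reg a) (s.reg b))) 1
  | load (d a : ℕ) (s : State α) :
      Exec (.load d a) s ((s.touch (s.reg a)).setReg d (s.mem (s.reg a))) 1
  | store (a b : ℕ) (s : State α) : Exec (.store a b) s (s.write (s.reg a) (s.reg b)) 1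
  | read (d : ℕ) (s : State α) : Exec (.read d) s (s.receive d) 1
  | outLit (a : ℕ) (s : State α) (c : α) (hc : s.text[s.reg a]? = some c) :
      Exec (.outLit a) s (s.emit (.lit c)) 1
  | outCopy (a b : ℕ) (s : State α) :
      Exec (.outCopy a b) s (s.emit (.copy (s.reg a) (s.reg b))) 1
  | seq {P Q : Prog} {s s₁ s₂ : State α} {t₁ t₂ : ℕ}
      (hP : Exec P s s₁ t₁) (hQ : Exec Q s₁ s₂ t₂) : Exec (.seq P Q) s s₂ (t₁ + t₂)
  | condTrue {c : Test} {P Q : Prog} {s s₁ : State α} {t : ℕ}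
      (hc : c.Holds s) (hP : Exec P s s₁ t) : Exec (.cond c P Q) s s₁ (1 + t)
  | condFalse {c : Test} {P Q : Prog} {s s₁ : State α} {t : ℕ}
      (hc : ¬ c.Holds s) (hQ : Exec Q s s₁ t) : Exec (.cond c P Q) s s₁ (1 + t)
  | loopStop {c : Test} {P : Prog} {s : State α} (hc : ¬ c.Holds s) : Exec (.loop c P) s s 1
  | loopNext {c : Test} {P : Prog} {s s₁ s₂ : State α} {t₁ t₂ : ℕ}
      (hc : c.Holds s) (hP : Exec P s s₁ t₁) (hL : Exec (.loop c P) s₁ s₂ t₂) :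
      Exec (.loop c P) s s₂ (1 + t₁ + t₂)

end LZHB

/-! The greedy rule is a longest-previous-match problem in which some source positions are
forbidden. Since the index `s + k % (b - s)` runs through exactly those positions of the occurrence
at `s` that lie before `b`, the height constraint says that all of these have height below `h`. This
condition gets weaker when the length shrinks, so the greedy length is simply the largest one that
has an admissible occurrence (`admissible_iff`, `Next.isNextPhrase`). The occurrences fall into two
kinds, which are searched differently.

An occurrence that ends at or before `b` is searched in `word h B`: positions of height below `h`
carry the number of their symbol, every other position `j` carries the letter `2 ^ B + j`, which
occurs nowhere else. No match can run through a forbidden position, so matches in this word are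
exactly the admissible occurrences of this kind (`adm_iff`). The word is indexed by its suffix
automaton, which is extended once the heights of a phrase are known. Every state remembers where its
word ends first, so following transitions yields the longest match and its leftmost start
(`wp_walk`). An occurrence longer than the length `l` found there must overlap the phrase; it starts
among the last `l` positions before `b`, and behind the last forbidden position. A
Knuth-Morris-Pratt search of this window takes time linear in the final phrase length
(`wp_overlap`).

Symbols can only be compared. A balanced search tree (an AA tree) numbers them in order of first
appearance, with logarithmically many comparisons per symbol (`wp_numSym`). The transitions of a
state are kept in a digital search tree on the bits of these numbers. Its depth is bounded by the
number of bits, which is the reason for the factor `log σ`, and no advance knowledge of `σ` is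
required (`Dst.height_le`, `ETab.wp_findE`). The machine has no division, hence halves and parities
are tabulated as numbers are created. A symbol is received only when a comparison demands it, which
makes the algorithm on-line (`wp_need`).

The states of the automaton are the words that are not always preceded by the same letter (`Nd`).
Appending a letter creates at most two of them: the whole prefix, and the longest suffix that
occurred before (`Lrs.nd_succ`). This gives the two cases `Sam.ext` and `Sam.ext_clone`. The time is
amortized: `pot` counts the states on the suffix chain, each step along a suffix link uses up one
unit (`Sam.pot_step`), an extension restores a bounded amount (`Lrs.pot_succ`, `Sam.pot_clone`), and
copying transitions is paid for by their total number, at most the number of states plus the length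
(`Sam.card_le`).

The programs are verified on a structured machine by weakest preconditions (`wp`). `Run.exec`
transfers the result to the word RAM with a factor of five in time. The bound `N` on all numbers and
the bit length `B` belong to the analysis only; the program depends on `h` alone. -/

set_option linter.constructorNameAsVariable false
set_option linter.unusedSectionVars false

namespace LZHB

/-! ### A register machine with named variables and arrays -/

/-- Variables of the structured machine. -/
inductive Var where
  | b | i | l | s | v | go | j | c | x | y | sd | kk | kx | res | cnt | rt | k | ec | last | a
  | p | q | cur | r | lq | lp | d | e | t | m | g | f | hh | one | ok | xx | yy | tgt
  deriving DecidableEq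

/-- Arrays of the structured machine. -/
inductive Arr where
  | ID | H | PI | key | L | R | lev | hf | pr | stk | len | link | fp | tr | head
  | ek | et | eL | eR | enx
  deriving DecidableEq

/-- The machine register of a variable; the registers `0`, `1`, `2` are reserved. -/
def Var.code (v : Var) : ℕ := v.ctorIdx + 3

theorem Var.code_inj {v w : Var} : v.code = w.code ↔ v = w := by
  constructor
  · intro hc
    have h1 : v.ctorIdx = w.ctorIdx := by simpa [Var.code] using hc
    rw [← Var.ofNat_ctorIdx v, ← Var.ofNat_ctorIdx w, h1]
  · rintro rfl; rfl

/-- The number of arrays. -/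
def numArr : ℕ := 20

theorem Arr.ctorIdx_lt (a : Arr) : a.ctorIdx < numArr := by cases a <;> decide

theorem Arr.ctorIdx_inj {a a' : Arr} (h : a.ctorIdx = a'.ctorIdx) : a = a' := by
  rw [← Arr.ofNat_ctorIdx a, ← Arr.ofNat_ctorIdx a', h]

/-- The memory address of an array cell. -/
def addr (a : Arr) (i : ℕ) : ℕ := i * numArr + a.ctorIdx

theorem addr_inj {a a' : Arr} {i i' : ℕ} : addr a i = addr a' i' ↔ a = a' ∧ i = i' := by
  constructor
  · intro h
    have h1 := a.ctorIdx_lt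
    have h2 := a'.ctorIdx_lt
    simp only [addr, numArr] at *
    exact ⟨Arr.ctorIdx_inj (by omega), by omega⟩
  · rintro ⟨rfl, rfl⟩; rfl

/-- States of the structured machine; `clk` counts steps. -/
structure VS (α : Type u) where
  r : Var → ℕ
  m : Arr → ℕ → ℕ
  text : List α
  rest : List α
  out : List (Phrase α × ℕ)
  clk : ℕ

/-- Right-hand sides of assignments. -/
inductive Ex where
  | num (n : ℕ)
  | off (y : Var) (n : ℕ)
  | add (y z : Var)
  | sub (y z : Var)
  | get (a : Arr) (y : Var)

/-- Tests of the structured machine. -/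
inductive Tst where
  | pos (x : Var)
  | lt (x y : Var)
  | eq (x y : Var)
  | symLt (x y : Var)
  | symEq (x y : Var)

/-- Commands of the structured machine. -/
inductive Cmd where
  | asg (x : Var) (e : Ex)
  | put (a : Arr) (y z : Var)
  | read (x : Var)
  | outLit (x : Var)
  | outCopy (x y : Var)
  | skip
  | seq (c d : Cmd)
  | ite (t : Tst) (c d : Cmd)
  | while (t : Tst) (c : Cmd)

/-- Sequential composition. -/
infixr:60 " ;; " => Cmd.seq
/-- Assignment. -/
infix:70 " ::= " => Cmd.asg

namespace VS

variable {α : Type u}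

/-- One step of the clock. -/
def tick (s : VS α) : VS α := { s with clk := s.clk + 1 }

/-- Assign a value to a variable. -/
def set (s : VS α) (x : Var) (n : ℕ) : VS α :=
  { s with r := Function.update s.r x n, clk := s.clk + 1 }

/-- Assign a value to an array cell. -/
def put (s : VS α) (a : Arr) (i n : ℕ) : VS α :=
  { s with m := Function.update s.m a (Function.update (s.m a) i n), clk := s.clk + 1 }

/-- Receive a symbol. -/
def receive (s : VS α) (x : Var) : VS α :=
  match s.rest with
  | [] => s.set x 0
  | c :: r => { s.set x 1 with text := s.text ++ [c], rest := r }

/-- Output a phrase. -/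
def emit (s : VS α) (p : Phrase α) : VS α :=
  { s with out := s.out ++ [(p, s.text.length)], clk := s.clk + 1 }

section
variable (s : VS α) (x y : Var) (n i : ℕ) (a a' : Arr) (p : Phrase α)
@[simp] theorem tick_r : s.tick.r = s.r := rfl
@[simp] theorem tick_m : s.tick.m = s.m := rfl
@[simp] theorem tick_text : s.tick.text = s.text := rfl
@[simp] theorem tick_rest : s.tick.rest = s.rest := rfl
@[simp] theorem tick_out : s.tick.out = s.out := rfl
@[simp] theorem tick_clk : s.tick.clk = s.clk + 1 := rfl
@[simp] theorem set_r : (s.set x n).r y = if y = x then n else s.r y := by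
  simp [set, Function.update_apply]
@[simp] theorem set_m : (s.set x n).m = s.m := rfl
@[simp] theorem set_text : (s.set x n).text = s.text := rfl
@[simp] theorem set_rest : (s.set x n).rest = s.rest := rfl
@[simp] theorem set_out : (s.set x n).out = s.out := rfl
@[simp] theorem set_clk : (s.set x n).clk = s.clk + 1 := rfl
@[simp] theorem put_r : (s.put a i n).r = s.r := rfl
@[simp] theorem put_m : (s.put a i n).m a' =
    if a' = a then Function.update (s.m a) i n else s.m a' := by
  simp [put, Function.update_apply]
@[simp] theorem put_text : (s.put a i n).text = s.text := rfl
@[simp] theorem put_rest : (s.put a i n).rest = s.rest := rfl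
@[simp] theorem put_out : (s.put a i n).out = s.out := rfl
@[simp] theorem put_clk : (s.put a i n).clk = s.clk + 1 := rfl
@[simp] theorem emit_r : (s.emit p).r = s.r := rfl
@[simp] theorem emit_m : (s.emit p).m = s.m := rfl
@[simp] theorem emit_text : (s.emit p).text = s.text := rfl
@[simp] theorem emit_rest : (s.emit p).rest = s.rest := rfl
@[simp] theorem emit_out : (s.emit p).out = s.out ++ [(p, s.text.length)] := rfl
@[simp] theorem emit_clk : (s.emit p).clk = s.clk + 1 := rfl
end

end VS

/-- The value of an expression. -/
def Ex.eval {α : Type u} (s : VS α) : Ex → ℕ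
  | .num n => n
  | .off y n => s.r y + n
  | .add y z => s.r y + s.r z
  | .sub y z => s.r y - s.r z
  | .get a y => s.m a (s.r y)

/-- The value of an expression is at most `N`, provided that all variables and cells are. -/
def Ex.Bd {α : Type u} (N : ℕ) (s : VS α) : Ex → Prop
  | .num n => n ≤ N
  | .off y n => n = 0 ∨ s.r y + n ≤ N
  | .add y z => s.r y + s.r z ≤ N
  | .sub _ _ => True
  | .get _ _ => True

/-- The truth of a test. -/
def Tst.Holds {α : Type u} [LinearOrder α] (s : VS α) : Tst → Prop
  | .pos x => 0 < s.r x
  | .lt x y => s.r x < s.r y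
  | .eq x y => s.r x = s.r y
  | .symLt x y => ∃ c d, s.text[s.r x]? = some c ∧ s.text[s.r y]? = some d ∧ c < d
  | .symEq x y => ∃ c d, s.text[s.r x]? = some c ∧ s.text[s.r y]? = some d ∧ c = d

/-- Big-step semantics of the structured machine; all sums must be at most `N`. -/
inductive Run {α : Type u} [LinearOrder α] (N : ℕ) : Cmd → VS α → VS α → Prop where
  | asg (x : Var) (e : Ex) (s : VS α) (h : e.Bd N s) : Run N (.asg x e) s (s.set x (e.eval s))
  | put (a : Arr) (y z : Var) (s : VS α) : Run N (.put a y z) s (s.put a (s.r y) (s.r z))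
  | read (x : Var) (s : VS α) : Run N (.read x) s (s.receive x)
  | outLit (x : Var) (s : VS α) (c : α) (hc : s.text[s.r x]? = some c) :
      Run N (.outLit x) s (s.emit (.lit c))
  | outCopy (x y : Var) (s : VS α) : Run N (.outCopy x y) s (s.emit (.copy (s.r x) (s.r y)))
  | skip (s : VS α) : Run N .skip s s.tick
  | seq {c d : Cmd} {s s₁ s₂ : VS α} (h₁ : Run N c s s₁) (h₂ : Run N d s₁ s₂) :
      Run N (.seq c d) s s₂
  | iteTrue {t : Tst} {c d : Cmd} {s s₁ : VS α} (ht : t.Holds s) (h₁ : Run N c s.tick s₁) :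
      Run N (.ite t c d) s s₁
  | iteFalse {t : Tst} {c d : Cmd} {s s₁ : VS α} (ht : ¬ t.Holds s) (h₁ : Run N d s.tick s₁) :
      Run N (.ite t c d) s s₁
  | whileStop {t : Tst} {c : Cmd} {s : VS α} (ht : ¬ t.Holds s) : Run N (.while t c) s s.tick
  | whileNext {t : Tst} {c : Cmd} {s s₁ s₂ : VS α} (ht : t.Holds s) (h₁ : Run N c s.tick s₁)
      (h₂ : Run N (.while t c) s₁ s₂) : Run N (.while t c) s s₂

/-- The command `c`, started in `s`, halts in a state that satisfies `Q`. -/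
def wp {α : Type u} [LinearOrder α] (N : ℕ) (c : Cmd) (s : VS α) (Q : VS α → Prop) : Prop :=
  ∃ s', Run N c s s' ∧ Q s'

section
variable {α : Type u} [LinearOrder α] {N : ℕ} {s : VS α} {Q Q' : VS α → Prop}

theorem wp_mono {c : Cmd} (h : wp N c s Q) (hQ : ∀ s', Q s' → Q' s') : wp N c s Q' :=
  let ⟨s', h1, h2⟩ := h; ⟨s', h1, hQ s' h2⟩

theorem wp_asg {x : Var} {e : Ex} :
    wp N (.asg x e) s Q ↔ e.Bd N s ∧ Q (s.set x (e.eval s)) := by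
  constructor
  · rintro ⟨s', h, hq⟩; cases h with | asg _ _ _ h => exact ⟨h, hq⟩
  · rintro ⟨h, hq⟩; exact ⟨_, .asg x e s h, hq⟩

theorem wp_put {a : Arr} {y z : Var} : wp N (.put a y z) s Q ↔ Q (s.put a (s.r y) (s.r z)) := by
  constructor
  · rintro ⟨s', h, hq⟩; cases h; exact hq
  · intro hq; exact ⟨_, .put a y z s, hq⟩

theorem wp_read {x : Var} : wp N (.read x) s Q ↔ Q (s.receive x) := by
  constructor
  · rintro ⟨s', h, hq⟩; cases h; exact hq
  · intro hq; exact ⟨_, .read x s, hq⟩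

theorem wp_skip : wp N .skip s Q ↔ Q s.tick := by
  constructor
  · rintro ⟨s', h, hq⟩; cases h; exact hq
  · intro hq; exact ⟨_, .skip s, hq⟩

theorem wp_outLit {x : Var} (c : α) (hc : s.text[s.r x]? = some c) (hq : Q (s.emit (.lit c))) :
    wp N (.outLit x) s Q := ⟨_, .outLit x s c hc, hq⟩

theorem wp_outCopy {x y : Var} :
    wp N (.outCopy x y) s Q ↔ Q (s.emit (.copy (s.r x) (s.r y))) := by
  constructor
  · rintro ⟨s', h, hq⟩; cases h; exact hq
  · intro hq; exact ⟨_, .outCopy x y s, hq⟩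

theorem wp_seq {c d : Cmd} : wp N (c ;; d) s Q ↔ wp N c s fun s' => wp N d s' Q := by
  constructor
  · rintro ⟨s', h, hq⟩; cases h with | seq h1 h2 => exact ⟨_, h1, _, h2, hq⟩
  · rintro ⟨s1, h1, s2, h2, hq⟩; exact ⟨s2, .seq h1 h2, hq⟩

theorem wp_ite {t : Tst} {c d : Cmd} :
    wp N (.ite t c d) s Q ↔ (t.Holds s → wp N c s.tick Q) ∧ (¬ t.Holds s → wp N d s.tick Q) := by
  constructor
  · rintro ⟨s', h, hq⟩
    cases h with
    | iteTrue ht h1 => exact ⟨fun _ => ⟨_, h1, hq⟩, fun h => absurd ht h⟩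
    | iteFalse ht h1 => exact ⟨fun h => absurd h ht, fun _ => ⟨_, h1, hq⟩⟩
  · rintro ⟨h1, h2⟩
    by_cases ht : t.Holds s
    · obtain ⟨s', h, hq⟩ := h1 ht; exact ⟨s', .iteTrue ht h, hq⟩
    · obtain ⟨s', h, hq⟩ := h2 ht; exact ⟨s', .iteFalse ht h, hq⟩

/-- Verification of a loop by an invariant and a decreasing measure. -/
theorem wp_while {t : Tst} {c : Cmd} (I : VS α → Prop) (μ : VS α → ℕ) (h0 : I s)
    (hstep : ∀ s, I s → t.Holds s → wp N c s.tick fun s' => I s' ∧ μ s' < μ s)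
    (hend : ∀ s, I s → ¬ t.Holds s → Q s.tick) : wp N (.while t c) s Q := by
  generalize hn : μ s = n
  induction n using Nat.strong_induction_on generalizing s with
  | _ n ih =>
    by_cases ht : t.Holds s
    · obtain ⟨s1, h1, hI, hμ⟩ := hstep s h0 ht
      obtain ⟨s2, h2, hq⟩ := ih (μ s1) (hn ▸ hμ) hI rfl
      exact ⟨s2, .whileNext ht h1 h2, hq⟩
    · exact ⟨_, .whileStop ht, hend s h0 ht⟩

end

/-- All variables outside `vs`, all arrays outside `as`, the text and the output are unchanged. -/
structure Keep {α : Type u} (vs : List Var) (as : List Arr) (s s' : VS α) : Prop where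
  r : ∀ x, x ∉ vs → s'.r x = s.r x
  m : ∀ a, a ∉ as → s'.m a = s.m a
  text : s'.text = s.text
  rest : s'.rest = s.rest
  out : s'.out = s.out

theorem Keep.refl {α : Type u} (vs : List Var) (as : List Arr) (s : VS α) : Keep vs as s s :=
  ⟨fun _ _ => rfl, fun _ _ => rfl, rfl, rfl, rfl⟩

/-- The four inclusions are default arguments closed by `decide`, so that frame conditions for
concrete lists of variables and arrays compose without further proof. -/
theorem Keep.trans {α : Type u} {vs vs' vs'' : List Var} {as as' as'' : List Arr}
    {s s' s'' : VS α} (h : Keep vs as s s') (h' : Keep vs' as' s' s'')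
    (h1 : vs ⊆ vs'' := by decide) (h2 : vs' ⊆ vs'' := by decide)
    (h3 : as ⊆ as'' := by decide) (h4 : as' ⊆ as'' := by decide) : Keep vs'' as'' s s'' where
  r x hx := (h'.r x fun h => hx (h2 h)).trans (h.r x fun h => hx (h1 h))
  m a ha := (h'.m a fun h => ha (h4 h)).trans (h.m a fun h => ha (h3 h))
  text := h'.text.trans h.text
  rest := h'.rest.trans h.rest
  out := h'.out.trans h.out

/-! ### Translation to the word RAM -/

/-- Put the address of an array cell into register `1`. -/
def compAddr (a : Arr) (y : Var) (P : Prog) : Prog :=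
  .seq (.const 1 numArr) (.seq (.arith .mul 1 y.code 1) (.seq (.const 2 a.ctorIdx)
    (.seq (.arith .add 1 1 2) P)))

/-- The translation of tests. -/
def Tst.comp : Tst → Test
  | .pos x => .lt 0 x.code
  | .lt x y => .lt x.code y.code
  | .eq x y => .eq x.code y.code
  | .symLt x y => .symLt x.code y.code
  | .symEq x y => .symEq x.code y.code

/-- The translation of commands. -/
def Cmd.comp : Cmd → Prog
  | .asg x (.num n) => .const x.code n
  | .asg x (.off y n) => .seq (.const 1 n) (.arith .add x.code y.code 1)
  | .asg x (.add y z) => .arith .add x.code y.code z.code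
  | .asg x (.sub y z) => .arith .sub x.code y.code z.code
  | .asg x (.get a y) => compAddr a y (.load x.code 1)
  | .put a y z => compAddr a y (.store 1 z.code)
  | .read x => .read x.code
  | .outLit x => .outLit x.code
  | .outCopy x y => .outCopy x.code y.code
  | .skip => .const 1 0
  | .seq c d => .seq c.comp d.comp
  | .ite t c d => .cond t.comp c.comp d.comp
  | .while t c => .loop t.comp c.comp

/-- The machine state `S` represents the structured state `s`. -/
structure Repr {α : Type u} (N : ℕ) (s : VS α) (S : State α) : Prop where
  reg : ∀ v : Var, S.reg v.code = s.r v
  zero : S.reg 0 = 0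
  reg_le : ∀ v, s.r v ≤ N
  mem : ∀ a i, S.mem (addr a i) = s.m a i
  mem_le : ∀ a i, s.m a i ≤ N
  text : S.text = s.text
  rest : S.rest = s.rest
  out : S.out = s.out
  top : S.top ≤ numArr * (N + 1)
  peak : S.peak ≤ numArr * (N + 1)

section
variable {α : Type u} [LinearOrder α] {N : ℕ} {s : VS α} {S : State α}

theorem Var.code_ge (v : Var) : 3 ≤ v.code := by simp [Var.code]

theorem Repr.set (h : Repr N s S) (x : Var) {n : ℕ} (hn : n ≤ N) :
    Repr N (s.set x n) (S.setReg x.code n) where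
  reg v := by
    simp only [State.setReg, VS.set_r, Function.update_apply, Var.code_inj, h.reg]
  zero := by
    have := x.code_ge
    simp only [State.setReg, Function.update_apply]
    rw [if_neg (by omega)]; exact h.zero
  reg_le v := by
    rw [VS.set_r]; split_ifs
    · exact hn
    · exact h.reg_le v
  mem := h.mem
  mem_le := h.mem_le
  text := h.text
  rest := h.rest
  out := h.out
  top := h.top
  peak := max_le h.peak (by simp only [numArr]; omega)

/-- Registers `1` and `2` represent no variable, because codes start at `3`. They may exceed `N`,
since they hold addresses; only the weaker bound on the peak applies to them. -/
theorem Repr.temp (h : Repr N s S) {d n : ℕ} (hd : d = 1 ∨ d = 2) (hn : n ≤ numArr * (N + 1)) :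
    Repr N s (S.setReg d n) where
  reg v := by
    have := v.code_ge
    simp only [State.setReg, Function.update_apply]
    rw [if_neg (by omega)]; exact h.reg v
  zero := by
    simp only [State.setReg, Function.update_apply]
    rw [if_neg (by omega)]; exact h.zero
  reg_le := h.reg_le
  mem := h.mem
  mem_le := h.mem_le
  text := h.text
  rest := h.rest
  out := h.out
  top := h.top
  peak := max_le h.peak hn

theorem Repr.touch (h : Repr N s S) (a : Arr) {i : ℕ} (hi : i ≤ N) :
    Repr N s (S.touch (addr a i)) where
  reg := h.reg
  zero := h.zero
  reg_le := h.reg_le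
  mem := h.mem
  mem_le := h.mem_le
  text := h.text
  rest := h.rest
  out := h.out
  top := max_le h.top (by have := a.ctorIdx_lt; simp only [addr, numArr] at *; omega)
  peak := h.peak

theorem Repr.put (h : Repr N s S) (a : Arr) {i n : ℕ} (hi : i ≤ N) (hn : n ≤ N) :
    Repr N (s.put a i n) (S.write (addr a i) n) where
  reg := h.reg
  zero := h.zero
  reg_le := h.reg_le
  mem a' i' := by
    simp only [State.write, VS.put_m, Function.update_apply, addr_inj, h.mem]
    by_cases h1 : a' = a
    · subst h1; simp [Function.update_apply]
    · simp [h1]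
  mem_le a' i' := by
    rw [VS.put_m]; split_ifs
    · rw [Function.update_apply]; split_ifs
      · exact hn
      · exact h.mem_le _ _
    · exact h.mem_le _ _
  text := h.text
  rest := h.rest
  out := h.out
  top := (h.touch a hi).top
  peak := max_le h.peak (by simp only [numArr]; omega)

theorem Repr.tick (h : Repr N s S) : Repr N s.tick S :=
  ⟨h.reg, h.zero, h.reg_le, h.mem, h.mem_le, h.text, h.rest, h.out, h.top, h.peak⟩

theorem Repr.emit (h : Repr N s S) (p : Phrase α) : Repr N (s.emit p) (S.emit p) :=
  ⟨h.reg, h.zero, h.reg_le, h.mem, h.mem_le, h.text, h.rest,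
    by simp [State.emit, h.out, h.text], h.top, h.peak⟩

theorem Repr.receive (h : Repr N s S) (x : Var) (hN : 1 ≤ N) :
    Repr N (s.receive x) (S.receive x.code) := by
  unfold VS.receive State.receive
  rw [h.rest]
  cases s.rest with
  | nil => exact h.set x (Nat.zero_le _)
  | cons c r =>
    have h1 := h.set x hN
    exact ⟨h1.reg, h1.zero, h1.reg_le, h1.mem, h1.mem_le, by simp [h.text], rfl, h1.out, h1.top,
      h1.peak⟩

theorem Repr.holds (h : Repr N s S) (t : Tst) : t.comp.Holds S ↔ t.Holds s := by
  cases t <;> simp [Tst.comp, Test.Holds, Tst.Holds, h.reg, h.zero, h.text]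

/-- Four instructions compute the address in register `1` before the access itself. The access is a
parameter, so that loads and stores share the argument; these five steps are the worst case in the
factor of `Run.exec`. -/
theorem Repr.comp_addr (h : Repr N s S) (a : Arr) (y : Var) {P : Prog} {S' : State α} {t : ℕ}
    (hP : ∀ S₁, Repr N s S₁ → S₁.reg 1 = addr a (s.r y) → ∃ S', Exec P S₁ S' t ∧ Repr N s' S') :
    ∃ S', Exec (compAddr a y P) S S' (1 + (1 + (1 + (1 + t)))) ∧ Repr N s' S' := by
  have hy := h.reg_le y
  have ha := a.ctorIdx_lt
  have hc := y.code_ge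
  have h1 := h.temp (d := 1) (n := numArr) (Or.inl rfl) (by simp only [numArr]; omega)
  have h2 := h1.temp (d := 1) (n := s.r y * numArr) (Or.inl rfl)
    (by simp only [numArr] at *; omega)
  have h3 := h2.temp (d := 2) (n := a.ctorIdx) (Or.inr rfl) (by simp only [numArr] at *; omega)
  have h4 := h3.temp (d := 1) (n := addr a (s.r y)) (Or.inl rfl)
    (by simp only [numArr, addr] at *; omega)
  obtain ⟨S', hS, hr⟩ := hP _ h4 (by simp [State.setReg])
  refine ⟨S', ?_, hr⟩
  refine .seq (.const _ _ _) (.seq (s₁ := (S.setReg 1 numArr).setReg 1 (s.r y * numArr)) ?_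
    (.seq (.const _ _ _) (.seq ?_ hS)))
  · have := Exec.arith .mul 1 y.code 1 (S.setReg 1 numArr)
    convert this using 2
    simp only [Arith.eval, State.setReg, Function.update_apply]
    rw [if_neg (by omega), h.reg]; simp
  · have := Exec.arith .add 1 1 2 (((S.setReg 1 numArr).setReg 1 (s.r y * numArr)).setReg 2
      a.ctorIdx)
    convert this using 2
    rfl

/-- A run of the structured machine is simulated by the word RAM. -/
theorem Run.exec (hN : 1 ≤ N) {c : Cmd} {s s' : VS α} (h : Run N c s s') :
    ∀ S, Repr N s S → ∃ S' t, Exec c.comp S S' t ∧ Repr N s' S' ∧ t + 5 * s.clk ≤ 5 * s'.clk := by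
  induction h with
  | asg x e s h =>
    intro S hS
    cases e with
    | num n => exact ⟨_, _, .const _ _ _, hS.set x h, by simp; omega⟩
    | off y n =>
      have hy := hS.reg_le y
      -- A copy of a variable is written with offset `0` and carries no side condition: its bound is
      -- the invariant on registers.
      have h' : s.r y + n ≤ N := by rcases h with h | h <;> omega
      refine ⟨_, _, .seq (.const _ _ _) (.arith _ _ _ _ _), ?_, ?_⟩
      · have h1 := hS.temp (d := 1) (n := n) (Or.inl rfl) (by simp only [numArr]; omega)
        have h2 := h1.set x h'
        rwa [h1.reg, show (S.setReg 1 n).reg 1 = n by simp [State.setReg]]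
      · rw [VS.set_clk]; omega
    | add y z =>
      refine ⟨_, _, .arith _ _ _ _ _, ?_, by simp; omega⟩
      rw [hS.reg, hS.reg]
      exact hS.set x h
    | sub y z =>
      refine ⟨_, _, .arith _ _ _ _ _, ?_, by simp; omega⟩
      rw [hS.reg, hS.reg]
      exact hS.set x ((Nat.sub_le _ _).trans (hS.reg_le y))
    | get a y =>
      obtain ⟨S', h1, h2⟩ := hS.comp_addr (s' := s.set x (s.m a (s.r y))) a y (P := .load x.code 1)
        (S' := S) (t := 1) (by
          intro S₁ hr h1
          refine ⟨_, .load _ _ _, ?_⟩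
          rw [h1, hr.mem]
          exact (hr.touch a (hr.reg_le y)).set x (hr.mem_le _ _))
      exact ⟨S', _, h1, h2, by simp; omega⟩
  | put a y z s =>
    intro S hS
    obtain ⟨S', h1, h2⟩ := hS.comp_addr (s' := s.put a (s.r y) (s.r z)) a y (P := .store 1 z.code)
      (S' := S) (t := 1) (by
        intro S₁ hr h1
        refine ⟨_, .store _ _ _, ?_⟩
        rw [h1, hr.reg]
        exact hr.put a (hr.reg_le y) (hr.reg_le z))
    exact ⟨S', _, h1, h2, by simp; omega⟩
  | read x s =>
    intro S hS
    refine ⟨_, _, .read _ _, hS.receive x hN, ?_⟩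
    have : (s.receive x).clk = s.clk + 1 := by
      unfold VS.receive; split <;> simp
    omega
  | outLit x s c hc =>
    intro S hS
    exact ⟨_, _, .outLit _ _ c (by rw [hS.text, hS.reg]; exact hc), hS.emit _, by simp; omega⟩
  | outCopy x y s =>
    intro S hS
    refine ⟨_, _, .outCopy _ _ _, ?_, by simp; omega⟩
    rw [hS.reg, hS.reg]; exact hS.emit _
  | skip s =>
    intro S hS
    exact ⟨_, _, .const _ _ _, (hS.temp (Or.inl rfl) (Nat.zero_le _)).tick, by simp; omega⟩
  | seq h₁ h₂ ih1 ih2 =>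
    intro S hS
    obtain ⟨S1, t1, e1, r1, l1⟩ := ih1 S hS
    obtain ⟨S2, t2, e2, r2, l2⟩ := ih2 S1 r1
    exact ⟨S2, _, .seq e1 e2, r2, by omega⟩
  | iteTrue ht h₁ ih =>
    intro S hS
    obtain ⟨S1, t1, e1, r1, l1⟩ := ih S hS.tick
    exact ⟨S1, _, .condTrue ((hS.holds _).2 ht) e1, r1, by simp at l1; omega⟩
  | iteFalse ht h₁ ih =>
    intro S hS
    obtain ⟨S1, t1, e1, r1, l1⟩ := ih S hS.tick
    exact ⟨S1, _, .condFalse (fun h => ht ((hS.holds _).1 h)) e1, r1, by simp at l1; omega⟩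
  | whileStop ht =>
    intro S hS
    exact ⟨_, _, .loopStop (fun h => ht ((hS.holds _).1 h)), hS.tick, by simp; omega⟩
  | whileNext ht h₁ h₂ ih1 ih2 =>
    intro S hS
    obtain ⟨S1, t1, e1, r1, l1⟩ := ih1 S hS.tick
    obtain ⟨S2, t2, e2, r2, l2⟩ := ih2 S1 r1
    exact ⟨S2, _, .loopNext ((hS.holds _).2 ht) e1 e2, r2, by simp at l1; omega⟩

end


/-! ### Binary trees stored in arrays -/

/-- Binary trees; a node has an index `x` and a label `k`. -/
inductive Tr where
  | nil
  | node (l : Tr) (x k : ℕ) (r : Tr)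

namespace Tr

/-- The index of the root, `0` for the empty tree. -/
def root : Tr → ℕ
  | nil => 0
  | node _ x _ _ => x

@[simp] theorem root_nil : nil.root = 0 := rfl

@[simp] theorem root_node {l r : Tr} {x k : ℕ} : (node l x k r).root = x := rfl

/-- The entries in symmetric order. -/
def ents : Tr → List (ℕ × ℕ)
  | nil => []
  | node l x k r => ents l ++ (x, k) :: ents r

/-- The node indices in symmetric order. -/
def ids (t : Tr) : List ℕ := t.ents.map Prod.fst

@[simp] theorem ids_nil : nil.ids = [] := rfl

@[simp] theorem ids_node {l r : Tr} {x k : ℕ} : (node l x k r).ids = l.ids ++ x :: r.ids := by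
  simp [ids, ents]

theorem fst_mem_ids {t : Tr} {p : ℕ × ℕ} (h : p ∈ t.ents) : p.1 ∈ t.ids :=
  List.mem_map_of_mem h

/-- The height. -/
def height : Tr → ℕ
  | nil => 0
  | node l _ _ r => max (height l) (height r) + 1

/-- The tree is stored in the arrays `L`, `R`, `V` of left children, right children and labels. -/
def Rep (L R V : ℕ → ℕ) : Tr → Prop
  | nil => True
  | node l x k r => x ≠ 0 ∧ L x = l.root ∧ R x = r.root ∧ V x = k ∧ Rep L R V l ∧ Rep L R V r

theorem Rep.congr {L R V L' R' V' : ℕ → ℕ} {t : Tr} (h : Rep L R V t)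
    (hc : ∀ p ∈ t.ents, L' p.1 = L p.1 ∧ R' p.1 = R p.1 ∧ V' p.1 = V p.1) : Rep L' R' V' t := by
  induction t with
  | nil => trivial
  | node l x k r ihl ihr =>
    obtain ⟨h0, h1, h2, h3, h4, h5⟩ := h
    obtain ⟨c1, c2, c3⟩ := hc (x, k) (by simp [ents])
    exact ⟨h0, c1.trans h1, c2.trans h2, c3.trans h3,
      ihl h4 fun p hp => hc p (by simp [ents, hp]), ihr h5 fun p hp => hc p (by simp [ents, hp])⟩

theorem Rep.updL {L R V : ℕ → ℕ} {t : Tr} (h : Rep L R V t) {z v : ℕ} (hz : z ∉ t.ids) :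
    Rep (Function.update L z v) R V t :=
  h.congr fun p hp => ⟨Function.update_of_ne (fun he : p.1 = z => hz (he ▸ fst_mem_ids hp)) _ _, rfl, rfl⟩

theorem Rep.updR {L R V : ℕ → ℕ} {t : Tr} (h : Rep L R V t) {z v : ℕ} (hz : z ∉ t.ids) :
    Rep L (Function.update R z v) V t :=
  h.congr fun p hp => ⟨rfl, Function.update_of_ne (fun he : p.1 = z => hz (he ▸ fst_mem_ids hp)) _ _, rfl⟩

theorem Rep.updV {L R V : ℕ → ℕ} {t : Tr} (h : Rep L R V t) {z v : ℕ} (hz : z ∉ t.ids) :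
    Rep L R (Function.update V z v) t :=
  h.congr fun p hp => ⟨rfl, rfl, Function.update_of_ne (fun he : p.1 = z => hz (he ▸ fst_mem_ids hp)) _ _⟩

theorem Rep.root_eq_zero {L R V : ℕ → ℕ} {t : Tr} (h : Rep L R V t) (h0 : t.root = 0) :
    t = nil := by
  cases t with
  | nil => rfl
  | node l x k r => exact absurd h0 h.1

theorem Rep.label {L R V : ℕ → ℕ} {t : Tr} (h : Rep L R V t) : ∀ p ∈ t.ents, V p.1 = p.2 := by
  induction t with
  | nil => simp [ents]
  | node l x k r ihl ihr =>
    obtain ⟨-, -, -, h3, h4, h5⟩ := h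
    intro p hp
    simp only [ents, List.mem_append, List.mem_cons] at hp
    rcases hp with hp | rfl | hp
    exacts [ihl h4 p hp, h3, ihr h5 p hp]

end Tr

/-! ### Trees with a focus -/

/-- A node on the path to a subtree, with the sibling of the subtree. The subtree is the right
child if `dir` holds. -/
structure Fr where
  dir : Bool
  x : ℕ
  k : ℕ
  o : Tr

/-- The subtree at a frame. -/
def Fr.up (f : Fr) (t : Tr) : Tr := if f.dir then .node f.o f.x f.k t else .node t f.x f.k f.o

/-- The whole tree around a subtree; the innermost frame comes first. -/
def plug : List Fr → Tr → Tr
  | [], t => t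
  | f :: fs, t => plug fs (f.up t)

/-- The entries before the subtree. -/
def pre : List Fr → List (ℕ × ℕ)
  | [] => []
  | f :: fs => if f.dir then pre fs ++ (f.o.ents ++ [(f.x, f.k)]) else pre fs

/-- The entries after the subtree. -/
def post : List Fr → List (ℕ × ℕ)
  | [] => []
  | f :: fs => if f.dir then post fs else (f.x, f.k) :: f.o.ents ++ post fs

theorem ents_plug (fs : List Fr) (t : Tr) : (plug fs t).ents = pre fs ++ t.ents ++ post fs := by
  induction fs generalizing t with
  | nil => simp [plug, pre, post]
  | cons f fs ih =>
    rw [plug, ih, Fr.up, pre, post]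
    split_ifs <;> simp [Tr.ents]

/-- The frames are stored, and the innermost child pointer is `c`. -/
def FRep (L R V : ℕ → ℕ) : List Fr → ℕ → Prop
  | [], _ => True
  | f :: fs, c => f.x ≠ 0 ∧ (if f.dir then L f.x = f.o.root ∧ R f.x = c else
      L f.x = c ∧ R f.x = f.o.root) ∧ V f.x = f.k ∧ f.o.Rep L R V ∧ FRep L R V fs f.x

/-- Storage splits into the subtree in focus and its context, which meet only in the child pointer
of the innermost frame. Local changes can thus be verified without looking at the rest of the tree.
-/
theorem rep_plug {L R V : ℕ → ℕ} {fs : List Fr} {t : Tr} :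
    (plug fs t).Rep L R V ↔ t.Rep L R V ∧ FRep L R V fs t.root := by
  induction fs generalizing t with
  | nil => simp [plug, FRep]
  | cons f fs ih =>
    rw [plug, ih, FRep]
    rcases f with ⟨_ | _, x, k, o⟩ <;> simp [Fr.up, Tr.Rep, Tr.root] <;> tauto

theorem FRep.congr {L R V L' R' V' : ℕ → ℕ} {fs : List Fr} {c : ℕ} (h : FRep L R V fs c)
    (hc : ∀ p ∈ pre fs ++ post fs, L' p.1 = L p.1 ∧ R' p.1 = R p.1 ∧ V' p.1 = V p.1) :
    FRep L' R' V' fs c := by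
  induction fs generalizing c with
  | nil => trivial
  | cons f fs ih =>
    obtain ⟨h0, h1, h2, h3, h4⟩ := h
    obtain ⟨c1, c2, c3⟩ := hc (f.x, f.k) (by rw [pre, post]; split_ifs <;> simp)
    refine ⟨h0, ?_, c3.trans h2, h3.congr fun p hp => hc p ?_, ih h4 fun p hp => hc p ?_⟩
    · rw [c1, c2]; exact h1
    · rw [pre, post]; split_ifs <;> simp [hp]
    · rw [pre, post]
      rw [List.mem_append] at hp
      split_ifs <;> simp only [List.mem_append, List.mem_cons] <;> tauto

theorem height_up (f : Fr) (t : Tr) : t.height + 1 ≤ (f.up t).height := by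
  rw [Fr.up]; split_ifs <;> simp [Tr.height]

theorem height_plug (fs : List Fr) (t : Tr) : fs.length + t.height ≤ (plug fs t).height := by
  induction fs generalizing t with
  | nil => simp [plug]
  | cons f fs ih =>
    have := ih (f.up t)
    have := height_up f t
    simp only [plug, List.length_cons]; omega

/-! ### AA trees -/

/-- AA trees of level `n`, with the levels as labels. -/
inductive Ok : ℕ → Tr → Prop
  | nil : Ok 0 .nil
  | single {n x : ℕ} {l r : Tr} (hl : Ok n l) (hr : Ok n r) : Ok (n + 1) (.node l x (n + 1) r)
  | double {n x y : ℕ} {l m r : Tr} (hl : Ok n l) (hm : Ok n m) (hr : Ok n r) :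
      Ok (n + 1) (.node l x (n + 1) (.node m y (n + 1) r))

/-- The level of the root. -/
def Tr.lvl : Tr → ℕ
  | .nil => 0
  | .node _ _ k _ => k

theorem Ok.lvl_eq {n : ℕ} {t : Tr} (h : Ok n t) : t.lvl = n := by cases h <;> rfl

/-- A path meets at most two nodes of each level. -/
theorem Ok.height_le {n : ℕ} {t : Tr} (h : Ok n t) : t.height ≤ 2 * n := by
  induction h <;> simp only [Tr.height] <;> omega

/-- A tree of positive level contains at least two disjoint trees of the next lower level. Together
with the bound on the height this makes the tree logarithmic. -/
theorem Ok.pow_le {n : ℕ} {t : Tr} (h : Ok n t) : 2 ^ n ≤ t.ents.length + 1 := by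
  induction h with
  | nil => simp [Tr.ents]
  | _ => simp only [Tr.ents, List.length_append, List.length_cons, pow_succ]; omega

/-- The tree has level `n`, and its right child has a smaller level. -/
def Sg (n : ℕ) (t : Tr) : Prop :=
  ∃ m l x r, n = m + 1 ∧ t = .node l x (m + 1) r ∧ Ok m l ∧ Ok m r

theorem Sg.ok {n : ℕ} {t : Tr} (h : Sg n t) : Ok n t := by
  obtain ⟨m, l, x, r, rfl, rfl, h1, h2⟩ := h; exact .single h1 h2

/-- The relation between a subtree and the subtree after an insertion into it. -/
def Grow (t t' : Tr) : Prop := ∃ n, Ok n t ∧ (Ok n t' ∨ ¬ Sg n t ∧ Sg (n + 1) t')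

/-- Remove a left child of equal level. -/
def skew : Tr → Tr
  | .node (.node a x k b) y k' c =>
    if k = k' then .node a x k (.node b y k' c) else .node (.node a x k b) y k' c
  | t => t

/-- Remove a right grandchild of equal level. -/
def split : Tr → Tr
  | .node a x k (.node b y k' (.node c z k'' d)) =>
    if k'' = k then .node (.node a x k b) y (k + 1) (.node c z k'' d)
    else .node a x k (.node b y k' (.node c z k'' d))
  | t => t

theorem ids_skew (t : Tr) : (skew t).ids = t.ids := by
  unfold skew
  split
  · split_ifs <;> simp
  · rfl

theorem ids_split (t : Tr) : (split t).ids = t.ids := by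
  unfold split
  split
  · split_ifs <;> simp
  · rfl

theorem Ok.of_up {f : Fr} {n : ℕ} {t : Tr} (h : Ok n (f.up t)) : ∃ m, Ok m t := by
  rcases f with ⟨_ | _, x, k, o⟩
  · simp only [Fr.up, Bool.false_eq_true, if_false] at h
    cases h with
    | single hl hr => exact ⟨_, hl⟩
    | double hl hm hr => exact ⟨_, hl⟩
  · simp only [Fr.up, if_true] at h
    cases h with
    | single hl hr => exact ⟨_, hr⟩
    | double hl hm hr => exact ⟨_, .single hm hr⟩

theorem Ok.of_plug {fs : List Fr} {n : ℕ} {t : Tr} (h : Ok n (plug fs t)) : ∃ m, Ok m t := by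
  induction fs generalizing t with
  | nil => exact ⟨n, h⟩
  | cons f fs ih => obtain ⟨m, hm⟩ := ih h; exact hm.of_up

theorem skew_of_lt {l r : Tr} {x k : ℕ} (h : l.lvl < k) : skew (.node l x k r) = .node l x k r := by
  cases l with
  | nil => rfl
  | node a y k' b =>
    simp only [Tr.lvl] at h
    simp only [skew]; rw [if_neg (by omega)]

theorem split_of_lt {l r : Tr} {x k : ℕ} (h : r.lvl < k) (hr : Ok r.lvl r) :
    split (.node l x k r) = .node l x k r := by
  cases hr' : r with
  | nil => rfl
  | node a y k' b =>
    subst hr'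
    cases b with
    | nil => rfl
    | node c z k'' d =>
      simp only [split]
      rw [if_neg]
      generalize hn : (Tr.node a y k' (Tr.node c z k'' d)).lvl = n at *
      cases hr with
      | single h1 h2 => have := h2.lvl_eq; simp only [Tr.lvl] at this; omega
      | double h1 h2 h3 => omega

theorem split_double {l m r : Tr} {x y n : ℕ} (hr : Ok n r) :
    split (.node l x (n + 1) (.node m y (n + 1) r)) = .node l x (n + 1) (.node m y (n + 1) r) := by
  cases r with
  | nil => rfl
  | node c z k'' d =>
    simp only [split]
    have := hr.lvl_eq; simp only [Tr.lvl] at this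
    rw [if_neg (by omega)]

/-- The invariant of rebalancing is that a subtree gains a level only if it was not of the form
`Sg`, and that the result then is of this form. A left child that gains a level reaches the level of
its parent, and `skew` turns it into a right child. A right grandchild of equal level is lifted by
`split`; this happens only if the parent already had a right child of its own level, so the parent
was not of the form `Sg` either and the invariant passes upward. -/
theorem Grow.up {f : Fr} {N : ℕ} {t t' : Tr} (hN : Ok N (f.up t)) (h : Grow t t') :
    Grow (f.up t) (split (skew (f.up t'))) := by
  obtain ⟨n, hn, h⟩ := h
  refine ⟨N, hN, ?_⟩
  rcases f with ⟨_ | _, x, k, o⟩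
  · simp only [Fr.up, Bool.false_eq_true, if_false] at hN ⊢
    have key : ∃ m, N = m + 1 ∧ k = m + 1 ∧ n = m ∧ (Ok m o ∨ Sg (m + 1) o) := by
      cases hN with
      | single hl hr => exact ⟨_, rfl, rfl, hn.lvl_eq.symm.trans hl.lvl_eq, .inl hr⟩
      | double hl hm hr => exact ⟨_, rfl, rfl, hn.lvl_eq.symm.trans hl.lvl_eq,
          .inr ⟨_, _, _, _, rfl, rfl, hm, hr⟩⟩
    obtain ⟨m, rfl, rfl, rfl, ho⟩ := key
    rcases h with h | ⟨-, h⟩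
    · left
      rw [skew_of_lt (by rw [h.lvl_eq]; omega)]
      rcases ho with ho | ⟨_, l1, y, r1, hm, rfl, h1, h2⟩
      · rw [split_of_lt (by rw [ho.lvl_eq]; omega) (ho.lvl_eq.symm ▸ ho)]
        exact .single h ho
      · cases hm
        rw [split_double h2]
        exact .double h h1 h2
    · obtain ⟨_, l2, z, r2, hm, rfl, h3, h4⟩ := h
      cases hm
      simp only [skew, if_true]
      rcases ho with ho | ⟨_, l1, y, r1, hm, rfl, h1, h2⟩
      · left
        rw [split_double ho]
        exact .double h3 h4 ho
      · cases hm
        right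
        constructor
        · rintro ⟨_, l, x', r, hm, he, h5, h6⟩
          cases hm; cases he
          have := h6.lvl_eq; simp [Tr.lvl] at this
        · simp only [split, if_true]
          exact ⟨_, _, _, _, rfl, rfl, .single h3 h4, .single h1 h2⟩
  · simp only [Fr.up, if_true] at hN ⊢
    have key : ∃ m, N = m + 1 ∧ k = m + 1 ∧ Ok m o ∧ (n = m ∨ n = m + 1 ∧ Sg (m + 1) t) := by
      cases hN with
      | single hl hr => exact ⟨_, rfl, rfl, hl, .inl (hn.lvl_eq.symm.trans hr.lvl_eq)⟩
      | double hl hm hr => exact ⟨_, rfl, rfl, hl, .inr ⟨hn.lvl_eq.symm.trans rfl,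
          ⟨_, _, _, _, rfl, rfl, hm, hr⟩⟩⟩
    obtain ⟨m, rfl, rfl, ho, hn'⟩ := key
    rw [skew_of_lt (by rw [ho.lvl_eq]; omega)]
    rcases hn' with rfl | ⟨rfl, hs⟩
    · left
      rcases h with h | ⟨-, h⟩
      · rw [split_of_lt (by rw [h.lvl_eq]; omega) (h.lvl_eq.symm ▸ h)]
        exact .single ho h
      · obtain ⟨_, l2, z, r2, hm, rfl, h3, h4⟩ := h
        cases hm
        rw [split_double h4]
        exact .double ho h3 h4
    · rcases h with h | ⟨h, -⟩
      · obtain ⟨_, l1, y, r1, hm, rfl, h1, h2⟩ := hs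
        cases hm
        cases h with
        | single h3 h4 => left; rw [split_double h4]; exact .double ho h3 h4
        | double h3 h4 h5 =>
          right
          constructor
          · rintro ⟨_, l, x', r, hm, he, h5, h6⟩
            cases hm; cases he
            have := h6.lvl_eq; simp [Tr.lvl] at this
          · simp only [split, if_true]
            exact ⟨_, _, _, _, rfl, rfl, .single ho h3, .single h4 h5⟩
      -- A right child on the level of its parent has the form `Sg`, hence cannot gain a level.
      · exact absurd hs h

theorem grow_nil (x : ℕ) : Grow .nil (.node .nil x 1 .nil) :=
  ⟨0, .nil, .inr ⟨fun ⟨_, _, _, _, h, _⟩ => by simp at h,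
    ⟨0, _, _, _, rfl, rfl, .nil, .nil⟩⟩⟩

/-! ### Digital search trees -/

/-- Digital search trees on the labels: at depth `d`, bit number `d` selects the child. -/
def Dst : ℕ → Tr → Prop
  | _, .nil => True
  | d, .node l _ _ r => (∀ p ∈ l.ents, p.2 / 2 ^ d % 2 = 0) ∧ (∀ p ∈ r.ents, p.2 / 2 ^ d % 2 = 1) ∧
      Dst (d + 1) l ∧ Dst (d + 1) r

/-- The frames are those on the search path of the key `c`. -/
def Path (c : ℕ) : List Fr → Prop
  | [] => True
  | f :: fs => f.dir = decide (c / 2 ^ fs.length % 2 = 1) ∧ Path c fs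

/-- The frames follow the bits of `c`, so entries with the key `c` may be added below them without
violating the condition at any ancestor. -/
theorem Dst.plug_aux {c : ℕ} {fs : List Fr} {t t' : Tr} (h : Dst 0 (plug fs t)) (hp : Path c fs)
    (hk : ∀ p ∈ t'.ents, p ∈ t.ents ∨ p.2 = c) (ht : Dst fs.length t → Dst fs.length t') :
    Dst 0 (plug fs t') := by
  induction fs generalizing t t' with
  | nil => exact ht h
  | cons f fs ih =>
    rw [plug] at h ⊢
    refine ih h hp.2 ?_ ?_
    · intro p hp
      rw [Fr.up] at hp ⊢
      split_ifs at hp ⊢ <;> simp only [Tr.ents, List.mem_append, List.mem_cons] at hp ⊢ <;>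
        rcases hp with hp | hp | hp <;> first | tauto | (have := hk p hp; tauto)
    · have h1 := hp.1
      rcases f with ⟨_ | _, x, k, o⟩ <;> simp at h1
      · simp only [Fr.up, Bool.false_eq_true, if_false, Dst]
        rintro ⟨h2, h3, h4, h5⟩
        refine ⟨fun p hp => ?_, h3, ht h4, h5⟩
        rcases hk p hp with h | rfl
        exacts [h2 p h, h1]
      · simp only [Fr.up, if_true, Dst]
        rintro ⟨h2, h3, h4, h5⟩
        refine ⟨h2, fun p hp => ?_, h4, ht h5⟩
        rcases hk p hp with h | rfl
        exacts [h3 p h, h1]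

theorem Dst.insert {c x : ℕ} {fs : List Fr} (h : Dst 0 (plug fs .nil)) (hp : Path c fs) :
    Dst 0 (plug fs (.node .nil x c .nil)) :=
  h.plug_aux hp (fun p hp => by simp [Tr.ents] at hp; simp [hp]) fun _ => by simp [Dst, Tr.ents]

/-- All keys in a subtree at depth `d` agree modulo `2 ^ d`, with common residue `ρ`. At depth `B`
keys below `2 ^ B` that agree in this way are equal, and distinctness leaves at most one node there.
-/
theorem Dst.height_le {B : ℕ} {t : Tr} {d ρ : ℕ} (h : Dst d t) (hd : d ≤ B)
    (hρ : ∀ p ∈ t.ents, p.2 % 2 ^ d = ρ) (hB : ∀ p ∈ t.ents, p.2 < 2 ^ B)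
    (hn : (t.ents.map Prod.snd).Nodup) : t.height + d ≤ B + 1 := by
  induction t generalizing d ρ with
  | nil => simp [Tr.height]; omega
  | node l x k r ihl ihr =>
    obtain ⟨h1, h2, h3, h4⟩ := h
    simp only [Tr.ents, List.map_append, List.map_cons, List.nodup_append, List.nodup_cons] at hn
    obtain ⟨n1, ⟨n2, n3⟩, n4⟩ := hn
    have hk := hρ (x, k) (by simp [Tr.ents])
    have hkB := hB (x, k) (by simp [Tr.ents])
    simp only at hk hkB
    have mod : ∀ a e : ℕ, a / 2 ^ d % 2 = e → a % 2 ^ d = ρ → a % 2 ^ (d + 1) = ρ + 2 ^ d * e := by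
      intro a e h1 h2
      rw [pow_succ, Nat.mod_mul, h1, h2]
    rcases Nat.lt_or_ge d B with hlt | hge
    · have a1 := ihl h3 hlt (fun p hp => mod _ _ (h1 p hp) (hρ p (by simp [Tr.ents, hp])))
        (fun p hp => hB p (by simp [Tr.ents, hp])) n1
      have a2 := ihr h4 hlt (fun p hp => mod _ _ (h2 p hp) (hρ p (by simp [Tr.ents, hp])))
        (fun p hp => hB p (by simp [Tr.ents, hp])) n3
      simp only [Tr.height]; omega
    · obtain rfl : d = B := le_antisymm hd hge
      have eq : ∀ p ∈ (Tr.node l x k r).ents, p.2 = k := by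
        intro p hp
        have e1 := hρ p hp
        rw [Nat.mod_eq_of_lt (hB p hp)] at e1
        rw [Nat.mod_eq_of_lt hkB] at hk
        omega
      have hl : l = .nil := by
        cases l with
        | nil => rfl
        | node l' x' k' r' =>
          exfalso
          have := eq (x', k') (by simp [Tr.ents])
          simp only at this
          exact n4 k' (List.mem_map.2 ⟨(x', k'), by simp [Tr.ents], rfl⟩) k (by simp) this
      have hr : r = .nil := by
        cases r with
        | nil => rfl
        | node l' x' k' r' =>
          exfalso
          have := eq (x', k') (by simp [Tr.ents])
          simp only at this
          exact n2 (List.mem_map.2 ⟨(x', k'), by simp [Tr.ents], this⟩)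
      subst hl hr
      simp [Tr.height]; omega


/-! ### Numbering the symbols -/

/-- The symbol at position `i` is smaller than that at position `j`. -/
def SL {α : Type u} [LinearOrder α] (T : List α) (i j : ℕ) : Prop :=
  ∃ c d, T[i]? = some c ∧ T[j]? = some d ∧ c < d

/-- A stack of node indices. -/
def SRep (stk : ℕ → ℕ) : List Fr → Prop
  | [] => True
  | f :: fs => stk fs.length = f.x ∧ SRep stk fs

theorem SRep.update {stk : ℕ → ℕ} {fs : List Fr} (h : SRep stk fs) {j n : ℕ} (hj : fs.length ≤ j) :
    SRep (Function.update stk j n) fs := by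
  induction fs with
  | nil => trivial
  | cons f fs ih =>
    simp only [List.length_cons] at hj
    exact ⟨by rw [Function.update_of_ne (by omega)]; exact h.1, ih h.2 (by omega)⟩

/-- Search the symbol at position `i`; the path is stored on a stack. -/
def findSym : Cmd :=
  .x ::= .off .rt 0 ;; .d ::= .num 0 ;; .res ::= .num 0 ;;
  .while (.pos .x) (
    .y ::= .get .key .x ;;
    .ite (.symEq .i .y) (.res ::= .off .x 0 ;; .x ::= .num 0)
      (.put .stk .d .x ;; .d ::= .off .d 1 ;;
       .ite (.symLt .i .y) (.x ::= .get .L .x) (.x ::= .get .R .x)))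

section
variable {α : Type u} [LinearOrder α] {N : ℕ} {s : VS α}

theorem SL.trichotomy {T : List α} {i j : ℕ} (hi : i < T.length) (hj : j < T.length) :
    (∃ c d, T[i]? = some c ∧ T[j]? = some d ∧ c = d) ∨ SL T i j ∨ SL T j i := by
  rcases lt_trichotomy T[i] T[j] with h | h | h
  · exact .inr (.inl ⟨_, _, List.getElem?_eq_getElem hi, List.getElem?_eq_getElem hj, h⟩)
  · exact .inl ⟨_, _, List.getElem?_eq_getElem hi, List.getElem?_eq_getElem hj, h⟩
  · exact .inr (.inr ⟨_, _, List.getElem?_eq_getElem hj, List.getElem?_eq_getElem hi, h⟩)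

theorem SL.trans {T : List α} {i j k : ℕ} (h : SL T i j) (h' : SL T j k) : SL T i k := by
  obtain ⟨a, b, h1, h2, h3⟩ := h
  obtain ⟨c, d, h4, h5, h6⟩ := h'
  rw [h2] at h4; cases h4
  exact ⟨a, d, h1, h5, h3.trans h6⟩

/-- The invariant keeps a focus such that every entry before it has a smaller symbol and every entry
after it a larger one. Falling off the tree therefore proves that the symbol is new, and the frames
with the stack of their nodes describe where it must be inserted. -/
theorem wp_findSym {t₀ : Tr} (hrep : t₀.Rep (s.m .L) (s.m .R) (s.m .lev))
    (hrt : t₀.root = s.r .rt) (hi : s.r .i < s.text.length)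
    (hkey : ∀ p ∈ t₀.ents, s.m .key p.1 < s.text.length)
    (hs : t₀.ents.Pairwise fun p q => SL s.text (s.m .key p.1) (s.m .key q.1)) (hN : t₀.height + 1 ≤ N) :
    wp N findSym s fun s' => Keep [.x, .d, .res, .y] [.stk] s s' ∧
      s'.clk ≤ s.clk + 8 * t₀.height + 10 ∧
      ((s'.r .res ∈ t₀.ids ∧ s'.r .res ≠ 0 ∧
        s.text[s.m .key (s'.r .res)]? = s.text[s.r .i]?) ∨
      (s'.r .res = 0 ∧ ∃ fs, plug fs .nil = t₀ ∧ s'.r .d = fs.length ∧ SRep (s'.m .stk) fs ∧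
        (∀ p ∈ pre fs, SL s.text (s.m .key p.1) (s.r .i)) ∧
        (∀ p ∈ post fs, SL s.text (s.r .i) (s.m .key p.1)))) := by
  simp only [findSym, wp_seq, wp_asg, Ex.Bd, Ex.eval, true_or, true_and, Nat.zero_le]
  refine wp_while (fun s' => Keep [.x, .d, .res, .y] [.stk] s s' ∧ ∃ fs t, plug fs t = t₀ ∧
    s'.clk ≤ s.clk + 8 * fs.length + 3 + (if s'.r .res = 0 then 0 else 6) ∧
    ((s'.r .x = 0 ∧ s'.r .res ∈ t₀.ids ∧ s'.r .res ≠ 0 ∧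
        s.text[s.m .key (s'.r .res)]? = s.text[s.r .i]?) ∨
      (s'.r .res = 0 ∧ s'.r .x = t.root ∧ s'.r .d = fs.length ∧ SRep (s'.m .stk) fs ∧
        (∀ p ∈ pre fs, SL s.text (s.m .key p.1) (s.r .i)) ∧
        (∀ p ∈ post fs, SL s.text (s.r .i) (s.m .key p.1)))))
    -- The depth in `d` grows in every round that goes down; `x = 0` signals both success and the
    -- end of the path.
    (fun s' => if s'.r .x = 0 then 0 else N - s'.r .d + 1) ?_ ?_ ?_
  · refine ⟨⟨?_, ?_, rfl, rfl, rfl⟩, [], t₀, rfl, ?_, .inr ?_⟩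
    · intro x hx; simp at hx; simp [hx]
    · intro a ha; simp
    · simp
    · simp [hrt, SRep, pre, post]
  · rintro s1 ⟨hk, fs, t, rfl, hclk, h⟩ hx
    simp only [Tst.Holds] at hx
    rcases h with ⟨h, -⟩ | ⟨hres, hx', hd, hst, hpre, hpost⟩
    · omega
    have hx0 : t.root ≠ 0 := by omega
    have hRt := (rep_plug.1 hrep).1
    cases t with
    | nil => simp [Tr.root] at hx0
    | node l x k r =>
    obtain ⟨h0, h1, h2, h3, h4, h5⟩ := hRt
    simp only [Tr.root] at hx'
    have hmem : (x, k) ∈ (plug fs (.node l x k r)).ents := by simp [ents_plug, Tr.ents]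
    have hkx := hkey _ hmem
    simp only at hkx
    have hh := height_plug fs (.node l x k r)
    simp only [Tr.height] at hh
    simp [wp_seq, wp_asg, wp_put, wp_ite, Ex.Bd, Ex.eval, Tst.Holds, hk.text, hk.r, hk.m, hx', hd]
    simp only [hres, if_true] at hclk
    constructor
    · intro c1 hc1 hc2
      refine ⟨⟨⟨fun z hz => ?_, fun a ha => ?_, hk.text, hk.rest, hk.out⟩, fs, .node l x k r, rfl,
        ?_, .inl ⟨Tr.fst_mem_ids hmem, h0, ?_⟩⟩, by simp [h0]⟩
      · simp at hz; simp [hz, hk.r]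
      · simp at ha; simp [ha, hk.m]
      · simp [h0]; omega
      · rw [hc1, hc2]
    · intro hne
      refine ⟨by omega, ?_⟩
      have tri := SL.trichotomy hi hkx
      rw [ents_plug, Tr.ents, List.pairwise_append, List.pairwise_append, List.pairwise_append,
        List.pairwise_cons] at hs
      have hmu : ∀ a, (if a = 0 then 0 else N - (fs.length + 1) + 1) < N - fs.length + 1 := by
        intro a; split_ifs <;> omega
      rw [if_neg h0]
      constructor
      · intro c1 hc1 c2 hc2 hlt
        refine ⟨⟨⟨fun z hz => ?_, fun a ha => ?_, hk.text, hk.rest, hk.out⟩, ⟨false, x, k, r⟩ :: fs,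
          l, rfl, ?_, .inr ⟨hres, h1, by simp, ?_, ?_, ?_⟩⟩, hmu _⟩
        · simp at hz; simp [hz, hk.r]
        · simp at ha; rw [VS.set_m, VS.tick_m, VS.set_m, VS.put_m]; simp [ha, hk.m]
        · simp [hres]; omega
        · exact ⟨by simp, by simpa using hst.update le_rfl⟩
        · simpa [pre] using hpre
        · intro p p' hp
          simp only [post, Bool.false_eq_true, if_false, List.mem_append, List.mem_cons] at hp
          have hxi : SL s.text (s.r .i) (s.m .key x) := ⟨c1, c2, hc1, hc2, hlt⟩
          rcases hp with (hp | hp) | hp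
          · cases hp; exact hxi
          · exact hxi.trans (hs.1.2.1.2.1.1 _ hp)
          · exact hpost _ hp
      · intro hnlt
        refine ⟨⟨⟨fun z hz => ?_, fun a ha => ?_, hk.text, hk.rest, hk.out⟩, ⟨true, x, k, l⟩ :: fs,
          r, rfl, ?_, .inr ⟨hres, h2, by simp, ?_, ?_, ?_⟩⟩, hmu _⟩
        · simp at hz; simp [hz, hk.r]
        · simp at ha; rw [VS.set_m, VS.tick_m, VS.set_m, VS.put_m]; simp [ha, hk.m]
        · simp [hres]; omega
        · exact ⟨by simp, by simpa using hst.update le_rfl⟩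
        · intro p p' hp
          simp only [pre, if_true, List.mem_append, List.mem_singleton] at hp
          have hxi : SL s.text (s.m .key x) (s.r .i) := by
            rcases tri with ⟨c, d, h1, h2, h3⟩ | ⟨c, d, h1, h2, h3⟩ | h
            · exact absurd (h3 ▸ h2) (hne c h1)
            · exact absurd h3 (by simpa using hnlt c h1 d h2)
            · exact h
          rcases hp with hp | hp | hp
          · exact hpre _ hp
          · exact (hs.1.2.1.2.2 _ hp (x, k) (by simp)).trans hxi
          · cases hp; exact hxi
        · simpa [post] using hpost
  · rintro s1 ⟨hk, fs, t, rfl, hclk, h⟩ hx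
    simp only [Tst.Holds, not_lt, Nat.le_zero] at hx
    have hh := height_plug fs t
    refine ⟨⟨hk.r, hk.m, hk.text, hk.rest, hk.out⟩, ?_, ?_⟩
    · simp only [VS.tick_clk]
      split_ifs at hclk <;> omega
    · rcases h with ⟨-, h1, h2, h3⟩ | ⟨hres, hx', hd, hst, hpre, hpost⟩
      · exact .inl ⟨h1, h2, h3⟩
      · have : t = .nil := (rep_plug.1 hrep).1.root_eq_zero (by omega)
        subst this
        exact .inr ⟨hres, fs, rfl, hd, hst, hpre, hpost⟩

end

/-! ### Rotations and rebalancing after an insertion -/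

/-- The command for `skew` at the node `x`. -/
def skewCmd : Cmd :=
  .y ::= .get .L .x ;; .c ::= .get .lev .y ;; .e ::= .get .lev .x ;;
  .ite (.eq .c .e)
    (.c ::= .get .R .y ;; .put .L .x .c ;; .put .R .y .x ;; .x ::= .off .y 0) .skip

/-- The command for `split` at the node `x` with level `e`. -/
def splitCmd : Cmd :=
  .y ::= .get .R .x ;; .c ::= .get .R .y ;; .c ::= .get .lev .c ;;
  .ite (.eq .c .e)
    (.c ::= .get .L .y ;; .put .R .x .c ;; .put .L .y .x ;; .e ::= .off .e 1 ;;
      .put .lev .y .e ;; .x ::= .off .y 0) .skip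

/-- The effect of a rotation that transforms the tree `t` at the node `x` into `t'`. -/
structure Rot {α : Type u} (t t' : Tr) (s s' : VS α) : Prop where
  keep : Keep [.y, .c, .e, .x] [.L, .R, .lev] s s'
  rep : t'.Rep (s'.m .L) (s'.m .R) (s'.m .lev)
  root : s'.r .x = t'.root
  same : ∀ z, z ∉ t.ids →
    s'.m .L z = s.m .L z ∧ s'.m .R z = s.m .R z ∧ s'.m .lev z = s.m .lev z
  clk : s'.clk ≤ s.clk + 10

section
variable {α : Type u} [LinearOrder α] {N : ℕ} {s : VS α}

/-- Index `0` serves as the empty tree. Its level entry is `0` and `k` is positive, so the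
comparison with a missing left child fails without a separate test. The level is left in `e` for the
command that follows. -/
theorem wp_skewCmd {l r : Tr} {z k : ℕ} (hx : s.r .x = z)
    (hrep : (Tr.node l z k r).Rep (s.m .L) (s.m .R) (s.m .lev))
    (hn : (Tr.node l z k r).ids.Nodup) (h0 : s.m .lev 0 = 0) (hk : 0 < k) :
    wp N skewCmd s fun s' => Rot (.node l z k r) (skew (.node l z k r)) s s' ∧ s'.r .e = k := by
  obtain ⟨z0, hl, hr, hv, hL, hR⟩ := hrep
  simp [skewCmd, wp_seq, wp_asg, wp_put, wp_ite, wp_skip, Ex.Bd, Ex.eval, Tst.Holds, hx, hl, hr, hv]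
  cases l with
  | nil =>
    simp only [Tr.root_nil, Tr.root_node, h0, skew]
    refine ⟨fun h => by omega, fun _ => ⟨⟨?_, ?_, rfl, rfl, rfl⟩, ⟨z0, hl, hr, hv, hL, hR⟩, ?_, ?_, ?_⟩⟩
    · intro v hv; simp at hv; simp [hv]
    · intro a ha; simp
    · simp [hx]
    · simp
    · simp
  | node a w k' b =>
    obtain ⟨w0, hl', hr', hv', hL', hR'⟩ := hL
    simp only [Tr.root_nil, Tr.root_node, hv', hr', skew]
    simp only [Tr.ids_node, List.nodup_append, List.nodup_cons,
      List.mem_append, List.mem_cons, List.append_assoc, List.cons_append] at hn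
    have hwz : w ≠ z := by grind
    refine ⟨fun h => ?_, fun h => ?_⟩
    · rw [if_pos h]
      refine ⟨⟨?_, ?_, rfl, rfl, rfl⟩, ?_, ?_, ?_, ?_⟩
      · intro v hv; simp at hv; simp [hv]
      · intro a ha; simp at ha; simp [ha]
      · refine ⟨w0, ?_, ?_, hv', (hL'.updL ?_).updR ?_, z0, ?_, ?_, ?_, (hR'.updL ?_).updR ?_,
          (hR.updL ?_).updR ?_⟩
        · simp [hwz, hl']
        · simp
        · grind
        · grind
        · simp
        · simp [hwz.symm, hr]
        · simp [hv]
        all_goals grind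
      · simp
      · intro u hu
        simp at hu
        have h1 : u ≠ z := by tauto
        have h2 : u ≠ w := by tauto
        simp [h1, h2]
      · simp
    · rw [if_neg h]
      refine ⟨⟨?_, ?_, rfl, rfl, rfl⟩, ⟨z0, hl, hr, hv, ⟨w0, hl', hr', hv', hL', hR'⟩, hR⟩, ?_, ?_, ?_⟩
      · intro v hv; simp at hv; simp [hv]
      · intro a ha; simp
      · simp [hx]
      · simp
      · simp

/-- The grandchild is read through a possibly missing right child; `R 0 = 0` and `lev 0 = 0` make
this read yield level `0`. The sum `k + 1` is formed only when the root level rises. -/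
theorem wp_splitCmd {l r : Tr} {z k : ℕ} (hx : s.r .x = z) (he : s.r .e = k)
    (hrep : (Tr.node l z k r).Rep (s.m .L) (s.m .R) (s.m .lev))
    (hn : (Tr.node l z k r).ids.Nodup) (h0 : s.m .lev 0 = 0) (h0' : s.m .R 0 = 0) (hk : 0 < k)
    (hN : k + 1 ≤ N) :
    wp N splitCmd s fun s' => Rot (.node l z k r) (split (.node l z k r)) s s' := by
  obtain ⟨z0, hl, hr, hv, hL, hR⟩ := hrep
  simp [splitCmd, wp_seq, wp_asg, wp_put, wp_ite, wp_skip, Ex.Bd, Ex.eval, Tst.Holds, hx, hl, hr,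
    hv, he]
  cases r with
  | nil =>
    simp only [Tr.root_nil, Tr.root_node, h0, h0', split]
    refine ⟨fun h => by omega, fun _ => ⟨⟨?_, ?_, rfl, rfl, rfl⟩, ⟨z0, hl, hr, hv, hL, hR⟩, ?_, ?_, ?_⟩⟩
    · intro v hv; simp at hv; simp [hv]
    · intro a ha; simp
    · simp [hx]
    · simp
    · simp
  | node a w k' b =>
    obtain ⟨w0, hl', hr', hv', hL', hR'⟩ := hR
    cases b with
    | nil =>
      simp only [Tr.root_nil, Tr.root_node, h0, split, hr']
      refine ⟨fun h => by omega, fun _ => ⟨⟨?_, ?_, rfl, rfl, rfl⟩,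
        ⟨z0, hl, hr, hv, hL, ⟨w0, hl', hr', hv', hL', hR'⟩⟩, ?_, ?_, ?_⟩⟩
      · intro v hv; simp at hv; simp [hv]
      · intro a ha; simp
      · simp [hx]
      · simp
      · simp
    | node c u k'' d =>
      obtain ⟨u0, hl'', hr'', hv'', hL'', hR''⟩ := hR'
      simp only [Tr.root_nil, Tr.root_node, hr', split, hl', hv'']
      simp only [Tr.ids_node, List.nodup_append, List.nodup_cons,
        List.mem_append, List.mem_cons, List.append_assoc, List.cons_append] at hn
      have hwz : w ≠ z := by grind
      have hwu : w ≠ u := by grind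
      have hzu : z ≠ u := by grind
      refine ⟨fun h => ⟨hN, ?_⟩, fun h => ?_⟩
      · rw [if_pos h]
        refine ⟨⟨?_, ?_, rfl, rfl, rfl⟩, ?_, ?_, ?_, ?_⟩
        · intro v hv; simp at hv; simp [hv]
        · intro a ha; simp at ha; simp [ha]
        · refine ⟨w0, ?_, ?_, ?_, ⟨z0, ?_, ?_, ?_, ((hL.updL ?_).updR ?_).updV ?_,
            ((hL'.updL ?_).updR ?_).updV ?_⟩, u0, ?_, ?_, ?_, ((hL''.updL ?_).updR ?_).updV ?_,
            ((hR''.updL ?_).updR ?_).updV ?_⟩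
          · simp
          · simp [hwz, hr']
          · simp
          · simp [hwz.symm, hl]
          · simp
          · simp [hwz.symm, hv]
          rotate_left 6
          · simp [hwu.symm, hl'']
          · simp [hzu.symm, hr'']
          · simp [hwu.symm, hv'']
          all_goals grind
        · simp
        · intro x hx
          simp at hx
          have h1 : x ≠ z := by tauto
          have h2 : x ≠ w := by tauto
          simp [h1, h2]
        · simp
      · rw [if_neg h]
        refine ⟨⟨?_, ?_, rfl, rfl, rfl⟩, ⟨z0, hl, hr, hv, hL,
          ⟨w0, hl', hr', hv', hL', ⟨u0, hl'', hr'', hv'', hL'', hR''⟩⟩⟩, ?_, ?_, ?_⟩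
        · intro v hv; simp at hv; simp [hv]
        · intro a ha; simp
        · simp [hx]
        · simp
        · simp

end

/-- Rebalance along the stacked path after an insertion. -/
def fixUp : Cmd :=
  .while (.pos .d) (
    .d ::= .sub .d .one ;; .p ::= .get .stk .d ;; .y ::= .get .key .p ;;
    .ite (.symLt .i .y) (.put .L .p .x) (.put .R .p .x) ;;
    .x ::= .off .p 0 ;; skewCmd ;; splitCmd)

/-- The root may change but its level does not, so `splitCmd` can start from the level that
`skewCmd` left in `e`. -/
theorem exists_skew (l r : Tr) (z k : ℕ) :
    ∃ l' z' r', skew (.node l z k r) = .node l' z' k r' := by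
  cases l with
  | nil => exact ⟨_, _, _, rfl⟩
  | node a w k' b =>
    simp only [skew]
    split_ifs with h
    · exact ⟨_, _, _, by rw [h]⟩
    · exact ⟨_, _, _, rfl⟩

/-- The indices on the path to a subtree, before the subtree. -/
def preI (fs : List Fr) : List ℕ := (pre fs).map Prod.fst

/-- The indices on the path to a subtree, after the subtree. -/
def postI (fs : List Fr) : List ℕ := (post fs).map Prod.fst

theorem ids_plug (fs : List Fr) (t : Tr) : (plug fs t).ids = preI fs ++ t.ids ++ postI fs := by
  simp [Tr.ids, ents_plug, preI, postI]

theorem Tr.Rep.zero_notMem {L R V : ℕ → ℕ} {t : Tr} (h : t.Rep L R V) : 0 ∉ t.ids := by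
  induction t with
  | nil => simp
  | node l x k r ihl ihr =>
    obtain ⟨h0, -, -, -, h4, h5⟩ := h
    simp [ihl h4, ihr h5, h0.symm]

theorem preI_up (f : Fr) (fs : List Fr) (t : Tr) :
    preI (f :: fs) ++ t.ids ++ postI (f :: fs) = preI fs ++ (f.up t).ids ++ postI fs := by
  rw [← ids_plug, ← ids_plug]; rfl

theorem FRep.congrI {L R V L' R' V' : ℕ → ℕ} {fs : List Fr} {c : ℕ} (h : FRep L R V fs c)
    (hc : ∀ x ∈ preI fs ++ postI fs, L' x = L x ∧ R' x = R x ∧ V' x = V x) :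
    FRep L' R' V' fs c :=
  h.congr fun p hp => hc p.1 (by
    rw [List.mem_append] at hp ⊢
    exact hp.imp (fun h => List.mem_map_of_mem h) fun h => List.mem_map_of_mem h)

section
variable {α : Type u} [LinearOrder α] {N : ℕ} {s : VS α}

/-- The stack stores no directions. They are recovered by comparing the new symbol with the key of
the stacked node, because the entries before the focus are smaller and those after it larger. Here
`t₀` is the subtree before the insertion, so that `Grow` can be carried up the frames of the old
balanced tree, and `c₀` is the stale child pointer, which the first store overwrites. -/
theorem wp_fixUp {fs : List Fr} {t₀ t : Tr} {c₀ n : ℕ} (hone : s.r .one = 1)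
    (hL : s.m .lev 0 = 0) (hR : s.m .R 0 = 0)
    (hd : s.r .d = fs.length) (hx : s.r .x = t.root) (hrep : t.Rep (s.m .L) (s.m .R) (s.m .lev))
    (hfs : FRep (s.m .L) (s.m .R) (s.m .lev) fs c₀) (hst : SRep (s.m .stk) fs)
    (hpre : ∀ x ∈ preI fs, SL s.text (s.m .key x) (s.r .i))
    (hpost : ∀ x ∈ postI fs, SL s.text (s.r .i) (s.m .key x))
    (hn : (preI fs ++ t.ids ++ postI fs).Nodup) (hok : Ok n (plug fs t₀)) (hg : Grow t₀ t)
    (hN : (preI fs ++ t.ids ++ postI fs).length + 1 ≤ N) (hlen : t₀.ids.length ≤ t.ids.length) :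
    wp N fixUp s fun s' => Keep [.d, .p, .y, .x, .c, .e] [.L, .R, .lev] s s' ∧
      s'.clk ≤ s.clk + 30 * fs.length + 5 ∧ s'.m .lev 0 = 0 ∧ s'.m .R 0 = 0 ∧
      ∃ t' n', t'.Rep (s'.m .L) (s'.m .R) (s'.m .lev) ∧ s'.r .x = t'.root ∧ Ok n' t' ∧
        t'.ids = preI fs ++ t.ids ++ postI fs := by
  obtain ⟨I, hI⟩ : ∃ I : VS α → Prop, I = fun s' => Keep [.d, .p, .y, .x, .c, .e] [.L, .R, .lev] s s' ∧
    s'.m .lev 0 = 0 ∧ s'.m .R 0 = 0 ∧ ∃ fs' t₀' t' c', s'.r .d = fs'.length ∧ 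
    s'.clk + 30 * fs'.length ≤ s.clk + 30 * fs.length ∧
    s'.r .x = t'.root ∧ t'.Rep (s'.m .L) (s'.m .R) (s'.m .lev) ∧
    FRep (s'.m .L) (s'.m .R) (s'.m .lev) fs' c' ∧ SRep (s'.m .stk) fs' ∧
    (∀ x ∈ preI fs', SL s.text (s.m .key x) (s.r .i)) ∧
    (∀ x ∈ postI fs', SL s.text (s.r .i) (s.m .key x)) ∧
    preI fs' ++ t'.ids ++ postI fs' = preI fs ++ t.ids ++ postI fs ∧
    Ok n (plug fs' t₀') ∧ Grow t₀' t' ∧ t₀'.ids.length ≤ t'.ids.length := ⟨_, rfl⟩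
  refine wp_while I (fun s' => s'.r .d) ?_ ?_ ?_
  · rw [hI]
    exact ⟨.refl _ _ _, hL, hR, fs, t₀, t, c₀, hd, le_rfl, hx, hrep, hfs, hst, hpre, hpost, rfl, hok,
      hg, hlen⟩
  · clear hd hx hrep hfs hst hpre hpost hok hg hL hR hlen
    rintro s1 h1 ht
    rw [hI] at h1
    obtain ⟨hk, hL, hR, fs', t₀', t', c', hd, hclk, hx, hrep, hfs, hst, hpre, hpost, hids, hok, hg,
      hlen⟩ := h1
    simp only [Tst.Holds] at ht
    cases fs' with
    | nil => simp at hd; omega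
    | cons f fs' =>
    simp only [List.length_cons] at hd hclk
    rw [← hids, preI_up] at hn hN
    have hids' := hids
    rw [preI_up] at hids'
    have hok' := hok
    rw [plug] at hok'
    have hg' := hg
    obtain ⟨m, hm⟩ := hok'.of_plug
    have hgu := hg.up hm
    obtain ⟨f0, hf1, hf2, hf3, hf4⟩ := hfs
    -- The level `m` of a subtree satisfies `m < 2 ^ m`, which is at most one more than its number
    -- of nodes; this bounds all levels by `N`.
    have hfk : 0 < f.k ∧ f.k + 1 ≤ N := by
      have h1 : f.k = m := by
        have := hm.lvl_eq
        rw [Fr.up] at this; split_ifs at this <;> exact this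
      have h2 : (f.up t₀').ids.length ≤ (f.up t').ids.length := by
        rw [Fr.up, Fr.up]; split_ifs <;> simp <;> omega
      have h3 := hm.pow_le
      have h4 : (f.up t₀').ents.length = (f.up t₀').ids.length := by simp [Tr.ids]
      have h5 : m < 2 ^ m := Nat.lt_two_pow_self
      simp only [List.length_append] at hN
      have h6 : 0 < m := by
        rcases Nat.eq_zero_or_pos m with rfl | h
        · cases h' : f.up t₀' with
          | nil => rw [Fr.up] at h'; split_ifs at h'
          | node => rw [h'] at hm; cases hm
        · exact h
      omega
    have hfx : f.x ∉ preI fs' ++ postI fs' := by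
      rw [Fr.up] at hn; split_ifs at hn <;> simp at hn <;> simp <;> grind
    have hdir : (if f.dir then ¬ (∃ a b, s.text[s.r .i]? = some a ∧ s.text[s.m .key f.x]? = some b ∧ a < b)
        else (∃ a b, s.text[s.r .i]? = some a ∧ s.text[s.m .key f.x]? = some b ∧ a < b)) := by
      split_ifs with h
      · obtain ⟨a, b, h1, h2, h3⟩ := hpre f.x (by simp [preI, pre, h])
        rintro ⟨a', b', h4, h5, h6⟩
        rw [h2] at h4; rw [h1] at h5; cases h4; cases h5
        exact lt_asymm h3 h6
      · exact hpost f.x (by simp [postI, post, h])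
    have hne : t'.ids.Nodup ∧ f.o.ids.Nodup ∧ f.x ∉ t'.ids ∧ f.x ∉ f.o.ids := by
      rw [Fr.up] at hn; split_ifs at hn <;> simp at hn <;> grind
    have hst1 : s1.m .stk fs'.length = f.x := hst.1
    have main : ∀ s2 : VS α, Keep [.d, .p, .y, .x] [.L, .R] s1 s2 → s2.clk ≤ s1.clk + 8 →
        s2.r .d = fs'.length → s2.r .x = f.x →
        (f.up t').Rep (s2.m .L) (s2.m .R) (s2.m .lev) →
        FRep (s2.m .L) (s2.m .R) (s2.m .lev) fs' f.x → s2.m .R 0 = 0 →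
        wp N skewCmd s2 fun s' => wp N splitCmd s' fun s' => I s' ∧ s'.r .d < s1.r .d := by
      intro s2 hk2 hc2 hd2 hx2 hrep2 hfs2 hR2
      have hlev2 : s2.m .lev = s1.m .lev := hk2.m _ (by decide)
      have hup : ∃ l r, f.up t' = .node l f.x f.k r := by
        rw [Fr.up]; split_ifs <;> exact ⟨_, _, rfl⟩
      obtain ⟨l, r, hup⟩ := hup
      have hnu : (f.up t').ids.Nodup := by
        rw [List.nodup_append, List.nodup_append] at hn; exact hn.1.2.1
      have hlu : (f.up t₀').ids.length ≤ (f.up t').ids.length := by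
        rw [Fr.up, Fr.up]; split_ifs <;> simp <;> omega
      rw [hup] at hrep2 hgu hnu hn hids' hlu
      have hz : (0 : ℕ) ∉ (Tr.node l f.x f.k r).ids := fun h0 => hrep2.zero_notMem h0
      refine wp_mono (wp_skewCmd hx2 hrep2 hnu (by rw [hlev2]; exact hL) hfk.1) ?_
      rintro s3 ⟨hr3, he3⟩
      obtain ⟨l', z', r', hsk⟩ := exists_skew l r f.x f.k
      have hi3 := ids_skew (.node l f.x f.k r)
      have h03 := hr3.same 0 hz
      have hr3' := hr3.rep
      have hx3 := hr3.root
      rw [hsk] at hr3' hx3 hi3 hgu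
      rw [Tr.root_node] at hx3
      refine wp_mono (wp_splitCmd hx3 he3 hr3' (by rw [hi3]; exact hnu)
        (by rw [h03.2.2, hlev2]; exact hL) (by rw [h03.2.1]; exact hR2) hfk.1 hfk.2) ?_
      intro s4 hr4
      have h04 := hr4.same 0 (by rw [hi3]; exact hz)
      have hi4 := ids_split (.node l' z' f.k r')
      have hd4 : s4.r .d = fs'.length := by
        rw [hr4.keep.r _ (by decide), hr3.keep.r _ (by decide), hd2]
      have hk4 : Keep [.d, .p, .y, .x, .c, .e] [.L, .R, .lev] s s4 :=
        ((hk.trans (vs'' := [.d, .p, .y, .x, .c, .e]) (as'' := [.L, .R, .lev]) hk2).trans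
          (vs'' := [.d, .p, .y, .x, .c, .e]) (as'' := [.L, .R, .lev]) hr3.keep).trans hr4.keep
      have same : ∀ x ∈ preI fs' ++ postI fs', x ∉ (Tr.node l f.x f.k r).ids := by
        intro x hx; rw [List.nodup_append, List.nodup_append] at hn; grind
      have hc3 := hr3.clk
      have hc4 := hr4.clk
      rw [hI]
      refine ⟨⟨hk4, by rw [h04.2.2, h03.2.2, hlev2]; exact hL, by rw [h04.2.1, h03.2.1]; exact hR2,
        fs', f.up t₀', _, f.x, hd4, by omega, hr4.root, hr4.rep, hfs2.congrI fun x hx => ?_, ?_, ?_,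
        ?_, by rw [hi4, hi3]; exact hids', hok, hgu, by rw [hi4, hi3]; exact hlu⟩, by omega⟩
      · have h1 := same x hx
        have h2 := hr3.same x h1
        have h3 := hr4.same x (by rw [hi3]; exact h1)
        exact ⟨h3.1.trans h2.1, h3.2.1.trans h2.2.1, h3.2.2.trans h2.2.2⟩
      · rw [hr4.keep.m _ (by decide), hr3.keep.m _ (by decide), hk2.m _ (by decide)]; exact hst.2
      · exact fun x hx => hpre x (by rw [preI, pre]; split_ifs <;> simp [preI] at hx ⊢; tauto; tauto)
      · exact fun x hx => hpost x (by rw [postI, post]; split_ifs <;> simp [postI] at hx ⊢; tauto; tauto)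
    have hfs5 : ∀ L' R' : ℕ → ℕ, (∀ y, y ≠ f.x → L' y = s1.m .L y ∧ R' y = s1.m .R y) →
        FRep L' R' (s1.m .lev) fs' f.x := fun L' R' h => hf4.congrI fun y hy => by
      have := h y (fun he => hfx (he ▸ hy)); simp [this]
    rcases f with ⟨_ | _, x, k, o⟩
    · simp at hf1 hdir hst1 f0
      obtain ⟨c1, hc1, c2, hc2, hlt⟩ := hdir
      have hd' : s1.r .d - 1 = fs'.length := by omega
      simp [wp_seq, wp_asg, wp_put, wp_ite, Ex.Bd, Ex.eval, Tst.Holds, hk.text, hk.r, hk.m, hone,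
        hst1, hd', hc1, hc2, hlt]
      refine main _ ?_ ?_ ?_ ?_ ?_ ?_ ?_
      · refine ⟨fun v hv => ?_, fun a ha => ?_, rfl, rfl, rfl⟩
        · simp at hv; simp [hv]
        · simp at ha; simp [ha]
      · simp
      · simp
      · simp
      rotate_left
      · exact hfs5 _ _ fun y hy => by simp [hy]
      · simpa using hR
      · refine ⟨f0, by simpa using hx, by simpa using hf1.2, by simpa using hf2, ?_, ?_⟩
        · simpa using hrep.updL hne.2.2.1
        · simpa using hf3.updL hne.2.2.2
    · simp at hf1 hdir hst1 f0
      have hd' : s1.r .d - 1 = fs'.length := by omega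
      simp [wp_seq, wp_asg, wp_put, wp_ite, Ex.Bd, Ex.eval, Tst.Holds, hk.text, hk.r, hk.m, hone,
        hst1, hd']
      refine ⟨fun c1 hc1 c2 hc2 hlt => absurd hlt (by simpa using hdir c1 hc1 c2 hc2), fun _ => ?_⟩
      refine main _ ?_ ?_ ?_ ?_ ?_ ?_ ?_
      · refine ⟨fun v hv => ?_, fun a ha => ?_, rfl, rfl, rfl⟩
        · simp at hv; simp [hv]
        · simp at ha; simp [ha]
      · simp
      · simp
      · simp
      rotate_left
      · exact hfs5 _ _ fun y hy => by simp [hy]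
      · simpa [Ne.symm f0] using hR
      · refine ⟨f0, by simpa using hf1.1, by simpa using hx, by simpa using hf2, ?_, ?_⟩
        · simpa using hf3.updR hne.2.2.2
        · simpa using hrep.updR hne.2.2.1
  · rintro s1 h1 ht
    rw [hI] at h1
    obtain ⟨hk, hL, hR, fs', t₀', t', c', hd, hclk, hx, hrep, hfs, hst, hpre, hpost, hids, hok, hg,
      hlen⟩ := h1
    simp only [Tst.Holds, not_lt, Nat.le_zero] at ht
    have : fs' = [] := List.length_eq_zero_iff.1 (by omega)
    subst this
    obtain ⟨n', -, h⟩ := hg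
    have h' : ∃ n', Ok n' t' := by
      rcases h with h | ⟨-, h⟩
      exacts [⟨_, h⟩, ⟨_, h.ok⟩]
    obtain ⟨n', h⟩ := h'
    refine ⟨⟨hk.r, hk.m, hk.text, hk.rest, hk.out⟩, by simp at hclk ⊢; omega, hL, hR, t', n', hrep, hx,
      h, ?_⟩
    simpa [preI, postI, pre, post] using hids

end

/-! ### The dictionary of symbols -/

/-- Create a node for a new symbol, and extend the table of halves. -/
def newSym : Cmd :=
  .cnt ::= .off .cnt 1 ;; .res ::= .off .cnt 0 ;; .put .key .res .i ;; .put .lev .res .one ;;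
  .x ::= .num 0 ;; .put .L .res .x ;; .put .R .res .x ;;
  .y ::= .sub .cnt .one ;; .kk ::= .get .hf .y ;; .c ::= .get .pr .y ;;
  .ite (.pos .c) (.kk ::= .off .kk 1 ;; .put .hf .cnt .kk ;; .put .pr .cnt .x)
    (.put .hf .cnt .kk ;; .put .pr .cnt .one) ;;
  .x ::= .off .res 0 ;; fixUp ;; .rt ::= .off .x 0

/-- Compute the number of the symbol at position `i`. -/
def numSym : Cmd :=
  findSym ;; .ite (.pos .res) .skip newSym ;; .put .ID .i .res

/-- The dictionary of the symbols at the positions below `i`. -/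
structure Dict {α : Type u} [LinearOrder α] (T : List α) (i : ℕ) (s : VS α) : Prop where
  tree : ∃ t n, t.Rep (s.m .L) (s.m .R) (s.m .lev) ∧ t.root = s.r .rt ∧ Ok n t ∧
    (t.ids.Pairwise fun x y => SL T (s.m .key x) (s.m .key y)) ∧
    ∀ x, x ∈ t.ids ↔ 1 ≤ x ∧ x ≤ s.r .cnt
  lev_zero : s.m .lev 0 = 0
  R_zero : s.m .R 0 = 0
  key_lt : ∀ x, 1 ≤ x → x ≤ s.r .cnt → s.m .key x < i
  id_pos : ∀ j < i, 1 ≤ s.m .ID j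
  id_le : ∀ j < i, s.m .ID j ≤ s.r .cnt
  id_sym : ∀ j < i, T[s.m .key (s.m .ID j)]? = T[j]?
  hf : ∀ k ≤ s.r .cnt, s.m .hf k = k / 2
  pr : ∀ k ≤ s.r .cnt, s.m .pr k = k % 2

section
variable {α : Type u} [LinearOrder α] {N : ℕ} {s : VS α} {T : List α} {i : ℕ}

theorem SL.irrefl {i j : ℕ} (h : SL T i j) : T[i]? ≠ T[j]? := by
  obtain ⟨c, d, h1, h2, h3⟩ := h
  rw [h1, h2]
  intro h; cases h; exact lt_irrefl _ h3

theorem nodup_of_SL {l : List ℕ} {key : ℕ → ℕ}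
    (h : l.Pairwise fun x y => SL T (key x) (key y)) : l.Nodup :=
  h.imp fun h he => h.irrefl (by rw [he])

theorem Dict.inj (h : Dict T i s) {x y : ℕ} (hx : 1 ≤ x) (hx' : x ≤ s.r .cnt) (hy : 1 ≤ y)
    (hy' : y ≤ s.r .cnt) (he : T[s.m .key x]? = T[s.m .key y]?) : x = y := by
  obtain ⟨t, n, -, -, -, hp, hm⟩ := h.tree
  have hp' : (t.ids.map fun x => T[s.m .key x]?).Nodup :=
    List.pairwise_map.2 (hp.imp fun h => h.irrefl)
  exact List.inj_on_of_nodup_map hp' ((hm x).2 ⟨hx, hx'⟩) ((hm y).2 ⟨hy, hy'⟩) he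

theorem Dict.id_eq (h : Dict T i s) {j k : ℕ} (hj : j < i) (hk : k < i) :
    s.m .ID j = s.m .ID k ↔ T[j]? = T[k]? := by
  rw [← h.id_sym j hj, ← h.id_sym k hk]
  exact ⟨fun he => by rw [he], h.inj (h.id_pos j hj) (h.id_le j hj) (h.id_pos k hk) (h.id_le k hk)⟩

/-- Distinct nodes carry distinct symbols, so the numbers in use inject into the alphabet of the
text. Consequently every number fits into `B` bits as soon as `2 ^ B` exceeds `σ`. -/
theorem Dict.cnt_le (h : Dict T i s) (hi : i ≤ T.length) : s.r .cnt ≤ T.toFinset.card := by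
  have h1 : (Finset.Icc 1 (s.r .cnt)).card ≤ (T.toFinset.image some).card := by
    refine Finset.card_le_card_of_injOn (fun x => T[s.m .key x]?) ?_ ?_
    · intro x hx
      simp only [Finset.coe_Icc, Set.mem_Icc] at hx
      have := h.key_lt x hx.1 hx.2
      have h2 : s.m .key x < T.length := by omega
      simp [List.getElem?_eq_getElem h2]
    · intro x hx y hy he
      simp only [Finset.coe_Icc, Set.mem_Icc] at hx hy
      exact h.inj hx.1 hx.2 hy.1 hy.2 he
  rw [Finset.card_image_of_injective _ (Option.some_injective _)] at h1
  simpa using h1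

theorem Dict.congr {s' : VS α} (h : Dict T i s)
    (hm : ∀ a ∈ [Arr.L, .R, .lev, .key, .ID, .hf, .pr], s'.m a = s.m a) (h1 : s'.r .rt = s.r .rt)
    (h2 : s'.r .cnt = s.r .cnt) : Dict T i s' := by
  have e1 := hm .L (by decide)
  have e2 := hm .R (by decide)
  have e3 := hm .lev (by decide)
  have e4 := hm .key (by decide)
  have e5 := hm .ID (by decide)
  have e6 := hm .hf (by decide)
  have e7 := hm .pr (by decide)
  constructor
  · simpa only [e1, e2, e3, e4, h1, h2] using h.tree
  · simpa only [e3] using h.lev_zero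
  · simpa only [e2] using h.R_zero
  · simpa only [e4, h2] using h.key_lt
  · simpa only [e5] using h.id_pos
  · simpa only [e5, h2] using h.id_le
  · simpa only [e4, e5] using h.id_sym
  · simpa only [e6, h2] using h.hf
  · simpa only [e7, h2] using h.pr

theorem SL_take {n i j : ℕ} (hi : i < n) (hj : j < n) : SL (T.take n) i j ↔ SL T i j := by
  simp [SL, hi, hj]

theorem length_ids {t : Tr} {c : ℕ} (hn : t.ids.Nodup)
    (hm : ∀ x, x ∈ t.ids ↔ 1 ≤ x ∧ x ≤ c) : t.ids.length = c := by
  rw [← List.toFinset_card_of_nodup hn]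
  have : t.ids.toFinset = Finset.Icc 1 c := by ext x; simp [hm]
  simp [this]

theorem le_log_succ {n σ : ℕ} (h : 2 ^ n ≤ σ + 1) : n ≤ Nat.log 2 σ + 1 := by
  by_contra hc
  have h1 : σ < 2 ^ (Nat.log 2 σ + 1) := Nat.lt_pow_succ_log_self (by norm_num) σ
  have h2 : 2 ^ (Nat.log 2 σ + 1 + 1) ≤ 2 ^ n := Nat.pow_le_pow_right (by norm_num) (by omega)
  rw [pow_succ] at h2
  omega

/-- The entry in `ID` is written only afterwards by the caller. The conclusion is therefore stated
for every state that differs in `ID` alone and has the right entry at `i`. -/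
theorem wp_newSym {fs : List Fr} {n : ℕ} (hD : Dict T i s) (hi : s.r .i = i) (hT : i < T.length)
    (htext : s.text = T.take (i + 1)) (hone : s.r .one = 1) (hN : 2 * T.length + 4 ≤ N)
    (hrep : (plug fs .nil).Rep (s.m .L) (s.m .R) (s.m .lev)) (hok : Ok n (plug fs .nil))
    (hp : (plug fs .nil).ids.Pairwise fun x y => SL T (s.m .key x) (s.m .key y))
    (hm : ∀ x, x ∈ (plug fs .nil).ids ↔ 1 ≤ x ∧ x ≤ s.r .cnt)
    (hd : s.r .d = fs.length) (hst : SRep (s.m .stk) fs)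
    (hpre : ∀ x ∈ preI fs, SL T (s.m .key x) i) (hpost : ∀ x ∈ postI fs, SL T i (s.m .key x)) :
    wp N newSym s fun s' =>
      Keep [.x, .d, .res, .y, .cnt, .kk, .c, .rt, .p, .e] [.key, .lev, .L, .R, .hf, .pr]
        s s' ∧ (∀ m, (∀ j < i, m j = s.m .ID j) → m i = s'.r .res →
          ∀ s'' : VS α, Keep [] [.ID] s' s'' → s''.m .ID = m → Dict T (i + 1) s'') ∧
      s'.clk ≤ s.clk + 30 * fs.length + 40 := by
  set n' := s.r .cnt + 1 with hn'
  have hcnt := hD.cnt_le hT.le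
  have hσ := T.toFinset_card_le
  have hlen := length_ids (nodup_of_SL hp) hm
  obtain ⟨I, hI⟩ : ∃ I : VS α → Prop, I = fun s' =>
      Keep [.x, .d, .res, .y, .cnt, .kk, .c, .rt, .p, .e] [.key, .lev, .L, .R, .hf, .pr]
        s s' ∧ (∀ m, (∀ j < i, m j = s.m .ID j) → m i = s'.r .res →
          ∀ s'' : VS α, Keep [] [.ID] s' s'' → s''.m .ID = m → Dict T (i + 1) s'') ∧
      s'.clk ≤ s.clk + 30 * fs.length + 40 := ⟨_, rfl⟩
  rw [← hI]
  have hn0 : n' ∉ (plug fs .nil).ids := by rw [hm]; omega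
  have hmem : ∀ x ∈ preI fs ++ postI fs, x ∈ (plug fs .nil).ids := by
    intro x hx; rw [ids_plug]; simpa using hx
  have main : ∀ s2 : VS α, Keep [.x, .res, .y, .cnt, .kk, .c] [.key, .lev, .L, .R, .hf, .pr] s s2 →
      s2.clk ≤ s.clk + 20 → s2.r .cnt = n' → s2.r .res = n' → s2.r .x = n' →
      s2.m .key = Function.update (s.m .key) n' i → s2.m .lev = Function.update (s.m .lev) n' 1 →
      s2.m .L = Function.update (s.m .L) n' 0 → s2.m .R = Function.update (s.m .R) n' 0 →
      (∀ k ≤ n', s2.m .hf k = k / 2) → (∀ k ≤ n', s2.m .pr k = k % 2) →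
      wp N fixUp s2 fun s' => I (s'.set .rt (s'.r .x)) := by
    intro s2 hk hclk h1 h2 h3 h4 h5 h6 h7 h8 h9
    obtain ⟨-, hfs⟩ := rep_plug.1 hrep
    have hkey : ∀ x ∈ preI fs ++ postI fs, s2.m .key x = s.m .key x := by
      intro x hx
      rw [h4, Function.update_of_ne]
      rintro rfl; exact hn0 (hmem _ hx)
    have hklt : ∀ x ∈ preI fs ++ postI fs, s.m .key x < i + 1 := by
      intro x hx
      have := (hm x).1 (hmem x hx)
      have := hD.key_lt x this.1 this.2; omega
    have hnd : (preI fs ++ (Tr.node .nil n' 1 .nil).ids ++ postI fs).Nodup := by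
      have := nodup_of_SL hp
      rw [ids_plug] at this hn0
      simp only [Tr.ids_nil, Tr.ids_node, List.append_assoc, List.nil_append] at this hn0 ⊢
      rw [List.singleton_append, List.nodup_middle]
      exact List.nodup_cons.2 ⟨hn0, this⟩
    refine wp_mono (wp_fixUp (fs := fs) (t₀ := .nil) (t := .node .nil n' 1 .nil) (n := n) ?_ ?_ ?_ ?_
      ?_ ?_ (hfs.congrI ?_) ?_ ?_ ?_ hnd hok (grow_nil _) ?_ ?_) ?_
    · rw [hk.r _ (by decide), hone]
    · rw [h5, Function.update_of_ne (by omega)]; exact hD.lev_zero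
    · rw [h7, Function.update_of_ne (by omega)]; exact hD.R_zero
    · rw [hk.r _ (by decide), hd]
    · exact h3
    · exact ⟨by omega, by rw [h6]; simp, by rw [h7]; simp, by rw [h5]; simp, trivial, trivial⟩
    · intro x hx
      have : x ≠ n' := by rintro rfl; exact hn0 (hmem _ hx)
      rw [h5, h6, h7]; simp [this]
    · rw [hk.m _ (by decide)]; exact hst
    · intro x hx
      have hx' : x ∈ preI fs ++ postI fs := List.mem_append_left _ hx
      rw [hkey x hx', hk.text, htext, hk.r _ (by decide), hi, SL_take (hklt x hx') (by omega)]
      exact hpre x hx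
    · intro x hx
      have hx' : x ∈ preI fs ++ postI fs := List.mem_append_right _ hx
      rw [hkey x hx', hk.text, htext, hk.r _ (by decide), hi, SL_take (by omega) (hklt x hx')]
      exact hpost x hx
    · rw [ids_plug] at hlen
      simp only [List.length_append, Tr.ids_nil, Tr.ids_node, List.length_cons, List.length_nil]
        at hlen ⊢
      omega
    · simp
    · rintro s3 ⟨hk3, hc3, hl3, hR3, t', n3, hr3, hx3, ho3, hi3⟩
      rw [hI]
      have hkeep : Keep [.x, .d, .res, .y, .cnt, .kk, .c, .p, .e] [.key, .lev, .L, .R, .hf, .pr]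
        s s3 := hk.trans hk3
      refine ⟨⟨fun x hx => ?_, hkeep.m, hkeep.text, hkeep.rest, hkeep.out⟩, ?_, by simp; omega⟩
      · simp at hx; rw [VS.set_r, if_neg (by tauto)]; exact hkeep.r x (by simp; tauto)
      · rintro m hm1 hm2 s4 hk4 rfl
        have hres : s3.r .res = n' := by rw [hk3.r _ (by decide), h2]
        simp only [VS.set_r, reduceCtorEq, if_false, hres] at hm2
        have e : ∀ a, a ≠ Arr.ID → s4.m a = s3.m a := fun a ha => hk4.m a (by simpa using ha)
        have ekey : s4.m .key = Function.update (s.m .key) n' i := by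
          rw [e _ (by decide), hk3.m _ (by decide), h4]
        have ecnt : s4.r .cnt = n' := by
          rw [hk4.r _ (by decide)]; simp [hk3.r, h1]
        have ert : s4.r .rt = t'.root := by
          rw [hk4.r _ (by decide)]; simp [hx3]
        constructor
        · refine ⟨t', n3, ?_, ert.symm, ho3, ?_, ?_⟩
          · rw [e _ (by decide), e _ (by decide), e _ (by decide)]; exact hr3
          · rw [hi3, ekey]
            rw [ids_plug] at hp
            simp only [Tr.ids_nil, List.append_nil] at hp
            rw [List.pairwise_append] at hp
            have hne : ∀ x ∈ preI fs ++ postI fs, x ≠ n' := by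
              rintro x hx rfl; exact hn0 (hmem _ hx)
            simp only [Tr.ids_node, Tr.ids_nil, List.nil_append, List.append_assoc,
              List.singleton_append, List.pairwise_append, List.pairwise_cons]
            refine ⟨hp.1.imp_of_mem ?_, ⟨?_, hp.2.1.imp_of_mem ?_⟩, ?_⟩
            · intro x y hx hy h
              rw [Function.update_of_ne (hne x (by simp [hx])),
                Function.update_of_ne (hne y (by simp [hy]))]; exact h
            · intro x hx
              rw [Function.update_self, Function.update_of_ne (hne x (by simp [hx]))]
              exact hpost x hx
            · intro x y hx hy h
              rw [Function.update_of_ne (hne x (by simp [hx])),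
                Function.update_of_ne (hne y (by simp [hy]))]; exact h
            · intro x hx y hy
              rw [Function.update_of_ne (hne x (by simp [hx]))]
              rcases List.mem_cons.1 hy with rfl | hy
              · rw [Function.update_self]; exact hpre x hx
              · rw [Function.update_of_ne (hne y (by simp [hy]))]; exact hp.2.2 x hx y hy
          · intro x
            have := hm x
            rw [ids_plug] at this
            rw [hi3, ecnt]
            simp only [Tr.ids_node, Tr.ids_nil, List.nil_append, List.mem_append, List.mem_cons,
              List.not_mem_nil, or_false] at this ⊢
            have h' : 1 ≤ x ∧ x ≤ n' ↔ (1 ≤ x ∧ x ≤ s.r .cnt) ∨ x = n' := by omega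
            rw [h', ← this]; tauto
        · rw [e _ (by decide)]; exact hl3
        · rw [e _ (by decide)]; exact hR3
        · intro x hx hx'
          rw [ecnt] at hx'
          rw [ekey, Function.update_apply]
          split_ifs
          · omega
          · have := hD.key_lt x hx (by omega); omega
        · intro j hj
          rcases Nat.lt_succ_iff_lt_or_eq.1 hj with h | rfl
          · rw [hm1 j h]; exact hD.id_pos j h
          · rw [hm2]; omega
        · intro j hj
          rw [ecnt]
          rcases Nat.lt_succ_iff_lt_or_eq.1 hj with h | rfl
          · rw [hm1 j h]; have := hD.id_le j h; omega
          · rw [hm2]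
        · intro j hj
          rw [ekey]
          rcases Nat.lt_succ_iff_lt_or_eq.1 hj with h | rfl
          · rw [hm1 j h, Function.update_of_ne (by have := hD.id_le j h; omega)]
            exact hD.id_sym j h
          · rw [hm2, Function.update_self]
        · intro k hk'; rw [ecnt] at hk'
          rw [e _ (by decide), hk3.m _ (by decide)]; exact h8 k hk'
        · intro k hk'; rw [ecnt] at hk'
          rw [e _ (by decide), hk3.m _ (by decide)]; exact h9 k hk'
  -- The half and the parity of the new number follow from those of its predecessor: an odd
  -- predecessor raises the half and resets the parity.
  have hhf := hD.hf (s.r .cnt) le_rfl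
  have hpr := hD.pr (s.r .cnt) le_rfl
  simp only [newSym, wp_seq, wp_asg, wp_put, wp_ite, Ex.Bd, Ex.eval, Tst.Holds]
  have hpred : n' - 1 = s.r .cnt := by omega
  simp [hi, hone, hhf, hpr, ← hn', hpred]
  refine ⟨by omega, fun h => ⟨by omega, ?_⟩, fun h => ?_⟩
  · refine main _ ?_ ?_ ?_ ?_ ?_ ?_ ?_ ?_ ?_ ?_ ?_
    · refine ⟨fun v hv => ?_, fun a ha => ?_, rfl, rfl, rfl⟩
      · simp at hv; simp [hv]
      · simp at ha; simp [ha]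
    all_goals try simp
    · intro k hk
      rw [Function.update_apply]; split_ifs
      · omega
      · exact hD.hf k (by omega)
    · intro k hk
      rw [Function.update_apply]; split_ifs
      · omega
      · exact hD.pr k (by omega)
  · refine main _ ?_ ?_ ?_ ?_ ?_ ?_ ?_ ?_ ?_ ?_ ?_
    · refine ⟨fun v hv => ?_, fun a ha => ?_, rfl, rfl, rfl⟩
      · simp at hv; simp [hv]
      · simp at ha; simp [ha]
    all_goals try simp
    · intro k hk
      rw [Function.update_apply]; split_ifs
      · omega
      · exact hD.hf k (by omega)
    · intro k hk
      rw [Function.update_apply]; split_ifs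
      · omega
      · exact hD.pr k (by omega)

/-- The height is at most twice the level `n`, and `n` is at most `log σ + 1`. Searching costs 8 per
unit of height and rebalancing at most 30, together at most 76 per level. -/
theorem wp_numSym (hD : Dict T i s) (hi : s.r .i = i) (hT : i < T.length)
    (htext : s.text = T.take (i + 1)) (hone : s.r .one = 1) (hN : 2 * T.length + 4 ≤ N) :
    wp N numSym s fun s' =>
      Keep [.x, .d, .res, .y, .cnt, .kk, .c, .rt, .p, .e] [.stk, .key, .lev, .L, .R, .hf, .pr, .ID]
        s s' ∧ Dict T (i + 1) s' ∧ (∀ j < i, s'.m .ID j = s.m .ID j) ∧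
      s'.clk ≤ s.clk + 80 * (Nat.log 2 T.toFinset.card + 1) + 60 := by
  obtain ⟨t, n, hrep, hroot, hok, hp, hm⟩ := id hD.tree
  have hcnt := hD.cnt_le hT.le
  have hσ := T.toFinset_card_le
  have hlen := length_ids (nodup_of_SL hp) hm
  have hpow := hok.pow_le
  have hh := hok.height_le
  have hel : t.ents.length = t.ids.length := by simp [Tr.ids]
  have hn := le_log_succ (n := n) (σ := T.toFinset.card) (by omega)
  have hn2 : n < 2 ^ n := Nat.lt_two_pow_self
  have htl : s.text.length = i + 1 := by rw [htext, List.length_take]; omega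
  have hkl : ∀ p ∈ t.ents, s.m .key p.1 < i + 1 := by
    intro p hp
    have := (hm p.1).1 (Tr.fst_mem_ids hp)
    have := hD.key_lt p.1 this.1 this.2; omega
  rw [numSym, wp_seq]
  refine wp_mono (wp_findSym hrep hroot (by omega) (fun p hp => by rw [htl]; exact hkl p hp) ?_
    (by omega)) ?_
  · rw [Tr.ids, List.pairwise_map] at hp
    refine hp.imp_of_mem ?_
    intro p q hp hq h
    rw [htext, SL_take (hkl p hp) (hkl q hq)]; exact h
  · rintro s1 ⟨hk, hclk, h⟩
    rw [wp_seq, wp_ite]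
    rcases h with ⟨h1, h2, h3⟩ | ⟨h1, fs, rfl, hd, hst, hpre, hpost⟩
    · simp only [Tst.Holds, wp_skip]
      refine ⟨fun _ => ?_, fun h => by omega⟩
      rw [wp_put]
      have hr := (hm _).1 h1
      have hk' := hD.key_lt _ hr.1 hr.2
      have hs : T[s.m .key (s1.r .res)]? = T[i]? := by
        rw [htext, hi, List.getElem?_take_of_lt (by omega), List.getElem?_take_of_lt (by omega)] at h3
        exact h3
      have e5 : ∀ a, a ≠ .ID → a ≠ .stk → ((s1.tick.tick.put .ID (s1.tick.tick.r .i) (s1.tick.tick.r .res)).m a) =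
          s.m a := by
        intro a ha hb; simp [ha, hk.m, hb]
      have eID : (s1.tick.tick.put .ID (s1.tick.tick.r .i) (s1.tick.tick.r .res)).m .ID =
          Function.update (s.m .ID) i (s1.r .res) := by
        simp [hk.m, hk.r, hi]
      have ecnt : (s1.tick.tick.put .ID (s1.tick.tick.r .i) (s1.tick.tick.r .res)).r .cnt = s.r .cnt := by
        simp [hk.r]
      refine ⟨⟨fun v hv => ?_, fun a ha => ?_, hk.text, hk.rest, hk.out⟩, ?_, ?_, ?_⟩
      · simp at hv; simp [hv, hk.r]
      · simp at ha; simp [ha, hk.m]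
      · constructor
        · rw [e5 _ (by decide) (by decide), e5 _ (by decide) (by decide),
            e5 _ (by decide) (by decide), e5 _ (by decide) (by decide), ecnt]
          exact ⟨t, n, hrep, by simp [hk.r, hroot], hok, hp, hm⟩
        · rw [e5 _ (by decide) (by decide)]; exact hD.lev_zero
        · rw [e5 _ (by decide) (by decide)]; exact hD.R_zero
        · intro x hx hx'
          rw [ecnt] at hx'
          rw [e5 _ (by decide) (by decide)]; have := hD.key_lt x hx hx'; omega
        · intro j hj
          rw [eID, Function.update_apply]; split_ifs
          · omega
          · exact hD.id_pos j (by omega)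
        · intro j hj
          rw [eID, ecnt, Function.update_apply]; split_ifs
          · omega
          · exact hD.id_le j (by omega)
        · intro j hj
          rw [eID, e5 _ (by decide) (by decide), Function.update_apply]; split_ifs with h
          · rw [h]; exact hs
          · exact hD.id_sym j (by omega)
        · rw [e5 _ (by decide) (by decide), ecnt]; exact hD.hf
        · rw [e5 _ (by decide) (by decide), ecnt]; exact hD.pr
      · intro j hj
        rw [eID, Function.update_of_ne (by omega)]
      · simp; omega
    · simp only [Tst.Holds]
      refine ⟨fun h => by omega, fun _ => ?_⟩
      have hD1 : Dict T i s1.tick := hD.congr (fun a ha => by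
        have : a ≠ .stk := by rintro rfl; simp at ha
        simp [hk.m, this]) (by simp [hk.r]) (by simp [hk.r])
      have hfl := height_plug fs .nil
      have hke : s1.m .key = s.m .key := hk.m _ (by decide)
      have hmem : ∀ x ∈ preI fs ++ postI fs, x ∈ (plug fs .nil).ids := by
        intro x hx; rw [ids_plug]; simpa using hx
      have hklt : ∀ x ∈ preI fs ++ postI fs, s.m .key x < i + 1 := by
        intro x hx
        have := (hm x).1 (hmem x hx)
        have := hD.key_lt x this.1 this.2; omega
      refine wp_mono (wp_newSym (fs := fs) (n := n) hD1 (by simp [hk.r, hi]) hT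
        (by simp [hk.text, htext]) (by simp [hk.r, hone]) hN (by simpa [hk.m] using hrep) hok
        (by simpa [hke] using hp) (by simpa [hk.r] using hm) hd hst ?_ ?_) ?_
      · intro x hx
        obtain ⟨p, hp', rfl⟩ := List.mem_map.1 hx
        have := hpre p hp'
        rw [htext, hi, SL_take (hklt _ (by simp [hx])) (by omega)] at this
        simpa [hke] using this
      · intro x hx
        obtain ⟨p, hp', rfl⟩ := List.mem_map.1 hx
        have := hpost p hp'
        rw [htext, hi, SL_take (by omega) (hklt _ (by simp [hx]))] at this
        simpa [hke] using this
      · rintro s2 ⟨hk2, hD2, hc2⟩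
        rw [wp_put]
        have hID : s2.m .ID = s.m .ID := by rw [hk2.m _ (by decide)]; simp [hk.m]
        have hi2 : s2.r .i = i := by rw [hk2.r _ (by decide)]; simp [hk.r, hi]
        have hkk : Keep [.x, .d, .res, .y, .cnt, .kk, .c, .rt, .p, .e]
          [.stk, .key, .lev, .L, .R, .hf, .pr, .ID] s s2 :=
          (hk.trans (s' := s1) (vs'' := [.x, .d, .res, .y]) (as'' := [.stk])
            (s'' := s1.tick) ⟨fun _ _ => rfl, fun _ _ => rfl, rfl, rfl, rfl⟩ (vs' := []) (as' := [])
            ).trans hk2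
        refine ⟨⟨hkk.r, fun a ha => ?_, hkk.text, hkk.rest, hkk.out⟩, ?_, ?_, ?_⟩
        · have : a ≠ .ID := by rintro rfl; simp at ha
          rw [VS.put_m, if_neg this]; exact hkk.m a ha
        · refine hD2 _ ?_ ?_ _ ⟨fun _ _ => rfl, fun a ha => ?_, rfl, rfl, rfl⟩ rfl
          · intro j hj; simp [hi2, hID, hk.m, show j ≠ i by omega]
          · simp [hi2]
          · simp at ha; simp [ha]
        · intro j hj; simp [hi2, hID, show j ≠ i by omega]
        · simp at hc2 ⊢; omega

end

/-! ### Suffix automata -/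

/-- The last `l` letters before the positions `e` and `e'` of the word `w` agree. -/
def Suf (w : ℕ → ℕ) (l e e' : ℕ) : Prop :=
  l ≤ e ∧ l ≤ e' ∧ ∀ i < l, w (e - 1 - i) = w (e' - 1 - i)

/-- The word of length `l` that ends at `e` is not always preceded by the same letter in
the prefix of length `n` of `w`. -/
def Nd (w : ℕ → ℕ) (n l e : ℕ) : Prop :=
  l ≤ e ∧ e ≤ n ∧ ∃ e' ≤ n, Suf w l e e' ∧ ¬ Suf w (l + 1) e e'

section
variable {w : ℕ → ℕ} {n l l' e e' e'' : ℕ}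

theorem Suf.rfl (h : l ≤ e) : Suf w l e e := ⟨h, h, fun _ _ => by rfl⟩

theorem Suf.zero : Suf w 0 e e' := ⟨by omega, by omega, fun _ h => by omega⟩

theorem Suf.symm (h : Suf w l e e') : Suf w l e' e := ⟨h.2.1, h.1, fun i hi => (h.2.2 i hi).symm⟩

theorem Suf.trans (h : Suf w l e e') (h' : Suf w l e' e'') : Suf w l e e'' :=
  ⟨h.1, h'.2.1, fun i hi => (h.2.2 i hi).trans (h'.2.2 i hi)⟩

theorem Suf.mono (h : Suf w l e e') (hl : l' ≤ l) : Suf w l' e e' :=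
  ⟨hl.trans h.1, hl.trans h.2.1, fun i hi => h.2.2 i (by omega)⟩

theorem suf_succ : Suf w (l + 1) (e + 1) (e' + 1) ↔ w e = w e' ∧ Suf w l e e' := by
  constructor
  · rintro ⟨h1, h2, h3⟩
    refine ⟨by simpa using h3 0 (by omega), by omega, by omega, fun i hi => ?_⟩
    have := h3 (i + 1) (by omega)
    rwa [show e + 1 - 1 - (i + 1) = e - 1 - i by omega,
      show e' + 1 - 1 - (i + 1) = e' - 1 - i by omega] at this
  · rintro ⟨h0, h1, h2, h3⟩
    refine ⟨by omega, by omega, fun i hi => ?_⟩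
    rcases i with _ | i
    · simpa using h0
    · rw [show e + 1 - 1 - (i + 1) = e - 1 - i by omega,
        show e' + 1 - 1 - (i + 1) = e' - 1 - i by omega]
      exact h3 i (by omega)

theorem Suf.exists_pred (h : Suf w (l + 1) (e + 1) e') :
    ∃ f, e' = f + 1 ∧ w e = w f ∧ Suf w l e f := by
  obtain ⟨f, rfl⟩ : ∃ f, e' = f + 1 := ⟨e' - 1, by have := h.2.1; omega⟩
  exact ⟨f, by rfl, suf_succ.1 h⟩

/-- The property belongs to the word, not to the occurrence: if the new end position is preceded by
a different letter, the old one is the required witness; otherwise the old witness still works. -/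
theorem Nd.of_suf (h : Nd w n l e) (hs : Suf w l e e') (he : e' ≤ n) : Nd w n l e' := by
  obtain ⟨h1, h2, f, hf, h3, h4⟩ := h
  refine ⟨hs.2.1, he, ?_⟩
  by_cases hc : Suf w (l + 1) e e'
  · exact ⟨f, hf, hs.symm.trans h3, fun h => h4 (hc.trans h)⟩
  · exact ⟨e, h2, hs.symm, fun h => hc h.symm⟩

/-- Two occurrences that are preceded differently remain so when the last letter is dropped. Hence
the nodes are closed under removal of last letters, which underlies both the amortization and the
count of transitions. -/
theorem Nd.pred (h : Nd w n (l + 1) (e + 1)) : Nd w n l e := by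
  obtain ⟨h1, h2, f, hf, h3, h4⟩ := h
  obtain ⟨f, rfl, h5, h6⟩ := h3.exists_pred
  exact ⟨by omega, by omega, f, by omega, h6, fun h => h4 (suf_succ.2 ⟨h5, h⟩)⟩

/-- The length bounds in `Suf` make an occurrence at the very beginning count as preceded
differently, even compared with itself. -/
theorem Nd.self : Nd w n n n :=
  ⟨le_rfl, le_rfl, n, le_rfl, Suf.rfl le_rfl, fun h => by have := h.1; omega⟩

theorem Nd.mono (h : Nd w n l e) : Nd w (n + 1) l e := by
  obtain ⟨h1, h2, f, hf, h3, h4⟩ := h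
  exact ⟨h1, by omega, f, by omega, h3, h4⟩

/-- `Z` is the length of the longest suffix of the prefix of length `n + 1` that occurs before. -/
structure Lrs (w : ℕ → ℕ) (n Z : ℕ) : Prop where
  occ : ∃ e ≤ n, Suf w Z (n + 1) e
  max : ∀ e ≤ n, ¬ Suf w (Z + 1) (n + 1) e

theorem exists_lrs (w : ℕ → ℕ) (n : ℕ) : ∃ Z, Lrs w n Z := by
  classical
  let P : ℕ → Prop := fun Z => ∃ e ≤ n, Suf w Z (n + 1) e
  have h0 : P 0 := ⟨0, by omega, Suf.zero⟩
  refine ⟨Nat.findGreatest P (n + 1), Nat.findGreatest_spec (P := P) (Nat.zero_le _) h0, ?_⟩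
  intro e he hs
  have h1 : Nat.findGreatest P (n + 1) + 1 ≤ n + 1 := hs.1
  have := Nat.le_findGreatest (P := P) h1 ⟨e, he, hs⟩
  omega

theorem Lrs.le {Z : ℕ} (h : Lrs w n Z) : Z ≤ n := by
  obtain ⟨e, he, hs⟩ := h.occ
  exact hs.2.1.trans he

/-- The new occurrence at `n + 1` can create a node only for a repeated suffix. For one shorter than
`Z` the letter before it is the same as at an earlier occurrence, so nothing changes; length `Z` is
the only exception, as no earlier occurrence extends it. -/
theorem Lrs.nd_succ {Z : ℕ} (h : Lrs w n Z) (he : e ≤ n) :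
    Nd w (n + 1) l e ↔ Nd w n l e ∨ (l = Z ∧ Suf w Z e (n + 1)) := by
  constructor
  · rintro ⟨h1, -, f, hf, h3, h4⟩
    rcases Nat.lt_or_ge n f with hn | hn
    · obtain rfl : f = n + 1 := by omega
      rcases lt_trichotomy l Z with hl | rfl | hl
      · obtain ⟨e₀, he₀, hs⟩ := h.occ
        have hs' := hs.mono (show l + 1 ≤ Z by omega)
        exact .inl ⟨h1, he, e₀, he₀, h3.trans (hs'.mono (by omega)),
          fun h => h4 (h.trans hs'.symm)⟩
      · exact .inr ⟨rfl, h3⟩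
      · exact absurd (h3.symm.mono hl) (h.max e he)
    · exact .inl ⟨h1, he, f, hn, h3, h4⟩
  · rintro (h' | ⟨rfl, hs⟩)
    · exact h'.mono
    · exact ⟨hs.1, by omega, n + 1, le_rfl, hs, fun h' => h.max e he h'.symm⟩

/-- This describes the new suffix chain: the whole prefix, the longest repeated suffix, and below it
only nodes that existed already at the earlier occurrence `e₀`. -/
theorem Lrs.nd_succ_top {Z e₀ : ℕ} (h : Lrs w n Z) (he₀ : e₀ ≤ n) (hs : Suf w Z (n + 1) e₀)
    (hl : Nd w (n + 1) l (n + 1)) : l = n + 1 ∨ l = Z ∨ (l < Z ∧ Nd w n l e₀) := by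
  rcases Nat.lt_or_ge Z l with hZ | hZ
  · obtain ⟨h1, -, f, hf, h3, h4⟩ := hl
    rcases Nat.lt_or_ge n f with hn | hn
    · obtain rfl : f = n + 1 := by omega
      left
      by_contra hne
      exact h4 (Suf.rfl (by omega))
    · exact absurd (h3.mono hZ) (h.max f hn)
  · have := (h.nd_succ he₀).1 (hl.of_suf (hs.mono hZ) (by omega))
    rcases this with h | h
    · rcases Nat.lt_or_ge l Z with h' | h'
      exacts [.inr (.inr ⟨h', h⟩), .inr (.inl (by omega))]
    · exact .inr (.inl h.1)

/-- The longest repeated suffix without its last letter is a node. -/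
theorem Lrs.nd_pred {m : ℕ} (h : Lrs w n (m + 1)) : Nd w n m n := by
  obtain ⟨e, he, hs⟩ := h.occ
  obtain ⟨f, rfl, h1, h2⟩ := hs.exists_pred
  exact ⟨h2.1, le_rfl, f, by omega, h2, fun h3 => h.max _ he (suf_succ.2 ⟨h1, h3⟩)⟩

/-- The number of suffixes of length less than `m` of the prefix of length `n` that are nodes. -/
noncomputable def pot (w : ℕ → ℕ) (n m : ℕ) : ℕ :=
  open Classical in ((Finset.range m).filter fun j => Nd w n j n).card

theorem pot_le (w : ℕ → ℕ) (n m : ℕ) : pot w n m ≤ m := by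
  classical
  unfold pot
  refine (Finset.card_filter_le _ _).trans (by simp)

theorem pot_lt {a b : ℕ} (hab : a ≤ b) (hb : Nd w n b n) : pot w n a + 1 ≤ pot w n (b + 1) := by
  classical
  unfold pot
  rw [← Finset.card_insert_of_notMem (a := b) (by simp; intro h; omega)]
  refine Finset.card_le_card ?_
  intro x hx
  simp only [Finset.mem_insert, Finset.mem_filter, Finset.mem_range] at hx ⊢
  rcases hx with rfl | ⟨h1, h2⟩
  exacts [⟨by omega, hb⟩, ⟨by omega, h2⟩]

/-- Apart from the lengths `0`, `Z` and `n + 1`, each length on the new chain is one more than a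
length on the old chain, because nodes are closed under dropping the last letter. The bound `M` says
which part of the old chain can occur in this way. -/
theorem Lrs.pot_succ {Z e₀ M : ℕ} (h : Lrs w n Z) (he₀ : e₀ ≤ n) (hs : Suf w Z (n + 1) e₀)
    (hM : ∀ j, 0 < j → j < Z → Nd w n j e₀ → j ≤ M) : pot w (n + 1) (n + 2) ≤ 3 + pot w n M := by
  classical
  unfold pot
  have hsub : (Finset.range (n + 2)).filter (fun j => Nd w (n + 1) j (n + 1)) ⊆
      insert 0 (insert (n + 1) (insert Z
        (((Finset.range M).filter fun j => Nd w n j n).image (· + 1)))) := by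
    intro j hj
    simp only [Finset.mem_insert, Finset.mem_filter, Finset.mem_range, Finset.mem_image] at hj ⊢
    rcases h.nd_succ_top he₀ hs hj.2 with h1 | h1 | ⟨h1, h2⟩
    · exact .inr (.inl h1)
    · exact .inr (.inr (.inl h1))
    · rcases j with _ | j
      · exact .inl rfl
      · right; right; right
        have hj := hM (j + 1) (by omega) h1 h2
        obtain ⟨f, rfl, h3, h4⟩ := (hs.mono (show j + 1 ≤ Z by omega)).exists_pred
        exact ⟨j, ⟨by omega, h2.pred.of_suf h4.symm le_rfl⟩, rfl⟩
  refine (Finset.card_le_card hsub).trans ?_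
  refine (Finset.card_insert_le _ _).trans ?_
  have h1 := Finset.card_insert_le (n + 1) (insert Z
        (((Finset.range M).filter fun j => Nd w n j n).image (· + 1)))
  have h2 := Finset.card_insert_le Z
        (((Finset.range M).filter fun j => Nd w n j n).image (· + 1))
  have h3 := Finset.card_image_le (f := (· + 1)) (s := (Finset.range M).filter fun j => Nd w n j n)
  omega

end

/-! ### The automaton and its extension by one letter -/

/-- The suffix automaton of the prefix of length `n` of `w`, with the states `1, ..., k`. The state
`v` stands for the word of length `len v` that ends at `fp v`, its first occurrence. Transitions
are kept only for the letters that satisfy `G`. -/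
structure Sam (w : ℕ → ℕ) (G : ℕ → Prop) (n k : ℕ) (len fp link : ℕ → ℕ) (δ : ℕ → ℕ → ℕ) :
    Prop where
  k_pos : 1 ≤ k
  node : ∀ v, 1 ≤ v → v ≤ k → Nd w n (len v) (fp v)
  min : ∀ v, 1 ≤ v → v ≤ k → ∀ e ≤ n, Suf w (len v) (fp v) e → fp v ≤ e
  inj : ∀ u v, 1 ≤ u → u ≤ k → 1 ≤ v → v ≤ k → len u = len v → Suf w (len u) (fp u) (fp v) → u = v
  surj : ∀ l e, Nd w n l e → ∃ v, 1 ≤ v ∧ v ≤ k ∧ len v = l ∧ Suf w l (fp v) e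
  root : len 1 = 0
  link_one : link 1 = 0
  link_pos : ∀ v, 1 < v → v ≤ k → 1 ≤ link v
  link_le : ∀ v, 1 < v → v ≤ k → link v ≤ k
  link_lt : ∀ v, 1 < v → v ≤ k → len (link v) < len v
  link_suf : ∀ v, 1 < v → v ≤ k → Suf w (len (link v)) (fp (link v)) (fp v)
  link_max : ∀ v, 1 < v → v ≤ k → ∀ l, len (link v) < l → l < len v → ¬ Nd w n l (fp v)
  t_zero : ∀ v c, 1 ≤ v → v ≤ k → G c → δ v c = 0 → ∀ e < n, Suf w (len v) (fp v) e → w e ≠ c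
  t_le : ∀ v c, 1 ≤ v → v ≤ k → G c → δ v c ≤ k
  t_occ : ∀ v c, 1 ≤ v → v ≤ k → G c → δ v c ≠ 0 → ∃ e < n, Suf w (len v) (fp v) e ∧ w e = c
  t_ext : ∀ v c, 1 ≤ v → v ≤ k → G c → δ v c ≠ 0 → ∀ e < n, Suf w (len v) (fp v) e → w e = c →
    Suf w (len (δ v c)) (fp (δ v c)) (e + 1)
  t_len : ∀ v c, 1 ≤ v → v ≤ k → G c → δ v c ≠ 0 → len v < len (δ v c)

section
variable {w : ℕ → ℕ} {G : ℕ → Prop} {n k : ℕ} {len fp link : ℕ → ℕ} {δ : ℕ → ℕ → ℕ}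

theorem Sam.fp_le (h : Sam w G n k len fp link δ) {v : ℕ} (h1 : 1 ≤ v) (h2 : v ≤ k) : fp v ≤ n :=
  (h.node v h1 h2).2.1

theorem Sam.len_le_fp (h : Sam w G n k len fp link δ) {v : ℕ} (h1 : 1 ≤ v) (h2 : v ≤ k) :
    len v ≤ fp v := (h.node v h1 h2).1

theorem Sam.len_le (h : Sam w G n k len fp link δ) {v : ℕ} (h1 : 1 ≤ v) (h2 : v ≤ k) : len v ≤ n :=
  (h.len_le_fp h1 h2).trans (h.fp_le h1 h2)

/-- A state is no longer than any word that extends all its occurrences. -/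
theorem Sam.le_of_ext (h : Sam w G n k len fp link δ) {v m f : ℕ} (h1 : 1 ≤ v) (h2 : v ≤ k)
    (hm : ∀ e ≤ n, Suf w (len v) (fp v) e → Suf w m f e) : m ≤ len v := by
  by_contra hc
  obtain ⟨-, -, e, he, h3, h4⟩ := h.node v h1 h2
  exact h4 (((hm _ (h.fp_le h1 h2) (Suf.rfl (h.len_le_fp h1 h2))).symm.trans (hm e he h3)).mono
    (by omega))

/-- The longest repeated suffix is found at the first state on the suffix path that has
a transition. -/
theorem Sam.lrs (h : Sam w G n k len fp link δ) (hG : G (w n)) {p : ℕ} (h1 : 1 ≤ p) (h2 : p ≤ k)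
    (hp : Suf w (len p) (fp p) n) (hδ : δ p (w n) ≠ 0)
    (hmax : ∀ v, 1 ≤ v → v ≤ k → Suf w (len v) (fp v) n → len p < len v → δ v (w n) = 0) :
    Lrs w n (len p + 1) := by
  obtain ⟨Z, hZ⟩ := exists_lrs w n
  obtain ⟨e, he, h3, h4⟩ := h.t_occ p _ h1 h2 hG hδ
  have hs : Suf w (len p + 1) (n + 1) (e + 1) := suf_succ.2 ⟨h4.symm, hp.symm.trans h3⟩
  have hle : len p + 1 ≤ Z := by
    by_contra hc
    exact hZ.max (e + 1) (by omega) (hs.mono (by omega))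
  obtain ⟨m, rfl⟩ : ∃ m, Z = m + 1 := ⟨Z - 1, by omega⟩
  obtain ⟨v, hv1, hv2, rfl, hv3⟩ := h.surj _ _ hZ.nd_pred
  obtain ⟨f, hf, hs'⟩ := hZ.occ
  obtain ⟨f, rfl, h5, h6⟩ := hs'.exists_pred
  have : len v = len p := by
    by_contra hne
    exact h.t_zero v _ hv1 hv2 hG (hmax v hv1 hv2 hv3 (by omega)) f (by omega) (hv3.trans h6) h5.symm
  rw [← this]; exact hZ

/-- A nonempty repeated suffix, without its last letter, is a state on the chain and has a
transition by the new letter. -/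
theorem Sam.lrs_zero (h : Sam w G n k len fp link δ) (hG : G (w n))
    (hmax : ∀ v, 1 ≤ v → v ≤ k → Suf w (len v) (fp v) n → δ v (w n) = 0) : Lrs w n 0 := by
  obtain ⟨Z, hZ⟩ := exists_lrs w n
  rcases Z with _ | m
  · exact hZ
  obtain ⟨v, hv1, hv2, rfl, hv3⟩ := h.surj _ _ hZ.nd_pred
  obtain ⟨f, hf, hs'⟩ := hZ.occ
  obtain ⟨f, rfl, h5, h6⟩ := hs'.exists_pred
  exact absurd h5.symm (h.t_zero v _ hv1 hv2 hG (hmax v hv1 hv2 hv3) f (by omega) (hv3.trans h6))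

theorem lrs_zero_of_fresh (h : ∀ e < n, w e ≠ w n) : Lrs w n 0 :=
  ⟨⟨0, by omega, Suf.zero⟩, fun e he hs => by
    obtain ⟨f, rfl, h1, -⟩ := hs.exists_pred
    exact h f (by omega) h1.symm⟩

/-- The transitions after the extension by a letter. -/
def NewTrans (w : ℕ → ℕ) (G : ℕ → Prop) (n k : ℕ) (len fp : ℕ → ℕ) (δ : ℕ → ℕ → ℕ)
    (Z q zs : ℕ) (δ' : ℕ → ℕ → ℕ) : Prop :=
  ∀ v c, 1 ≤ v → v ≤ k → G c →
    (c = w n → Suf w (len v) (fp v) n → Z ≤ len v → δ' v c = k + 1) ∧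
    (c = w n → Suf w (len v) (fp v) n → len v < Z → δ v c = q → δ' v c = zs) ∧
    (c = w n → Suf w (len v) (fp v) n → len v < Z → δ v c ≠ q → δ' v c = δ v c) ∧
    (c ≠ w n → δ' v c = δ v c) ∧ (¬ Suf w (len v) (fp v) n → δ' v c = δ v c)

/-- The properties of the transitions of the state `v` after the extension by a letter. -/
structure TransOk (w : ℕ → ℕ) (G : ℕ → Prop) (n k : ℕ) (len fp : ℕ → ℕ) (δ : ℕ → ℕ → ℕ) (v : ℕ) :
    Prop where
  t_zero : ∀ c, G c → δ v c = 0 → ∀ e < n, Suf w (len v) (fp v) e → w e ≠ c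
  t_le : ∀ c, G c → δ v c ≤ k
  t_occ : ∀ c, G c → δ v c ≠ 0 → ∃ e < n, Suf w (len v) (fp v) e ∧ w e = c
  t_ext : ∀ c, G c → δ v c ≠ 0 → ∀ e < n, Suf w (len v) (fp v) e → w e = c →
    Suf w (len (δ v c)) (fp (δ v c)) (e + 1)
  t_len : ∀ c, G c → δ v c ≠ 0 → len v < len (δ v c)

/-- The state `q` stands for the longest word whose occurrences are those of the longest repeated
suffix. -/
structure Tgt (w : ℕ → ℕ) (n k : ℕ) (len fp : ℕ → ℕ) (Z q : ℕ) : Prop where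
  pos : 1 ≤ q
  le : q ≤ k
  le_len : Z ≤ len q
  suf : Suf w Z (fp q) (n + 1)
  ext : ∀ e ≤ n, Suf w Z (n + 1) e → Suf w (len q) (fp q) e

theorem Sam.tgt_one (h : Sam w G n k len fp link δ) : Tgt w n k len fp 0 1 :=
  ⟨le_rfl, h.k_pos, Nat.zero_le _, Suf.zero, fun e _ _ => by rw [h.root]; exact Suf.zero⟩

/-- Each earlier occurrence of the longest repeated suffix extends an occurrence of `p` by the new
letter, so the target of the transition ends there too. -/
theorem Sam.tgt (h : Sam w G n k len fp link δ) (hG : G (w n)) {p : ℕ} (h1 : 1 ≤ p) (h2 : p ≤ k)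
    (hp : Suf w (len p) (fp p) n) (hδ : δ p (w n) ≠ 0) :
    Tgt w n k len fp (len p + 1) (δ p (w n)) := by
  have hl := h.t_len p _ h1 h2 hG hδ
  have hext : ∀ e ≤ n, Suf w (len p + 1) (n + 1) e →
      Suf w (len (δ p (w n))) (fp (δ p (w n))) e := fun e he hs => by
    obtain ⟨f, rfl, h3, h4⟩ := hs.exists_pred
    exact h.t_ext p _ h1 h2 hG hδ f (by omega) (hp.trans h4) h3.symm
  obtain ⟨e, he, h3, h4⟩ := h.t_occ p _ h1 h2 hG hδ
  have h5 : Suf w (len p + 1) (n + 1) (e + 1) := suf_succ.2 ⟨h4.symm, hp.symm.trans h3⟩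
  exact ⟨by omega, h.t_le p _ h1 h2 hG, hl, ((hext _ (by omega) h5).mono hl).trans h5.symm, hext⟩

/-- Every state that ends with the longest repeated suffix is at least as long as the target. -/
theorem Sam.len_tgt_le (h : Sam w G n k len fp link δ) {Z q v : ℕ} (ht : Tgt w n k len fp Z q)
    (h1 : 1 ≤ v) (h2 : v ≤ k) (hZ : Z ≤ len v) (hs : Suf w Z (fp v) (n + 1)) : len q ≤ len v :=
  h.le_of_ext h1 h2 (f := fp q) fun e he hv => ht.ext e he (hs.symm.trans (hv.mono hZ))

/-- A target longer than `Z` ends at all earlier occurrences of the longest repeated suffix and also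
ends with that suffix. It and `q` thus bound each other's lengths, and equal words are equal states.
-/
theorem Sam.tgt_unique (h : Sam w G n k len fp link δ) {Z q v : ℕ} (ht : Tgt w n k len fp Z q)
    (h1 : 1 ≤ v) (h2 : v ≤ k) (hG : G (w n)) (hv : Suf w (len v) (fp v) n)
    (hl : len v < Z) (hδ : δ v (w n) ≠ 0) (hZ : Lrs w n Z) (hlu : Z < len (δ v (w n))) :
    δ v (w n) = q := by
  have hu := h.t_le v _ h1 h2 hG
  have hext : ∀ e ≤ n, Suf w Z (n + 1) e → Suf w (len (δ v (w n))) (fp (δ v (w n))) e :=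
      fun e he hs => by
    obtain ⟨f, rfl, h3, h4⟩ := (hs.mono (show len v + 1 ≤ Z by omega)).exists_pred
    exact h.t_ext v _ h1 h2 hG hδ f (by omega) (hv.trans h4) h3.symm
  obtain ⟨e, he, hs⟩ := hZ.occ
  have hle := h.len_tgt_le ht (by omega) hu hlu.le (((hext e he hs).mono hlu.le).trans hs.symm)
  have hge : len (δ v (w n)) ≤ len q := h.le_of_ext ht.pos ht.le (f := fp (δ v (w n)))
    fun e he hq => hext e he (ht.suf.symm.trans (hq.mono ht.le_len))
  have heq : len (δ v (w n)) = len q := by omega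
  refine h.inj _ _ (by omega) hu ht.pos ht.le heq ?_
  have := ht.ext e he hs
  rw [← heq] at this
  exact (hext e he hs).trans this.symm

/-- Only transitions by the new letter from states on the chain matter. Those of length at least `Z`
have no earlier occurrence followed by this letter and go to the new prefix. Those that led to `q`
go to the state of the longest repeated suffix. The remaining targets have length at most `Z` and
end at the new position anyway. Stating this for a general `zs` covers the extension with and
without a clone. -/
theorem Sam.transOk (h : Sam w G n k len fp link δ) {Z q zs k' : ℕ} {len' fp' : ℕ → ℕ}
    {δ' : ℕ → ℕ → ℕ} (hZ : Lrs w n Z) (hδ : NewTrans w G n k len fp δ Z q zs δ')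
    (hlen : ∀ v ≤ k, len' v = len v) (hfp : ∀ v ≤ k, fp' v = fp v) (hlen1 : len' (k + 1) = n + 1)
    (hfp1 : fp' (k + 1) = n + 1) (hzs : zs ≠ 0) (hzsk : zs ≤ k') (hk' : k + 1 ≤ k')
    (hzsl : len' zs = Z) (hzss : Suf w Z (fp' zs) (n + 1)) (ht : Tgt w n k len fp Z q)
    {v : ℕ} (h1 : 1 ≤ v) (h2 : v ≤ k) :
    TransOk w G (n + 1) k' len' fp' δ' v := by
  have hq : q ≠ 0 := by have := ht.pos; omega
  -- A longer target would have to be `q`; so an unredirected target is a suffix of the longest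
  -- repeated suffix.
  have hqu : Suf w (len v) (fp v) n → len v < Z → G (w n) → δ v (w n) ≠ 0 →
      δ v (w n) ≠ q → len (δ v (w n)) ≤ Z := fun a1 a2 a3 a4 a5 => by
    by_contra hc
    exact a5 (h.tgt_unique ht h1 h2 a3 a1 a2 a4 hZ (by omega))
  obtain ⟨e₀, he₀, hs₀⟩ := hZ.occ
  have key : ∀ c, G c →
      (c = w n ∧ Suf w (len v) (fp v) n ∧ Z ≤ len v ∧ δ' v c = k + 1) ∨
      (c = w n ∧ Suf w (len v) (fp v) n ∧ len v < Z ∧ δ v c = q ∧ δ' v c = zs) ∨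
      (c = w n ∧ Suf w (len v) (fp v) n ∧ len v < Z ∧ δ v c ≠ q ∧ δ' v c = δ v c) ∨
      ((c ≠ w n ∨ ¬ Suf w (len v) (fp v) n) ∧ δ' v c = δ v c) := by
    intro c hc
    obtain ⟨a1, a2, a3, a4, a5⟩ := hδ v c h1 h2 hc
    by_cases b1 : c = w n
    · by_cases b2 : Suf w (len v) (fp v) n
      · rcases Nat.lt_or_ge (len v) Z with b3 | b3
        · by_cases b4 : δ v c = q
          · exact .inr (.inl ⟨b1, b2, b3, b4, a2 b1 b2 b3 b4⟩)
          · exact .inr (.inr (.inl ⟨b1, b2, b3, b4, a3 b1 b2 b3 b4⟩))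
        · exact .inl ⟨b1, b2, b3, a1 b1 b2 b3⟩
      · exact .inr (.inr (.inr ⟨.inr b2, a5 b2⟩))
    · exact .inr (.inr (.inr ⟨.inl b1, a4 b1⟩))
  constructor
  · intro c hc h0 e he hs hw
    rw [hlen v h2, hfp v h2] at hs
    rcases key c hc with ⟨-, -, -, h3⟩ | ⟨-, -, -, -, h3⟩ | ⟨h3, h4, h5, h6, h7⟩ | ⟨h3, h4⟩
    · omega
    · omega
    · rw [h7] at h0
      obtain ⟨f, rfl, h8, h9⟩ := (hs₀.mono (show len v + 1 ≤ Z by omega)).exists_pred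
      exact h.t_zero v c h1 h2 hc h0 f (by omega) (h4.trans h9) (by rw [← h8, h3])
    · rw [h4] at h0
      rcases Nat.lt_succ_iff_lt_or_eq.1 he with he | rfl
      · exact h.t_zero v c h1 h2 hc h0 e he hs hw
      · rcases h3 with h3 | h3
        exacts [h3 hw.symm, h3 hs]
  · intro c hc
    have := h.t_le v c h1 h2 hc
    rcases key c hc with ⟨-, -, -, h3⟩ | ⟨-, -, -, -, h3⟩ | ⟨h3, h4, h5, h6, h7⟩ | ⟨h3, h4⟩ <;> omega
  · intro c hc h0
    rw [hlen v h2, hfp v h2]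
    have old : δ v c ≠ 0 → ∃ e < n + 1, Suf w (len v) (fp v) e ∧ w e = c := fun h0 => by
      obtain ⟨e, he, h3⟩ := h.t_occ v c h1 h2 hc h0
      exact ⟨e, by omega, h3⟩
    rcases key c hc with ⟨h3, h4, -, -⟩ | ⟨-, -, -, h3, h4⟩ | ⟨h3, h4, h5, h6, h7⟩ | ⟨h3, h4⟩
    · exact ⟨n, by omega, h4, h3.symm⟩
    · exact old (h3 ▸ hq)
    · exact old (h7 ▸ h0)
    · exact old (h4 ▸ h0)
  · intro c hc h0 e he hs hw
    rw [hlen v h2, hfp v h2] at hs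
    rcases key c hc with ⟨h3, h4, h5, h6⟩ | ⟨h3, h4, h5, h6, h7⟩ | ⟨h3, h4, h5, h6, h7⟩ | ⟨h3, h4⟩
    · rw [h6, hlen1, hfp1]
      rcases Nat.lt_succ_iff_lt_or_eq.1 he with he | rfl
      -- An earlier occurrence of `v` followed by the new letter would be a repeated suffix longer
      -- than `Z`.
      · have : Suf w (len v + 1) (n + 1) (e + 1) :=
          suf_succ.2 ⟨by rw [hw, h3], h4.symm.trans hs⟩
        exact absurd (this.mono (by omega)) (hZ.max (e + 1) (by omega))
      · exact Suf.rfl le_rfl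
    · rw [h7, hzsl]
      rcases Nat.lt_succ_iff_lt_or_eq.1 he with he | rfl
      · have h8 := h.t_ext v c h1 h2 hc (by omega) e he hs hw
        rw [h6] at h8
        exact (hzss.trans ht.suf.symm).trans (h8.mono ht.le_len)
      · exact hzss
    · rw [h7] at h0 ⊢
      have hle := h.t_le v c h1 h2 hc
      rw [hlen _ hle, hfp _ hle]
      rcases Nat.lt_succ_iff_lt_or_eq.1 he with he | rfl
      · exact h.t_ext v c h1 h2 hc h0 e he hs hw
      · obtain ⟨f, rfl, h8, h9⟩ := (hs₀.mono (show len v + 1 ≤ Z by omega)).exists_pred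
        have h10 := h.t_ext v c h1 h2 hc h0 f (by omega) (h4.trans h9) (by rw [← h8, h3])
        subst h3
        exact h10.trans (hs₀.symm.mono (hqu h4 h5 hc h0 h6))
    · rw [h4] at h0 ⊢
      have hle := h.t_le v c h1 h2 hc
      rw [hlen _ hle, hfp _ hle]
      rcases Nat.lt_succ_iff_lt_or_eq.1 he with he | rfl
      · exact h.t_ext v c h1 h2 hc h0 e he hs hw
      · rcases h3 with h3 | h3
        exacts [absurd hw.symm h3, absurd hs h3]
  · intro c hc h0
    rw [hlen v h2]
    have hle := h.t_le v c h1 h2 hc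
    have := h.len_le h1 h2
    rcases key c hc with ⟨h3, h4, h5, h6⟩ | ⟨h3, h4, h5, h6, h7⟩ | ⟨h3, h4, h5, h6, h7⟩ | ⟨h3, h4⟩
    · rw [h6, hlen1]; omega
    · rw [h7, hzsl]; exact h5
    · rw [h7] at h0 ⊢; rw [hlen _ hle]; exact h.t_len v c h1 h2 hc h0
    · rw [h4] at h0 ⊢; rw [hlen _ hle]; exact h.t_len v c h1 h2 hc h0

/-- The conditions common to the extensions by a letter with and without a new state for the longest
repeated suffix, which becomes the state `zs`. -/
structure Ext (w : ℕ → ℕ) (G : ℕ → Prop) (n k : ℕ) (len fp : ℕ → ℕ) (δ : ℕ → ℕ → ℕ) (Z q zs : ℕ)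
    (len' fp' link' : ℕ → ℕ) (δ' : ℕ → ℕ → ℕ) : Prop where
  lrs : Lrs w n Z
  tgt : Tgt w n k len fp Z q
  len_old : ∀ v ≤ k, len' v = len v
  fp_old : ∀ v ≤ k, fp' v = fp v
  len_cur : len' (k + 1) = n + 1
  fp_cur : fp' (k + 1) = n + 1
  link_cur : link' (k + 1) = zs
  t_cur : ∀ c, G c → δ' (k + 1) c = 0
  trans : NewTrans w G n k len fp δ Z q zs δ'

variable {len' fp' link' : ℕ → ℕ} {δ' : ℕ → ℕ → ℕ} {Z q : ℕ}

theorem transOk_cur {k' : ℕ} (hl : len' (k + 1) = n + 1) (ht : ∀ c, G c → δ' (k + 1) c = 0) :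
    TransOk w G (n + 1) k' len' fp' δ' (k + 1) := by
  constructor
  · intro c hc h0 e he hs
    have := hs.2.1
    omega
  all_goals intro c hc
  · rw [ht c hc]; exact Nat.zero_le _
  all_goals exact fun h0 => absurd (ht c hc) h0

/-- The longest repeated suffix is already the state `q`, so the whole prefix is the only new node.
It occurs only once, and its suffix link is `q`. -/
theorem Sam.ext (h : Sam w G n k len fp link δ)
    (hE : Ext w G n k len fp δ Z q q len' fp' link' δ') (hq : len q = Z)
    (hlink : ∀ v ≤ k, link' v = link v) : Sam w G (n + 1) (k + 1) len' fp' link' δ' := by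
  obtain ⟨hZ, ht, hlen, hfp, hlen1, hfp1, hlink1, ht1, hδ⟩ := hE
  obtain ⟨e₀, he₀, hs₀⟩ := hZ.occ
  have hZn := hZ.le
  have hq1 := ht.pos
  have hqk := ht.le
  have hT : ∀ v, 1 ≤ v → v ≤ k + 1 → TransOk w G (n + 1) (k + 1) len' fp' δ' v := by
    intro v h1 h2
    rcases Nat.lt_succ_iff_lt_or_eq.1 (Nat.lt_succ_of_le h2) with h2 | rfl
    · exact h.transOk hZ hδ hlen hfp hlen1 hfp1 (by omega) (by omega) le_rfl
        (by rw [hlen q hqk, hq]) (by rw [hfp q hqk]; exact ht.suf) ht h1 (by omega)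
    · exact transOk_cur hlen1 ht1
  constructor
  · omega
  · intro v h1 h2
    rcases Nat.lt_or_ge k v with hv | hv
    · obtain rfl : v = k + 1 := by omega
      rw [hlen1, hfp1]; exact Nd.self
    · rw [hlen v hv, hfp v hv]; exact (h.node v h1 hv).mono
  · intro v h1 h2 e he hs
    rcases Nat.lt_or_ge k v with hv | hv
    · obtain rfl : v = k + 1 := by omega
      rw [hlen1] at hs; rw [hfp1]; exact hs.2.1
    · rw [hlen v hv, hfp v hv] at hs
      rw [hfp v hv]
      rcases Nat.lt_or_ge n e with he' | he'
      · have := h.fp_le h1 hv; omega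
      · exact h.min v h1 hv e he' hs
  · intro u v hu1 hu2 hv1 hv2 hl hs
    rcases Nat.lt_or_ge k u with hu | hu <;> rcases Nat.lt_or_ge k v with hv | hv
    · omega
    · obtain rfl : u = k + 1 := by omega
      rw [hlen1, hlen v hv] at hl
      have := h.len_le hv1 hv; omega
    · obtain rfl : v = k + 1 := by omega
      rw [hlen1, hlen u hu] at hl
      have := h.len_le hu1 hu; omega
    · rw [hlen u hu, hfp u hu, hfp v hv] at hs
      rw [hlen u hu, hlen v hv] at hl
      exact h.inj u v hu1 hu hv1 hv hl hs
  · intro l e hN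
    have old : ∀ e', Nd w n l e' → Suf w l e' e → ∃ v, 1 ≤ v ∧ v ≤ k + 1 ∧ len' v = l ∧
        Suf w l (fp' v) e := fun e' h1 h2 => by
      obtain ⟨v, hv1, hv2, hv3, hv4⟩ := h.surj l e' h1
      exact ⟨v, hv1, by omega, by rw [hlen v hv2, hv3], by rw [hfp v hv2]; exact hv4.trans h2⟩
    have new : l = Z → Suf w Z (n + 1) e → ∃ v, 1 ≤ v ∧ v ≤ k + 1 ∧ len' v = l ∧
        Suf w l (fp' v) e := fun h1 h2 =>
      ⟨q, hq1, by omega, by rw [hlen q hqk, hq, h1], by rw [hfp q hqk, h1]; exact ht.suf.trans h2⟩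
    rcases Nat.lt_or_ge n e with he | he
    · obtain rfl : e = n + 1 := by have := hN.2.1; omega
      rcases hZ.nd_succ_top he₀ hs₀ hN with rfl | h1 | ⟨h1, h2⟩
      · exact ⟨k + 1, by omega, le_rfl, hlen1, by rw [hfp1]; exact Suf.rfl le_rfl⟩
      · exact new h1 (Suf.rfl (by omega))
      · exact old _ h2 (hs₀.symm.mono h1.le)
    · rcases (hZ.nd_succ he).1 hN with h1 | ⟨h1, h2⟩
      · exact old _ h1 (Suf.rfl h1.1)
      · exact new h1 h2.symm
  · rw [hlen 1 h.k_pos]; exact h.root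
  · rw [hlink 1 h.k_pos]; exact h.link_one
  · intro v h1 h2
    rcases Nat.lt_or_ge k v with hv | hv
    · obtain rfl : v = k + 1 := by omega
      omega
    · rw [hlink v hv]; exact h.link_pos v h1 hv
  · intro v h1 h2
    rcases Nat.lt_or_ge k v with hv | hv
    · obtain rfl : v = k + 1 := by omega
      omega
    · rw [hlink v hv]; have := h.link_le v h1 hv; omega
  · intro v h1 h2
    rcases Nat.lt_or_ge k v with hv | hv
    · obtain rfl : v = k + 1 := by omega
      rw [hlink1, hlen1, hlen q hqk]; omega
    · rw [hlink v hv, hlen v hv, hlen _ (h.link_le v h1 hv)]; exact h.link_lt v h1 hv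
  · intro v h1 h2
    rcases Nat.lt_or_ge k v with hv | hv
    · obtain rfl : v = k + 1 := by omega
      rw [hlink1, hlen q hqk, hfp1, hfp q hqk, hq]; exact ht.suf
    · have := h.link_le v h1 hv
      rw [hlink v hv, hfp v hv, hlen _ this, hfp _ this]; exact h.link_suf v h1 hv
  · intro v h1 h2 l hl1 hl2 hN
    rcases Nat.lt_or_ge k v with hv | hv
    · obtain rfl : v = k + 1 := by omega
      rw [hlink1, hlen q hqk] at hl1
      rw [hlen1] at hl2
      rw [hfp1] at hN
      rcases hZ.nd_succ_top he₀ hs₀ hN with h1 | h1 | h1 <;> omega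
    · rw [hlink v hv, hlen _ (h.link_le v h1 hv)] at hl1
      rw [hlen v hv] at hl2
      rw [hfp v hv] at hN
      rcases (hZ.nd_succ (h.fp_le (by omega) hv)).1 hN with h3 | ⟨rfl, h3⟩
      · exact h.link_max v h1 hv l hl1 hl2 h3
      · have h4 := h.node q hq1 hqk
        rw [hq] at h4
        exact h.link_max v h1 hv l hl1 hl2
          (h4.of_suf (ht.suf.trans h3.symm) (h.fp_le (by omega) hv))
  · exact fun v c h1 h2 hc => (hT v h1 h2).t_zero c hc
  · exact fun v c h1 h2 hc => (hT v h1 h2).t_le c hc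
  · exact fun v c h1 h2 hc => (hT v h1 h2).t_occ c hc
  · exact fun v c h1 h2 hc => (hT v h1 h2).t_ext c hc
  · exact fun v c h1 h2 hc => (hT v h1 h2).t_len c hc

/-- Until now the longest repeated suffix was always preceded by the same letter and shared its
occurrences with the longer word `q`; the occurrence at `n + 1` separates them. The new state
inherits first occurrence, suffix link and transitions of `q`, and it becomes the link of both `q`
and the whole prefix. -/
theorem Sam.ext_clone (h : Sam w G n k len fp link δ)
    (hE : Ext w G n k len fp δ Z q (k + 2) len' fp' link' δ') (hq : Z < len q)
    (hlen2 : len' (k + 2) = Z) (hfp2 : fp' (k + 2) = fp q) (hlink2 : link' (k + 2) = link q)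
    (hlinkq : link' q = k + 2) (hlink : ∀ v ≤ k, v ≠ q → link' v = link v)
    (ht2 : ∀ c, G c → δ' (k + 2) c = δ' q c) : Sam w G (n + 1) (k + 2) len' fp' link' δ' := by
  obtain ⟨hZ, ht, hlen, hfp, hlen1, hfp1, hlink1, ht1, hδ⟩ := hE
  obtain ⟨e₀, he₀, hs₀⟩ := hZ.occ
  have hZn := hZ.le
  have hq1 := ht.pos
  have hqk := ht.le
  have hq2 : 1 < q := by
    by_contra hc
    obtain rfl : q = 1 := by omega
    rw [h.root] at hq; omega
  have hqn := h.fp_le hq1 hqk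
  have hlq1 := h.link_pos q hq2 hqk
  have hlqk := h.link_le q hq2 hqk
  -- Up to `n`, the word of the clone and that of `q` end at the same positions, which is why the
  -- data of `q` may be copied.
  have hocc : ∀ e ≤ n, Suf w Z (fp q) e → Suf w (len q) (fp q) e := fun e he hs =>
    ht.ext e he (ht.suf.symm.trans hs)
  -- If the link of `q` had length at least `Z`, it would end with the longest repeated suffix,
  -- hence be at least as long as `q`.
  have hlq : len (link q) < Z := by
    by_contra hc
    have h1 := h.link_lt q hq2 hqk
    have := h.len_tgt_le ht hlq1 hlqk (by omega)
      (((h.link_suf q hq2 hqk).mono (by omega)).trans ht.suf)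
    omega
  have hT : ∀ v, 1 ≤ v → v ≤ k → TransOk w G (n + 1) (k + 2) len' fp' δ' v := by
    intro v h1 h2
    exact h.transOk hZ hδ hlen hfp hlen1 hfp1 (by omega) (by omega) (by omega)
      hlen2 (by rw [hfp2]; exact ht.suf) ht h1 (by omega)
  have hT : ∀ v, 1 ≤ v → v ≤ k + 2 → TransOk w G (n + 1) (k + 2) len' fp' δ' v := by
    intro v h1 h2
    rcases Nat.lt_or_ge k v with hv | hv
    · rcases Nat.lt_or_ge (k + 1) v with hv | hv
      · obtain rfl : v = k + 2 := by omega
        have hQ := hT q hq1 hqk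
        have hlenq := hlen q hqk
        have hfpq := hfp q hqk
        constructor
        · intro c hc
          rw [ht2 c hc, hlen2, hfp2]
          intro h0 e he hs
          exact hQ.t_zero c hc h0 e he (by rw [hlenq, hfpq]; exact hocc e (by omega) hs)
        · intro c hc; rw [ht2 c hc]; exact hQ.t_le c hc
        · intro c hc
          rw [ht2 c hc, hlen2, hfp2]
          intro h0
          obtain ⟨e, he, hs, hw⟩ := hQ.t_occ c hc h0
          rw [hlenq, hfpq] at hs
          exact ⟨e, he, hs.mono hq.le, hw⟩
        · intro c hc
          rw [ht2 c hc, hlen2, hfp2]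
          intro h0 e he hs
          exact hQ.t_ext c hc h0 e he (by rw [hlenq, hfpq]; exact hocc e (by omega) hs)
        · intro c hc
          rw [ht2 c hc, hlen2]
          intro h0
          have := hQ.t_len c hc h0
          omega
      · obtain rfl : v = k + 1 := by omega
        exact transOk_cur hlen1 ht1
    · exact hT v h1 hv
  have split : ∀ v, v ≤ k + 2 → v ≤ k ∨ v = k + 1 ∨ v = k + 2 := fun v hv => by omega
  -- The word of the clone is not yet a state: such a state would be at least as long as `q`.
  have hne : ∀ v, 1 ≤ v → v ≤ k → len v = Z → ¬ Suf w Z (fp v) (n + 1) := fun v h1 h2 h3 h4 => by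
    have := h.len_tgt_le ht h1 h2 h3.ge h4
    omega
  constructor
  · omega
  · intro v h1 h2
    rcases split v h2 with hv | rfl | rfl
    · rw [hlen v hv, hfp v hv]; exact (h.node v h1 hv).mono
    · rw [hlen1, hfp1]; exact Nd.self
    · rw [hlen2, hfp2]; exact (hZ.nd_succ hqn).2 (.inr ⟨rfl, ht.suf⟩)
  · intro v h1 h2 e he hs
    rcases split v h2 with hv | rfl | rfl
    · rw [hlen v hv, hfp v hv] at hs
      rw [hfp v hv]
      rcases Nat.lt_or_ge n e with he' | he'
      · have := h.fp_le h1 hv; omega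
      · exact h.min v h1 hv e he' hs
    · rw [hlen1] at hs; rw [hfp1]; exact hs.2.1
    · rw [hlen2, hfp2] at hs
      rw [hfp2]
      rcases Nat.lt_or_ge n e with he' | he'
      · omega
      · exact h.min q hq1 hqk e he' (hocc e he' hs)
  · intro u v hu1 hu2 hv1 hv2 hl hs
    rcases split u hu2 with hu | rfl | rfl <;> rcases split v hv2 with hv | rfl | rfl
    · rw [hlen u hu, hfp u hu, hfp v hv] at hs
      rw [hlen u hu, hlen v hv] at hl
      exact h.inj u v hu1 hu hv1 hv hl hs
    · rw [hlen1, hlen u hu] at hl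
      have := h.len_le hu1 hu; omega
    · rw [hlen2, hlen u hu] at hl
      rw [hlen u hu, hfp u hu, hfp2, hl] at hs
      exact absurd (hs.trans ht.suf) (hne u hu1 hu hl)
    · rw [hlen1, hlen v hv] at hl
      have := h.len_le hv1 hv; omega
    · rfl
    · omega
    · rw [hlen2, hlen v hv] at hl
      rw [hlen2, hfp v hv, hfp2] at hs
      exact absurd (hs.symm.trans ht.suf) (hne v hv1 hv hl.symm)
    · omega
    · rfl
  · intro l e hN
    have old : ∀ e', Nd w n l e' → Suf w l e' e → ∃ v, 1 ≤ v ∧ v ≤ k + 2 ∧ len' v = l ∧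
        Suf w l (fp' v) e := fun e' h1 h2 => by
      obtain ⟨v, hv1, hv2, hv3, hv4⟩ := h.surj l e' h1
      exact ⟨v, hv1, by omega, by rw [hlen v hv2, hv3], by rw [hfp v hv2]; exact hv4.trans h2⟩
    have new : l = Z → Suf w Z (n + 1) e → ∃ v, 1 ≤ v ∧ v ≤ k + 2 ∧ len' v = l ∧
        Suf w l (fp' v) e := fun h1 h2 =>
      ⟨k + 2, by omega, le_rfl, by rw [hlen2, h1], by rw [hfp2, h1]; exact ht.suf.trans h2⟩
    rcases Nat.lt_or_ge n e with he | he
    · obtain rfl : e = n + 1 := by have := hN.2.1; omega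
      rcases hZ.nd_succ_top he₀ hs₀ hN with rfl | h1 | ⟨h1, h2⟩
      · exact ⟨k + 1, by omega, by omega, hlen1, by rw [hfp1]; exact Suf.rfl le_rfl⟩
      · exact new h1 (Suf.rfl (by omega))
      · exact old _ h2 (hs₀.symm.mono h1.le)
    · rcases (hZ.nd_succ he).1 hN with h1 | ⟨h1, h2⟩
      · exact old _ h1 (Suf.rfl h1.1)
      · exact new h1 h2.symm
  · rw [hlen 1 h.k_pos]; exact h.root
  · rw [hlink 1 h.k_pos (by omega)]; exact h.link_one
  · intro v h1 h2
    rcases split v h2 with hv | rfl | rfl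
    · by_cases hvq : v = q
      · subst hvq; omega
      · rw [hlink v hv hvq]; exact h.link_pos v h1 hv
    · omega
    · omega
  · intro v h1 h2
    rcases split v h2 with hv | rfl | rfl
    · by_cases hvq : v = q
      · subst hvq; omega
      · rw [hlink v hv hvq]; have := h.link_le v h1 hv; omega
    · omega
    · omega
  · intro v h1 h2
    rcases split v h2 with hv | rfl | rfl
    · by_cases hvq : v = q
      · subst hvq; rw [hlinkq, hlen2, hlen _ hv]; exact hq
      · rw [hlink v hv hvq, hlen v hv, hlen _ (h.link_le v h1 hv)]; exact h.link_lt v h1 hv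
    · rw [hlink1, hlen1, hlen2]; omega
    · rw [hlink2, hlen2, hlen _ hlqk]; exact hlq
  · intro v h1 h2
    rcases split v h2 with hv | rfl | rfl
    · by_cases hvq : v = q
      · subst hvq
        rw [hlinkq, hlen2, hfp2, hfp _ hv]
        exact Suf.rfl (hq.le.trans (h.len_le_fp hq1 hv))
      · have := h.link_le v h1 hv
        rw [hlink v hv hvq, hfp v hv, hlen _ this, hfp _ this]; exact h.link_suf v h1 hv
    · rw [hlink1, hlen2, hfp1, hfp2]; exact ht.suf
    · rw [hlink2, hlen _ hlqk, hfp _ hlqk, hfp2]; exact h.link_suf q hq2 hqk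
  · intro v h1 h2 l hl1 hl2 hN
    rcases split v h2 with hv | rfl | rfl
    · rw [hfp v hv] at hN
      rw [hlen v hv] at hl2
      by_cases hvq : v = q
      · subst hvq
        rw [hlinkq, hlen2] at hl1
        rcases (hZ.nd_succ (h.fp_le (by omega) hv)).1 hN with h3 | ⟨rfl, h3⟩
        · exact h.link_max v h1 hv l (by omega) hl2 h3
        · omega
      · rw [hlink v hv hvq, hlen _ (h.link_le v h1 hv)] at hl1
        rcases (hZ.nd_succ (h.fp_le (by omega) hv)).1 hN with h3 | ⟨rfl, h3⟩
        · exact h.link_max v h1 hv l hl1 hl2 h3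
        · have h4 := h.len_tgt_le ht (by omega) hv hl2.le h3
          have h5 := ht.ext _ (h.fp_le (by omega) hv) h3.symm
          rcases h4.eq_or_lt with h6 | h6
          · exact hvq (h.inj q v hq1 hqk (by omega) hv h6 h5).symm
          · exact h.link_max v h1 hv _ (by omega) h6
              ((h.node q hq1 hqk).of_suf h5 (h.fp_le (by omega) hv))
    · rw [hlink1, hlen2] at hl1
      rw [hlen1] at hl2
      rw [hfp1] at hN
      rcases hZ.nd_succ_top he₀ hs₀ hN with h1 | h1 | h1 <;> omega
    · rw [hlink2, hlen _ hlqk] at hl1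
      rw [hlen2] at hl2
      rw [hfp2] at hN
      rcases (hZ.nd_succ hqn).1 hN with h3 | ⟨rfl, h3⟩
      · exact h.link_max q hq2 hqk l hl1 (by omega) h3
      · omega
  · exact fun v c h1 h2 hc => (hT v h1 h2).t_zero c hc
  · exact fun v c h1 h2 hc => (hT v h1 h2).t_le c hc
  · exact fun v c h1 h2 hc => (hT v h1 h2).t_occ c hc
  · exact fun v c h1 h2 hc => (hT v h1 h2).t_ext c hc
  · exact fun v c h1 h2 hc => (hT v h1 h2).t_len c hc

end


/-! ### Suffix chains, the number of transitions, and matching -/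

section
variable {w w' : ℕ → ℕ} {n l e e' : ℕ}

theorem Suf.congr (hw : ∀ i < n, w i = w' i) (he : e ≤ n) (he' : e' ≤ n) (h : Suf w l e e') :
    Suf w' l e e' := by
  obtain ⟨h1, h2, h3⟩ := h
  refine ⟨h1, h2, fun i hi => ?_⟩
  rw [← hw _ (by omega), ← hw _ (by omega), h3 i hi]

theorem Nd.congr (hw : ∀ i < n, w i = w' i) (h : Nd w n l e) : Nd w' n l e := by
  obtain ⟨h1, h2, f, hf, h3, h4⟩ := h
  exact ⟨h1, h2, f, hf, h3.congr hw h2 hf, fun h => h4 (h.congr (fun i hi => (hw i hi).symm) h2 hf)⟩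

end

section
variable {w w' : ℕ → ℕ} {G : ℕ → Prop} {n k : ℕ} {len fp link : ℕ → ℕ} {δ : ℕ → ℕ → ℕ}

/-- The automaton depends only on the prefix. -/
theorem Sam.congr (h : Sam w G n k len fp link δ) (hw : ∀ i < n, w i = w' i) :
    Sam w' G n k len fp link δ := by
  have hw' : ∀ i < n, w' i = w i := fun i hi => (hw i hi).symm
  have hf : ∀ v, 1 ≤ v → v ≤ k → fp v ≤ n := fun v h1 h2 => h.fp_le h1 h2
  refine ⟨h.k_pos, fun v h1 h2 => (h.node v h1 h2).congr hw, fun v h1 h2 e he hs =>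
    h.min v h1 h2 e he (hs.congr hw' (hf v h1 h2) he), fun u v h1 h2 h3 h4 h5 h6 =>
    h.inj u v h1 h2 h3 h4 h5 (h6.congr hw' (hf u h1 h2) (hf v h3 h4)), fun l e hN => ?_,
    h.root, h.link_one, h.link_pos, h.link_le, h.link_lt, fun v h1 h2 =>
    (h.link_suf v h1 h2).congr hw (hf _ (h.link_pos v h1 h2) (h.link_le v h1 h2))
      (hf v (by omega) h2), fun v h1 h2 l h3 h4 h5 => h.link_max v h1 h2 l h3 h4 (h5.congr hw'),
    fun v c h1 h2 hc h0 e he hs => ?_, h.t_le, fun v c h1 h2 hc h0 => ?_,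
    fun v c h1 h2 hc h0 e he hs hwe => ?_, h.t_len⟩
  · obtain ⟨v, h1, h2, h3, h4⟩ := h.surj l e (hN.congr hw')
    exact ⟨v, h1, h2, h3, h4.congr hw (hf v h1 h2) hN.2.1⟩
  · rw [← hw e he]
    exact h.t_zero v c h1 h2 hc h0 e he (hs.congr hw' (hf v h1 h2) he.le)
  · obtain ⟨e, he, h3, h4⟩ := h.t_occ v c h1 h2 hc h0
    exact ⟨e, he, h3.congr hw (hf v h1 h2) he.le, by rw [← hw e he, h4]⟩
  · rw [← hw e he] at hwe
    exact (h.t_ext v c h1 h2 hc h0 e he (hs.congr hw' (hf v h1 h2) he.le) hwe).congr hw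
      (hf _ (by omega) (h.t_le v c h1 h2 hc)) he

/-- The automaton of the empty word. -/
theorem Sam.empty (hl : len 1 = 0) (hf : fp 1 = 0) (hk : link 1 = 0)
    (hδ : ∀ c, G c → δ 1 c = 0) : Sam w G 0 1 len fp link δ := by
  have h1 : ∀ v, 1 ≤ v → v ≤ 1 → v = 1 := fun v _ _ => by omega
  constructor
  · omega
  · intro v h2 h3; rw [h1 v h2 h3, hl, hf]; exact Nd.self
  · intro v h2 h3; rw [h1 v h2 h3, hf]; simp
  · intros; omega
  · rintro l e ⟨h3, h4, -⟩
    obtain rfl : l = 0 := by omega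
    exact ⟨1, le_rfl, le_rfl, hl, Suf.zero⟩
  · exact hl
  · exact hk
  all_goals intro v
  any_goals intros; omega
  all_goals intro c h2 h3 hc
  all_goals obtain rfl := h1 v h2 h3
  · exact (hδ c hc).le.trans (by omega)
  all_goals exact fun h0 => absurd (hδ c hc) h0

/-- The state `v` stands for a suffix of the whole prefix. -/
def Chain (w : ℕ → ℕ) (n k : ℕ) (len fp : ℕ → ℕ) (v : ℕ) : Prop :=
  1 ≤ v ∧ v ≤ k ∧ Suf w (len v) (fp v) n

/-- All states of the chain that are not processed yet have lengths below this bound when the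
state `p` comes next. -/
def bnd (len : ℕ → ℕ) (p : ℕ) : ℕ := if p = 0 then 0 else len p + 1

theorem bnd_of_pos {p : ℕ} (h : 1 ≤ p) : bnd len p = len p + 1 := if_neg (by omega)

theorem Sam.chain_inj (h : Sam w G n k len fp link δ) {u v : ℕ} (hu : Chain w n k len fp u)
    (hv : Chain w n k len fp v) (hl : len u = len v) : u = v :=
  h.inj u v hu.1 hu.2.1 hv.1 hv.2.1 hl (hu.2.2.trans (hl ▸ hv.2.2.symm))

/-- No node lies strictly between a state and its link, so following the link visits the next
shorter state of the chain and `bnd` still bounds everything that is left. -/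
theorem Sam.chain_step (h : Sam w G n k len fp link δ) {p : ℕ} (hp : Chain w n k len fp p) :
    (link p ≠ 0 → Chain w n k len fp (link p)) ∧ bnd len (link p) ≤ len p ∧
      ∀ u, Chain w n k len fp u → len u < len p → len u < bnd len (link p) := by
  obtain ⟨h1, h2, h3⟩ := hp
  rcases h1.eq_or_lt with rfl | h1
  · rw [h.link_one, h.root]
    exact ⟨fun h => absurd rfl h, by simp [bnd], fun u _ hu => by omega⟩
  · have h4 := h.link_lt p h1 h2
    have h5 := h.link_pos p h1 h2
    rw [bnd_of_pos h5]
    refine ⟨fun _ => ⟨h5, h.link_le p h1 h2, (h.link_suf p h1 h2).trans (h3.mono h4.le)⟩, h4,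
      fun u hu hl => ?_⟩
    by_contra hc
    exact h.link_max p h1 h2 (len u) (by omega) hl
      ((h.node u hu.1 hu.2.1).of_suf (hu.2.2.trans (h3.mono hl.le).symm) (h.fp_le h1.le h2))

/-- The state that is left behind is itself counted by the potential. -/
theorem Sam.pot_step (h : Sam w G n k len fp link δ) {p : ℕ} (hp : Chain w n k len fp p) :
    pot w n (bnd len (link p)) + 1 ≤ pot w n (bnd len p) := by
  rw [bnd_of_pos hp.1]
  exact pot_lt (h.chain_step hp).2.1 ((h.node p hp.1 hp.2.1).of_suf hp.2.2 le_rfl)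

/-- When the transition of a state on the chain leads to the target, so do those of all longer
states below the longest repeated suffix. -/
theorem Sam.redirect (h : Sam w G n k len fp link δ) {Z q u v : ℕ} (hZ : Lrs w n Z)
    (ht : Tgt w n k len fp Z q) (hq : Z < len q) (hG : G (w n)) (hu : Chain w n k len fp u)
    (hv : Chain w n k len fp v) (huv : len u ≤ len v) (hvZ : len v < Z) (hδ : δ u (w n) = q) :
    δ v (w n) = q := by
  obtain ⟨e, he, hs⟩ := hZ.occ
  have hq1 := ht.pos
  have hδv : δ v (w n) ≠ 0 := fun h0 => by
    obtain ⟨f, rfl, h3, h4⟩ := (hs.mono (show len v + 1 ≤ Z by omega)).exists_pred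
    exact h.t_zero v _ hv.1 hv.2.1 hG h0 f (by omega) (hv.2.2.trans h4) h3.symm
  refine h.tgt_unique ht hv.1 hv.2.1 hG hv.2.2 hvZ hδv hZ (hq.trans_le ?_)
  have hzk := h.t_le v _ hv.1 hv.2.1 hG
  have hzl := h.t_len v _ hv.1 hv.2.1 hG hδv
  have hz1 : 1 ≤ δ v (w n) := by omega
  refine h.le_of_ext hz1 hzk (f := fp q) fun e he hs => ?_
  have h1 := hs.mono (show len v + 1 ≤ _ from hzl)
  have h2 : Suf w (len v + 1) (n + 1) (fp (δ v (w n))) := by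
    obtain ⟨f, hf, h3, h4⟩ := h.t_occ v _ hv.1 hv.2.1 hG hδv
    have h5 := (h.t_ext v _ hv.1 hv.2.1 hG hδv f hf h3 h4).mono (show len v + 1 ≤ _ from hzl)
    exact (suf_succ.2 ⟨h4.symm, hv.2.2.symm.trans h3⟩ : Suf w (len v + 1) (n + 1) (f + 1)).trans
      h5.symm
  obtain ⟨f, rfl, h3, h4⟩ := ((h2.trans h1).mono (show len u + 1 ≤ len v + 1 by omega)).exists_pred
  have := h.t_ext u _ hu.1 hu.2.1 hG (by omega) f (by omega) (hu.2.2.trans h4) h3.symm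
  rwa [hδ] at this

/-- The chain states of length between `M` and `Z`, all redirected from `q`, contribute nothing to
the new chain. If a node of length `j + 1 < Z` arose from such a state of length `j`, all its
occurrences would extend to those of `q`, so its length would be at least that of `q`, which exceeds
`Z`. -/
theorem Sam.pot_clone (h : Sam w G n k len fp link δ) {Z q M : ℕ} (hZ : Lrs w n Z)
    (hq : Z < len q) (hG : G (w n))
    (hM : ∀ v, Chain w n k len fp v → M ≤ len v → len v < Z → δ v (w n) = q) :
    pot w (n + 1) (n + 2) ≤ 3 + pot w n M := by
  obtain ⟨e, he, hs⟩ := hZ.occ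
  refine hZ.pot_succ he hs fun j h1 h2 h3 => ?_
  obtain ⟨j, rfl⟩ : ∃ i, j = i + 1 := ⟨j - 1, by omega⟩
  by_contra hc
  obtain ⟨f, rfl, h4, h5⟩ := (hs.mono h2.le).exists_pred
  obtain ⟨v, hv1, hv2, rfl, hv4⟩ := h.surj _ _ h3.pred
  have hv : Chain w n k len fp v := ⟨hv1, hv2, hv4.trans h5.symm⟩
  have hδ := hM v hv (by omega) (by omega)
  have h0 : δ v (w n) ≠ 0 := fun h0 =>
    h.t_zero v _ hv1 hv2 hG h0 f (by omega) hv4 h4.symm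
  obtain ⟨z, hz1, hz2, hz3, hz4⟩ := h.surj _ _ h3
  have := h.le_of_ext hz1 hz2 (m := len q) (f := fp q) fun e he hse => by
    rw [hz3] at hse
    obtain ⟨g, rfl, h6, h7⟩ := (hz4.symm.trans hse).exists_pred
    have := h.t_ext v _ hv1 hv2 hG h0 g (by omega) (hv4.trans h7) (by rw [← h6, h4])
    rwa [hδ] at this
  omega

theorem Nd.pred' {l e d : ℕ} (h : Nd w n (l + d) (e + d)) : Nd w n l e := by
  induction d with
  | zero => exact h
  | succ d ih => exact ih h.pred

/-- The number of transitions is at most the number of states plus the length. -/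
theorem Sam.card_le (h : Sam w G n k len fp link δ) (E : Finset (ℕ × ℕ))
    (hE : ∀ p ∈ E, 1 ≤ p.1 ∧ p.1 ≤ k ∧ G p.2 ∧ δ p.1 p.2 ≠ 0) : E.card ≤ k + n := by
  classical
  have h1 : ∀ p ∈ E, ∃ e < n, Suf w (len p.1) (fp p.1) e ∧ w e = p.2 := fun p hp =>
    h.t_occ p.1 p.2 (hE p hp).1 (hE p hp).2.1 (hE p hp).2.2.1 (hE p hp).2.2.2
  choose! e he hs hw using h1
  have h2 : ∀ p ∈ E, Nd w n (len p.1 + 1) (e p + 1) → ∃ v, 1 ≤ v ∧ v ≤ k ∧ len v = len p.1 + 1 ∧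
      Suf w (len p.1 + 1) (fp v) (e p + 1) := fun p _ hN => h.surj _ _ hN
  choose! z hz1 hz2 hz3 hz4 using h2
  -- Transitions are split by whether the extended word is itself a node. If so, this node
  -- determines both the source and the letter, which gives at most `k` of them.
  let A := E.filter fun p => Nd w n (len p.1 + 1) (e p + 1)
  let B := E.filter fun p => ¬ Nd w n (len p.1 + 1) (e p + 1)
  have hA : A.card ≤ (Finset.Icc 1 k).card := by
    refine Finset.card_le_card_of_injOn z (fun p hp => ?_) fun p hp p' hp' hpp => ?_
    · obtain ⟨hp, hN⟩ := Finset.mem_filter.1 hp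
      simp [hz1 p hp hN, hz2 p hp hN]
    · obtain ⟨hp, hN⟩ := Finset.mem_filter.1 hp
      obtain ⟨hp', hN'⟩ := Finset.mem_filter.1 hp'
      have h3 := hz3 p hp hN
      have h3' := hz3 p' hp' hN'
      rw [← hpp] at h3'
      have hl : len p.1 = len p'.1 := by omega
      have h4 := hz4 p hp hN
      have h4' := hz4 p' hp' hN'
      rw [← hpp, ← hl] at h4'
      obtain ⟨h5, h6⟩ := suf_succ.1 (h4.symm.trans h4')
      have h7 := h.inj p.1 p'.1 (hE p hp).1 (hE p hp).2.1 (hE p' hp').1 (hE p' hp').2.1 hl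
        (((hs p hp).trans h6).trans (hl ▸ (hs p' hp').symm))
      rw [hw p hp, hw p' hp'] at h5
      exact Prod.ext h7 h5
  have hB : B.card ≤ (Finset.range n).card := by
    -- The other transitions are determined by the starting position of a chosen occurrence: of two
    -- different lengths from the same start, the shorter word with its letter would be a prefix of
    -- the longer source and hence a node.
    refine Finset.card_le_card_of_injOn (fun p => e p - len p.1) (fun p hp => ?_)
      fun p hp p' hp' hpp => ?_
    · obtain ⟨hp, hN⟩ := Finset.mem_filter.1 hp
      have := he p hp
      simp; omega
    · obtain ⟨hp, hN⟩ := Finset.mem_filter.1 hp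
      obtain ⟨hp', hN'⟩ := Finset.mem_filter.1 hp'
      have aux : ∀ p ∈ E, ∀ p' ∈ E, ¬ Nd w n (len p.1 + 1) (e p + 1) →
          e p - len p.1 = e p' - len p'.1 → len p'.1 ≤ len p.1 := by
        intro p hp p' hp' hN hpp
        by_contra hc
        apply hN
        have h3 := ((h.node p'.1 (hE p' hp').1 (hE p' hp').2.1).of_suf (hs p' hp') (he p' hp').le)
        have h4 := (hs p' hp').2.1
        have h5 := (hs p hp).2.1
        refine Nd.pred' (d := len p'.1 - (len p.1 + 1)) ?_
        rwa [show len p.1 + 1 + (len p'.1 - (len p.1 + 1)) = len p'.1 by omega,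
          show e p + 1 + (len p'.1 - (len p.1 + 1)) = e p' by omega]
      simp only at hpp
      have hl : len p.1 = len p'.1 :=
        le_antisymm (aux p' hp' p hp hN' hpp.symm) (aux p hp p' hp' hN hpp)
      have h4 := (hs p' hp').2.1
      have h5 := (hs p hp).2.1
      have hee : e p = e p' := by omega
      have h7 := h.inj p.1 p'.1 (hE p hp).1 (hE p hp).2.1 (hE p' hp').1 (hE p' hp').2.1 hl
        ((hs p hp).trans (hee ▸ (hl ▸ (hs p' hp').symm)))
      exact Prod.ext h7 (by rw [← hw p hp, ← hw p' hp', hee])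
  have hAB : A.card + B.card = E.card := Finset.card_filter_add_card_filter_not _
  simp only [Nat.card_Icc, Finset.card_range] at hA hB
  omega

/-- The word of length `l` that ends at the first occurrence of `v` occurs exactly where `v`
does, and it agrees with the word `u` from position `b` on. -/
structure InMatch (w : ℕ → ℕ) (n k : ℕ) (len fp : ℕ → ℕ) (u : ℕ → ℕ) (b v l : ℕ) : Prop where
  pos : 1 ≤ v
  le : v ≤ k
  le_len : l ≤ len v
  ext : ∀ e ≤ n, Suf w l (fp v) e → Suf w (len v) (fp v) e
  eq : ∀ i < l, w (fp v - l + i) = u (b + i)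

variable {u : ℕ → ℕ} {b v l : ℕ}

theorem Sam.inMatch_one (h : Sam w G n k len fp link δ) : InMatch w n k len fp u b 1 0 :=
  ⟨le_rfl, h.k_pos, Nat.zero_le _, fun e _ _ => by rw [h.root]; exact Suf.zero,
    fun _ h => by omega⟩

theorem suf_of_starts {x y l : ℕ} (h : ∀ i < l, w (x + i) = w (y + i)) :
    Suf w l (x + l) (y + l) :=
  ⟨by omega, by omega, fun i hi => by
    have := h (l - 1 - i) (by omega)
    rwa [show x + l - 1 - i = x + (l - 1 - i) by omega,
      show y + l - 1 - i = y + (l - 1 - i) by omega]⟩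

theorem Sam.inMatch_suf (h : Sam w G n k len fp link δ) (hM : InMatch w n k len fp u b v l)
    {s : ℕ} (hs : s + l ≤ n) (hw : ∀ i < l, w (s + i) = u (b + i)) :
    Suf w (len v) (fp v) (s + l) := by
  have h1 := h.len_le_fp hM.pos hM.le
  have h2 := hM.le_len
  refine hM.ext _ hs ?_
  have := suf_of_starts (w := w) (x := fp v - l) (y := s) (l := l) fun i hi => by
    rw [hM.eq i hi, hw i hi]
  rwa [Nat.sub_add_cancel (by omega)] at this

/-- Any occurrence of the matched word is one of the state as well, and `fp` is the smallest end
position of the state. -/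
theorem Sam.inMatch_min (h : Sam w G n k len fp link δ) (hM : InMatch w n k len fp u b v l)
    {s : ℕ} (hs : s + l ≤ n) (hw : ∀ i < l, w (s + i) = u (b + i)) : fp v - l ≤ s := by
  have := h.min v hM.pos hM.le _ hs (h.inMatch_suf hM hs hw)
  omega

/-- The state may be longer than the matched word, but the two have the same occurrences, so a
missing transition rules out every continuation of the match. -/
theorem Sam.inMatch_stop (h : Sam w G n k len fp link δ) (hM : InMatch w n k len fp u b v l)
    (hG : G (u (b + l))) (h0 : δ v (u (b + l)) = 0) {s : ℕ} (hs : s + (l + 1) ≤ n) :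
    ¬ ∀ i < l + 1, w (s + i) = u (b + i) := fun hw =>
  h.t_zero v _ hM.pos hM.le hG h0 (s + l) (by omega)
    (h.inMatch_suf hM (by omega) fun i hi => hw i (by omega)) (hw l (by omega))

/-- An occurrence of the extended match is an occurrence of the old state followed by the letter, so
the target ends there. One actual occurrence transfers the matched letters to the first occurrence
of the target. -/
theorem Sam.inMatch_succ (h : Sam w G n k len fp link δ) (hM : InMatch w n k len fp u b v l)
    (hG : G (u (b + l))) (h0 : δ v (u (b + l)) ≠ 0) :
    InMatch w n k len fp u b (δ v (u (b + l))) (l + 1) := by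
  have h1 := hM.pos
  have h2 := hM.le
  obtain ⟨e, he, h3, h4⟩ := h.t_occ v _ h1 h2 hG h0
  have h5 := h.t_ext v _ h1 h2 hG h0 e he h3 h4
  have h6 := h.t_len v _ h1 h2 hG h0
  have h7 := hM.le_len
  have h8 : Suf w (l + 1) (fp (δ v (u (b + l)))) (e + 1) := h5.mono (by omega)
  have h9 := h8.1
  obtain ⟨f, hf⟩ : ∃ f, fp (δ v (u (b + l))) = f + 1 := ⟨_, (Nat.sub_add_cancel (by omega)).symm⟩
  refine ⟨by omega, h.t_le v _ h1 h2 hG, by omega, fun g hg hs => ?_, fun i hi => ?_⟩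
  · obtain ⟨g, rfl, h10, h11⟩ := (h8.symm.trans hs).exists_pred
    exact h.t_ext v _ h1 h2 hG h0 g (by omega) (hM.ext g (by omega) ((h3.mono h7).trans h11))
      (by rw [← h10, h4])
  · rw [hf] at h8 ⊢
    obtain ⟨h10, h11⟩ := suf_succ.1 h8
    have h13 := h11.1
    rcases Nat.lt_succ_iff_lt_or_eq.1 hi with hi | rfl
    · have h12 := ((h3.mono h7).trans h11.symm)
      have h14 := h12.2.2 (l - 1 - i) (by omega)
      have h15 := h12.1
      rw [show f + 1 - (l + 1) + i = f - 1 - (l - 1 - i) by omega, ← h14, ← hM.eq i hi]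
      congr 1
      omega
    · rw [show f + 1 - (i + 1) + i = f by omega, h10, h4]

end


/-! ### Transitions in digital search trees -/

theorem Dst.of_up {d : ℕ} {f : Fr} {t : Tr} (h : Dst d (f.up t)) : Dst (d + 1) t := by
  unfold Fr.up at h
  split_ifs at h
  exacts [h.2.2.2, h.2.2.1]

theorem Dst.of_plug {fs : List Fr} {t : Tr} (h : Dst 0 (plug fs t)) : Dst fs.length t := by
  induction fs generalizing t with
  | nil => exact h
  | cons f fs ih => exact (ih h).of_up

/-- A key can be found only below the end of its path. -/
theorem Dst.mem_of_path {fs : List Fr} {t : Tr} {c x : ℕ} (h : Dst 0 (plug fs t)) (hp : Path c fs)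
    (hk : ∀ f ∈ fs, f.k ≠ c) (hx : (x, c) ∈ (plug fs t).ents) : (x, c) ∈ t.ents := by
  induction fs generalizing t with
  | nil => exact hx
  | cons f fs ih =>
    have h1 := ih h hp.2 (fun g hg => hk g (by simp [hg])) hx
    have h2 : Dst fs.length (f.up t) := Dst.of_plug (t := f.up t) h
    have h3 := hp.1
    have h4 : c ≠ f.k := fun he => hk f (by simp) he.symm
    unfold Fr.up at h1 h2
    split_ifs at h1 h2 with hd
    · simp only [Tr.ents, List.mem_append, List.mem_cons, Prod.mk.injEq, h4, and_false,
        false_or] at h1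
      rw [hd] at h3
      rcases h1 with h1 | h1
      · have := h2.1 _ h1
        simp [this] at h3
      · exact h1
    · simp only [Tr.ents, List.mem_append, List.mem_cons, Prod.mk.injEq, h4, and_false,
        false_or] at h1
      rcases h1 with h1 | h1
      · exact h1
      · have := h2.2.1 _ h1
        simp [this] at h3
        exact absurd h3 hd

theorem Keep.tick {α : Type u} {vs : List Var} {as : List Arr} {s s' : VS α}
    (h : Keep vs as s s') : Keep vs as s s'.tick := ⟨h.r, h.m, h.text, h.rest, h.out⟩

/-- Hanging a leaf below the innermost frame changes one child pointer of one node, and this node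
appears nowhere else in the context. -/
theorem FRep.attach {L R V L' R' V' : ℕ → ℕ} {f : Fr} {fs : List Fr} {c e : ℕ}
    (h : FRep L R V (f :: fs) c) (hn : (preI (f :: fs) ++ postI (f :: fs)).Nodup)
    (hc : ∀ x ∈ preI (f :: fs) ++ postI (f :: fs), (x ≠ f.x → L' x = L x ∧ R' x = R x) ∧ V' x = V x)
    (hd : if f.dir then L' f.x = L f.x ∧ R' f.x = e else L' f.x = e ∧ R' f.x = R f.x) :
    FRep L' R' V' (f :: fs) e := by
  obtain ⟨h0, h1, h2, h3, h4⟩ := h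
  have e1 : preI (f :: fs) = if f.dir then preI fs ++ (f.o.ids ++ [f.x]) else preI fs := by
    rw [preI, pre]; split_ifs <;> simp [preI, Tr.ids]
  have e2 : postI (f :: fs) = if f.dir then postI fs else f.x :: f.o.ids ++ postI fs := by
    rw [postI, post]; split_ifs <;> simp [postI, Tr.ids]
  rw [e1, e2] at hn hc
  have hmem : ∀ x, (x ∈ preI fs ++ postI fs ∨ x ∈ f.o.ids) → L' x = L x ∧ R' x = R x ∧ V' x = V x := by
    intro x hx
    have hx' : x ≠ f.x := by
      rintro rfl
      split_ifs at hn <;> grind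
    have := hc x (by split_ifs <;> grind)
    exact ⟨(this.1 hx').1, (this.1 hx').2, this.2⟩
  have hx := hc f.x (by split_ifs <;> grind)
  refine ⟨h0, ?_, by rw [hx.2, h2], h3.congr fun p hp => hmem p.1 (.inr (Tr.fst_mem_ids hp)),
    h4.congrI fun x hx => hmem x (.inl hx)⟩
  split_ifs at hd h1 ⊢
  exacts [⟨hd.1.trans h1.1, hd.2⟩, ⟨hd.1, hd.2.trans h1.2⟩]

/-- `l` is the linked list that starts at `h`. -/
def LL (nx : ℕ → ℕ) : ℕ → List ℕ → Prop
  | h, [] => h = 0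
  | h, x :: l => h = x ∧ x ≠ 0 ∧ LL nx (nx x) l

theorem LL.congr {nx nx' : ℕ → ℕ} {h : ℕ} {l : List ℕ} (hl : LL nx h l)
    (hc : ∀ x ∈ l, nx' x = nx x) : LL nx' h l := by
  induction l generalizing h with
  | nil => exact hl
  | cons x l ih =>
    exact ⟨hl.1, hl.2.1, by rw [hc x (by simp)]; exact ih hl.2.2 fun y hy => hc y (by simp [hy])⟩

/-- The transitions `δ` of the states `1, ..., k` are stored in digital search trees. -/
structure ETab {α : Type u} (B k : ℕ) (δ : ℕ → ℕ → ℕ) (tab : ℕ → Tr) (s : VS α) : Prop where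
  rep : ∀ v, 1 ≤ v → v ≤ k → (tab v).Rep (s.m .eL) (s.m .eR) (s.m .ek)
  root : ∀ v, 1 ≤ v → v ≤ k → s.m .tr v = (tab v).root
  dst : ∀ v, 1 ≤ v → v ≤ k → Dst 0 (tab v)
  ent : ∀ v, 1 ≤ v → v ≤ k → ∀ p ∈ (tab v).ents, 1 ≤ p.1 ∧ p.1 ≤ s.r .ec ∧ p.2 < 2 ^ B ∧
    s.m .et p.1 = δ v p.2 ∧ δ v p.2 ≠ 0
  nodup : ∀ v, 1 ≤ v → v ≤ k → (tab v).ids.Nodup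
  keys : ∀ v, 1 ≤ v → v ≤ k → ((tab v).ents.map Prod.snd).Nodup
  disj : ∀ u v x, 1 ≤ u → u ≤ k → 1 ≤ v → v ≤ k → x ∈ (tab u).ids → x ∈ (tab v).ids → u = v
  all : ∀ v c, 1 ≤ v → v ≤ k → c < 2 ^ B → δ v c ≠ 0 → ∃ x, (x, c) ∈ (tab v).ents
  own : ∀ x, 1 ≤ x → x ≤ s.r .ec → ∃ v, 1 ≤ v ∧ v ≤ k ∧ x ∈ (tab v).ids
  list : ∀ v, 1 ≤ v → v ≤ k → ∃ l, LL (s.m .enx) (s.m .head v) l ∧ l.Nodup ∧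
    ∀ x, x ∈ l ↔ x ∈ (tab v).ids

/-- The arrays and variables in which the transitions are stored. -/
def edgeArrs : List Arr := [.ek, .et, .eL, .eR, .enx, .tr, .head]

section
variable {α : Type u} [LinearOrder α] {N B k : ℕ} {δ : ℕ → ℕ → ℕ} {tab : ℕ → Tr} {s s' : VS α}

theorem ETab.congr (h : ETab B k δ tab s) (hm : ∀ a ∈ edgeArrs, s'.m a = s.m a)
    (hr : s'.r .ec = s.r .ec) : ETab B k δ tab s' := by
  simp only [edgeArrs, List.mem_cons, List.not_mem_nil, or_false, forall_eq_or_imp,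
    forall_eq] at hm
  obtain ⟨h1, h2, h3, h4, h5, h6, h7⟩ := hm
  obtain ⟨a1, a2, a3, a4, a5, a6, a7, a8, a9, a10⟩ := h
  constructor
  · rw [h1, h3, h4]; exact a1
  · rw [h6]; exact a2
  · exact a3
  · rw [h2, hr]; exact a4
  · exact a5
  · exact a6
  · exact a7
  · exact a8
  · rw [hr]; exact a9
  · rw [h5, h7]; exact a10

theorem ETab.height_le (h : ETab B k δ tab s) {v : ℕ} (h1 : 1 ≤ v) (h2 : v ≤ k) :
    (tab v).height ≤ B + 1 := by
  have := (h.dst v h1 h2).height_le (B := B) (ρ := 0) (Nat.zero_le _)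
    (fun p _ => by rw [pow_zero, Nat.mod_one]) (fun p hp => (h.ent v h1 h2 p hp).2.2.1)
    (h.keys v h1 h2)
  omega

theorem ETab.label (h : ETab B k δ tab s) {v x : ℕ} (h1 : 1 ≤ v) (h2 : v ≤ k)
    (hx : x ∈ (tab v).ids) : (x, s.m .ek x) ∈ (tab v).ents := by
  obtain ⟨p, hp, rfl⟩ := List.mem_map.1 hx
  rw [(h.rep v h1 h2).label p hp]
  exact hp

/-- The number of stored transitions. -/
theorem ETab.exists_finset (h : ETab B k δ tab s) : ∃ E : Finset (ℕ × ℕ), E.card = s.r .ec ∧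
    ∀ p ∈ E, 1 ≤ p.1 ∧ p.1 ≤ k ∧ p.2 < 2 ^ B ∧ δ p.1 p.2 ≠ 0 := by
  classical
  choose! f hf1 hf2 hf3 using h.own
  refine ⟨(Finset.Icc 1 (s.r .ec)).image fun x => (f x, s.m .ek x), ?_, ?_⟩
  · rw [Finset.card_image_of_injOn, Nat.card_Icc, Nat.add_sub_cancel]
    intro x hx y hy hxy
    simp only [Finset.coe_Icc, Set.mem_Icc, Prod.mk.injEq] at hx hy hxy
    have a1 := h.label (hf1 x hx.1 hx.2) (hf2 x hx.1 hx.2) (hf3 x hx.1 hx.2)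
    have a2 := h.label (hf1 y hy.1 hy.2) (hf2 y hy.1 hy.2) (hf3 y hy.1 hy.2)
    rw [hxy.1, hxy.2] at a1
    have := List.inj_on_of_nodup_map (h.keys _ (hf1 y hy.1 hy.2) (hf2 y hy.1 hy.2)) a1 a2 rfl
    exact congrArg Prod.fst this
  · intro p hp
    simp only [Finset.mem_image, Finset.mem_Icc] at hp
    obtain ⟨x, hx, rfl⟩ := hp
    have a1 := hf1 x hx.1 hx.2
    have a2 := hf2 x hx.1 hx.2
    have a3 := h.ent _ a1 a2 _ (h.label a1 a2 (hf3 x hx.1 hx.2))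
    exact ⟨a1, a2, a3.2.2.1, a3.2.2.2.2⟩

/-- Look up the transition of the state in `v` by the letter in `c`. -/
def findE : Cmd :=
  .x ::= .get .tr .v ;; .kk ::= .off .c 0 ;; .y ::= .num 0 ;; .sd ::= .num 0 ;; .res ::= .num 0 ;;
  .while (.pos .x) (
    .kx ::= .get .ek .x ;;
    .ite (.eq .kx .c) (.res ::= .off .x 0 ;; .x ::= .num 0)
      (.y ::= .off .x 0 ;; .sd ::= .get .pr .kk ;; .kk ::= .get .hf .kk ;;
        .ite (.pos .sd) (.x ::= .get .eR .x) (.x ::= .get .eL .x)))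

/-- The variables `y` and `sd` describe the place of a new leaf. -/
def Place (y sd : ℕ) : List Fr → Prop
  | [] => y = 0
  | f :: _ => y = f.x ∧ sd = if f.dir then 1 else 0

/-- At depth `d` the variable `kk` holds `c / 2 ^ d`, advanced by table look-up; all these quotients
are at most `c`, so the tables need to be correct only up to there. On failure `y` and `sd` keep the
parent and the side of the missing leaf for a subsequent insertion. -/
theorem ETab.wp_findE (h : ETab B k δ tab s) {v c : ℕ} (hv : s.r .v = v) (hc : s.r .c = c)
    (h1 : 1 ≤ v) (h2 : v ≤ k) (hhf : ∀ k ≤ c, s.m .hf k = k / 2) (hpr : ∀ k ≤ c, s.m .pr k = k % 2) :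
    wp N findE s fun s' => Keep [.x, .kk, .y, .sd, .res, .kx] [] s s' ∧
      (s'.r .res ≠ 0 → (s'.r .res, c) ∈ (tab v).ents) ∧
      (s'.r .res = 0 → (∀ x, (x, c) ∉ (tab v).ents) ∧
        ∃ fs, tab v = plug fs .nil ∧ Path c fs ∧ Place (s'.r .y) (s'.r .sd) fs) ∧
      s'.clk ≤ s.clk + 12 * (B + 2) := by
  have hh := h.height_le h1 h2
  have hdst := h.dst v h1 h2
  have hrep := h.rep v h1 h2
  have main : ∀ s2 : VS α, Keep [.x, .kk, .y, .sd, .res, .kx] [] s s2 →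
      s2.r .x = (tab v).root → s2.r .kk = c → s2.r .y = 0 → s2.r .res = 0 → s2.clk = s.clk + 5 →
      wp N (.while (.pos .x) (
        .kx ::= .get .ek .x ;;
        .ite (.eq .kx .c) (.res ::= .off .x 0 ;; .x ::= .num 0)
          (.y ::= .off .x 0 ;; .sd ::= .get .pr .kk ;; .kk ::= .get .hf .kk ;;
            .ite (.pos .sd) (.x ::= .get .eR .x) (.x ::= .get .eL .x)))) s2
      fun s' => Keep [.x, .kk, .y, .sd, .res, .kx] [] s s' ∧
      (s'.r .res ≠ 0 → (s'.r .res, c) ∈ (tab v).ents) ∧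
      (s'.r .res = 0 → (∀ x, (x, c) ∉ (tab v).ents) ∧
        ∃ fs, tab v = plug fs .nil ∧ Path c fs ∧ Place (s'.r .y) (s'.r .sd) fs) ∧
      s'.clk ≤ s.clk + 12 * (B + 2) := by
    intro s2 hk2 hx2 hkk2 hy2 hres2 hclk2
    obtain ⟨I, hI⟩ : ∃ I : VS α → Prop, I = fun s' => Keep [.x, .kk, .y, .sd, .res, .kx] [] s s' ∧
        ((∃ fs t, tab v = plug fs t ∧ s'.r .x = t.root ∧ Path c fs ∧ s'.r .kk = c / 2 ^ fs.length ∧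
          Place (s'.r .y) (s'.r .sd) fs ∧ s'.r .res = 0 ∧ (∀ f ∈ fs, f.k ≠ c) ∧
          s'.clk + 10 * t.height ≤ s.clk + 5 + 10 * (B + 1)) ∨
          (s'.r .x = 0 ∧ s'.r .res ≠ 0 ∧ (s'.r .res, c) ∈ (tab v).ents ∧
          s'.clk ≤ s.clk + 5 + 10 * (B + 1))) := ⟨_, rfl⟩
    -- The invariant bounds the clock by a fixed budget, so what remains of the budget is a
    -- decreasing measure.
    refine wp_while I (fun s' => s.clk + 5 + 10 * (B + 1) - s'.clk) ?_ ?_ ?_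
    · rw [hI]
      exact ⟨hk2, .inl ⟨[], tab v, rfl, hx2, trivial, by simp [hkk2], hy2, hres2, by simp,
        by omega⟩⟩
    · intro s3 h3 hpos
      rw [hI] at h3
      obtain ⟨hk3, hor⟩ := h3
      simp only [Tst.Holds] at hpos
      rcases hor with ⟨fs, t, htab, hx3, hp3, hkk3, hpl3, hres3, hne3, hclk⟩ | ⟨h0, -⟩
      swap
      · omega
      cases t with
      | nil => simp at hx3; omega
      | node l x key r =>
      rw [Tr.root_node] at hx3
      have hrep' := hrep
      rw [htab, rep_plug] at hrep'
      obtain ⟨⟨hx0, hL, hR, hV, -, -⟩, -⟩ := hrep'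
      have hle : c / 2 ^ fs.length ≤ c := Nat.div_le_self _ _
      have hc3 : s3.r .c = c := by rw [hk3.r _ (by decide), hc]
      have hm3 : ∀ a, s3.m a = s.m a := fun a => hk3.m a (by simp)
      have ht3 : s3.text = s.text := hk3.text
      have hre3 : s3.rest = s.rest := hk3.rest
      have ho3 : s3.out = s.out := hk3.out
      simp only [Tr.height] at hclk
      have hkeep : ∀ s4 : VS α, Keep [.x, .kk, .y, .sd, .res, .kx] [] s3 s4 →
        Keep [.x, .kk, .y, .sd, .res, .kx] [] s s4 := fun s4 h4 => hk3.trans h4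
      simp [wp_seq, wp_asg, wp_put, wp_ite, Ex.Bd, Ex.eval, Tst.Holds, hx3, hm3, hV, hc3, hkk3,
        hhf _ hle, hpr _ hle, hL, hR]
      constructor
      · intro hkc
        constructor
        · rw [hI]
          refine ⟨hkeep _ ⟨fun z hz => ?_, fun a ha => ?_, rfl, rfl, rfl⟩, .inr ⟨?_, ?_, ?_, ?_⟩⟩
          · simp at hz; simp [hz]
          · simp
          · simp
          · simp [hx0]
          · simp [htab, ents_plug, Tr.ents, hkc]
          · simp; omega
        · omega
      · intro hkc
        constructor
        · intro hbit
          have hbit' : c / 2 ^ fs.length % 2 = 1 := by omega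
          constructor
          · rw [hI]
            refine ⟨hkeep _ ⟨fun z hz => ?_, fun a ha => ?_, rfl, rfl, rfl⟩,
              .inl ⟨⟨true, x, key, l⟩ :: fs, r, ?_, ?_, ?_, ?_, ?_, ?_, ?_, ?_⟩⟩
            · simp at hz; simp [hz]
            · simp
            · rw [htab]; rfl
            · simp
            · exact ⟨by simp [hbit'], hp3⟩
            · simp [pow_succ, Nat.div_div_eq_div_mul]
            · simp [Place, hbit']
            · simp [hres3]
            · simpa [hkc] using hne3
            · simp; omega
          · omega
        · intro hbit
          constructor
          · rw [hI]
            refine ⟨hkeep _ ⟨fun z hz => ?_, fun a ha => ?_, rfl, rfl, rfl⟩,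
              .inl ⟨⟨false, x, key, r⟩ :: fs, l, ?_, ?_, ?_, ?_, ?_, ?_, ?_, ?_⟩⟩
            · simp at hz; simp [hz]
            · simp
            · rw [htab]; rfl
            · simp
            · exact ⟨by simp [hbit], hp3⟩
            · simp [pow_succ, Nat.div_div_eq_div_mul]
            · simp [Place, hbit]
            · simp [hres3]
            · simpa [hkc] using hne3
            · simp; omega
          · omega
    · intro s3 h3 hpos
      rw [hI] at h3
      obtain ⟨hk3, hor⟩ := h3
      simp only [Tst.Holds, Nat.not_lt, Nat.le_zero] at hpos
      refine ⟨hk3.tick, ?_⟩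
      rcases hor with ⟨fs, t, htab, hx3, hp3, hkk3, hpl3, hres3, hne3, hclk⟩ | ⟨h0, h1, h2, h3⟩
      · have hrep' := hrep
        rw [htab, rep_plug] at hrep'
        obtain rfl := hrep'.1.root_eq_zero (by omega)
        refine ⟨fun h => absurd hres3 h, fun _ => ⟨fun x hx => ?_, fs, htab, hp3, hpl3⟩, ?_⟩
        -- No key on the path equals `c`, so the digital order would force an entry for `c` into the
        -- empty subtree.
        · rw [htab] at hx hdst
          simpa [Tr.ents] using hdst.mem_of_path hp3 hne3 hx
        · simp [Tr.height] at hclk ⊢; omega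
      · exact ⟨fun _ => h2, fun h => absurd h h1, by simp; omega⟩
  unfold findE
  simp [wp_seq, wp_asg, Ex.Bd, Ex.eval, hv, hc]
  refine main _ ?_ ?_ ?_ ?_ ?_ ?_
  · refine ⟨fun z hz => ?_, fun a ha => ?_, rfl, rfl, rfl⟩
    · simp at hz; simp [hz]
    · simp
  all_goals simp [h.root v h1 h2]

/-- Store a transition from the state in `v` by the letter in `c` to the state in `tgt`, at the place
found by the search. -/
def insertE : Cmd :=
  .ec ::= .off .ec 1 ;; .put .ek .ec .c ;; .put .et .ec .tgt ;; .x ::= .num 0 ;;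
  .put .eL .ec .x ;; .put .eR .ec .x ;; .x ::= .get .head .v ;; .put .enx .ec .x ;;
  .put .head .v .ec ;;
  .ite (.pos .y) (.ite (.pos .sd) (.put .eR .y .ec) (.put .eL .y .ec)) (.put .tr .v .ec)

/-- Only the effect on the arrays is assumed, so that the three cases of `insertE` (new root, left
leaf, right leaf) share one argument. -/
theorem ETab.insert (h : ETab B k δ tab s) {v c t : ℕ} {fs : List Fr} (ht0 : t ≠ 0)
    (h1 : 1 ≤ v) (h2 : v ≤ k) (hcB : c < 2 ^ B) (hδ : δ v c = 0)
    (hfs : tab v = plug fs .nil) (hp : Path c fs)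
    (hec : s'.r .ec = s.r .ec + 1)
    (hek : s'.m .ek = Function.update (s.m .ek) (s.r .ec + 1) c)
    (het : s'.m .et = Function.update (s.m .et) (s.r .ec + 1) t)
    (henx : s'.m .enx = Function.update (s.m .enx) (s.r .ec + 1) (s.m .head v))
    (hhead : s'.m .head = Function.update (s.m .head) v (s.r .ec + 1))
    (hL : ∀ x ≤ s.r .ec, x ≠ s.r .y ∨ fs = [] → s'.m .eL x = s.m .eL x)
    (hR : ∀ x ≤ s.r .ec, x ≠ s.r .y ∨ fs = [] → s'.m .eR x = s.m .eR x)
    (hL0 : s'.m .eL (s.r .ec + 1) = 0) (hR0 : s'.m .eR (s.r .ec + 1) = 0)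
    (htr : ∀ u, (u ≠ v ∨ fs ≠ []) → s'.m .tr u = s.m .tr u)
    (htrv : fs = [] → s'.m .tr v = s.r .ec + 1)
    (hat : ∀ f gs, fs = f :: gs → s.r .y = f.x ∧
      if f.dir then s'.m .eL f.x = s.m .eL f.x ∧ s'.m .eR f.x = s.r .ec + 1
      else s'.m .eL f.x = s.r .ec + 1 ∧ s'.m .eR f.x = s.m .eR f.x) :
    ETab B k (Function.update δ v (Function.update (δ v) c t))
        (Function.update tab v (plug fs (.node .nil (s.r .ec + 1) c .nil))) s' := by
  generalize he : s.r .ec + 1 = e at *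
  have hle : ∀ u, 1 ≤ u → u ≤ k → ∀ x ∈ (tab u).ids, 1 ≤ x ∧ x < e := by
    intro u hu1 hu2 x hx
    obtain ⟨p, hp, rfl⟩ := List.mem_map.1 hx
    have := h.ent u hu1 hu2 p hp
    omega
  have hids : ∀ x, x ∈ (plug fs (.node .nil e c .nil)).ids ↔ x = e ∨ x ∈ (tab v).ids := by
    intro x; rw [hfs, ids_plug, ids_plug]; simp; tauto
  have hents : ∀ p, p ∈ (plug fs (.node .nil e c .nil)).ents ↔ p = (e, c) ∨ p ∈ (tab v).ents := by
    intro x; rw [hfs, ents_plug, ents_plug]; simp [Tr.ents]; tauto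
  have hnoc : ∀ x, (x, c) ∉ (tab v).ents := fun x hx => (h.ent v h1 h2 _ hx).2.2.2.2 hδ
  -- Trees of different states are disjoint, so the changed pointer at `y` belongs to none of the
  -- others.
  have hy : ∀ u, 1 ≤ u → u ≤ k → u ≠ v → ∀ x ∈ (tab u).ids, x ≠ s.r .y ∨ fs = [] := by
    intro u hu1 hu2 hne x hx
    rcases fs with _ | ⟨f, gs⟩
    · exact .inr rfl
    · left
      rintro rfl
      obtain ⟨hf, -⟩ := hat f gs rfl
      refine hne (h.disj u v _ hu1 hu2 h1 h2 hx ?_)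
      rw [hfs, ids_plug, hf]
      simp only [preI, postI, pre, post]
      split_ifs <;> simp
  have hepos : e ≠ 0 := by omega
  constructor
  · intro u hu1 hu2
    by_cases huv : u = v
    · subst huv
      rw [Function.update_self, rep_plug]
      have hrep := h.rep u hu1 hu2
      rw [hfs, rep_plug] at hrep
      refine ⟨⟨hepos, by rw [hL0]; rfl, by rw [hR0]; rfl, by simp [hek], trivial, trivial⟩, ?_⟩
      have hnd := h.nodup u hu1 hu2
      have hle' := hle u hu1 hu2
      rw [hfs, ids_plug] at hnd hle'
      simp only [Tr.ids_nil, List.append_nil] at hnd hle'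
      rcases fs with _ | ⟨f, gs⟩
      · trivial
      obtain ⟨hf, hd⟩ := hat f gs rfl
      refine hrep.2.attach hnd (fun x hx => ?_) hd
      have := hle' x hx
      exact ⟨fun hne => ⟨hL x (by omega) (.inl (hf ▸ hne)), hR x (by omega) (.inl (hf ▸ hne))⟩,
        by rw [hek, Function.update_of_ne (by omega)]⟩
    · rw [Function.update_of_ne huv]
      refine (h.rep u hu1 hu2).congr fun p hp => ?_
      have hx := Tr.fst_mem_ids hp
      have := hle u hu1 hu2 _ hx
      have hyy := hy u hu1 hu2 huv _ hx
      exact ⟨hL _ (by omega) hyy, hR _ (by omega) hyy, by rw [hek, Function.update_of_ne (by omega)]⟩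
  · intro u hu1 hu2
    by_cases huv : u = v
    · subst huv
      rw [Function.update_self]
      rcases fs with _ | ⟨f, gs⟩
      · rw [htrv rfl]; rfl
      · rw [htr u (.inr (by simp)), h.root u hu1 hu2, hfs]
        -- With at least one frame the root does not depend on the subtree in focus.
        have : ∀ (t t' : Tr) (f : Fr) (gs : List Fr), (plug (f :: gs) t).root = (plug (f :: gs) t').root := by
          intro t t' f gs
          induction gs generalizing t t' f with
          | nil => simp only [plug, Fr.up]; split_ifs <;> simp
          | cons g gs ih => exact ih _ _ g
        exact this _ _ f gs
    · rw [Function.update_of_ne huv, htr u (.inl huv), h.root u hu1 hu2]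
  · intro u hu1 hu2
    by_cases huv : u = v
    · subst huv
      rw [Function.update_self]
      exact (hfs ▸ h.dst u hu1 hu2).insert hp
    · rw [Function.update_of_ne huv]; exact h.dst u hu1 hu2
  · intro u hu1 hu2 p hpu
    rw [hec]
    by_cases huv : u = v
    · subst huv
      rw [Function.update_self] at hpu ⊢
      rcases (hents p).1 hpu with rfl | hpu
      · simp only [Function.update_self, het]
        exact ⟨by omega, le_rfl, hcB, trivial, ht0⟩
      · have h3 := h.ent u hu1 hu2 p hpu
        have hne : p.2 ≠ c := fun hc => hnoc p.1 (by rw [← hc]; exact hpu)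
        rw [Function.update_of_ne hne, het, Function.update_of_ne (by omega)]
        exact ⟨h3.1, by omega, h3.2.2⟩
    · rw [Function.update_of_ne huv] at hpu ⊢
      have h3 := h.ent u hu1 hu2 p hpu
      rw [het, Function.update_of_ne (by omega)]
      exact ⟨h3.1, by omega, h3.2.2⟩
  · intro u hu1 hu2
    by_cases huv : u = v
    · subst huv
      rw [Function.update_self, ids_plug]
      have hnd := h.nodup u hu1 hu2
      have hnot : e ∉ (tab u).ids := fun hx => by have := hle u hu1 hu2 e hx; omega
      rw [hfs, ids_plug] at hnd hnot
      simp at hnd hnot ⊢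
      grind
    · rw [Function.update_of_ne huv]; exact h.nodup u hu1 hu2
  · intro u hu1 hu2
    by_cases huv : u = v
    · subst huv
      rw [Function.update_self, ents_plug]
      have hnd := h.keys u hu1 hu2
      have hnot : c ∉ (tab u).ents.map Prod.snd := fun hx => by
        obtain ⟨p, hpm, hpc⟩ := List.mem_map.1 hx
        exact hnoc p.1 (hpc ▸ hpm)
      rw [hfs, ents_plug] at hnd hnot
      simp only [Tr.ents, List.append_nil, List.map_append, List.nil_append, List.map_cons,
        List.map_nil] at hnd hnot ⊢
      grind
    · rw [Function.update_of_ne huv]; exact h.keys u hu1 hu2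
  · intro u v' x hu1 hu2 hv1 hv2 hxu hxv
    have key : ∀ u, 1 ≤ u → u ≤ k → x ∈ (Function.update tab v (plug fs (.node .nil e c .nil)) u).ids →
        (x = e ∧ u = v) ∨ (x ∈ (tab u).ids ∧ x ≠ e) := by
      intro u hu1 hu2 hx
      have h3 := hle u hu1 hu2 x
      by_cases huv : u = v
      · subst huv
        rw [Function.update_self, hids] at hx
        rcases hx with hx | hx
        · exact .inl ⟨hx, rfl⟩
        · have := h3 hx; exact .inr ⟨hx, by omega⟩
      · rw [Function.update_of_ne huv] at hx
        have := h3 hx; exact .inr ⟨hx, by omega⟩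
    rcases key u hu1 hu2 hxu with h3 | h3 <;> rcases key v' hv1 hv2 hxv with h4 | h4
    · rw [h3.2, h4.2]
    · exact absurd h3.1 h4.2
    · exact absurd h4.1 h3.2
    · exact h.disj u v' x hu1 hu2 hv1 hv2 h3.1 h4.1
  · intro u c' hu1 hu2 hc' h0
    by_cases huv : u = v
    · subst huv
      rw [Function.update_self] at h0 ⊢
      by_cases hcc : c' = c
      · subst hcc; exact ⟨e, (hents _).2 (.inl rfl)⟩
      · rw [Function.update_of_ne hcc] at h0
        obtain ⟨x, hx⟩ := h.all u c' hu1 hu2 hc' h0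
        exact ⟨x, (hents _).2 (.inr hx)⟩
    · rw [Function.update_of_ne huv] at h0 ⊢
      exact h.all u c' hu1 hu2 hc' h0
  · intro x hx1 hx2
    rw [hec] at hx2
    rcases hx2.eq_or_lt with rfl | hx2
    · exact ⟨v, h1, h2, by rw [Function.update_self, hids]; exact .inl rfl⟩
    · obtain ⟨u, hu1, hu2, hu3⟩ := h.own x hx1 (by omega)
      refine ⟨u, hu1, hu2, ?_⟩
      by_cases huv : u = v
      · subst huv; rw [Function.update_self, hids]; exact .inr hu3
      · rw [Function.update_of_ne huv]; exact hu3
  · intro u hu1 hu2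
    obtain ⟨l, hl1, hl2, hl3⟩ := h.list u hu1 hu2
    have hlt : ∀ x ∈ l, x < e := fun x hx => (hle u hu1 hu2 x ((hl3 x).1 hx)).2
    have hl4 : LL (s'.m .enx) (s.m .head u) l := hl1.congr fun x hx => by
      have := hlt x hx
      rw [henx, Function.update_of_ne (by omega)]
    by_cases huv : u = v
    · subst huv
      refine ⟨e :: l, ⟨by simp [hhead], hepos, by simpa [henx] using henx ▸ hl4⟩, ?_, fun x => ?_⟩
      · rw [List.nodup_cons]
        exact ⟨fun hx => by have := hlt e hx; omega, hl2⟩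
      · rw [Function.update_self, hids, List.mem_cons, hl3]
    · refine ⟨l, ?_, hl2, fun x => ?_⟩
      · rw [hhead, Function.update_of_ne huv]; exact hl4
      · rw [Function.update_of_ne huv]; exact hl3 x

/-- The statements that old edge cells and the other list heads are unchanged serve the copying
loop, which traverses one list while it adds edges to another state. -/
theorem ETab.wp_insertE (h : ETab B k δ tab s) {v c t : ℕ} {fs : List Fr} (hv : s.r .v = v)
    (hc : s.r .c = c) (ht : s.r .tgt = t) (ht0 : t ≠ 0)
    (h1 : 1 ≤ v) (h2 : v ≤ k) (hcB : c < 2 ^ B) (hδ : δ v c = 0)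
    (hfs : tab v = plug fs .nil) (hp : Path c fs) (hpl : Place (s.r .y) (s.r .sd) fs)
    (hN : s.r .ec + 1 ≤ N) :
    wp N insertE s fun s' => Keep [.ec, .x] edgeArrs s s' ∧ s'.r .ec = s.r .ec + 1 ∧
      ETab B k (Function.update δ v (Function.update (δ v) c t))
        (Function.update tab v (plug fs (.node .nil (s.r .ec + 1) c .nil))) s' ∧
      (∀ x ≤ s.r .ec, s'.m .ek x = s.m .ek x ∧ s'.m .et x = s.m .et x ∧
        s'.m .enx x = s.m .enx x) ∧
      (∀ u, u ≠ v → s'.m .head u = s.m .head u) ∧ s'.clk ≤ s.clk + 12 := by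
  have hy0 : ∀ f gs, fs = f :: gs → f.x ≠ 0 ∧ f.x ≤ s.r .ec ∧ s.r .y = f.x ∧
      s.r .sd = if f.dir then 1 else 0 := fun f gs hfg => by
    have hm : (f.x, f.k) ∈ (tab v).ents := by
      rw [hfs, ents_plug, hfg]
      simp only [pre, post]
      split_ifs <;> simp
    have := h.ent v h1 h2 _ hm
    rw [hfg] at hpl
    exact ⟨by omega, this.2.1, hpl⟩
  obtain ⟨Q, hQ⟩ : ∃ Q : VS α → Prop, Q = fun s' => Keep [.ec, .x] edgeArrs s s' ∧
      s'.r .ec = s.r .ec + 1 ∧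
      ETab B k (Function.update δ v (Function.update (δ v) c t))
        (Function.update tab v (plug fs (.node .nil (s.r .ec + 1) c .nil))) s' ∧
      (∀ x ≤ s.r .ec, s'.m .ek x = s.m .ek x ∧ s'.m .et x = s.m .et x ∧
        s'.m .enx x = s.m .enx x) ∧
      (∀ u, u ≠ v → s'.m .head u = s.m .head u) ∧ s'.clk ≤ s.clk + 12 := ⟨_, rfl⟩
  rw [← hQ]
  have upd : ∀ (f : ℕ → ℕ) (x z : ℕ), x ≤ s.r .ec → Function.update f (s.r .ec + 1) z x = f x :=
    fun f x z hx => Function.update_of_ne (by omega) _ _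
  unfold insertE
  simp [wp_seq, wp_asg, wp_put, wp_ite, Ex.Bd, Ex.eval, Tst.Holds, hN, hv, hc, ht]
  refine ⟨fun hy => ?_, fun hy => ?_⟩
  · rcases fs with _ | ⟨f, gs⟩
    · have : s.r .y = 0 := hpl
      omega
    obtain ⟨a1, a2, a3, a4⟩ := hy0 f gs rfl
    refine ⟨fun hsd => ?_, fun hsd => ?_⟩
    · have hd : f.dir = true := by
        by_contra hd; rw [a4, if_neg hd] at hsd; omega
      rw [hQ]
      refine ⟨⟨fun z hz => ?_, fun a ha => ?_, rfl, rfl, rfl⟩, ?_, h.insert ht0 h1 h2 hcB hδ hfs hp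
        ?_ ?_ ?_ ?_ ?_ ?_ ?_ ?_ ?_ ?_ ?_ ?_, ?_, ?_, ?_⟩
      · simp at hz; simp [hz]
      · simp [edgeArrs] at ha; simp [ha]
      any_goals simp
      · intro x hx hxy; simp [upd _ _ _ hx]
      · intro x hx hxy; simp [upd _ _ _ hx, hxy]
      · rw [Function.update_of_ne (by omega)]; simp
      · simp [hd, a3, upd _ _ _ a2]
      · intro x hx; simp [upd _ _ _ hx]
      · intro u hu; simp [hu]
    · have hd : f.dir = false := by
        by_contra hd; rw [a4, if_pos (by simpa using hd)] at hsd; omega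
      rw [hQ]
      refine ⟨⟨fun z hz => ?_, fun a ha => ?_, rfl, rfl, rfl⟩, ?_, h.insert ht0 h1 h2 hcB hδ hfs hp
        ?_ ?_ ?_ ?_ ?_ ?_ ?_ ?_ ?_ ?_ ?_ ?_, ?_, ?_, ?_⟩
      · simp at hz; simp [hz]
      · simp [edgeArrs] at ha; simp [ha]
      any_goals simp
      · intro x hx hxy; simp [upd _ _ _ hx, hxy]
      · intro x hx hxy; simp [upd _ _ _ hx]
      · rw [Function.update_of_ne (by omega)]; simp
      · simp [hd, a3, upd _ _ _ a2]
      · intro x hx; simp [upd _ _ _ hx]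
      · intro u hu; simp [hu]
  · rcases fs with _ | ⟨f, gs⟩
    · rw [hQ]
      refine ⟨⟨fun z hz => ?_, fun a ha => ?_, rfl, rfl, rfl⟩, ?_, h.insert ht0 h1 h2 hcB hδ hfs hp
        ?_ ?_ ?_ ?_ ?_ ?_ ?_ ?_ ?_ ?_ ?_ ?_, ?_, ?_, ?_⟩
      · simp at hz; simp [hz]
      · simp [edgeArrs] at ha; simp [ha]
      any_goals simp
      · intro x hx; simp [upd _ _ _ hx]
      · intro x hx; simp [upd _ _ _ hx]
      · intro u hu; simp [hu]
      · intro x hx; simp [upd _ _ _ hx]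
      · intro u hu; simp [hu]
    · obtain ⟨a1, a2, a3, a4⟩ := hy0 f gs rfl
      omega

/-- A new state without transitions. -/
theorem ETab.grow (h : ETab B k δ tab s) {δ' : ℕ → ℕ → ℕ}
    (hm : ∀ a ∈ edgeArrs, a ≠ .tr → a ≠ .head → s'.m a = s.m a)
    (htr : ∀ v ≤ k, s'.m .tr v = s.m .tr v) (hhead : ∀ v ≤ k, s'.m .head v = s.m .head v)
    (htr' : s'.m .tr (k + 1) = 0) (hhead' : s'.m .head (k + 1) = 0)
    (hr : s'.r .ec = s.r .ec) (hδ : ∀ v ≤ k, δ' v = δ v) (hδ' : ∀ c < 2 ^ B, δ' (k + 1) c = 0) :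
    ETab B (k + 1) δ' (Function.update tab (k + 1) .nil) s' := by
  have h1 := hm .ek (by decide) (by decide) (by decide)
  have h2 := hm .et (by decide) (by decide) (by decide)
  have h3 := hm .eL (by decide) (by decide) (by decide)
  have h4 := hm .eR (by decide) (by decide) (by decide)
  have h5 := hm .enx (by decide) (by decide) (by decide)
  have split : ∀ v, v ≤ k + 1 → v = k + 1 ∨ (v ≤ k ∧ v ≠ k + 1) := fun v hv => by omega
  constructor
  · intro v hv1 hv2
    rcases split v hv2 with rfl | ⟨hv, hne⟩
    · rw [Function.update_self]; trivial
    · rw [Function.update_of_ne hne, h1, h3, h4]; exact h.rep v hv1 hv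
  · intro v hv1 hv2
    rcases split v hv2 with rfl | ⟨hv, hne⟩
    · rw [Function.update_self]; exact htr'
    · rw [Function.update_of_ne hne, htr v hv]; exact h.root v hv1 hv
  · intro v hv1 hv2
    rcases split v hv2 with rfl | ⟨hv, hne⟩
    · rw [Function.update_self]; trivial
    · rw [Function.update_of_ne hne]; exact h.dst v hv1 hv
  · intro v hv1 hv2
    rcases split v hv2 with rfl | ⟨hv, hne⟩
    · rw [Function.update_self]; simp [Tr.ents]
    · rw [Function.update_of_ne hne, hr, hδ v hv, h2]; exact h.ent v hv1 hv
  · intro v hv1 hv2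
    rcases split v hv2 with rfl | ⟨hv, hne⟩
    · rw [Function.update_self]; simp
    · rw [Function.update_of_ne hne]; exact h.nodup v hv1 hv
  · intro v hv1 hv2
    rcases split v hv2 with rfl | ⟨hv, hne⟩
    · rw [Function.update_self]; simp [Tr.ents]
    · rw [Function.update_of_ne hne]; exact h.keys v hv1 hv
  · intro u v x hu1 hu2 hv1 hv2 hxu hxv
    rcases split v hv2 with rfl | ⟨hv, hne⟩
    · rw [Function.update_self] at hxv; simp at hxv
    rcases split u hu2 with rfl | ⟨hu, hne'⟩
    · rw [Function.update_self] at hxu; simp at hxu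
    rw [Function.update_of_ne hne] at hxv
    rw [Function.update_of_ne hne'] at hxu
    exact h.disj u v x hu1 hu hv1 hv hxu hxv
  · intro v c hv1 hv2 hc h0
    rcases split v hv2 with rfl | ⟨hv, hne⟩
    · exact absurd (hδ' c hc) h0
    · rw [Function.update_of_ne hne]
      rw [hδ v hv] at h0
      exact h.all v c hv1 hv hc h0
  · intro x hx1 hx2
    rw [hr] at hx2
    obtain ⟨v, hv1, hv2, hv3⟩ := h.own x hx1 hx2
    exact ⟨v, hv1, by omega, by rwa [Function.update_of_ne (by omega)]⟩
  · intro v hv1 hv2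
    rcases split v hv2 with rfl | ⟨hv, hne⟩
    · exact ⟨[], hhead', by simp, by simp⟩
    · rw [Function.update_of_ne hne, h5, hhead v hv]; exact h.list v hv1 hv

/-- Redirect a transition. -/
theorem ETab.redirect (h : ETab B k δ tab s) {v c x t : ℕ} (h1 : 1 ≤ v) (h2 : v ≤ k)
    (hx : (x, c) ∈ (tab v).ents) (ht : t ≠ 0) (het : s'.m .et = Function.update (s.m .et) x t)
    (hm : ∀ a ∈ edgeArrs, a ≠ .et → s'.m a = s.m a) (hr : s'.r .ec = s.r .ec) :
    ETab B k (Function.update δ v (Function.update (δ v) c t)) tab s' := by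
  have e1 := hm .ek (by decide) (by decide)
  have e3 := hm .eL (by decide) (by decide)
  have e4 := hm .eR (by decide) (by decide)
  have e5 := hm .enx (by decide) (by decide)
  have e6 := hm .tr (by decide) (by decide)
  have e7 := hm .head (by decide) (by decide)
  have hent := h.ent v h1 h2 _ hx
  constructor
  · rw [e1, e3, e4]; exact h.rep
  · rw [e6]; exact h.root
  · exact h.dst
  · intro u hu1 hu2 p hp
    have h3 := h.ent u hu1 hu2 p hp
    rw [hr, het]
    refine ⟨h3.1, h3.2.1, h3.2.2.1, ?_⟩
    by_cases huv : u = v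
    · subst huv
      rw [Function.update_self]
      by_cases hpc : p.2 = c
      · have : p = (x, c) := List.inj_on_of_nodup_map (h.keys u hu1 hu2) hp hx hpc
        subst this
        simp [ht]
      · rw [Function.update_of_ne hpc, Function.update_of_ne]
        · exact h3.2.2.2
        · intro hpx
          have h4 := List.inj_on_of_nodup_map (h.nodup u hu1 hu2) hp hx hpx
          exact hpc (by rw [h4])
    · rw [Function.update_of_ne huv, Function.update_of_ne]
      · exact h3.2.2.2
      · intro hpx
        exact huv (h.disj u v x hu1 hu2 h1 h2 (hpx ▸ Tr.fst_mem_ids hp) (Tr.fst_mem_ids hx))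
  · exact h.nodup
  · exact h.keys
  · exact h.disj
  · intro u c' hu1 hu2 hc' h0
    by_cases huv : u = v
    · subst huv
      rw [Function.update_self] at h0
      by_cases hcc : c' = c
      · subst hcc; exact ⟨x, hx⟩
      · rw [Function.update_of_ne hcc] at h0; exact h.all u c' hu1 hu2 hc' h0
    · rw [Function.update_of_ne huv] at h0; exact h.all u c' hu1 hu2 hc' h0
  · rw [hr]; exact h.own
  · rw [e5, e7]; exact h.list

end


/-! ### The loops of an extension -/

/-- The tables of halves and parities are correct up to `c`. -/
def HfOk {α : Type u} (s : VS α) (c : ℕ) : Prop :=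
  ∀ k ≤ c, s.m .hf k = k / 2 ∧ s.m .pr k = k % 2

theorem HfOk.congr {α : Type u} {s s' : VS α} {c : ℕ} (h : HfOk s c) (h1 : s'.m .hf = s.m .hf)
    (h2 : s'.m .pr = s.m .pr) : HfOk s' c := by
  intro k hk; rw [h1, h2]; exact h k hk

/-- The time for a constant number of searches in trees of height `B + 1`. -/
def tE (B : ℕ) : ℕ := 12 * (B + 2) + 30

section
variable {α : Type u} [LinearOrder α] {N B k : ℕ} {δ : ℕ → ℕ → ℕ} {tab : ℕ → Tr} {s s' : VS α}
variable {w : ℕ → ℕ} {n : ℕ} {len fp link : ℕ → ℕ}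

theorem ETab.find_ne (h : ETab B k δ tab s) {v c : ℕ} (h1 : 1 ≤ v) (h2 : v ≤ k) {x : ℕ}
    (hx : (x, c) ∈ (tab v).ents) : δ v c ≠ 0 ∧ s.m .et x = δ v c := by
  have := h.ent v h1 h2 _ hx
  exact ⟨this.2.2.2.2, this.2.2.2.1⟩

theorem ETab.find_zero (h : ETab B k δ tab s) {v c : ℕ} (h1 : 1 ≤ v) (h2 : v ≤ k)
    (hc : c < 2 ^ B) (hx : ∀ x, (x, c) ∉ (tab v).ents) : δ v c = 0 := by
  by_contra h0
  obtain ⟨x, hx'⟩ := h.all v c h1 h2 hc h0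
  exact hx x hx'

/-- Add transitions to the new state along the suffix path until a state has one. -/
def addLoop : Cmd :=
  .go ::= .num 1 ;;
  .while (.pos .go) (
    .v ::= .off .p 0 ;; findE ;;
    .ite (.pos .res) (.go ::= .num 0) (insertE ;; .p ::= .get .link .p ;; .go ::= .off .p 0))

/-- The transitions while the states of the chain of length at least `M` are processed. -/
def Added (w : ℕ → ℕ) (n k : ℕ) (len fp : ℕ → ℕ) (M t : ℕ) (δ δ' : ℕ → ℕ → ℕ) : Prop :=
  ∀ v c, v ≤ k → (c = w n → Chain w n k len fp v → M ≤ len v → δ' v c = t) ∧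
    (c ≠ w n ∨ ¬ Chain w n k len fp v ∨ len v < M → δ' v c = δ v c)

/-- Each added transition is followed by a step along a suffix link, so both the growth of `ec` and
the time are paid for by the decrease of the potential; one further search finds the state at which
the loop stops. The stored function `δ₀` may have rows beyond those of the automaton, since the new
state has already been created. -/
theorem wp_addLoop (h : Sam w (· < 2 ^ B) n k len fp link δ) (hG : w n < 2 ^ B) {t k' : ℕ}
    {δ₀ : ℕ → ℕ → ℕ} (hT : ETab B k' δ₀ tab s) (hkk : k ≤ k')
    (hδ : ∀ v ≤ k, δ₀ v = δ v) (hc : s.r .c = w n) (ht : s.r .tgt = t) (ht0 : t ≠ 0)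
    (hlink : ∀ v ≤ k, s.m .link v = link v) (hp : Chain w n k len fp (s.r .p))
    (hpl : len (s.r .p) = n) (hH : HfOk s (w n)) (hN1 : 1 ≤ N)
    (hN : s.r .ec + pot w n (n + 1) ≤ N) :
    wp N addLoop s fun s' => Keep [.go, .v, .p, .x, .kk, .y, .sd, .res, .kx, .ec] edgeArrs s s' ∧
      ∃ δ' tab', ETab B k' δ' tab' s' ∧
        Added w n k len fp (bnd len (s'.r .p)) t δ δ' ∧
        (∀ v, k < v → δ' v = δ₀ v) ∧
        (∀ v, Chain w n k len fp v → bnd len (s'.r .p) ≤ len v → δ v (w n) = 0) ∧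
        (s'.r .p ≠ 0 → Chain w n k len fp (s'.r .p) ∧
          (s'.r .res, w n) ∈ (tab' (s'.r .p)).ents) ∧
        (s.r .ec ≤ s'.r .ec ∧
          s'.r .ec + pot w n (bnd len (s'.r .p)) ≤ s.r .ec + pot w n (n + 1)) ∧
        s'.clk + tE B * pot w n (bnd len (s'.r .p)) ≤ s.clk + tE B * (pot w n (n + 1) + 1) := by
  obtain ⟨Q, hQ⟩ : ∃ Q : VS α → Prop, Q = fun s' =>
      Keep [.go, .v, .p, .x, .kk, .y, .sd, .res, .kx, .ec] edgeArrs s s' ∧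
      ∃ δ' tab', ETab B k' δ' tab' s' ∧
        Added w n k len fp (bnd len (s'.r .p)) t δ δ' ∧
        (∀ v, k < v → δ' v = δ₀ v) ∧
        (∀ v, Chain w n k len fp v → bnd len (s'.r .p) ≤ len v → δ v (w n) = 0) ∧
        (s'.r .p ≠ 0 → Chain w n k len fp (s'.r .p) ∧
          (s'.r .res, w n) ∈ (tab' (s'.r .p)).ents) ∧
        (s.r .ec ≤ s'.r .ec ∧
          s'.r .ec + pot w n (bnd len (s'.r .p)) ≤ s.r .ec + pot w n (n + 1)) ∧
        s'.clk + tE B * pot w n (bnd len (s'.r .p)) ≤ s.clk + tE B * (pot w n (n + 1) + 1) :=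
      ⟨_, rfl⟩
  rw [← hQ]
  obtain ⟨I, hI⟩ : ∃ I : VS α → Prop, I = fun s' =>
      Keep [.go, .v, .p, .x, .kk, .y, .sd, .res, .kx, .ec] edgeArrs s s' ∧
      (∃ δ' tab', ETab B k' δ' tab' s' ∧
        Added w n k len fp (bnd len (s'.r .p)) t δ δ' ∧
        (∀ v, k < v → δ' v = δ₀ v) ∧
        (∀ v, Chain w n k len fp v → bnd len (s'.r .p) ≤ len v → δ v (w n) = 0) ∧
        (s'.r .p ≠ 0 → Chain w n k len fp (s'.r .p) ∧
          (s'.r .go = 0 → (s'.r .res, w n) ∈ (tab' (s'.r .p)).ents))) ∧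
        (0 < s'.r .go → s'.r .p ≠ 0) ∧
        (s.r .ec ≤ s'.r .ec ∧
          s'.r .ec + pot w n (bnd len (s'.r .p)) ≤ s.r .ec + pot w n (n + 1)) ∧
        s'.clk + tE B * pot w n (bnd len (s'.r .p)) + (if s'.r .go = 0 then 2 else tE B) ≤
          s.clk + 1 + tE B * (pot w n (n + 1) + 1) := ⟨_, rfl⟩
  have hb0 : bnd len (s.r .p) = n + 1 := by rw [bnd_of_pos hp.1, hpl]
  have hKB : 12 * (B + 2) + 30 = tE B := rfl
  have loop : ∀ s2, I s2 → wp N (.while (.pos .go) (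
      .v ::= .off .p 0 ;; findE ;;
      .ite (.pos .res) (.go ::= .num 0) (insertE ;; .p ::= .get .link .p ;; .go ::= .off .p 0)))
      s2 Q := by
    intro s2 h2
    -- The last round only clears `go` and leaves the potential unchanged; the doubled potential
    -- leaves room for this bit.
    refine wp_while I (fun s' => 2 * pot w n (bnd len (s'.r .p)) + if s'.r .go = 0 then 0 else 1)
      h2 ?_ ?_
    · intro s3 h3 hgo
      simp only [Tst.Holds] at hgo
      rw [hI] at h3
      obtain ⟨hk3, ⟨δ', tab', hT3, hA3, hnew3, hz3, hp3⟩, hgp, hec3, hclk3⟩ := h3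
      obtain ⟨hch, -⟩ := hp3 (hgp hgo)
      rw [if_neg (by omega)] at hclk3
      have hpk := hch.2.1
      have hp1 := hch.1
      simp [wp_seq, wp_asg, Ex.Bd, Ex.eval]
      refine wp_mono ((hT3.congr (s' := s3.tick.set .v (s3.r .p)) (fun _ _ => rfl) rfl).wp_findE
        (v := s3.r .p) (c := w n) (by simp) ?_ hp1 (by omega) ?_ ?_) ?_
      · simp [hk3.r, hc]
      · intro z hz; simp only [VS.set_m, VS.tick_m, hk3.m .hf (by decide)]; exact (hH z hz).1
      · intro z hz; simp only [VS.set_m, VS.tick_m, hk3.m .pr (by decide)]; exact (hH z hz).2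
      rintro s4 ⟨hk4, hres, hres0, hclk4⟩
      simp at hclk4
      have hk34 : Keep [.v, .x, .kk, .y, .sd, .res, .kx] [] s3 s4 := by
        refine Keep.trans (s' := s3.tick.set .v (s3.r .p)) (vs := [.v]) (as := [])
          ⟨fun z hz => ?_, fun a ha => rfl, rfl, rfl, rfl⟩ hk4
        simp at hz; simp [hz]
      have hT4 := hT3.congr (s' := s4) (fun a _ => hk34.m a (by simp)) (hk34.r _ (by decide))
      have hp4 : s4.r .p = s3.r .p := hk34.r _ (by decide)
      have hv4 : s4.r .v = s3.r .p := by rw [hk4.r _ (by decide)]; simp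
      have hgo4 : s4.r .go = s3.r .go := hk34.r _ (by decide)
      simp only [wp_ite, wp_seq, wp_asg]
      refine ⟨fun hr => ?_, fun hr => ?_⟩
      · simp only [Tst.Holds] at hr
        have h0 := (hT3.find_ne hp1 (by omega) (hres (by omega))).1
        simp [Ex.Bd, Ex.eval, hp4]
        refine ⟨?_, ?_⟩
        · rw [hI]
          refine ⟨hk3.trans (hk34.trans (s'' := (s4.tick.set .go 0)) (vs' := [.go]) (as' := [])
              (vs'' := [.v, .x, .kk, .y, .sd, .res, .kx, .go]) (as'' := [])
              ⟨fun z hz => ?_, fun a ha => rfl, rfl, rfl, rfl⟩),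
            ⟨δ', tab', hT4.congr (fun _ _ => rfl) (by simp), ?_, hnew3, ?_, ?_⟩, ?_, ?_, ?_⟩
          · simp at hz; simp [hz]
          · simpa [hp4] using hA3
          · simpa [hp4] using hz3
          · intro _
            simp only [VS.set_r, VS.tick_r, reduceCtorEq, if_false, if_true, hp4]
            exact ⟨hch, fun _ => hres (by omega)⟩
          · simp
          · simp [hp4, hk34.r .ec (by decide)]; exact hec3
          · simp [hp4]; omega
        · rw [if_neg (by omega)]; exact Nat.one_pos
      · simp only [Tst.Holds, Nat.not_lt, Nat.le_zero] at hr
        obtain ⟨hno, fs, hfs, hpath, hpl4⟩ := hres0 hr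
        have h0 := hT3.find_zero hp1 (by omega) hG hno
        obtain ⟨hst1, hst2, hst3⟩ := h.chain_step hch
        have hpot := h.pot_step hch
        have hmul := Nat.mul_le_mul_left (tE B) hpot
        rw [Nat.mul_add, Nat.mul_one] at hmul
        have hA0 := hA3 (s3.r .p) (w n) hpk
        -- The row of the current state has not been changed yet, so the search tells about the
        -- original automaton.
        have hδp : δ (s3.r .p) (w n) = 0 := by
          have hlt : len (s3.r .p) < bnd len (s3.r .p) := by rw [bnd_of_pos hp1]; omega
          rw [← hA0.2 (.inr (.inr hlt)), h0]
        refine wp_mono ((hT4.congr (s' := s4.tick) (fun _ _ => rfl) rfl).wp_insertE (v := s3.r .p)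
          (c := w n) (t := t) hv4 ?_ ?_ ht0 hp1 (by omega) hG h0 hfs hpath hpl4 ?_) ?_
        · simp [hk34.r, hk3.r, hc]
        · simp [hk34.r, hk3.r, ht]
        · simp [hk34.r .ec (by decide)]; omega
        rintro s5 ⟨hk5, hec5, hT5, -, -, hclk5⟩
        simp at hclk5 hec5
        rw [hk34.r .ec (by decide)] at hec5
        have hp5 : s5.r .p = s3.r .p := by rw [hk5.r _ (by decide)]; simp [hp4]
        have hl5 : s5.m .link (s3.r .p) = link (s3.r .p) := by
          rw [hk5.m _ (by decide)]; simp [hk34.m, hk3.m .link (by decide), hlink _ hpk]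
        have hk05 : Keep [.go, .v, .p, .x, .kk, .y, .sd, .res, .kx, .ec] edgeArrs s s5 :=
          hk3.trans (hk34.tick.trans hk5 (vs'' := [.v, .x, .kk, .y, .sd, .res, .kx, .ec])
            (as'' := edgeArrs))
        simp [Ex.Bd, Ex.eval, hp5, hl5]
        refine ⟨?_, ?_⟩
        · rw [hI]
          refine ⟨hk05.trans (s'' := (s5.set .p (link (s3.r .p))).set .go (link (s3.r .p)))
              (vs' := [.go, .p]) (as' := []) ⟨fun z hz => ?_, fun a ha => rfl, rfl, rfl, rfl⟩,
            ⟨_, _, hT5.congr (fun _ _ => rfl) (by simp), ?_, ?_, ?_, ?_⟩, ?_, ?_, ?_⟩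
          · simp at hz; simp [hz]
          · simp only [VS.set_r, reduceCtorEq, if_false, if_true]
            intro v c hv
            obtain ⟨a1, a2⟩ := hA3 v c hv
            constructor
            · intro hcw hcv hle
              by_cases hvp : v = s3.r .p
              · subst hvp; subst hcw; simp
              · rw [Function.update_of_ne hvp]
                refine a1 hcw hcv ?_
                rw [bnd_of_pos hp1]
                by_contra hlt
                rcases Nat.lt_or_ge (len v) (len (s3.r .p)) with hlt' | hge
                · have := hst3 v hcv hlt'; omega
                · exact hvp (h.chain_inj hcv hch (by omega))
            · intro hor
              by_cases hvp : v = s3.r .p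
              · subst hvp
                rw [Function.update_self, Function.update_of_ne]
                · refine a2 (hor.imp_right (Or.imp_right fun hlt => ?_))
                  rw [bnd_of_pos hp1]; omega
                · intro hcw
                  rcases hor with hor | hor | hor
                  exacts [hor hcw, hor hch, by omega]
              · rw [Function.update_of_ne hvp]
                refine a2 (hor.imp_right (Or.imp_right fun hlt => ?_))
                rw [bnd_of_pos hp1]; omega
          · intro v hv
            rw [Function.update_of_ne (by omega)]; exact hnew3 v hv
          · simp only [VS.set_r, reduceCtorEq, if_false, if_true]
            intro v hcv hle
            by_cases hvp : v = s3.r .p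
            · subst hvp; exact hδp
            · refine hz3 v hcv ?_
              rw [bnd_of_pos hp1]
              by_contra hlt
              rcases Nat.lt_or_ge (len v) (len (s3.r .p)) with hlt' | hge
              · have := hst3 v hcv hlt'; omega
              · exact hvp (h.chain_inj hcv hch (by omega))
          · simp only [VS.set_r, reduceCtorEq, if_false, if_true]
            exact fun h0 => ⟨hst1 h0, fun h1 => absurd h1 h0⟩
          · simp only [VS.set_r, reduceCtorEq, if_false, if_true]; omega
          · simp [hec5]; omega
          · simp
            split_ifs <;> omega
        · have : ¬ s3.r .go = 0 := by omega
          simp only [this, if_false]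
          split_ifs <;> omega
    · intro s3 h3 hgo
      simp only [Tst.Holds, Nat.not_lt, Nat.le_zero] at hgo
      rw [hI] at h3
      obtain ⟨hk3, ⟨δ', tab', hT3, hA3, hnew3, hz3, hp3⟩, hgp, hec3, hclk3⟩ := h3
      rw [if_pos hgo] at hclk3
      rw [hQ]
      refine ⟨hk3.tick, δ', tab', hT3.congr (fun _ _ => rfl) rfl, hA3, hnew3, hz3,
        fun h0 => ⟨(hp3 h0).1, (hp3 h0).2 hgo⟩, hec3, ?_⟩
      simp; omega
  unfold addLoop
  simp only [wp_seq, wp_asg]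
  refine ⟨?_, loop _ ?_⟩
  · exact hN1
  rw [hI]
  refine ⟨⟨fun z hz => ?_, fun a ha => rfl, rfl, rfl, rfl⟩, ⟨δ₀, tab, hT.congr (fun _ _ => rfl)
    (by simp), ?_, fun _ _ => rfl, ?_, ?_⟩, ?_, ?_, ?_⟩
  · simp at hz; simp [hz, Ex.eval]
  · simp only [VS.set_r, reduceCtorEq, if_false, hb0]
    intro v c hv
    refine ⟨fun _ hcv hle => ?_, fun _ => by rw [hδ v hv]⟩
    have := h.len_le hcv.1 hcv.2.1
    omega
  · simp only [VS.set_r, reduceCtorEq, if_false, hb0]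
    intro v hcv hle
    have := h.len_le hcv.1 hcv.2.1
    omega
  · simp [Ex.eval, hp]
  · intro _; simp; have := hp.1; omega
  · simp [hb0]
  · simp [hb0, Ex.eval, Nat.mul_add]; omega

end

section
variable {α : Type u} [LinearOrder α] {N B k : ℕ} {δ : ℕ → ℕ → ℕ} {tab : ℕ → Tr} {s s' : VS α}
variable {w : ℕ → ℕ} {n : ℕ} {len fp link : ℕ → ℕ}

/-- Copy the remaining transitions in the list `e` to the state in `v`. -/
def copyLoop : Cmd :=
  .while (.pos .e) (
    .c ::= .get .ek .e ;; .tgt ::= .get .et .e ;; findE ;; insertE ;; .e ::= .get .enx .e)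

theorem ETab.length_le (h : ETab B k δ tab s) {v : ℕ} (h1 : 1 ≤ v) (h2 : v ≤ k) {l : List ℕ}
    (hn : l.Nodup) (hl : ∀ x ∈ l, x ∈ (tab v).ids) : l.length ≤ s.r .ec := by
  have : l.toFinset ⊆ Finset.Icc 1 (s.r .ec) := by
    intro x hx
    have := h.ent v h1 h2 _ (h.label h1 h2 (hl x (List.mem_toFinset.1 hx)))
    simp only [Finset.mem_Icc]
    exact ⟨this.1, this.2.1⟩
  have := Finset.card_le_card this
  rwa [List.toFinset_card_of_nodup hn, Nat.card_Icc, Nat.add_sub_cancel] at this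

/-- New edges get fresh numbers, so the list of `q` remains intact while it is read. Since each
copied transition raises `ec` by one, the time is charged to the number of edges and needs no
potential. The row `r` starts out empty, so each search ends at a free place. -/
theorem wp_copyLoop (hT : ETab B k δ tab s) {r q : ℕ} (hr1 : 1 ≤ r) (hrk : r ≤ k) (hq1 : 1 ≤ q)
    (hqk : q ≤ k) (hv : s.r .v = r) (he : s.r .e = s.m .head q)
    (hr0 : ∀ c < 2 ^ B, δ r c = 0) (hH : ∀ c < 2 ^ B, δ q c ≠ 0 → HfOk s c)
    (hN : 2 * s.r .ec ≤ N) :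
    wp N copyLoop s fun s' => Keep [.c, .tgt, .e, .x, .kk, .y, .sd, .res, .kx, .ec] edgeArrs s s' ∧
      (∃ δ' tab', ETab B k δ' tab' s' ∧ (∀ v, v ≠ r → δ' v = δ v) ∧
        (∀ c < 2 ^ B, δ' r c = δ q c)) ∧
      s.r .ec ≤ s'.r .ec ∧ s'.clk + tE B * s.r .ec ≤ s.clk + tE B * s'.r .ec + 1 := by
  obtain ⟨l, hl1, hl2, hl3⟩ := hT.list q hq1 hqk
  have hlen := hT.length_le hq1 hqk hl2 fun x hx => (hl3 x).1 hx
  have hlab : ∀ x ∈ l, (x, s.m .ek x) ∈ (tab q).ents := fun x hx =>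
    hT.label hq1 hqk ((hl3 x).1 hx)
  have hent : ∀ x ∈ l, 1 ≤ x ∧ x ≤ s.r .ec ∧ s.m .ek x < 2 ^ B ∧ s.m .et x = δ q (s.m .ek x) ∧
      δ q (s.m .ek x) ≠ 0 := fun x hx => hT.ent q hq1 hqk _ (hlab x hx)
  have hKB : 12 * (B + 2) + 30 = tE B := rfl
  obtain ⟨I, hI⟩ : ∃ I : VS α → Prop, I = fun s' =>
      Keep [.c, .tgt, .e, .x, .kk, .y, .sd, .res, .kx, .ec] edgeArrs s s' ∧
      ∃ l₁ l₂, l = l₁ ++ l₂ ∧ LL (s'.m .enx) (s'.r .e) l₂ ∧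
      (∃ δ' tab', ETab B k δ' tab' s' ∧ (∀ v, v ≠ r → δ' v = δ v) ∧
        ∀ c < 2 ^ B, ((∃ x ∈ l₁, s.m .ek x = c) → δ' r c = δ q c) ∧
          ((∀ x ∈ l₁, s.m .ek x ≠ c) → δ' r c = 0)) ∧
      (∀ x ∈ l, s'.m .ek x = s.m .ek x ∧ s'.m .et x = s.m .et x ∧ s'.m .enx x = s.m .enx x) ∧
      s'.r .ec = s.r .ec + l₁.length ∧ s'.clk ≤ s.clk + tE B * l₁.length := ⟨_, rfl⟩
  unfold copyLoop
  -- The list of `q` has at most `ec` members, so the number of edges at most doubles.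
  refine wp_while I (fun s' => 2 * s.r .ec - s'.r .ec) ?_ ?_ ?_
  · rw [hI]
    exact ⟨Keep.refl _ _ _, [], l, rfl, he ▸ hl1, ⟨δ, tab, hT, fun _ _ => rfl, fun c hc =>
      ⟨by simp, fun _ => hr0 c hc⟩⟩, fun _ _ => ⟨rfl, rfl, rfl⟩, by simp, by simp⟩
  · intro s3 h3 hpos
    simp only [Tst.Holds] at hpos
    rw [hI] at h3
    obtain ⟨hk3, l₁, l₂, hll, hLL, ⟨δ', tab', hT3, hne3, hr3⟩, hsame, hec3, hclk3⟩ := h3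
    rcases l₂ with _ | ⟨x, l₂⟩
    · have : s3.r .e = 0 := hLL
      omega
    obtain ⟨hex, hx0, hLL⟩ := hLL
    have hxl : x ∈ l := by rw [hll]; simp
    obtain ⟨hx1, hx2, hxc, hxt, hxd⟩ := hent x hxl
    obtain ⟨hs1, hs2, hs3⟩ := hsame x hxl
    have hlen1 : l₁.length + 1 ≤ l.length := by rw [hll]; simp
    have hxn : ∀ y ∈ l₁, s.m .ek y ≠ s.m .ek x := by
      intro y hy hyx
      have hyl : y ∈ l := by rw [hll]; simp [hy]
      have h1 := hlab y hyl
      rw [hyx] at h1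
      have h2 := List.inj_on_of_nodup_map (hT.keys q hq1 hqk) h1 (hlab x hxl) rfl
      have h3 : y = x := congrArg Prod.fst h2
      rw [hll] at hl2
      subst h3
      grind
    simp [wp_seq, wp_asg, Ex.Bd, Ex.eval, hex, hs1, hs2, hxt]
    refine wp_mono ((hT3.congr (s' := (s3.tick.set .c (s.m .ek x)).set .tgt (δ q (s.m .ek x)))
      (fun _ _ => rfl) (by simp)).wp_findE (v := r) (c := s.m .ek x) ?_ (by simp) hr1 hrk ?_ ?_) ?_
    · simp [hk3.r, hv]
    · intro z hz; simp only [VS.set_m, VS.tick_m, hk3.m .hf (by decide)]; exact (hH _ hxc hxd z hz).1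
    · intro z hz; simp only [VS.set_m, VS.tick_m, hk3.m .pr (by decide)]; exact (hH _ hxc hxd z hz).2
    rintro s4 ⟨hk4, hres, hres0, hclk4⟩
    simp at hclk4
    have hk34 : Keep [.c, .tgt, .x, .kk, .y, .sd, .res, .kx] [] s3 s4 := by
      refine Keep.trans (s' := (s3.tick.set .c (s.m .ek x)).set .tgt (δ q (s.m .ek x)))
        (vs := [.c, .tgt]) (as := []) ⟨fun z hz => ?_, fun a ha => rfl, rfl, rfl, rfl⟩ hk4
      simp at hz; simp [hz]
    have hT4 := hT3.congr (s' := s4) (fun a _ => hk34.m a (by simp)) (hk34.r _ (by decide))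
    have hδ0 : δ' r (s.m .ek x) = 0 := (hr3 _ hxc).2 hxn
    have hr4 : s4.r .res = 0 := by
      by_contra hc
      exact (hT3.find_ne hr1 hrk (hres hc)).1 hδ0
    obtain ⟨hno, fs, hfs, hpath, hpl4⟩ := hres0 hr4
    have hec4 : s4.r .ec = s3.r .ec := hk34.r _ (by decide)
    refine wp_mono (hT4.wp_insertE (v := r) (c := s.m .ek x) (t := δ q (s.m .ek x)) ?_ ?_ ?_ hxd
      hr1 hrk hxc hδ0 hfs hpath hpl4 ?_) ?_
    · rw [hk34.r _ (by decide), hk3.r _ (by decide), hv]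
    · rw [hk4.r _ (by decide)]; simp
    · rw [hk4.r _ (by decide)]; simp
    · omega
    rintro s5 ⟨hk5, hec5, hT5, hold5, -, hclk5⟩
    have hk05 : Keep [.c, .tgt, .e, .x, .kk, .y, .sd, .res, .kx, .ec] edgeArrs s s5 :=
      hk3.trans (hk34.trans hk5 (vs'' := [.c, .tgt, .x, .kk, .y, .sd, .res, .kx, .ec])
        (as'' := edgeArrs))
    have he5 : s5.r .e = x := by rw [hk5.r _ (by decide), hk34.r _ (by decide), hex]
    have hm4 : ∀ a, s4.m a = s3.m a := fun a => hk34.m a (by simp)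
    have hsame5 : ∀ y ∈ l, s5.m .ek y = s.m .ek y ∧ s5.m .et y = s.m .et y ∧
        s5.m .enx y = s.m .enx y := by
      intro y hy
      have h1 := hent y hy
      have h2 := hold5 y (by omega)
      rw [hm4, hm4, hm4] at h2
      have h3 := hsame y hy
      exact ⟨h2.1.trans h3.1, h2.2.1.trans h3.2.1, h2.2.2.trans h3.2.2⟩
    simp only [he5]
    have hmul : tE B * (l₁.length + 1) = tE B * l₁.length + tE B := by ring
    refine ⟨?_, ?_⟩
    · rw [hI]
      refine ⟨hk05.trans (s'' := s5.set .e (s5.m .enx x)) (vs' := [.e]) (as' := [])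
        ⟨fun z hz => ?_, fun a ha => rfl, rfl, rfl, rfl⟩, l₁ ++ [x], l₂, by simp [hll], ?_,
        ⟨_, _, hT5.congr (fun _ _ => rfl) (by simp), ?_, ?_⟩, ?_, ?_, ?_⟩
      · simp at hz; simp [hz]
      · simp only [VS.set_r, if_true, VS.set_m]
        rw [(hsame5 x hxl).2.2, ← hs3]
        refine hLL.congr fun y hy => ?_
        have hyl : y ∈ l := by rw [hll]; simp [hy]
        rw [(hsame5 y hyl).2.2, (hsame y hyl).2.2]
      · intro v hv
        rw [Function.update_of_ne hv]; exact hne3 v hv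
      · intro c hc
        rw [Function.update_self]
        by_cases hcx : c = s.m .ek x
        · subst hcx
          simp
        · rw [Function.update_of_ne hcx]
          refine ⟨fun ⟨y, hy, hyc⟩ => (hr3 c hc).1 ⟨y, ?_, hyc⟩, fun hy => (hr3 c hc).2 fun y hyl =>
            hy y (by simp [hyl])⟩
          rcases List.mem_append.1 hy with hy | hy
          · exact hy
          · simp at hy; subst hy; exact absurd hyc.symm hcx
      · exact hsame5
      · simp [hec5, hec4, hec3]; omega
      · simp [hmul]; omega
    · simp [hec5, hec4]; omega
  · intro s3 h3 hpos
    simp only [Tst.Holds, Nat.not_lt, Nat.le_zero] at hpos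
    rw [hI] at h3
    obtain ⟨hk3, l₁, l₂, hll, hLL, ⟨δ', tab', hT3, hne3, hr3⟩, hsame, hec3, hclk3⟩ := h3
    have hl2' : l₂ = [] := by
      rcases l₂ with _ | ⟨x, l₂⟩
      · rfl
      · exact absurd (hpos ▸ hLL.1).symm hLL.2.1
    subst hl2'
    rw [List.append_nil] at hll
    subst hll
    refine ⟨hk3.tick, ⟨δ', tab', hT3.congr (fun _ _ => rfl) rfl, hne3, fun c hc => ?_⟩, ?_, ?_⟩
    · by_cases h0 : δ q c = 0
      · rw [h0]
        refine (hr3 c hc).2 fun x hx hxc => ?_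
        exact (hent x hx).2.2.2.2 (hxc ▸ h0)
      · obtain ⟨x, hx⟩ := hT.all q c hq1 hqk hc h0
        refine (hr3 c hc).1 ⟨x, (hl3 x).2 (Tr.fst_mem_ids hx), ?_⟩
        exact (hT.rep q hq1 hqk).label _ hx
    · simp; omega
    · simp [hec3, Nat.mul_add]; omega

/-- Redirect the transitions to `q` along the suffix path to `r`. -/
def redirLoop : Cmd :=
  .go ::= .num 1 ;;
  .while (.pos .go) (
    .v ::= .off .p 0 ;; findE ;; .go ::= .num 0 ;;
    .ite (.pos .res) (.tgt ::= .get .et .res ;;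
      .ite (.eq .tgt .q) (.put .et .res .r ;; .p ::= .get .link .p ;; .go ::= .off .p 0) .skip) .skip)

/-- The transitions while the states of the chain of length at least `M` are processed. -/
def Redird (w : ℕ → ℕ) (n k : ℕ) (len fp : ℕ → ℕ) (M Z r : ℕ) (δ δ' : ℕ → ℕ → ℕ) : Prop :=
  ∀ v c, (c = w n → Chain w n k len fp v → M ≤ len v → len v < Z → δ' v c = r) ∧
    (c ≠ w n ∨ ¬ Chain w n k len fp v ∨ len v < M ∨ Z ≤ len v → δ' v c = δ v c)

/-- By `Sam.redirect`, the chain states with a transition to `q` are consecutive from length `Z`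
downward, so the loop may stop at the first one that leads elsewhere. The stored links are required
to be the original ones only below `Z`, because the link of `q` has already been changed to the
clone. -/
theorem wp_redirLoop (h : Sam w (· < 2 ^ B) n k len fp link δ) (hG : w n < 2 ^ B) {r q Z k' : ℕ}
    {δ₀ : ℕ → ℕ → ℕ} (hT : ETab B k' δ₀ tab s) (hkk : k ≤ k') (hZ : Lrs w n Z)
    (ht : Tgt w n k len fp Z q) (hq : Z < len q)
    (hδ : ∀ v, Chain w n k len fp v → len v < Z → δ₀ v (w n) = δ v (w n))
    (hc : s.r .c = w n) (hrq : s.r .q = q) (hrr : s.r .r = r) (hr0 : r ≠ 0)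
    (hlink : ∀ v, Chain w n k len fp v → len v < Z → s.m .link v = link v)
    (hp : Chain w n k len fp (s.r .p))
    (hpl : len (s.r .p) + 1 = Z) (hH : HfOk s (w n)) (hN1 : 1 ≤ N) :
    wp N redirLoop s fun s' => Keep [.go, .v, .p, .x, .kk, .y, .sd, .res, .kx, .tgt] [.et] s s' ∧
      ∃ δ' M, ETab B k' δ' tab s' ∧ Redird w n k len fp M Z r δ₀ δ' ∧
        (∀ v, Chain w n k len fp v → M ≤ len v → len v < Z → δ v (w n) = q) ∧
        (∀ v, Chain w n k len fp v → len v < M → δ v (w n) ≠ q) ∧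
        s'.clk + tE B * pot w n M ≤ s.clk + tE B * (pot w n Z + 1) := by
  obtain ⟨Q, hQ⟩ : ∃ Q : VS α → Prop, Q = fun s' =>
      Keep [.go, .v, .p, .x, .kk, .y, .sd, .res, .kx, .tgt] [.et] s s' ∧
      ∃ δ' M, ETab B k' δ' tab s' ∧ Redird w n k len fp M Z r δ₀ δ' ∧
        (∀ v, Chain w n k len fp v → M ≤ len v → len v < Z → δ v (w n) = q) ∧
        (∀ v, Chain w n k len fp v → len v < M → δ v (w n) ≠ q) ∧
        s'.clk + tE B * pot w n M ≤ s.clk + tE B * (pot w n Z + 1) := ⟨_, rfl⟩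
  rw [← hQ]
  obtain ⟨I, hI⟩ : ∃ I : VS α → Prop, I = fun s' =>
      Keep [.go, .v, .p, .x, .kk, .y, .sd, .res, .kx, .tgt] [.et] s s' ∧
      (∃ δ', ETab B k' δ' tab s' ∧ Redird w n k len fp (bnd len (s'.r .p)) Z r δ₀ δ') ∧
        (∀ v, Chain w n k len fp v → bnd len (s'.r .p) ≤ len v → len v < Z → δ v (w n) = q) ∧
        (0 < s'.r .go → Chain w n k len fp (s'.r .p) ∧ len (s'.r .p) < Z) ∧
        (s'.r .go = 0 → ∀ v, Chain w n k len fp v → len v < bnd len (s'.r .p) → δ v (w n) ≠ q) ∧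
        s'.clk + tE B * pot w n (bnd len (s'.r .p)) + (if s'.r .go = 0 then 2 else tE B) ≤
          s.clk + 1 + tE B * (pot w n Z + 1) := ⟨_, rfl⟩
  have hb0 : bnd len (s.r .p) = Z := by rw [bnd_of_pos hp.1, hpl]
  have hKB : 12 * (B + 2) + 30 = tE B := rfl
  have loop : ∀ s2, I s2 → wp N (.while (.pos .go) (
      .v ::= .off .p 0 ;; findE ;; .go ::= .num 0 ;;
      .ite (.pos .res) (.tgt ::= .get .et .res ;;
      .ite (.eq .tgt .q) (.put .et .res .r ;; .p ::= .get .link .p ;; .go ::= .off .p 0)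
        .skip) .skip)) s2 Q := by
    intro s2 h2
    refine wp_while I (fun s' => 2 * pot w n (bnd len (s'.r .p)) + if s'.r .go = 0 then 0 else 1)
      h2 ?_ ?_
    · intro s3 h3 hgo
      simp only [Tst.Holds] at hgo
      rw [hI] at h3
      obtain ⟨hk3, ⟨δ', hT3, hA3⟩, hz3, hp3, -, hclk3⟩ := h3
      obtain ⟨hch, hltZ⟩ := hp3 hgo
      have hgo' : ¬ s3.r .go = 0 := by omega
      rw [if_neg hgo'] at hclk3
      have hpk := hch.2.1
      have hp1 := hch.1
      have hbp : bnd len (s3.r .p) = len (s3.r .p) + 1 := bnd_of_pos hp1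
      have hδp : δ' (s3.r .p) (w n) = δ (s3.r .p) (w n) := by
        rw [(hA3 _ _).2 (.inr (.inr (.inl (by omega)))), hδ _ hch hltZ]
      simp [wp_seq, wp_asg, Ex.Bd, Ex.eval]
      refine wp_mono ((hT3.congr (s' := s3.tick.set .v (s3.r .p)) (fun _ _ => rfl) rfl).wp_findE
        (v := s3.r .p) (c := w n) (by simp) ?_ hp1 (by omega) ?_ ?_) ?_
      · simp [hk3.r, hc]
      · intro z hz; simp only [VS.set_m, VS.tick_m, hk3.m .hf (by decide)]; exact (hH z hz).1
      · intro z hz; simp only [VS.set_m, VS.tick_m, hk3.m .pr (by decide)]; exact (hH z hz).2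
      rintro s4 ⟨hk4, hres, hres0, hclk4⟩
      simp at hclk4
      have hk34 : Keep [.v, .x, .kk, .y, .sd, .res, .kx] [] s3 s4 := by
        refine Keep.trans (s' := s3.tick.set .v (s3.r .p)) (vs := [.v]) (as := [])
          ⟨fun z hz => ?_, fun a ha => rfl, rfl, rfl, rfl⟩ hk4
        simp at hz; simp [hz]
      have hT4 := hT3.congr (s' := s4) (fun a _ => hk34.m a (by simp)) (hk34.r _ (by decide))
      have hk04 := hk3.trans hk34 (vs'' := [.go, .v, .p, .x, .kk, .y, .sd, .res, .kx, .tgt])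
        (as'' := [.et])
      have hp4 : s4.r .p = s3.r .p := hk34.r _ (by decide)
      have hq4 : s4.r .q = q := by rw [hk04.r _ (by decide), hrq]
      have hr4 : s4.r .r = r := by rw [hk04.r _ (by decide), hrr]
      have hm4 : ∀ a, s4.m a = s3.m a := fun a => hk34.m a (by simp)
      have leave : ∀ s5 : VS α, δ (s3.r .p) (w n) ≠ q → Keep [.go, .tgt] [] s4 s5 →
          s5.r .go = 0 → s5.clk ≤ s4.clk + 5 → I s5 ∧
          (2 * pot w n (bnd len (s5.r .p)) + if s5.r .go = 0 then 0 else 1) <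
            2 * pot w n (bnd len (s3.r .p)) + if s3.r .go = 0 then 0 else 1 := by
        intro s5 hne hk5 hg5 hclk5
        have hp5 : s5.r .p = s3.r .p := by rw [hk5.r _ (by decide), hp4]
        rw [hI]
        refine ⟨⟨hk04.trans hk5, ⟨δ', hT4.congr (fun a _ => hk5.m a (by simp))
          (hk5.r _ (by decide)), ?_⟩, ?_, ?_, ?_, ?_⟩, ?_⟩
        · rw [hp5]; exact hA3
        · rw [hp5]; exact hz3
        · omega
        · intro _ u hu hlu hδu
          rw [hp5, hbp] at hlu
          exact hne (h.redirect hZ ht hq hG hu hch (by omega) hltZ hδu)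
        · rw [hp5, if_pos hg5]; omega
        · rw [hp5, if_pos hg5, if_neg hgo']; omega
      have hq0 : q ≠ 0 := by have := ht.pos; omega
      simp only [wp_ite, wp_seq, wp_asg, wp_skip, wp_put]
      refine ⟨fun hr => ?_, fun hr => ?_⟩
      · simp [Tst.Holds] at hr
        have hmem := hres (by omega)
        have h0 := hT3.find_ne hp1 (by omega) hmem
        simp [Ex.Bd, Ex.eval, Tst.Holds, hp4, hq4, hm4, hr4, h0.2, hδp]
        refine ⟨fun hdq => ?_, fun hdq => ?_⟩
        · obtain ⟨hst1, hst2, hst3⟩ := h.chain_step hch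
          have hpot := h.pot_step hch
          have hmul := Nat.mul_le_mul_left (tE B) hpot
          rw [Nat.mul_add, Nat.mul_one] at hmul
          have hl4 : s3.m .link (s3.r .p) = link (s3.r .p) := by
            rw [hk3.m _ (by decide), hlink _ hch hltZ]
          rw [hl4]
          refine ⟨?_, ?_⟩
          · rw [hI, hdq]
            have hT4' : ETab B k' δ' tab (((s4.set .go 0).tick.set .tgt q).tick) :=
              hT4.congr (fun _ _ => rfl) (by simp)
            refine ⟨hk04.trans (s'' := (((((((s4.set .go 0).tick.set .tgt q).tick.put .et (s4.r .res) r).set .p (link (s3.r .p))).set .go (link (s3.r .p))))))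
                (vs' := [.go, .p, .tgt]) (as' := [.et])
                (vs'' := [.go, .v, .p, .x, .kk, .y, .sd, .res, .kx, .tgt]) (as'' := [.et]) ⟨fun z hz => ?_, fun a ha => ?_, rfl, rfl, rfl⟩,
              ⟨_, hT4'.redirect (v := s3.r .p) (c := w n) (t := r) hp1 (by omega) hmem hr0 ?_ ?_ ?_,
                ?_⟩, ?_, ?_, ?_, ?_⟩
            · simp at hz; simp [hz]
            · simp at ha; simp [ha]
            · simp
            · intro a ha hne; simp [hne]
            · simp
            · simp only [VS.set_r, reduceCtorEq, if_false, if_true]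
              intro v c
              obtain ⟨a1, a2⟩ := hA3 v c
              constructor
              · intro hcw hcv hle hlz
                by_cases hvp : v = s3.r .p
                · subst hvp; subst hcw; simp
                · rw [Function.update_of_ne hvp]
                  refine a1 hcw hcv ?_ hlz
                  rw [hbp]
                  by_contra hlt
                  rcases Nat.lt_or_ge (len v) (len (s3.r .p)) with hlt' | hge
                  · have := hst3 v hcv hlt'; omega
                  · exact hvp (h.chain_inj hcv hch (by omega))
              · intro hor
                by_cases hvp : v = s3.r .p
                · subst hvp
                  rw [Function.update_self, Function.update_of_ne]
                  · refine a2 (hor.imp_right (Or.imp_right (Or.imp_left fun hlt => ?_)))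
                    omega
                  · intro hcw
                    rcases hor with hor | hor | hor | hor
                    exacts [hor hcw, hor hch, by omega, by omega]
                · rw [Function.update_of_ne hvp]
                  refine a2 (hor.imp_right (Or.imp_right (Or.imp_left fun hlt => ?_)))
                  omega
            · simp only [VS.set_r, reduceCtorEq, if_false, if_true]
              intro v hcv hle hlz
              by_cases hvp : v = s3.r .p
              · subst hvp; exact hdq
              · refine hz3 v hcv ?_ hlz
                rw [hbp]
                by_contra hlt
                rcases Nat.lt_or_ge (len v) (len (s3.r .p)) with hlt' | hge
                · have := hst3 v hcv hlt'; omega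
                · exact hvp (h.chain_inj hcv hch (by omega))
            · simp only [VS.set_r, reduceCtorEq, if_false, if_true]
              intro h0
              have hc1 := hst1 (by omega)
              rw [bnd_of_pos hc1.1] at hst2
              exact ⟨hc1, by omega⟩
            · simp only [VS.set_r, reduceCtorEq, if_false, if_true]
              intro h0 v hcv hlt
              rw [h0] at hlt
              simp [bnd] at hlt
            · simp
              split_ifs <;> omega
          · simp only [hgo', if_false]
            split_ifs <;> omega
        · refine ⟨(leave _ hdq ?_ ?_ ?_).1, by rw [if_neg hgo']; exact Nat.one_pos⟩
          · refine ⟨fun z hz => ?_, fun a ha => rfl, rfl, rfl, rfl⟩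
            simp at hz; simp [hz]
          · simp
          · simp
      · have hr : s4.r .res = 0 := by simpa [Tst.Holds] using hr
        have hno := (hres0 hr).1
        have h0 := hT3.find_zero hp1 (by omega) hG hno
        refine leave _ (by omega) ⟨fun z hz => ?_, fun a ha => rfl, rfl, rfl, rfl⟩ ?_ ?_
        · simp at hz; simp [hz]
        · simp
        · simp
    · intro s3 h3 hgo
      simp only [Tst.Holds, Nat.not_lt, Nat.le_zero] at hgo
      rw [hI] at h3
      obtain ⟨hk3, ⟨δ', hT3, hA3⟩, hz3, -, hq3, hclk3⟩ := h3
      rw [if_pos hgo] at hclk3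
      rw [hQ]
      exact ⟨hk3.tick, δ', _, hT3.congr (fun _ _ => rfl) rfl, hA3, hz3, hq3 hgo, by simp; omega⟩
  unfold redirLoop
  simp only [wp_seq, wp_asg]
  refine ⟨hN1, loop _ ?_⟩
  rw [hI]
  refine ⟨⟨fun z hz => ?_, fun a ha => rfl, rfl, rfl, rfl⟩, ⟨δ₀, hT.congr (fun _ _ => rfl)
    (by simp), ?_⟩, ?_, ?_, ?_, ?_⟩
  · simp at hz; simp [hz]
  · simp only [VS.set_r, reduceCtorEq, if_false, hb0]
    intro v c
    exact ⟨fun _ _ _ _ => by omega, fun _ => rfl⟩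
  · simp only [VS.set_r, reduceCtorEq, if_false, hb0]
    intro v hcv hle
    omega
  · intro _
    simp only [VS.set_r, reduceCtorEq, if_false]
    exact ⟨hp, by omega⟩
  · simp [Ex.eval]
  · simp [hb0, Ex.eval, Nat.mul_add]; omega

end

/-! ### Extending the stored automaton -/

/-- The machine stores the suffix automaton of the prefix of length `n` of `w`. -/
def Aut {α : Type u} (w : ℕ → ℕ) (B n : ℕ) (s : VS α) : Prop :=
  ∃ δ tab, Sam w (· < 2 ^ B) n (s.r .k) (s.m .len) (s.m .fp) (s.m .link) δ ∧
    ETab B (s.r .k) δ tab s ∧ Chain w n (s.r .k) (s.m .len) (s.m .fp) (s.r .last) ∧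
    s.m .len (s.r .last) = n ∧ s.r .k ≤ 2 * n + 1

/-- A new state for the whole prefix. -/
def newState : Cmd :=
  .k ::= .off .k 1 ;; .cur ::= .off .k 0 ;; .y ::= .off .b 1 ;; .put .len .cur .y ;;
  .put .fp .cur .y ;; .y ::= .num 0 ;; .put .tr .cur .y ;; .put .head .cur .y

/-- A copy of the state `q`, without transitions. -/
def cloneState : Cmd :=
  .k ::= .off .k 1 ;; .r ::= .off .k 0 ;; .put .len .r .lp ;; .x ::= .get .fp .q ;;
  .put .fp .r .x ;; .x ::= .get .link .q ;; .put .link .r .x ;; .x ::= .num 0 ;;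
  .put .tr .r .x ;; .put .head .r .x ;; .put .link .q .r ;; .put .link .cur .r ;;
  .e ::= .get .head .q ;; .v ::= .off .r 0

/-- Extend the automaton by the letter at position `b`. -/
def extendGood : Cmd :=
  newState ;; .p ::= .off .last 0 ;; .c ::= .get .ID .b ;; .tgt ::= .off .cur 0 ;; addLoop ;;
  .ite (.pos .p)
    (.q ::= .get .et .res ;; .lq ::= .get .len .q ;; .lp ::= .get .len .p ;; .lp ::= .off .lp 1 ;;
      .ite (.eq .lq .lp) (.put .link .cur .q)
        (cloneState ;; copyLoop ;; .c ::= .get .ID .b ;; redirLoop))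
    (.put .link .cur .one) ;;
  .last ::= .off .cur 0

/-- Extend the automaton by a letter that occurs nowhere else. -/
def extendBad : Cmd :=
  newState ;; .put .link .cur .one ;; .last ::= .off .cur 0

/-- The variables used for the extension. -/
def extVars : List Var :=
  [.k, .cur, .y, .p, .c, .tgt, .go, .v, .x, .kk, .sd, .res, .kx, .ec, .q, .lq, .lp, .r, .e, .last]

/-- The arrays used for the extension. -/
def extArrs : List Arr := [.len, .fp, .link, .ek, .et, .eL, .eR, .enx, .tr, .head]

section
variable {α : Type u} [LinearOrder α] {N B : ℕ} {δ : ℕ → ℕ → ℕ} {tab : ℕ → Tr} {s s' : VS α}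
variable {w : ℕ → ℕ} {n : ℕ}

theorem wp_newState {k : ℕ} (hk : s.r .k = k) (hb : s.r .b = n) (hkN : k + 1 ≤ N)
    (hnN : n < N) {Q : VS α → Prop}
    (hQ : ∀ s', Keep [.k, .cur, .y] [.len, .fp, .tr, .head] s s' → s'.r .k = k + 1 →
      s'.r .cur = k + 1 → s'.m .len = Function.update (s.m .len) (k + 1) (n + 1) →
      s'.m .fp = Function.update (s.m .fp) (k + 1) (n + 1) →
      s'.m .tr = Function.update (s.m .tr) (k + 1) 0 →
      s'.m .head = Function.update (s.m .head) (k + 1) 0 → s'.clk = s.clk + 8 → Q s') :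
    wp N newState s Q := by
  unfold newState
  simp [wp_seq, wp_asg, wp_put, Ex.Bd, Ex.eval, hk, hb, hkN, hnN]
  refine hQ _ ?_ ?_ ?_ ?_ ?_ ?_ ?_ ?_
  · refine ⟨fun z hz => ?_, fun a ha => ?_, rfl, rfl, rfl⟩
    · simp at hz; simp [hz]
    · simp at ha; simp [ha]
  all_goals simp

theorem wp_cloneState {k q lp cur : ℕ} (hk : s.r .k = k) (hq : s.r .q = q) (hlp : s.r .lp = lp)
    (hcur : s.r .cur = cur) (hqk : q ≠ k + 1) (hck : cur ≠ k + 1) (hcq : cur ≠ q)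
    (hkN : k + 1 ≤ N) {Q : VS α → Prop}
    (hQ : ∀ s', Keep [.k, .r, .x, .e, .v] [.len, .fp, .link, .tr, .head] s s' → s'.r .k = k + 1 →
      s'.r .r = k + 1 → s'.r .v = k + 1 → s'.r .e = s'.m .head q →
      s'.m .len = Function.update (s.m .len) (k + 1) lp →
      s'.m .fp = Function.update (s.m .fp) (k + 1) (s.m .fp q) →
      s'.m .tr = Function.update (s.m .tr) (k + 1) 0 →
      s'.m .head = Function.update (s.m .head) (k + 1) 0 →
      s'.m .link (k + 1) = s.m .link q → s'.m .link q = k + 1 → s'.m .link cur = k + 1 →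
      (∀ v, v ≠ k + 1 → v ≠ q → v ≠ cur → s'.m .link v = s.m .link v) →
      s'.clk = s.clk + 14 → Q s') :
    wp N cloneState s Q := by
  unfold cloneState
  simp [wp_seq, wp_asg, wp_put, Ex.Bd, Ex.eval, hk, hq, hcur, hlp, hkN, hqk]
  refine hQ _ ?_ ?_ ?_ ?_ ?_ ?_ ?_ ?_ ?_ ?_ ?_ ?_ ?_ ?_
  · refine ⟨fun z hz => ?_, fun a ha => ?_, rfl, rfl, rfl⟩
    · simp at hz; simp [hz]
    · simp at ha; simp [ha]
  any_goals simp [Ne.symm hqk, Ne.symm hck, hcq, Ne.symm hcq, Function.update_of_ne]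
  · simp [hqk]
  · intro v h1 h2 h3; simp [h1, h2, h3]

theorem Added.newTrans {k M q : ℕ} {len fp : ℕ → ℕ} {δ δ' : ℕ → ℕ → ℕ}
    (h : Added w n k len fp M (k + 1) δ δ') :
    NewTrans w (· < 2 ^ B) n k len fp δ M q q δ' := by
  intro v c h1 h2 hc
  obtain ⟨a1, a2⟩ := h v c h2
  refine ⟨fun b1 b2 b3 => a1 b1 ⟨h1, h2, b2⟩ b3, fun b1 b2 b3 b4 => ?_, fun b1 b2 b3 b4 => ?_,
    fun b1 => a2 (.inl b1), fun b1 => a2 (.inr (.inl fun b2 => b1 b2.2.2))⟩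
  · rw [a2 (.inr (.inr b3)), b4]
  · rw [a2 (.inr (.inr b3))]

/-- A fresh letter has no earlier occurrence, so the longest repeated suffix is empty and the new
state links to the root. Its letter is outside the kept range, hence no transition is stored and no
chain is followed. -/
theorem wp_extendBad (hA : Aut w B n s) (hb : s.r .b = n) (hone : s.r .one = 1)
    (hG : 2 ^ B ≤ w n) (hw : ∀ e < n, w e ≠ w n) (hN : 12 * n + 20 ≤ N) :
    wp N extendBad s fun s' => Keep extVars extArrs s s' ∧ Aut w B (n + 1) s' ∧
      s'.r .ec = s.r .ec ∧
      s'.clk + tE B * pot w (n + 1) (n + 2) ≤ s.clk + tE B * pot w n (n + 1) + 6 * tE B := by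
  obtain ⟨δ, tab, hS, hT, hch, hlast, hk2⟩ := hA
  generalize hk : s.r .k = k at *
  have hKB : 12 * (B + 2) + 30 = tE B := rfl
  unfold extendBad
  simp only [wp_seq]
  refine wp_newState hk hb (by omega) (by omega) ?_
  intro s1 hk1 e1 e2 e3 e4 e5 e6 e7
  have hone1 : s1.r .one = 1 := by rw [hk1.r _ (by decide), hone]
  simp [wp_asg, wp_put, Ex.Bd, Ex.eval, e2, hone1]
  have hZ : Lrs w n 0 := lrs_zero_of_fresh hw
  have hpot : pot w (n + 1) (n + 2) ≤ 3 := by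
    have := hZ.pot_succ (M := 0) (Nat.zero_le n) Suf.zero (fun j _ h => by omega)
    have := pot_le w n 0
    omega
  refine ⟨⟨fun z hz => ?_, fun a ha => ?_, hk1.text, hk1.rest, hk1.out⟩,
    ⟨fun v => if v ≤ k then δ v else fun _ => 0, Function.update tab (k + 1) .nil, ?_⟩,
    hk1.r _ (by decide), ?_⟩
  · simp [extVars] at hz; simp [hz]; exact hk1.r _ (by simp [hz])
  · simp [extArrs] at ha; simp [ha]; exact hk1.m _ (by simp [ha])
  · simp only [VS.set_r, VS.put_r, VS.set_m, VS.put_m, reduceCtorEq, if_false, if_true, e1, e3, e4]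
    refine ⟨?_, hT.grow ?_ ?_ ?_ ?_ ?_ ?_ ?_ ?_, ⟨by omega, le_rfl, ?_⟩, by simp, by omega⟩
    · refine hS.ext (Z := 0) (q := 1) ⟨hZ, hS.tgt_one, ?_, ?_, by simp, by simp, by simp, ?_, ?_⟩
        hS.root ?_
      · intro v hv; rw [Function.update_of_ne (by omega)]
      · intro v hv; rw [Function.update_of_ne (by omega)]
      · intro c _; simp
      · intro v c h1 h2 hc
        have : c ≠ w n := by rintro rfl; exact absurd hc (Nat.not_lt.2 hG)
        simp [this, h2]
      · intro v hv; rw [Function.update_of_ne (by omega), hk1.m _ (by decide)]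
    · intro a ha h1 h2
      simp [edgeArrs] at ha
      have : a ≠ .link := by rintro rfl; simp at ha
      simp [this]
      refine hk1.m _ ?_
      rcases ha with rfl | rfl | rfl | rfl | rfl | rfl | rfl <;> simp at h1 h2 ⊢
    · intro v hv; simp [e5]; rw [Function.update_of_ne (by omega)]
    · intro v hv; simp [e6]; rw [Function.update_of_ne (by omega)]
    · simp [e5]
    · simp [e6]
    · simp; exact hk1.r _ (by decide)
    · intro v hv; simp [hv]
    · intro c hc; simp
    · simp; exact Suf.rfl le_rfl
  · have := Nat.mul_le_mul_left (tE B) hpot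
    simp [e7]; omega

end

section
variable {α : Type u} [LinearOrder α] {N B : ℕ} {δ δ₁ : ℕ → ℕ → ℕ} {tab : ℕ → Tr} {s s' : VS α}
variable {w : ℕ → ℕ} {n k M q : ℕ} {len fp link : ℕ → ℕ}

theorem aut_of_plain (hS : Sam w (· < 2 ^ B) n k len fp link δ) (hZ : Lrs w n M)
    (ht : Tgt w n k len fp M q) (hlq : len q = M) (hadd : Added w n k len fp M (k + 1) δ δ₁)
    (hcur : ∀ c, δ₁ (k + 1) c = 0) (hT : ETab B (k + 1) δ₁ tab s') (hk : s'.r .k = k + 1)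
    (hkn : k ≤ 2 * n + 1)
    (hlast : s'.r .last = k + 1) (hlen : s'.m .len = Function.update len (k + 1) (n + 1))
    (hfp : s'.m .fp = Function.update fp (k + 1) (n + 1))
    (hlink : s'.m .link = Function.update link (k + 1) q) : Aut w B (n + 1) s' := by
  refine ⟨δ₁, tab, ?_⟩
  rw [hk, hlast, hlen, hfp, hlink]
  refine ⟨hS.ext (Z := M) (q := q) ⟨hZ, ht, ?_, ?_, by simp, by simp, by simp, fun c _ => hcur c,
    hadd.newTrans⟩ hlq ?_, hT, ⟨by omega, le_rfl, ?_⟩, by simp, by omega⟩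
  · intro v hv; rw [Function.update_of_ne (by omega)]
  · intro v hv; rw [Function.update_of_ne (by omega)]
  · intro v hv; rw [Function.update_of_ne (by omega)]
  · simp; exact Suf.rfl le_rfl

/-- The three changes compose to `NewTrans`: chain states of length at least `M` lead to the new
prefix, those between `M'` and `M` led to `q` and now lead to the clone, the rest is untouched. The
row of the clone equals that of `q` because neither is on the chain below `M`. -/
theorem aut_of_clone {δ₂ δ₃ : ℕ → ℕ → ℕ} {M' : ℕ} (hS : Sam w (· < 2 ^ B) n k len fp link δ)
    (hZ : Lrs w n M)
    (ht : Tgt w n k len fp M q) (hlq : M < len q) (hadd : Added w n k len fp M (k + 1) δ δ₁)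
    (hcur : ∀ c, δ₁ (k + 1) c = 0) (h12 : ∀ v, v ≠ k + 2 → δ₂ v = δ₁ v)
    (hcopy : ∀ c < 2 ^ B, δ₂ (k + 2) c = δ₁ q c)
    (h23 : Redird w n k len fp M' M (k + 2) δ₂ δ₃)
    (hM' : ∀ v, Chain w n k len fp v → len v < M' → δ v (w n) ≠ q)
    (hM : ∀ v, Chain w n k len fp v → M' ≤ len v → len v < M → δ v (w n) = q)
    (hT : ETab B (k + 2) δ₃ tab s') (hk : s'.r .k = k + 2) (hkn : k ≤ 2 * n + 1)
    (hlast : s'.r .last = k + 1)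
    (hlen : s'.m .len = Function.update (Function.update len (k + 1) (n + 1)) (k + 2) M)
    (hfp : s'.m .fp = Function.update (Function.update fp (k + 1) (n + 1)) (k + 2) (fp q))
    (hl1 : s'.m .link (k + 1) = k + 2) (hl2 : s'.m .link (k + 2) = link q)
    (hlq' : s'.m .link q = k + 2) (hl : ∀ v ≤ k, v ≠ q → s'.m .link v = link v) :
    Aut w B (n + 1) s' := by
  have hqk := ht.le
  have hnk : ∀ v, k < v → ¬ Chain w n k len fp v := fun v hv h => by have := h.2.1; omega
  refine ⟨δ₃, tab, ?_⟩
  rw [hk, hlast, hlen, hfp]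
  refine ⟨hS.ext_clone (Z := M) (q := q) ⟨hZ, ht, ?_, ?_, ?_, ?_, hl1, fun c _ => ?_, ?_⟩
    hlq (by simp) (by simp) hl2 hlq' hl ?_, hT, ⟨by omega, by omega, ?_⟩, by simp, by omega⟩
  · intro v hv; rw [Function.update_of_ne (by omega), Function.update_of_ne (by omega)]
  · intro v hv; rw [Function.update_of_ne (by omega), Function.update_of_ne (by omega)]
  · simp
  · simp
  · rw [(h23 _ _).2 (.inr (.inl (hnk _ (by omega)))), h12 _ (by omega), hcur]
  · intro v c h1 h2 hc
    obtain ⟨a1, a2⟩ := hadd v c h2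
    obtain ⟨b1, b2⟩ := h23 v c
    rw [h12 v (by omega)] at b2
    refine ⟨fun d1 d2 d3 => ?_, fun d1 d2 d3 d4 => ?_, fun d1 d2 d3 d4 => ?_, fun d1 => ?_,
      fun d1 => ?_⟩
    · rw [b2 (.inr (.inr (.inr d3))), a1 d1 ⟨h1, h2, d2⟩ d3]
    · refine b1 d1 ⟨h1, h2, d2⟩ ?_ d3
      by_contra hc
      exact hM' v ⟨h1, h2, d2⟩ (by omega) (d1 ▸ d4)
    · have : len v < M' := by
        by_contra hc
        exact d4 (d1 ▸ hM v ⟨h1, h2, d2⟩ (by omega) d3)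
      rw [b2 (.inr (.inr (.inl this))), a2 (.inr (.inr d3))]
    · rw [b2 (.inl d1), a2 (.inl d1)]
    · have : ¬ Chain w n k len fp v := fun h => d1 h.2.2
      rw [b2 (.inr (.inl this)), a2 (.inr (.inl this))]
  · intro c hc
    rw [(h23 _ _).2 (.inr (.inl (hnk _ (by omega)))), hcopy c hc,
      (h23 _ _).2 (.inr (.inr (.inr hlq.le))), h12 q (by omega)]
  · simp; exact Suf.rfl le_rfl

-- Time plus `tE B` times the potential grows by at most a constant number of searches and `tE B`
-- per new edge. Going down to the longest repeated suffix uses the potential above `M`, redirecting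
-- uses that between `M'` and `M`, and the new potential is at most three more than what is left.
set_option maxHeartbeats 1000000 in
theorem wp_extendGood (hA : Aut w B n s) (hb : s.r .b = n) (hone : s.r .one = 1)
    (hG : w n < 2 ^ B) (hID : s.m .ID n = w n) (hH : ∀ e ≤ n, w e < 2 ^ B → HfOk s (w e))
    (hN : 12 * n + 20 ≤ N) :
    wp N extendGood s fun s' => Keep extVars extArrs s s' ∧ Aut w B (n + 1) s' ∧
      s.r .ec ≤ s'.r .ec ∧
      s'.clk + tE B * pot w (n + 1) (n + 2) + tE B * s.r .ec ≤
        s.clk + tE B * pot w n (n + 1) + tE B * s'.r .ec + 6 * tE B := by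
  obtain ⟨δ, tab, hS, hT, hch, hlast, hk2⟩ := hA
  generalize hk : s.r .k = k at *
  have hKB : 12 * (B + 2) + 30 = tE B := rfl
  -- The count of transitions bounds edge numbers linearly in `n`, even after the copying loop
  -- doubles them; this is what the hypothesis on `N` has to cover.
  obtain ⟨E, hE1, hE2⟩ := hT.exists_finset
  have hec := hS.card_le E hE2
  rw [hE1] at hec
  have hp1 := pot_le w n (n + 1)
  obtain ⟨Q, hQ⟩ : ∃ Q : VS α → Prop, Q = fun s' => Keep extVars extArrs s s' ∧ Aut w B (n + 1) s' ∧
      s.r .ec ≤ s'.r .ec ∧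
      s'.clk + tE B * pot w (n + 1) (n + 2) + tE B * s.r .ec ≤
        s.clk + tE B * pot w n (n + 1) + tE B * s'.r .ec + 6 * tE B := ⟨_, rfl⟩
  rw [← hQ]
  unfold extendGood
  simp only [wp_seq]
  refine wp_newState hk hb (by omega) (by omega) ?_
  intro s1 hk1 e1 e2 e3 e4 e5 e6 e7
  have hb1 : s1.r .b = n := by rw [hk1.r _ (by decide), hb]
  have hl1 : s1.r .last = s.r .last := hk1.r _ (by decide)
  have hID1 : s1.m .ID n = w n := by rw [hk1.m _ (by decide), hID]
  simp [wp_asg, Ex.Bd, Ex.eval, e2, hb1, hl1, hID1]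
  obtain ⟨s2, hs2⟩ : ∃ s2, s2 = ((s1.set .p (s.r .last)).set .c (w n)).set .tgt (k + 1) := ⟨_, rfl⟩
  rw [← hs2]
  have hk12 : Keep [.p, .c, .tgt] [] s1 s2 := by
    rw [hs2]
    refine ⟨fun z hz => ?_, fun a ha => rfl, rfl, rfl, rfl⟩
    simp at hz; simp [hz]
  have hk02 : Keep extVars extArrs s s2 := hk1.trans hk12
  have hm2 : ∀ a, s2.m a = s1.m a := fun a => hk12.m a (by simp)
  have hp2 : s2.r .p = s.r .last := by simp [hs2]
  have hc2 : s2.clk = s.clk + 11 := by simp [hs2, e7]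
  have hec2 : s2.r .ec = s.r .ec := by
    rw [hk12.r _ (by decide), hk1.r _ (by decide)]
  have hH2 : ∀ e ≤ n, w e < 2 ^ B → HfOk s2 (w e) := fun e h1 h2 =>
    (hH e h1 h2).congr (hk02.m _ (by decide)) (hk02.m _ (by decide))
  have hT2 : ETab B (k + 1) (fun v => if v ≤ k then δ v else fun _ => 0)
      (Function.update tab (k + 1) .nil) s2 := by
    refine hT.grow ?_ ?_ ?_ ?_ ?_ hec2 (fun v hv => if_pos hv) fun c hc => by simp
    · intro a ha h1 h2
      rw [hm2]
      simp [edgeArrs] at ha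
      refine hk1.m _ ?_
      rcases ha with rfl | rfl | rfl | rfl | rfl | rfl | rfl <;> simp at h1 h2 ⊢
    · intro v hv; rw [hm2, e5, Function.update_of_ne (by omega)]
    · intro v hv; rw [hm2, e6, Function.update_of_ne (by omega)]
    · rw [hm2, e5, Function.update_self]
    · rw [hm2, e6, Function.update_self]
  refine wp_mono (wp_addLoop hS hG (t := k + 1) hT2 (by omega) (fun v hv => if_pos hv) (by simp [hs2])
    (by simp [hs2]) (by omega) ?_ (hp2 ▸ hch) (hp2 ▸ hlast) (hH2 n le_rfl hG) (by omega)
    (by omega)) ?_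
  · intro v hv; rw [hm2, hk1.m _ (by decide)]
  rintro s3 ⟨hk23, δ₁, tab₁, hT3, hadd, hnew, hz3, hp3, ⟨hec3a, hec3b⟩, hclk3⟩
  rw [hc2] at hclk3
  rw [hec2] at hec3a hec3b
  have hk03 : Keep extVars extArrs s s3 := hk02.trans hk23
  have hcur3 : s3.r .cur = k + 1 := by
    rw [hk23.r _ (by decide), hk12.r _ (by decide), e2]
  have hk3 : s3.r .k = k + 1 := by
    rw [hk23.r _ (by decide), hk12.r _ (by decide), e1]
  have hone3 : s3.r .one = 1 := by rw [hk03.r _ (by decide), hone]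
  have hb3 : s3.r .b = n := by rw [hk03.r _ (by decide), hb]
  have hlen3 : s3.m .len = Function.update (s.m .len) (k + 1) (n + 1) := by
    rw [hk23.m _ (by decide), hm2, e3]
  have hfp3 : s3.m .fp = Function.update (s.m .fp) (k + 1) (n + 1) := by
    rw [hk23.m _ (by decide), hm2, e4]
  have hlink3 : s3.m .link = s.m .link := by
    rw [hk23.m _ (by decide), hm2, hk1.m _ (by decide)]
  have hδ1 : ∀ v, k < v → ∀ c, δ₁ v c = 0 := fun v hv c => by
    rw [hnew v hv, if_neg (by omega)]
  obtain ⟨M, hM⟩ : ∃ M, M = bnd (s.m .len) (s3.r .p) := ⟨_, rfl⟩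
  rw [← hM] at hadd hz3 hec3b hclk3
  have hecm := Nat.mul_le_mul_left (tE B) hec3a
  rw [Nat.mul_add, Nat.mul_one] at hclk3
  -- Both cases without a clone end here: a target of exactly the right length, and the root when no
  -- state on the chain has a transition.
  have plain : ∀ (q : ℕ) (s5 : VS α), Lrs w n M → Tgt w n k (s.m .len) (s.m .fp) M q →
      s.m .len q = M → Keep [.q, .lq, .lp, .last] [.link] s3 s5 → s5.r .last = k + 1 →
      s5.m .link = Function.update (s.m .link) (k + 1) q → s5.clk ≤ s3.clk + 10 → Q s5 := by
    intro q s5 hZ ht hlq hk5 hl5 hlink5 hclk5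
    have hec5 : s5.r .ec = s3.r .ec := hk5.r _ (by decide)
    have hpot : pot w (n + 1) (n + 2) ≤ 3 + pot w n M := by
      obtain ⟨e, he, hs⟩ := hZ.occ
      exact hZ.pot_succ he hs fun j _ h _ => h.le
    have hmul := Nat.mul_le_mul_left (tE B) hpot
    rw [Nat.mul_add] at hmul
    rw [hQ]
    refine ⟨hk03.trans hk5, aut_of_plain hS hZ ht hlq hadd (hδ1 _ (by omega))
      (hT3.congr (s' := s5) ?_ hec5) ?_ hk2 hl5 ?_ ?_ hlink5, ?_, ?_⟩
    · intro a ha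
      refine hk5.m a ?_
      simp [edgeArrs] at ha ⊢
      rintro rfl; simp at ha
    · rw [hk5.r _ (by decide), hk3]
    · rw [hk5.m _ (by decide), hlen3]
    · rw [hk5.m _ (by decide), hfp3]
    · omega
    · rw [hec5]; omega
  simp only [wp_ite, wp_seq, wp_asg, wp_put]
  refine ⟨fun hp => ?_, fun hp => ?_⟩
  · simp only [Tst.Holds] at hp
    obtain ⟨hchp, hres⟩ := hp3 (by omega)
    have hpk := hchp.2.1
    have hbp : M = s.m .len (s3.r .p) + 1 := by rw [hM, bnd_of_pos hchp.1]
    obtain ⟨h0, het⟩ := hT3.find_ne hchp.1 (by omega) hres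
    have hδp : δ₁ (s3.r .p) (w n) = δ (s3.r .p) (w n) :=
      (hadd _ _ hpk).2 (.inr (.inr (by omega)))
    rw [hδp] at h0 het
    have hZ : Lrs w n M := by
      rw [hbp]
      exact hS.lrs hG hchp.1 hpk hchp.2.2 h0 fun v h1 h2 h3 h4 => hz3 v ⟨h1, h2, h3⟩ (by omega)
    have ht := hS.tgt hG hchp.1 hpk hchp.2.2 h0
    rw [← hbp] at ht
    generalize hq : δ (s3.r .p) (w n) = q at *
    have hqk := ht.le
    have hq1 := ht.pos
    have hlq3 : s3.m .len q = s.m .len q := by rw [hlen3, Function.update_of_ne (by omega)]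
    have hlp3 : s3.m .len (s3.r .p) = s.m .len (s3.r .p) := by
      rw [hlen3, Function.update_of_ne (by omega)]
    have hMn := hZ.le
    simp [Ex.Bd, Ex.eval, Tst.Holds, het, hlq3, hlp3, ← hbp, hcur3]
    refine ⟨by omega, fun hlq => ?_, fun hlq => ?_⟩
    · refine plain q _ hZ ht hlq ?_ ?_ ?_ ?_
      · refine ⟨fun z hz => ?_, fun a ha => ?_, rfl, rfl, rfl⟩
        · simp at hz; simp [hz]
        · simp at ha; simp [ha]
      · simp
      · simp [hlink3]
      · simp
    · have hlq' : M < s.m .len q := by have := ht.le_len; omega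
      refine wp_cloneState (k := k + 1) (q := q) (lp := M) (cur := k + 1) (by simp [hk3]) (by simp)
        (by simp) (by simp [hcur3]) (by omega) (by omega) (by omega) (by omega) ?_
      intro s4 hk4 f1 f2 f3 f4 f5 f6 f7 f8 f9 f10 f11 f12 f13
      simp only [VS.tick_m, VS.set_m] at f5 f6 f7 f8 f9 f12
      simp only [VS.tick_clk, VS.set_clk] at f13
      have hk34 : Keep [.k, .r, .x, .e, .v, .q, .lq, .lp] [.len, .fp, .link, .tr, .head] s3 s4 := by
        refine Keep.trans (vs := [.q, .lq, .lp]) (as := []) ⟨fun z hz => ?_, fun a ha => ?_, ?_, ?_, ?_⟩ hk4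
        · simp at hz; simp [hz]
        all_goals rfl
      have hk04 : Keep extVars extArrs s s4 := hk03.trans hk34
      have hec4 : s4.r .ec = s3.r .ec := hk34.r _ (by decide)
      have hT4 : ETab B (k + 2) δ₁ (Function.update tab₁ (k + 2) .nil) s4 := by
        refine hT3.grow ?_ ?_ ?_ ?_ ?_ hec4 (fun v hv => rfl) fun c hc => hδ1 _ (by omega) c
        · intro a ha h1 h2
          simp [edgeArrs] at ha
          refine hk34.m _ ?_
          rcases ha with rfl | rfl | rfl | rfl | rfl | rfl | rfl <;> simp at h1 h2 ⊢
        · intro v hv; rw [f7, Function.update_of_ne (by omega)]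
        · intro v hv; rw [f8, Function.update_of_ne (by omega)]
        · rw [f7, Function.update_self]
        · rw [f8, Function.update_self]
      have hH4 : ∀ e ≤ n, w e < 2 ^ B → HfOk s4 (w e) := fun e h1 h2 =>
        (hH e h1 h2).congr (hk04.m _ (by decide)) (hk04.m _ (by decide))
      refine wp_mono (wp_copyLoop hT4 (r := k + 2) (q := q) (by omega) le_rfl hq1 (by omega)
        f3 f4 (fun c hc => hδ1 _ (by omega) c) ?_ (by omega)) ?_
      -- A letter with a transition from `q` has occurred in the word, so the tables of halves reach
      -- it.
      · intro c hc hne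
        by_cases hcw : c = w n
        · rw [hcw]; exact hH4 n le_rfl hG
        · rw [(hadd q c hqk).2 (.inl hcw)] at hne
          obtain ⟨e, he, -, rfl⟩ := hS.t_occ q c hq1 hqk hc hne
          exact hH4 e he.le hc
      rintro s5 ⟨hk45, ⟨δ₂, tab₂, hT5, h12, hcopy⟩, hec5, hclk5⟩
      rw [hec4] at hec5 hclk5
      have hk05 : Keep extVars extArrs s s5 := hk04.trans hk45
      have hb5 : s5.r .b = n := by rw [hk05.r _ (by decide), hb]
      have hID5 : s5.m .ID n = w n := by rw [hk05.m _ (by decide), hID]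
      simp only [hb5, hID5]
      have hpp : s5.r .p = s3.r .p := by rw [hk45.r _ (by decide), hk34.r _ (by decide)]
      have hlink5 : s5.m .link = s4.m .link := hk45.m _ (by decide)
      have hfp3q : s3.m .fp q = s.m .fp q := by rw [hfp3, Function.update_of_ne (by omega)]
      refine wp_mono (wp_redirLoop (s := s5.set .c (w n)) hS hG (r := k + 2) (q := q) (Z := M)
        (hT5.congr (fun _ _ => rfl) (by simp)) (by omega) hZ ht hlq' ?_ (by simp) ?_ ?_ (by omega) ?_
        ?_ ?_ ?_ (by omega)) ?_
      · intro v hv hlt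
        rw [h12 v (by have := hv.2.1; omega), (hadd v _ hv.2.1).2 (.inr (.inr hlt))]
      · simp; rw [hk45.r _ (by decide), hk4.r _ (by decide)]; simp
      · simp; rw [hk45.r _ (by decide), f2]
      · intro v hv hlt
        have := hv.2.1
        simp only [VS.set_m, hlink5]
        rw [f12 v (by omega) (by rintro rfl; omega) (by omega), hlink3]
      · simp [hpp, hchp]
      · simp [hpp, hbp]
      · exact (hH n le_rfl hG).congr (by simp [hk05.m .hf (by decide)])
          (by simp [hk05.m .pr (by decide)])
      rintro s6 ⟨hk56, δ₃, M', hT6, h23, hMa, hMb, hclk6⟩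
      have hk56' : Keep [.go, .v, .p, .x, .kk, .y, .sd, .res, .kx, .tgt, .c] [.et] s5 s6 := by
        refine Keep.trans (vs := [.c]) (as := []) ⟨fun z hz => ?_, fun a ha => ?_, ?_, ?_, ?_⟩ hk56
        · simp at hz; simp [hz]
        all_goals rfl
      have hk06 : Keep extVars extArrs s s6 := hk05.trans hk56'
      have hcur6 : s6.r .cur = k + 1 := by
        rw [hk56'.r _ (by decide), hk45.r _ (by decide), hk34.r _ (by decide), hcur3]
      have hec6 : s6.r .ec = s5.r .ec := hk56'.r _ (by decide)
      have hpot := hS.pot_clone hZ hlq' hG hMa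
      have hmul := Nat.mul_le_mul_left (tE B) hpot
      rw [Nat.mul_add] at hmul
      rw [Nat.mul_add, Nat.mul_one] at hclk6
      simp only [hcur6]
      have hlink6 : s6.m .link = s4.m .link := by rw [hk56'.m _ (by decide), hlink5]
      rw [hQ]
      refine ⟨hk06.trans (s'' := s6.set .last (k + 1)) (vs' := [.last]) (as' := [])
        ⟨fun z hz => ?_, fun a ha => rfl, rfl, rfl, rfl⟩, aut_of_clone hS hZ ht hlq' hadd
        (hδ1 _ (by omega)) h12 hcopy h23 hMb hMa (hT6.congr (fun _ _ => rfl) (by simp)) ?_ hk2 (by simp)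
        ?_ ?_ ?_ ?_ ?_ ?_, ?_, ?_⟩
      · simp at hz; simp [hz]
      · simp; rw [hk56'.r _ (by decide), hk45.r _ (by decide), f1]
      · simp only [VS.set_m]
        rw [hk56'.m _ (by decide), hk45.m _ (by decide), f5, hlen3]
      · simp only [VS.set_m]
        rw [hk56'.m _ (by decide), hk45.m _ (by decide), f6, hfp3q, hfp3]
      · simp only [VS.set_m, hlink6, f11]
      · simp only [VS.set_m, hlink6, f9, hlink3]
      · simp only [VS.set_m, hlink6, f10]
      · intro v hv hvq
        simp only [VS.set_m, hlink6]
        rw [f12 v (by omega) hvq (by omega), hlink3]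
      · simp [hec6]; omega
      · simp [hec6] at hclk6 ⊢; omega
  · simp only [Tst.Holds, Nat.not_lt, Nat.le_zero] at hp
    have hM0 : M = 0 := by rw [hM, hp]; rfl
    have hZ : Lrs w n M := by
      rw [hM0]
      exact hS.lrs_zero hG fun v h1 h2 h3 => hz3 v ⟨h1, h2, h3⟩ (by omega)
    simp [Ex.Bd, Ex.eval, hcur3, hone3]
    refine plain 1 _ hZ (hM0 ▸ hS.tgt_one) (by rw [hM0]; exact hS.root) ?_ ?_ ?_ ?_
    · refine ⟨fun z hz => ?_, fun a ha => ?_, rfl, rfl, rfl⟩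
      · simp at hz; simp [hz]
      · simp at ha; simp [ha]
    · simp
    · simp [hlink3]
    · simp

end

/-! ### Reading symbols and searching for overlapping occurrences -/

/-- All variables outside `vs`, all arrays outside `as`, and the output are unchanged. -/
structure KeepR {α : Type u} (vs : List Var) (as : List Arr) (s s' : VS α) : Prop where
  r : ∀ x, x ∉ vs → s'.r x = s.r x
  m : ∀ a, a ∉ as → s'.m a = s.m a
  out : s'.out = s.out

theorem Keep.toR {α : Type u} {vs : List Var} {as : List Arr} {s s' : VS α}
    (h : Keep vs as s s') : KeepR vs as s s' := ⟨h.r, h.m, h.out⟩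

theorem KeepR.trans {α : Type u} {vs vs' vs'' : List Var} {as as' as'' : List Arr}
    {s s' s'' : VS α} (h : KeepR vs as s s') (h' : KeepR vs' as' s' s'')
    (h1 : vs ⊆ vs'' := by decide) (h2 : vs' ⊆ vs'' := by decide)
    (h3 : as ⊆ as'' := by decide) (h4 : as' ⊆ as'' := by decide) : KeepR vs'' as'' s s'' where
  r x hx := (h'.r x fun h => hx (h2 h)).trans (h.r x fun h => hx (h1 h))
  m a ha := (h'.m a fun h => ha (h4 h)).trans (h.m a fun h => ha (h3 h))
  out := h'.out.trans h.out

theorem KeepR.tick {α : Type u} {vs : List Var} {as : List Arr} {s s' : VS α}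
    (h : KeepR vs as s s') : KeepR vs as s s'.tick := ⟨h.r, h.m, h.out⟩

/-- The first `i` symbols have been received and numbered. -/
structure Inp {α : Type u} [LinearOrder α] (T : List α) (s : VS α) : Prop where
  i_le : s.r .i ≤ T.length
  text : s.text = T.take (s.r .i)
  rest : s.rest = T.drop (s.r .i)
  one : s.r .one = 1
  dict : Dict T (s.r .i) s

/-- The arrays of the dictionary. -/
def dictArrs : List Arr := [.L, .R, .lev, .key, .ID, .hf, .pr]

/-- Make sure that the symbol at position `b + l` has been received if there is one. -/
def need : Cmd :=
  .j ::= .add .b .l ;; .ok ::= .num 1 ;;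
  .ite (.lt .j .i) .skip
    (.read .ok ;; .ite (.pos .ok) (numSym ;; .i ::= .off .i 1) .skip)

def needVars : List Var := [.j, .ok, .x, .d, .res, .y, .cnt, .kk, .c, .rt, .p, .e, .i]

def needArrs : List Arr := [.stk, .key, .lev, .L, .R, .hf, .pr, .ID]

section
variable {α : Type u} [LinearOrder α] {N : ℕ} {s s' : VS α} {T : List α}

theorem Inp.congr (h : Inp T s) {vs : List Var} {as : List Arr} (hk : Keep vs as s s')
    (hv : ∀ v ∈ [Var.i, .one, .rt, .cnt], v ∉ vs) (ha : ∀ a ∈ dictArrs, a ∉ as) : Inp T s' := by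
  have e1 := hk.r .i (hv _ (by decide))
  have e2 := hk.r .one (hv _ (by decide))
  refine ⟨by rw [e1]; exact h.i_le, by rw [e1, hk.text, h.text], by rw [e1, hk.rest, h.rest],
    by rw [e2, h.one], ?_⟩
  rw [e1]
  exact h.dict.congr (fun a ha' => hk.m a (ha a ha')) (hk.r _ (hv _ (by decide)))
    (hk.r _ (hv _ (by decide)))

/-- The time to receive and number a symbol. -/
def tS {α : Type u} [LinearOrder α] (T : List α) : ℕ := 80 * (Nat.log 2 T.toFinset.card + 1) + 70

/-- The next symbol is received only if position `b + l` is not yet known. So `i` never runs more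
than one ahead of the matched part, and failure means that the text ends exactly there. The cost of
numbering is charged to `i`. -/
theorem wp_need (hI : Inp T s) (hj : s.r .b + s.r .l ≤ s.r .i) (hN : 2 * T.length + 4 ≤ N) :
    wp N need s fun s' => KeepR needVars needArrs s s' ∧ Inp T s' ∧
      (∀ j < s.r .i, s'.m .ID j = s.m .ID j) ∧ s.r .i ≤ s'.r .i ∧
      ((s'.r .ok = 1 ∧ s'.r .i = max (s.r .i) (s.r .b + s.r .l + 1)) ∨
        (s'.r .ok = 0 ∧ s'.r .i = s.r .i ∧ s.r .i = s.r .b + s.r .l ∧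
          T.length = s.r .b + s.r .l)) ∧
      s'.clk + tS T * s.r .i ≤ s.clk + tS T * s'.r .i + 10 := by
  have hiT := hI.i_le
  have htS : tS T = 80 * (Nat.log 2 T.toFinset.card + 1) + 70 := rfl
  obtain ⟨Q, hQ⟩ : ∃ Q : VS α → Prop, Q = fun s' => KeepR needVars needArrs s s' ∧ Inp T s' ∧
      (∀ j < s.r .i, s'.m .ID j = s.m .ID j) ∧ s.r .i ≤ s'.r .i ∧
      ((s'.r .ok = 1 ∧ s'.r .i = max (s.r .i) (s.r .b + s.r .l + 1)) ∨
        (s'.r .ok = 0 ∧ s'.r .i = s.r .i ∧ s.r .i = s.r .b + s.r .l ∧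
          T.length = s.r .b + s.r .l)) ∧
      s'.clk + tS T * s.r .i ≤ s.clk + tS T * s'.r .i + 10 := ⟨_, rfl⟩
  rw [← hQ]
  have stay : ∀ s2 : VS α, Keep [.j, .ok] [] s s2 → s2.clk ≤ s.clk + 10 →
      ((s2.r .ok = 1 ∧ s.r .b + s.r .l < s.r .i) ∨
      (s2.r .ok = 0 ∧ s.r .i = s.r .b + s.r .l ∧ T.length = s.r .b + s.r .l)) → Q s2 := by
    intro s2 hk hclk hor
    have hi2 : s2.r .i = s.r .i := hk.r _ (by decide)
    rw [hQ]
    refine ⟨⟨fun z hz => hk.r z ?_, fun a ha => hk.m a (by simp), hk.out⟩,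
      hI.congr hk (by decide) (by decide), fun j _ => by rw [hk.m _ (by simp)], hi2.ge, ?_, ?_⟩
    · simp [needVars] at hz ⊢; simp [hz]
    · rcases hor with ⟨h1, h2⟩ | ⟨h1, h2, h3⟩
      · exact .inl ⟨h1, by omega⟩
      · exact .inr ⟨h1, hi2, h2, h3⟩
    · rw [hi2]; omega
  unfold need
  simp [wp_seq, wp_asg, wp_ite, wp_skip, wp_read, Ex.Bd, Ex.eval, Tst.Holds]
  refine ⟨by omega, by omega, fun hlt => stay _ ?_ ?_ ?_, fun hge => ?_⟩
  · refine ⟨fun z hz => ?_, fun a ha => rfl, rfl, rfl, rfl⟩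
    simp at hz; simp [hz]
  · simp
  · simp [hlt]
  have hieq : s.r .i = s.r .b + s.r .l := by omega
  rcases hrest : s.rest with _ | ⟨c, rest⟩
  · have hr : ∀ s2 : VS α, s2.rest = [] → s2.receive .ok = s2.set .ok 0 := by
      intro s2 h2; simp [VS.receive, h2]
    rw [hr _ (by simp [hrest])]
    have hlen : T.length ≤ s.r .i := by
      have := hI.rest
      rw [hrest] at this
      exact List.drop_eq_nil_iff.1 this.symm
    simp
    refine stay _ ?_ ?_ ?_
    · refine ⟨fun z hz => ?_, fun a ha => rfl, rfl, rfl, rfl⟩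
      simp at hz; simp [hz]
    · simp
    · right; simp; omega
  · have hr : ∀ s2 : VS α, s2.rest = c :: rest →
        s2.receive .ok = { s2.set .ok 1 with text := s2.text ++ [c], rest := rest } := by
      intro s2 h2; simp [VS.receive, h2]
    rw [hr _ (by simp [hrest])]
    have hdrop := hI.rest
    rw [hrest] at hdrop
    have hlt : s.r .i < T.length := by
      by_contra hc
      rw [List.drop_eq_nil_of_le (by omega)] at hdrop
      simp at hdrop
    rw [List.drop_eq_getElem_cons hlt] at hdrop
    injection hdrop with hc hrest'
    generalize hs2 : (VS.mk _ _ _ _ _ _ : VS α) = s2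
    have hk2 : KeepR [.j, .ok] [] s s2 := by
      rw [← hs2]
      refine ⟨fun z hz => ?_, fun a ha => rfl, rfl⟩
      simp at hz; simp [hz]
    have hi2 : s2.r .i = s.r .i := hk2.r _ (by decide)
    have ht2 : s2.text = T.take (s.r .i + 1) := by
      rw [← hs2, List.take_succ_eq_append_getElem hlt, ← hI.text, hc]
      simp
    have hr2 : s2.rest = T.drop (s.r .i + 1) := by rw [← hs2]; exact hrest'
    have hok2 : s2.r .ok = 1 := by rw [← hs2]; simp
    have hclk2 : s2.clk ≤ s.clk + 4 := by rw [← hs2]; simp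
    simp only [hok2]
    refine ⟨fun _ => ?_, fun h => absurd h Nat.one_ne_zero⟩
    have hD2 : Dict T (s.r .i) s2.tick := hI.dict.congr (fun a _ => hk2.m a (by simp))
      (hk2.r _ (by decide)) (hk2.r _ (by decide))
    refine wp_mono (wp_numSym hD2 hi2 hlt ht2 ?_ hN) ?_
    · exact (hk2.r _ (by decide)).trans hI.one
    rintro s3 ⟨hk3, hD3, hID3, hclk3⟩
    have hi3 : s3.r .i = s.r .i := by rw [hk3.r _ (by decide)]; exact hi2
    have hone3 : s3.r .one = 1 := by
      rw [hk3.r _ (by decide)]; exact (hk2.r _ (by decide)).trans hI.one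
    simp at hclk3
    simp only [hi3]
    refine ⟨by omega, ?_⟩
    rw [hQ]
    have hmul : tS T * (s.r .i + 1) = tS T * s.r .i + tS T := by ring
    refine ⟨⟨fun z hz => ?_, fun a ha => ?_, ?_⟩, ⟨?_, ?_, ?_, ?_, ?_⟩, fun j hj => ?_, ?_, ?_, ?_⟩
    · simp [needVars] at hz
      simp only [VS.set_r, hz, if_false]
      rw [hk3.r _ (by simp [hz]), VS.tick_r, hk2.r _ (by simp [hz])]
    · simp [needArrs] at ha
      simp only [VS.set_m]
      rw [hk3.m _ (by simp [ha]), VS.tick_m, hk2.m _ (by simp)]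
    · simp only [VS.set_out]; rw [hk3.out, VS.tick_out, hk2.out]
    · simp; omega
    · simp; rw [hk3.text]; exact ht2
    · simp; rw [hk3.rest]; exact hr2
    · simp [hone3]
    · simp only [VS.set_r, if_true]
      exact hD3.congr (fun a _ => rfl) (by simp) (by simp)
    · simp only [VS.set_m]
      rw [hID3 j hj, VS.tick_m, hk2.m _ (by simp)]
    · simp
    · left
      simp
      refine ⟨?_, by omega⟩
      rw [hk3.r _ (by decide)]; exact hok2
    · simp [hmul]; omega

end

/-! ### Borders, and the search for overlapping occurrences -/

/-- The prefix of length `g` of the word `u` from position `b` on is a proper border of its prefix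
of length `t`. -/
def Bor {β : Type u} (u : ℕ → β) (b t g : ℕ) : Prop :=
  g < t ∧ ∀ i < g, u (b + i) = u (b + (t - g) + i)

section
variable {β : Type u} {u : ℕ → β} {b t f g : ℕ}

theorem Bor.zero (h : 0 < t) : Bor u b t 0 := ⟨h, fun _ h => absurd h (Nat.not_lt_zero _)⟩

theorem Bor.of_lt (hf : Bor u b t f) (hg : Bor u b t g) (h : g < f) : Bor u b f g := by
  refine ⟨h, fun i hi => ?_⟩
  rw [hg.2 i hi, show b + (f - g) + i = b + (f - g + i) by omega, hf.2 _ (by omega)]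
  have := hf.1
  congr 1; omega

theorem Bor.trans (hf : Bor u b t f) (hg : Bor u b f g) : Bor u b t g := by
  have h1 := hf.1
  have h2 := hg.1
  refine ⟨by omega, fun i hi => ?_⟩
  rw [hg.2 i hi, show b + (f - g) + i = b + (f - g + i) by omega, hf.2 _ (by omega)]
  congr 1; omega

theorem Bor.succ (h : Bor u b t f) (hu : u (b + f) = u (b + t)) : Bor u b (t + 1) (f + 1) := by
  have h1 := h.1
  refine ⟨by omega, fun i hi => ?_⟩
  rcases Nat.lt_succ_iff_lt_or_eq.1 hi with hi | rfl
  · rw [h.2 i hi]; congr 1; omega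
  · rw [hu]; congr 1; omega

theorem Bor.pred (h : Bor u b (t + 1) (g + 1)) : Bor u b t g ∧ u (b + g) = u (b + t) := by
  have h1 := h.1
  refine ⟨⟨by omega, fun i hi => ?_⟩, ?_⟩
  · rw [h.2 i (by omega)]; congr 1; omega
  · rw [h.2 g (by omega)]; congr 1; omega

/-- The table contains the lengths of the longest proper borders of the prefixes of length at
most `t`. -/
def PiOk (u : ℕ → β) (b t : ℕ) (P : ℕ → ℕ) : Prop :=
  ∀ x, 1 ≤ x → x ≤ t → Bor u b x (P x) ∧ ∀ g, Bor u b x g → g ≤ P x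

theorem PiOk.update {P : ℕ → ℕ} (h : PiOk u b t P) (h1 : Bor u b (t + 1) f)
    (h2 : ∀ g, Bor u b (t + 1) g → g ≤ f) : PiOk u b (t + 1) (Function.update P (t + 1) f) := by
  intro x hx1 hx2
  rcases hx2.eq_or_lt with rfl | hx2
  · simp only [Function.update_self]; exact ⟨h1, h2⟩
  · rw [Function.update_of_ne (by omega)]; exact h x hx1 (by omega)

end

/-- Extend the table of borders up to length `m`. -/
def piLoop : Cmd :=
  .while (.lt .t .m) (
    .xx ::= .add .b .f ;; .xx ::= .get .ID .xx ;; .yy ::= .add .b .t ;; .yy ::= .get .ID .yy ;;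
    .ite (.eq .xx .yy) (.f ::= .off .f 1 ;; .t ::= .off .t 1 ;; .put .PI .t .f)
      (.ite (.pos .f) (.f ::= .get .PI .f) (.t ::= .off .t 1 ;; .put .PI .t .f)))

/-- The variable `f` contains a border of the prefix of length `t` such that no longer border can be
extended. -/
def BorNext {β : Type u} (u : ℕ → β) (b t f : ℕ) : Prop :=
  Bor u b t f ∧ ∀ g, f < g → Bor u b t g → u (b + g) ≠ u (b + t)

section
variable {α : Type u} [LinearOrder α] {N : ℕ} {s s' : VS α} {T : List α}

/-- The border table is extended only as far as a shift needs it, since the final length of the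
phrase is unknown. Falling back to a shorter border is paid for by the decrease of `f`, extending
the table by the growth of `t`; this is the role of `10 * f` and `20 * t` in the time bound. -/
theorem wp_piLoop {i b : ℕ} (hD : Dict T i s) (hb : s.r .b = b) (hm : b + s.r .m ≤ i)
    (hiN : i ≤ N)
    (h1 : PiOk (T[·]?) b (s.r .t) (s.m .PI)) (h2 : BorNext (T[·]?) b (s.r .t) (s.r .f)) :
    wp N piLoop s fun s' => Keep [.xx, .yy, .f, .t] [.PI] s s' ∧
      PiOk (T[·]?) b (s'.r .t) (s'.m .PI) ∧ BorNext (T[·]?) b (s'.r .t) (s'.r .f) ∧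
      s'.r .t = max (s.r .t) (s.r .m) ∧
      s'.clk + 10 * s'.r .f + 20 * s.r .t ≤ s.clk + 10 * s.r .f + 20 * s'.r .t + 1 := by
  obtain ⟨I, hI⟩ : ∃ I : VS α → Prop, I = fun s' => Keep [.xx, .yy, .f, .t] [.PI] s s' ∧
      PiOk (T[·]?) b (s'.r .t) (s'.m .PI) ∧ BorNext (T[·]?) b (s'.r .t) (s'.r .f) ∧
      s.r .t ≤ s'.r .t ∧ s'.r .t ≤ max (s.r .t) (s.r .m) ∧
      s'.clk + 10 * s'.r .f + 20 * s.r .t ≤ s.clk + 10 * s.r .f + 20 * s'.r .t := ⟨_, rfl⟩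
  unfold piLoop
  refine wp_while I (fun s' => 2 * (s.r .m - s'.r .t) + s'.r .f) ?_ ?_ ?_
  · rw [hI]; exact ⟨Keep.refl _ _ _, h1, h2, le_rfl, by omega, by omega⟩
  · intro s3 h3 hlt
    rw [hI] at h3
    obtain ⟨hk, hP, hB, ht1, ht2, hclk⟩ := h3
    simp only [Tst.Holds] at hlt
    have hm3 : s3.r .m = s.r .m := hk.r _ (by decide)
    have hb3 : s3.r .b = b := by rw [hk.r _ (by decide), hb]
    have hf := hB.1.1
    have hID : s3.m .ID = s.m .ID := hk.m _ (by decide)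
    have hiff := hD.id_eq (j := b + s3.r .f) (k := b + s3.r .t) (by omega) (by omega)
    simp [wp_seq, wp_asg, wp_ite, wp_put, Ex.Bd, Ex.eval, Tst.Holds, hb3, hID, hiff]
    refine ⟨by omega, by omega, fun heq => ⟨by omega, by omega, ?_, ?_⟩,
      fun hne => ⟨fun hpos => ⟨?_, ?_⟩, fun hpos => ⟨by omega, ?_, ?_⟩⟩⟩
    · rw [hI]
      have hsucc : Bor (T[·]?) b (s3.r .t + 1) (s3.r .f + 1) := hB.1.succ heq
      have hmax : ∀ g, Bor (T[·]?) b (s3.r .t + 1) g → g ≤ s3.r .f + 1 := by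
        intro g hg
        rcases g with _ | g
        · omega
        obtain ⟨hg1, hg2⟩ := hg.pred
        by_contra hc
        exact hB.2 g (by omega) hg1 hg2
      refine ⟨hk.trans (vs' := [.xx, .yy, .f, .t]) (as' := [.PI]) (s'' := _) ?_, ?_, ?_, ?_, ?_, ?_⟩
      · refine ⟨fun z hz => ?_, fun a ha => ?_, rfl, rfl, rfl⟩
        · simp at hz; simp [hz]
        · simp at ha; simp [ha]
      · simp; exact hP.update hsucc hmax
      · simp
        exact ⟨hsucc, fun g hg hg2 => absurd (hmax g hg2) (by omega)⟩
      · simp; omega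
      · simp; omega
      · simp; omega
    · omega
    · rw [hI]
      obtain ⟨hP1, hP2⟩ := hP (s3.r .f) hpos (by omega)
      have := hP1.1
      refine ⟨hk.trans (vs' := [.xx, .yy, .f]) (as' := []) (s'' := _) ?_, ?_, ?_, ?_, ?_, ?_⟩
      · refine ⟨fun z hz => ?_, fun a ha => ?_, rfl, rfl, rfl⟩
        · simp at hz; simp [hz]
        · simp
      · simp; exact hP
      · simp
        refine ⟨hB.1.trans hP1, fun g hg hg2 => ?_⟩
        rcases lt_trichotomy g (s3.r .f) with h | rfl | h
        · exact absurd (hP2 g (hB.1.of_lt hg2 h)) (by omega)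
        · exact hne
        · exact hB.2 g h hg2
      · simp; omega
      · simp; omega
      · simp; omega
    · have := (hP (s3.r .f) hpos (by omega)).1.1
      omega
    · rw [hI]
      have hmax : ∀ g, Bor (T[·]?) b (s3.r .t + 1) g → g ≤ 0 := by
        intro g hg
        rcases g with _ | g
        · omega
        obtain ⟨hg1, hg2⟩ := hg.pred
        rcases Nat.eq_zero_or_pos g with rfl | hg0
        · rw [hpos] at hne; exact absurd hg2 hne
        · exact absurd hg2 (hB.2 g (by omega) hg1)
      refine ⟨hk.trans (vs' := [.xx, .yy, .t]) (as' := [.PI]) (s'' := _) ?_, ?_, ?_, ?_, ?_, ?_⟩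
      · refine ⟨fun z hz => ?_, fun a ha => ?_, rfl, rfl, rfl⟩
        · simp at hz; simp [hz]
        · simp at ha; simp [ha]
      · simp [hpos]; exact hP.update (Bor.zero (by omega)) hmax
      · simp [hpos]
        exact ⟨Bor.zero (by omega), fun g hg hg2 => absurd (hmax g hg2) (by omega)⟩
      · simp; omega
      · simp; omega
      · simp; omega
    · omega
  · intro s3 h3 hlt
    rw [hI] at h3
    obtain ⟨hk, hP, hB, ht1, ht2, hclk⟩ := h3
    simp only [Tst.Holds, Nat.not_lt] at hlt
    have hm3 : s3.r .m = s.r .m := hk.r _ (by decide)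
    refine ⟨hk.tick, hP, hB, ?_, ?_⟩
    · simp; omega
    · simp; omega

end

/-- The words of length `l` from the positions `q` and `b` on agree. -/
def Eqv {β : Type u} (u : ℕ → β) (b l q : ℕ) : Prop := ∀ i < l, u (q + i) = u (b + i)

section
variable {β : Type u} {u : ℕ → β} {b l m q g : ℕ}

theorem Eqv.mono {l' : ℕ} (h : Eqv u b l q) (hl : l' ≤ l) : Eqv u b l' q :=
  fun i hi => h i (by omega)

theorem Eqv.succ (h : Eqv u b m q) (hu : u (q + m) = u (b + m)) : Eqv u b (m + 1) q := by
  intro i hi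
  rcases Nat.lt_succ_iff_lt_or_eq.1 hi with hi | rfl
  exacts [h i hi, hu]

theorem Eqv.shift (h : Eqv u b m q) (hg : Bor u b m g) : Eqv u b g (q + (m - g)) := by
  intro i hi
  have := hg.1
  rw [hg.2 i hi, show q + (m - g) + i = q + (m - g + i) by omega, h _ (by omega)]
  congr 1; omega

/-- No occurrence is skipped by the shift. -/
theorem Eqv.not_between (h : Eqv u b m q) (hu : u (q + m) ≠ u (b + m))
    (hg : ∀ f, Bor u b m f → f ≤ g) (hml : m ≤ l) {q' : ℕ} (h1 : q ≤ q') (h2 : q' < q + (m - g)) :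
    ¬ Eqv u b (l + 1) q' := by
  intro hq
  obtain ⟨d, rfl⟩ : ∃ d, q' = q + d := ⟨q' - q, by omega⟩
  rcases Nat.eq_zero_or_pos d with rfl | hd
  · exact hu (hq m (by omega))
  · have : Bor u b m (m - d) := by
      refine ⟨by omega, fun i hi => ?_⟩
      rw [← hq i (by omega), show q + d + i = q + (d + i) by omega, h _ (by omega)]
      congr 1; omega
    have := hg _ this
    omega

end

/-- Search for occurrences that overlap with the phrase. -/
def overlapLoop : Cmd :=
  .while (.pos .go) (
   .xx ::= .add .q .m ;; .xx ::= .get .ID .xx ;; .yy ::= .add .b .m ;; .yy ::= .get .ID .yy ;;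
   .ite (.eq .xx .yy)
     (.m ::= .off .m 1 ;;
       .ite (.lt .l .m) (.l ::= .off .m 0 ;; .s ::= .off .q 0 ;; need ;; .go ::= .off .ok 0) .skip)
     (.ite (.pos .m)
        (piLoop ;; .g ::= .get .PI .m ;; .xx ::= .sub .m .g ;; .q ::= .add .q .xx ;; .m ::= .off .g 0)
        (.q ::= .off .q 1) ;;
      .ite (.lt .q .b) .skip (.go ::= .num 0)))

/-- The first candidate is `max a (b - l)`: an earlier one would either contain a forbidden position
or give a match beyond length `l` that ends before or at `b`, which the automaton has excluded. -/
def overlap : Cmd :=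
  .q ::= .sub .b .l ;; .ite (.lt .q .a) (.q ::= .off .a 0) .skip ;;
  .m ::= .num 0 ;; .t ::= .num 1 ;; .f ::= .num 0 ;; .x ::= .num 0 ;; .put .PI .t .x ;;
  .go ::= .num 0 ;; .ite (.lt .q .b) (.go ::= .num 1) .skip ;; overlapLoop

def ovVars : List Var :=
  [.q, .m, .t, .f, .x, .go, .xx, .yy, .l, .s, .j, .ok, .d, .res, .y, .cnt, .kk, .c, .rt, .p, .e, .i,
    .g]

def ovArrs : List Arr := [.PI, .stk, .key, .lev, .L, .R, .hf, .pr, .ID]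

/-- The result of the search among the positions from `q₀` on. -/
structure Found {α : Type u} [LinearOrder α] (T : List α) (b q₀ : ℕ) (s s' : VS α) : Prop where
  le : s.r .l ≤ s'.r .l
  eq : s'.r .l = s.r .l → s'.r .s = s.r .s
  lt : s.r .l < s'.r .l → q₀ ≤ s'.r .s ∧ s'.r .s < b ∧ Eqv (T[·]?) b (s'.r .l) (s'.r .s) ∧
    ∀ q, q₀ ≤ q → q < s'.r .s → ¬ Eqv (T[·]?) b (s'.r .l) q

section
variable {α : Type u} [LinearOrder α] {N : ℕ} {s s' : VS α} {T : List α}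

-- This is Knuth-Morris-Pratt search for the text from `b` on in the text from `q₀` on, with `q` the
-- candidate start and `m` its matched length. The record `l`, `s` is replaced only by a strictly
-- longer match, and no earlier candidate reaches length `l + 1`, so the recorded start is the
-- leftmost one for its length. A symbol beyond the record is requested only when the record
-- improves.
set_option maxHeartbeats 1000000 in
theorem wp_overlapLoop {b q₀ : ℕ} {s2 : VS α} (hI2 : Inp T s2) (hb : s2.r .b = b)
    (hN : 2 * T.length + 4 ≤ N)
    (hi : s2.r .i = b + s2.r .l + 1) (hq : s2.r .q = q₀) (hqb : q₀ ≤ b) (hm : s2.r .m = 0)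
    (ht : s2.r .t = 1) (hf : s2.r .f = 0) (hPI : s2.m .PI 1 = 0)
    (hgo : 0 < s2.r .go ↔ q₀ < b) :
    wp N overlapLoop s2 fun s' => KeepR ovVars ovArrs s2 s' ∧ Inp T s' ∧
      (∀ j < s2.r .i, s'.m .ID j = s2.m .ID j) ∧ s2.r .i ≤ s'.r .i ∧
      Found T b q₀ s2 s' ∧
      ((b + s'.r .l = T.length ∧ s'.r .i = T.length) ∨ (s'.r .i = b + s'.r .l + 1 ∧
        ∀ q, q₀ ≤ q → q < b → ¬ Eqv (T[·]?) b (s'.r .l + 1) q)) ∧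
      s'.clk + tS T * s2.r .i + 80 * q₀ ≤
        s2.clk + tS T * s'.r .i + 80 * (b + s'.r .l) + 20 * s'.r .l + 20 := by
  obtain ⟨Q, hQ⟩ : ∃ Q : VS α → Prop, Q = fun s' => KeepR ovVars ovArrs s2 s' ∧ Inp T s' ∧
      (∀ j < s2.r .i, s'.m .ID j = s2.m .ID j) ∧ s2.r .i ≤ s'.r .i ∧
      Found T b q₀ s2 s' ∧
      ((b + s'.r .l = T.length ∧ s'.r .i = T.length) ∨ (s'.r .i = b + s'.r .l + 1 ∧
        ∀ q, q₀ ≤ q → q < b → ¬ Eqv (T[·]?) b (s'.r .l + 1) q)) ∧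
      s'.clk + tS T * s2.r .i + 80 * q₀ ≤
        s2.clk + tS T * s'.r .i + 80 * (b + s'.r .l) + 20 * s'.r .l + 20 := ⟨_, rfl⟩
  rw [← hQ]
  obtain ⟨I, hI⟩ : ∃ I : VS α → Prop, I = fun s' => KeepR ovVars ovArrs s2 s' ∧ Inp T s' ∧
      (∀ j < s2.r .i, s'.m .ID j = s2.m .ID j) ∧ s2.r .i ≤ s'.r .i ∧
      Found T b q₀ s2 s' ∧
      (s'.r .m ≤ s'.r .l ∧ s'.r .q + s'.r .m ≤ b + s'.r .l ∧ q₀ ≤ s'.r .q ∧ s'.r .t ≤ s'.r .l + 1) ∧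
      Eqv (T[·]?) b (s'.r .m) (s'.r .q) ∧
      (∀ q, q₀ ≤ q → q < s'.r .q → ¬ Eqv (T[·]?) b (s'.r .l + 1) q) ∧
      (PiOk (T[·]?) b (s'.r .t) (s'.m .PI) ∧ BorNext (T[·]?) b (s'.r .t) (s'.r .f)) ∧
      (0 < s'.r .go → s'.r .q < b ∧ s'.r .i = b + s'.r .l + 1) ∧
      (s'.r .go = 0 → (b + s'.r .l = T.length ∧ s'.r .i = T.length) ∨
        (s'.r .i = b + s'.r .l + 1 ∧ b ≤ s'.r .q)) ∧
      s'.clk + 10 * s'.r .f + tS T * s2.r .i + 80 * q₀ + 20 ≤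
        s2.clk + tS T * s'.r .i + 40 * (2 * s'.r .q + s'.r .m) + 20 * s'.r .t := ⟨_, rfl⟩
  unfold overlapLoop
  -- A match raises `m`, and a shift by `d` with `m > 0` raises `q` by `d` and lowers `m` by `d`; in
  -- each case `2 * q + m` grows, and it stays bounded because `q + m ≤ b + l`.
  refine wp_while I (fun s' => 2 * T.length + 1 - (2 * s'.r .q + s'.r .m)) ?_ ?_ ?_
  · rw [hI]
    refine ⟨⟨fun _ _ => rfl, fun _ _ => rfl, rfl⟩, hI2, fun _ _ => rfl, le_rfl,
      ⟨le_rfl, fun _ => rfl, fun h => absurd h (lt_irrefl _)⟩, ⟨by omega, by omega, by omega, by omega⟩,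
      fun i h => by omega, fun q h1 h2 => by omega, ⟨fun x h1 h2 => ?_, ?_⟩, fun h => ⟨?_, hi⟩,
      fun h => ?_, by omega⟩
    · obtain rfl : x = 1 := by omega
      rw [hPI]
      exact ⟨Bor.zero Nat.one_pos, fun g hg => by have := hg.1; omega⟩
    · rw [ht, hf]
      exact ⟨Bor.zero Nat.one_pos, fun g hg hg2 => by have := hg2.1; omega⟩
    · rw [hq]; exact hgo.1 h
    · exact .inr ⟨hi, by rw [hq]; by_contra hc; have := hgo.2 (by omega); omega⟩
  · intro s3 h3 hpos
    simp only [Tst.Holds] at hpos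
    rw [hI] at h3
    obtain ⟨hk, hI3, hID, hi3, hF, ⟨hml, hqm, hq0, htl⟩, hE, hno, ⟨hP, hBN⟩, hgo1, -, hclk⟩ := h3
    obtain ⟨hqb3, hi3'⟩ := hgo1 hpos
    have hb3 : s3.r .b = b := by rw [hk.r _ (by decide), hb]
    have hiT := hI3.i_le
    have hiff := hI3.dict.id_eq (j := s3.r .q + s3.r .m) (k := b + s3.r .m) (by omega) (by omega)
    simp [wp_seq, wp_asg, wp_ite, wp_skip, Ex.Bd, Ex.eval, Tst.Holds, hb3, hiff]
    refine ⟨by omega, by omega, fun heq => ?_, fun hne => ?_⟩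
    · have hE' : Eqv (T[·]?) b (s3.r .m + 1) (s3.r .q) := hE.succ heq
      refine ⟨by omega, fun hlt => ?_, fun hge => ⟨?_, ?_⟩⟩
      · have hmleq : s3.r .m = s3.r .l := by omega
        generalize hs4 : VS.set _ Var.s (s3.r .q) = s4
        have hk34 : Keep [.xx, .yy, .m, .l, .s] [] s3 s4 := by
          rw [← hs4]
          refine ⟨fun z hz => ?_, fun a ha => rfl, rfl, rfl, rfl⟩
          simp at hz; simp [hz]
        have hl4 : s4.r .l = s3.r .l + 1 := by rw [← hs4]; simp [hmleq]
        have hs4s : s4.r .s = s3.r .q := by rw [← hs4]; simp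
        have hm4 : s4.r .m = s3.r .l + 1 := by rw [← hs4]; simp [hmleq]
        have hclk4 : s4.clk ≤ s3.clk + 10 := by rw [← hs4]; simp
        have hi4 : s4.r .i = s3.r .i := hk34.r _ (by decide)
        have hb4 : s4.r .b = b := by rw [hk34.r _ (by decide), hb3]
        refine wp_mono (wp_need (hI3.congr hk34 (by decide) (by decide)) (by omega) hN) ?_
        rintro s5 ⟨hk45, hI5, hID5, hi5, hor, hclk5⟩
        rw [hi4, hb4, hl4] at hor
        rw [hi4] at hclk5 hID5 hi5
        have hk35 : KeepR ovVars ovArrs s3 s5 := hk34.toR.trans hk45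
        have hl5 : s5.r .l = s3.r .l + 1 := by rw [hk45.r _ (by decide), hl4]
        have hs5 : s5.r .s = s3.r .q := by rw [hk45.r _ (by decide), hs4s]
        have hm5 : s5.r .m = s3.r .l + 1 := by rw [hk45.r _ (by decide), hm4]
        have hq5 : s5.r .q = s3.r .q := by rw [hk45.r _ (by decide), hk34.r _ (by decide)]
        have ht5 : s5.r .t = s3.r .t := by rw [hk45.r _ (by decide), hk34.r _ (by decide)]
        have hf5 : s5.r .f = s3.r .f := by rw [hk45.r _ (by decide), hk34.r _ (by decide)]
        have hPI5 : s5.m .PI = s3.m .PI := by rw [hk45.m _ (by decide), hk34.m _ (by decide)]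
        have hid4 : s4.m .ID = s3.m .ID := hk34.m _ (by decide)
        rw [hmleq] at hE'
        have hFle := hF.le
        refine ⟨?_, ?_⟩
        · rw [hI]
          have hset : Keep [.go] [] s5 (s5.set .go (s5.r .ok)) := by
            refine ⟨fun z hz => ?_, fun a ha => rfl, rfl, rfl, rfl⟩
            simp at hz; simp [hz]
          refine ⟨(hk.trans hk35 (vs'' := ovVars) (as'' := ovArrs)).trans hset.toR,
            hI5.congr hset (by decide) (by decide),
            fun j hj => ?_, ?_, ⟨?_, ?_, ?_⟩, ?_, ?_, ?_, ?_, ?_, ?_, ?_⟩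
          · simp only [VS.set_m]; rw [hID5 j (by omega), hid4, hID j hj]
          · simp; omega
          · simp; omega
          · simp; omega
          · simp [hl5, hs5]
            intro _
            exact ⟨hq0, hqb3, hE', fun q h1 h2 => hno q h1 h2⟩
          · simp [hl5, hm5, hq5, ht5]; omega
          · simp [hm5, hq5]; exact hE'
          · simp only [VS.set_r, reduceCtorEq, if_false, hl5, hq5]
            intro q h1 h2 h3
            exact hno q h1 h2 (h3.mono (by omega))
          · simp [ht5, hf5, hPI5]; exact ⟨hP, hBN⟩
          · simp [hq5, hl5]; omega
          · simp [hl5]; omega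
          · simp [hf5, hq5, hm5, ht5]; omega
        · rw [hq5, hm5]; omega
      · rw [hI]
        have hset : Keep [.xx, .yy, .m] [] s3 ((((((((s3.tick.set .xx (s3.r .q + s3.r .m)).set .xx
            (s3.m .ID (s3.r .q + s3.r .m))).set .yy (b + s3.r .m)).set .yy
            (s3.m .ID (b + s3.r .m))).tick).set .m (s3.r .m + 1)).tick).tick) := by
          refine ⟨fun z hz => ?_, fun a ha => rfl, rfl, rfl, rfl⟩
          simp at hz; simp [hz]
        refine ⟨hk.trans hset.toR, hI3.congr hset (by decide) (by decide), hID, ?_, ?_, ?_, ?_, ?_, ?_,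
          ?_, ?_, ?_⟩
        · simpa using hi3
        · exact ⟨by simpa using hF.le, by simpa using hF.eq, by simpa using hF.lt⟩
        · simp; omega
        · simpa using hE'
        · simpa using hno
        · simpa using ⟨hP, hBN⟩
        · simpa using hgo1
        · simp; omega
        · simp; omega
      · omega
    -- Shifting by the longest border and moving on by one position when nothing matches are
    -- finished by the same test against `b`.
    · have advance : ∀ s4 : VS α, Keep [.xx, .yy, .f, .t, .g, .q, .m] [.PI] s3 s4 →
          s3.r .q ≤ s4.r .q → 2 * s3.r .q + s3.r .m + 1 ≤ 2 * s4.r .q + s4.r .m →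
          s4.r .q ≤ b ∨ s4.r .q + s4.r .m = s3.r .q + s3.r .m → s4.r .m ≤ s3.r .m →
          s4.r .q + s4.r .m ≤ b + s3.r .l →
          Eqv (T[·]?) b (s4.r .m) (s4.r .q) →
          (∀ q, s3.r .q ≤ q → q < s4.r .q → ¬ Eqv (T[·]?) b (s3.r .l + 1) q) →
          PiOk (T[·]?) b (s4.r .t) (s4.m .PI) → BorNext (T[·]?) b (s4.r .t) (s4.r .f) →
          s4.r .t ≤ s3.r .l + 1 →
          s4.clk + 10 * s4.r .f + 20 * s3.r .t ≤ s3.clk + 10 * s3.r .f + 20 * s4.r .t + 36 →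
          wp N (.ite (.lt .q .b) .skip (.go ::= .num 0)) s4 fun s' => I s' ∧
            2 * T.length + 1 - (2 * s'.r .q + s'.r .m) <
              2 * T.length + 1 - (2 * s3.r .q + s3.r .m) := by
        intro s4 hk4 c1 c2 c3 c4 c5 c6 c7 c8 c9 c10 c11
        have hb4 : s4.r .b = b := by rw [hk4.r _ (by decide), hb3]
        have hl4 : s4.r .l = s3.r .l := hk4.r _ (by decide)
        have hi4 : s4.r .i = s3.r .i := hk4.r _ (by decide)
        have hs4 : s4.r .s = s3.r .s := hk4.r _ (by decide)
        have hgo4 : s4.r .go = s3.r .go := hk4.r _ (by decide)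
        have hid4 : s4.m .ID = s3.m .ID := hk4.m _ (by decide)
        have fin : ∀ s5 : VS α, Keep [.go] [] s4 s5 → s5.clk ≤ s4.clk + 2 →
            (0 < s5.r .go → s4.r .q < b) → (s5.r .go = 0 → b ≤ s4.r .q) → I s5 ∧
            2 * T.length + 1 - (2 * s5.r .q + s5.r .m) <
              2 * T.length + 1 - (2 * s3.r .q + s3.r .m) := by
          intro s5 hk5 d1 d2 d3
          have hk35 := hk4.trans hk5 (vs'' := [.xx, .yy, .f, .t, .g, .q, .m, .go]) (as'' := [.PI])
          have hl5 : s5.r .l = s3.r .l := hk35.r _ (by decide)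
          have hi5 : s5.r .i = s3.r .i := hk35.r _ (by decide)
          have hs5 : s5.r .s = s3.r .s := hk35.r _ (by decide)
          have hq5 : s5.r .q = s4.r .q := hk5.r _ (by decide)
          have hm5 : s5.r .m = s4.r .m := hk5.r _ (by decide)
          have ht5 : s5.r .t = s4.r .t := hk5.r _ (by decide)
          have hf5 : s5.r .f = s4.r .f := hk5.r _ (by decide)
          have hPI5 : s5.m .PI = s4.m .PI := hk5.m _ (by decide)
          have hid5 : s5.m .ID = s3.m .ID := hk35.m _ (by decide)
          refine ⟨?_, by omega⟩
          rw [hI]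
          refine ⟨hk.trans hk35.toR, hI3.congr hk35 (by decide) (by decide), ?_, by omega,
            ⟨by rw [hl5]; exact hF.le, by rw [hl5, hs5]; exact hF.eq, by rw [hl5, hs5]; exact hF.lt⟩,
            by omega, by rw [hm5, hq5]; exact c6, ?_, by rw [ht5, hf5, hPI5]; exact ⟨c8, c9⟩, ?_, ?_, ?_⟩
          · rw [hid5]; exact hID
          · rw [hl5, hq5]
            intro q h1 h2
            rcases Nat.lt_or_ge q (s3.r .q) with h | h
            exacts [hno q h1 h, c7 q h h2]
          · intro h; have := d2 h; omega
          · intro h; have := d3 h; omega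
          · rw [hf5, hi5, hq5, hm5, ht5]; omega
        simp [wp_ite, wp_skip, wp_asg, Tst.Holds, Ex.Bd, Ex.eval, hb4]
        refine ⟨fun hlt => ?_, fun hge => ?_⟩
        · refine fin _ ⟨fun z hz => rfl, fun a ha => rfl, rfl, rfl, rfl⟩ (by simp) (fun _ => hlt) ?_
          simp; omega
        · refine fin _ ?_ ?_ ?_ ?_
          · refine ⟨fun z hz => ?_, fun a ha => rfl, rfl, rfl, rfl⟩
            simp at hz; simp [hz]
          · simp
          · simp
          · simpa using hge
      refine ⟨fun hm0 => ?_, fun hm0 => ?_⟩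
      · generalize hs4 : VS.tick _ = s4
        have hk34 : Keep [.xx, .yy] [] s3 s4 := by
          rw [← hs4]
          refine ⟨fun z hz => ?_, fun a ha => rfl, rfl, rfl, rfl⟩
          simp at hz; simp [hz]
        have hclk4 : s4.clk = s3.clk + 7 := by rw [← hs4]; simp
        have hm4 : s4.r .m = s3.r .m := hk34.r _ (by decide)
        have hq4 : s4.r .q = s3.r .q := hk34.r _ (by decide)
        have ht4 : s4.r .t = s3.r .t := hk34.r _ (by decide)
        have hf4 : s4.r .f = s3.r .f := hk34.r _ (by decide)
        have hP4 : s4.m .PI = s3.m .PI := hk34.m _ (by decide)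
        refine wp_mono (wp_piLoop (hI3.dict.congr (s' := s4) (fun a _ => hk34.m a (by simp))
          (hk34.r _ (by decide)) (hk34.r _ (by decide))) (b := b) (by rw [hk34.r _ (by decide), hb3])
          (by omega) (by omega) (by rw [ht4, hP4]; exact hP) (by rw [ht4, hf4]; exact hBN)) ?_
        rintro s5 ⟨hk45, hP5, hB5, ht5, hclk5⟩
        have hk35 := hk34.trans hk45 (vs'' := [.xx, .yy, .f, .t]) (as'' := [.PI])
        have hm5 : s5.r .m = s3.r .m := hk35.r _ (by decide)
        have hq5 : s5.r .q = s3.r .q := hk35.r _ (by decide)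
        rw [hm4, ht4] at ht5
        rw [ht4, hf4, hclk4] at hclk5
        obtain ⟨hb1, hb2⟩ := hP5 (s3.r .m) hm0 (by omega)
        have hlt := hb1.1
        simp only [hm5, hq5]
        refine ⟨by omega, ?_⟩
        generalize hs6 : VS.set _ Var.m _ = s6
        have hk36 : Keep [.xx, .yy, .f, .t, .g, .q, .m] [.PI] s3 s6 := by
          refine hk35.trans (vs' := [.g, .xx, .q, .m]) (as' := []) (s'' := s6) ?_
          rw [← hs6]
          refine ⟨fun z hz => ?_, fun a ha => rfl, rfl, rfl, rfl⟩
          simp at hz; simp [hz]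
        have e1 : s6.r .q = s3.r .q + (s3.r .m - s5.m .PI (s3.r .m)) := by rw [← hs6]; simp
        have e2 : s6.r .m = s5.m .PI (s3.r .m) := by rw [← hs6]; simp
        have e3 : s6.r .t = s5.r .t := by rw [← hs6]; simp
        have e4 : s6.r .f = s5.r .f := by rw [← hs6]; simp
        have e5 : s6.m .PI = s5.m .PI := by rw [← hs6]; simp
        have e6 : s6.clk = s5.clk + 4 := by rw [← hs6]; simp
        have := advance s6 hk36 (by omega) (by omega) (by omega) (by omega) (by omega)
          (by rw [e1, e2]; exact hE.shift hb1)
          (fun q h1 h2 => hE.not_between hne hb2 hml h1 (by omega)) (by rw [e3, e5]; exact hP5)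
          (by rw [e3, e4]; exact hB5) (by omega) (by rw [e3, e4, e6]; omega)
        have hb6 : s6.r .b = b := by rw [hk36.r _ (by decide), hb3]
        have hb5 : s5.r .b = b := by rw [hk35.r _ (by decide), hb3]
        simp [wp_ite, wp_skip, wp_asg, Tst.Holds, Ex.Bd, Ex.eval, e1, e2, hb6] at this
        simpa only [hb5] using this
      · refine ⟨by omega, ?_⟩
        generalize hs6 : VS.set _ Var.q _ = s6
        have hk36 : Keep [.xx, .yy, .f, .t, .g, .q, .m] [.PI] s3 s6 := by
          rw [← hs6]
          refine ⟨fun z hz => ?_, fun a ha => rfl, rfl, rfl, rfl⟩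
          simp at hz; simp [hz]
        have e1 : s6.r .q = s3.r .q + 1 := by rw [← hs6]; simp
        have e2 : s6.r .m = 0 := by rw [← hs6]; simp [hm0]
        have e3 : s6.r .t = s3.r .t := by rw [← hs6]; simp
        have e4 : s6.r .f = s3.r .f := by rw [← hs6]; simp
        have e5 : s6.m .PI = s3.m .PI := by rw [← hs6]; simp
        have e6 : s6.clk ≤ s3.clk + 10 := by rw [← hs6]; simp
        have := advance s6 hk36 (by omega) (by omega) (by omega) (by omega) (by omega)
          (by rw [e2]; exact fun i hi => absurd hi (Nat.not_lt_zero _))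
          (fun q h1 h2 h3 => by
            obtain rfl : q = s3.r .q := by omega
            have := h3 0 (by omega)
            rw [hm0] at hne
            exact hne this) (by rw [e3, e5]; exact hP)
          (by rw [e3, e4]; exact hBN) (by omega) (by rw [e3, e4]; omega)
        have hb6 : s6.r .b = b := by rw [hk36.r _ (by decide), hb3]
        simp [wp_ite, wp_skip, wp_asg, Tst.Holds, Ex.Bd, Ex.eval, e1, e2, hb6] at this
        simpa [hm0] using this
  · intro s3 h3 hpos
    simp only [Tst.Holds, Nat.not_lt, Nat.le_zero] at hpos
    rw [hI] at h3
    obtain ⟨hk, hI3, hID, hi3, hF, ⟨hml, hqm, hq0, htl⟩, hE, hno, ⟨hP, hBN⟩, -, hgo0, hclk⟩ := h3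
    rw [hQ]
    refine ⟨hk.tick, hI3.congr (vs := []) (as := []) ⟨fun _ _ => rfl, fun _ _ => rfl, rfl, rfl, rfl⟩
      (by simp) (by simp), hID, hi3, ⟨hF.le, hF.eq, hF.lt⟩, ?_, ?_⟩
    · rcases hgo0 hpos with h | ⟨h1, h2⟩
      · exact .inl h
      · exact .inr ⟨h1, fun q h3 h4 => hno q h3 (by omega)⟩
    · simp; omega

end

section
variable {α : Type u} [LinearOrder α] {N : ℕ} {s s' : VS α} {T : List α}

/-- The window starts at most `l` positions before `b`, so the cost `80 * (b + l' - q₀) + 20 * l'`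
of the loop, with `l'` the final length, is at most `180 * l'` up to a constant. -/
theorem wp_overlap {b : ℕ} (hI : Inp T s) (hb : s.r .b = b) (hN : 2 * T.length + 4 ≤ N)
    (hi : s.r .i = b + s.r .l + 1) (ha : s.r .a ≤ b) :
    wp N overlap s fun s' => KeepR ovVars ovArrs s s' ∧ Inp T s' ∧
      (∀ j < s.r .i, s'.m .ID j = s.m .ID j) ∧ s.r .i ≤ s'.r .i ∧
      Found T b (max (s.r .a) (b - s.r .l)) s s' ∧
      ((b + s'.r .l = T.length ∧ s'.r .i = T.length) ∨ (s'.r .i = b + s'.r .l + 1 ∧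
        ∀ q, max (s.r .a) (b - s.r .l) ≤ q → q < b → ¬ Eqv (T[·]?) b (s'.r .l + 1) q)) ∧
      s'.clk + tS T * s.r .i ≤ s.clk + tS T * s'.r .i + 180 * s'.r .l + 40 := by
  obtain ⟨Q, hQ⟩ : ∃ Q : VS α → Prop, Q = fun s' => KeepR ovVars ovArrs s s' ∧ Inp T s' ∧
      (∀ j < s.r .i, s'.m .ID j = s.m .ID j) ∧ s.r .i ≤ s'.r .i ∧
      Found T b (max (s.r .a) (b - s.r .l)) s s' ∧
      ((b + s'.r .l = T.length ∧ s'.r .i = T.length) ∨ (s'.r .i = b + s'.r .l + 1 ∧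
        ∀ q, max (s.r .a) (b - s.r .l) ≤ q → q < b → ¬ Eqv (T[·]?) b (s'.r .l + 1) q)) ∧
      s'.clk + tS T * s.r .i ≤ s.clk + tS T * s'.r .i + 180 * s'.r .l + 40 := ⟨_, rfl⟩
  rw [← hQ]
  have main : ∀ s2 : VS α, Keep [.q, .m, .t, .f, .x, .go] [.PI] s s2 →
      s2.r .q = max (s.r .a) (b - s.r .l) → s2.r .m = 0 → s2.r .t = 1 → s2.r .f = 0 →
      s2.m .PI 1 = 0 → (0 < s2.r .go ↔ max (s.r .a) (b - s.r .l) < b) → s2.clk ≤ s.clk + 12 →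
      wp N overlapLoop s2 Q := by
    intro s2 hk hq hm ht hf hPI hgo hclk
    have hl2 : s2.r .l = s.r .l := hk.r _ (by decide)
    have hi2 : s2.r .i = s.r .i := hk.r _ (by decide)
    have hs2 : s2.r .s = s.r .s := hk.r _ (by decide)
    have hID2 : s2.m .ID = s.m .ID := hk.m _ (by decide)
    refine wp_mono (wp_overlapLoop (hI.congr hk (by decide) (by decide))
      ((hk.r _ (by decide)).trans hb) hN (by omega) hq (by omega) hm ht hf hPI hgo) ?_
    rintro s3 ⟨hk3, hI3, hID3, hi3, hF, hor, hclk3⟩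
    rw [hQ]
    rw [hi2] at hi3 hclk3 hID3
    rw [hID2] at hID3
    have hFle := hF.le
    refine ⟨hk.toR.trans hk3, hI3, hID3, hi3,
      ⟨by rw [← hl2]; exact hF.le, by rw [← hl2, ← hs2]; exact hF.eq, fun h => hF.lt (by rw [hl2]; exact h)⟩,
      hor, by omega⟩
  unfold overlap
  have fin : ∀ s2 : VS α, Keep [.q] [] s s2 → s2.r .q = max (s.r .a) (b - s.r .l) →
      s2.clk ≤ s.clk + 3 → wp N (.m ::= .num 0 ;; .t ::= .num 1 ;; .f ::= .num 0 ;; .x ::= .num 0 ;;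
        .put .PI .t .x ;; .go ::= .num 0 ;; .ite (.lt .q .b) (.go ::= .num 1) .skip ;;
        overlapLoop) s2 Q := by
    intro s2 hk hq hclk
    have hb2 : s2.r .b = b := (hk.r _ (by decide)).trans hb
    have h1N : 1 ≤ N := by omega
    simp only [wp_seq, wp_asg, wp_put, wp_ite, wp_skip, Ex.Bd, Ex.eval, Tst.Holds]
    refine ⟨by omega, h1N, by omega, by omega, by omega, fun hlt => ⟨h1N, ?_⟩, fun hge => ?_⟩
    · simp [hb2, hq] at hlt
      refine main _ (hk.trans (vs' := [.m, .t, .f, .x, .go]) (as' := [.PI]) (s'' := _) ?_)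
        ?_ ?_ ?_ ?_ ?_ ?_ ?_
      · refine ⟨fun z hz => ?_, fun a ha => ?_, rfl, rfl, rfl⟩
        · simp at hz; simp [hz]
        · simp at ha; simp [ha]
      all_goals simp [hq, hlt]
      omega
    · simp [hb2, hq] at hge
      refine main _ (hk.trans (vs' := [.m, .t, .f, .x, .go]) (as' := [.PI]) (s'' := _) ?_)
        ?_ ?_ ?_ ?_ ?_ ?_ ?_
      · refine ⟨fun z hz => ?_, fun a ha => ?_, rfl, rfl, rfl⟩
        · simp at hz; simp [hz]
        · simp at ha; simp [ha]
      all_goals simp [hq]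
      all_goals omega
  rw [wp_seq, wp_asg]
  refine ⟨trivial, ?_⟩
  rw [wp_seq, wp_ite]
  simp only [Ex.eval, Tst.Holds, hb]
  refine ⟨fun hlt => ?_, fun hge => ?_⟩
  · simp at hlt
    rw [wp_asg]
    refine ⟨.inl rfl, ?_⟩
    refine fin _ ?_ ?_ ?_
    · refine ⟨fun z hz => ?_, fun a ha => rfl, rfl, rfl, rfl⟩
      simp at hz; simp [hz]
    · simp [Ex.eval]; omega
    · simp
  · simp at hge
    rw [wp_skip]
    refine fin _ ?_ ?_ ?_
    · refine ⟨fun z hz => ?_, fun a ha => rfl, rfl, rfl, rfl⟩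
      simp at hz; simp [hz]
    · simp; omega
    · simp

end

/-! ### Finding the next phrase -/

/-- The position `s` is the leftmost starting position of the word `u[b..b+l)` in `w[0..b)`. -/
def Leftmost (w u : ℕ → ℕ) (b l s : ℕ) : Prop :=
  s + l ≤ b ∧ (∀ i < l, w (s + i) = u (b + i)) ∧
    ∀ q, q + l ≤ b → (∀ i < l, w (q + i) = u (b + i)) → s ≤ q

theorem Leftmost.congr {w u u' : ℕ → ℕ} {b l s : ℕ} (h : Leftmost w u b l s)
    (hu : ∀ i < l, u' (b + i) = u (b + i)) : Leftmost w u' b l s :=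
  ⟨h.1, fun i hi => by rw [hu i hi]; exact h.2.1 i hi, fun q hq hw =>
    h.2.2 q hq fun i hi => by rw [← hu i hi]; exact hw i hi⟩

theorem InMatch.congr {w : ℕ → ℕ} {n k : ℕ} {len fp u u' : ℕ → ℕ} {b v l : ℕ}
    (h : InMatch w n k len fp u b v l) (hu : ∀ i < l, u' (b + i) = u (b + i)) :
    InMatch w n k len fp u' b v l :=
  ⟨h.pos, h.le, h.le_len, h.ext, fun i hi => by rw [hu i hi]; exact h.eq i hi⟩

/-- Follow the transitions of the automaton as long as possible. -/
def walk : Cmd :=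
  .l ::= .num 0 ;; .s ::= .num 0 ;; .v ::= .num 1 ;; .go ::= .num 1 ;;
  .while (.pos .go) (
    .xx ::= .add .b .l ;; .c ::= .get .ID .xx ;; findE ;;
    .ite (.pos .res)
      (.v ::= .get .et .res ;; .l ::= .off .l 1 ;; .s ::= .get .fp .v ;; .s ::= .sub .s .l ;;
        need ;; .go ::= .off .ok 0)
      (.go ::= .num 0))

def walkVars : List Var :=
  [.l, .s, .v, .go, .xx, .c, .x, .kk, .y, .sd, .res, .kx, .j, .ok, .d, .cnt, .rt, .p, .e, .i]

section
variable {α : Type u} [LinearOrder α] {N B : ℕ} {s s' : VS α} {T : List α} {w : ℕ → ℕ}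

-- `InMatch` ties the current state to the matched word, and `fp v - l` is then the leftmost start.
-- The search ends either because a transition is missing, which excludes a longer match ending by
-- `b`, or because the text has ended. Each matched symbol costs one search for a transition;
-- receiving symbols is charged to `i`.
set_option maxHeartbeats 1000000 in
theorem wp_walk {b : ℕ} (hI : Inp T s) (hb : s.r .b = b) (hA : Aut w B b s)
    (hB : T.toFinset.card < 2 ^ B) (hN : 2 * T.length + 4 ≤ N)
    (hi : s.r .i = b + 1) (hok : s.r .ok = 1) :
    wp N walk s fun s' => KeepR walkVars needArrs s s' ∧ Inp T s' ∧
      (∀ j < s.r .i, s'.m .ID j = s.m .ID j) ∧ s.r .i ≤ s'.r .i ∧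
      Leftmost w (s'.m .ID) b (s'.r .l) (s'.r .s) ∧
      ((s'.r .ok = 0 ∧ s'.r .i = b + s'.r .l ∧ T.length = b + s'.r .l) ∨
        (s'.r .ok = 1 ∧ s'.r .i = b + s'.r .l + 1 ∧
          ∀ q, q + (s'.r .l + 1) ≤ b → ¬ ∀ i < s'.r .l + 1, w (q + i) = s'.m .ID (b + i))) ∧
      s'.clk + tS T * s.r .i ≤ s.clk + tS T * s'.r .i + tE B * (s'.r .l + 1) + 5 := by
  obtain ⟨δ, tab, hS, hT, -⟩ := hA
  obtain ⟨Q, hQ⟩ : ∃ Q : VS α → Prop, Q = fun s' => KeepR walkVars needArrs s s' ∧ Inp T s' ∧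
      (∀ j < s.r .i, s'.m .ID j = s.m .ID j) ∧ s.r .i ≤ s'.r .i ∧
      Leftmost w (s'.m .ID) b (s'.r .l) (s'.r .s) ∧
      ((s'.r .ok = 0 ∧ s'.r .i = b + s'.r .l ∧ T.length = b + s'.r .l) ∨
        (s'.r .ok = 1 ∧ s'.r .i = b + s'.r .l + 1 ∧
          ∀ q, q + (s'.r .l + 1) ≤ b → ¬ ∀ i < s'.r .l + 1, w (q + i) = s'.m .ID (b + i))) ∧
      s'.clk + tS T * s.r .i ≤ s.clk + tS T * s'.r .i + tE B * (s'.r .l + 1) + 5 := ⟨_, rfl⟩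
  rw [← hQ]
  obtain ⟨I, hII⟩ : ∃ I : VS α → Prop, I = fun s' => KeepR walkVars needArrs s s' ∧ Inp T s' ∧
      (∀ j < s.r .i, s'.m .ID j = s.m .ID j) ∧ s.r .i ≤ s'.r .i ∧
      Leftmost w (s'.m .ID) b (s'.r .l) (s'.r .s) ∧
      InMatch w b (s.r .k) (s.m .len) (s.m .fp) (s'.m .ID) b (s'.r .v) (s'.r .l) ∧
      s'.r .go ≤ 1 ∧
      (s'.r .go = 1 → s'.r .ok = 1 ∧ s'.r .i = b + s'.r .l + 1) ∧
      (s'.r .go = 0 → (s'.r .ok = 0 ∧ s'.r .i = b + s'.r .l ∧ T.length = b + s'.r .l) ∨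
        (s'.r .ok = 1 ∧ s'.r .i = b + s'.r .l + 1 ∧
          ∀ q, q + (s'.r .l + 1) ≤ b → ¬ ∀ i < s'.r .l + 1, w (q + i) = s'.m .ID (b + i))) ∧
      s'.clk + tS T * s.r .i + tE B * s'.r .go ≤
        s.clk + tS T * s'.r .i + tE B * (s'.r .l + 1) + 4 := ⟨_, rfl⟩
  have hKB : 12 * (B + 2) + 30 = tE B := rfl
  have h1N : 1 ≤ N := by omega
  unfold walk
  simp only [wp_seq, wp_asg, Ex.Bd, Ex.eval]
  refine ⟨by omega, by omega, h1N, h1N, ?_⟩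
  refine wp_while I (fun s' => 2 * (T.length + 1 - s'.r .l) + s'.r .go) ?_ ?_ ?_
  · rw [hII]
    have hset : Keep [.l, .s, .v, .go] [] s
        ((((s.set .l 0).set .s 0).set .v 1).set .go 1) := by
      refine ⟨fun z hz => ?_, fun a ha => rfl, rfl, rfl, rfl⟩
      simp at hz; simp [hz]
    refine ⟨hset.toR.trans (vs' := []) (as' := []) ⟨fun _ _ => rfl, fun _ _ => rfl, rfl⟩,
      hI.congr hset (by decide) (by decide), fun _ _ => rfl, by simp, ?_, ?_, by simp, ?_, ?_, ?_⟩
    · simp; exact ⟨Nat.zero_le _, fun i hi => by omega, fun q _ _ => Nat.zero_le _⟩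
    · simp; exact hS.inMatch_one
    · simp [hok, hi]
    · simp
    · simp; omega
  · intro s3 h3 hpos
    simp only [Tst.Holds] at hpos
    rw [hII] at h3
    obtain ⟨hk, hI3, hID, hi3, hL, hM, hgo, hgo1, -, hclk⟩ := h3
    have hgo3 : s3.r .go = 1 := by omega
    obtain ⟨hok3, hi3'⟩ := hgo1 hgo3
    rw [hgo3] at hclk
    have hb3 : s3.r .b = b := by rw [hk.r _ (by decide), hb]
    have hiT := hI3.i_le
    have hcle := hI3.dict.id_le (b + s3.r .l) (by omega)
    have hcnt := hI3.dict.cnt_le hiT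
    have hG : s3.m .ID (b + s3.r .l) < 2 ^ B := by omega
    have hk3 : s3.r .k = s.r .k := hk.r _ (by decide)
    simp only [wp_seq, wp_asg, Ex.Bd, Ex.eval]
    refine ⟨by simp [hb3]; omega, trivial, ?_⟩
    generalize hs4 : VS.set _ Var.c _ = s4
    have hk34 : Keep [.xx, .c] [] s3 s4 := by
      rw [← hs4]
      refine ⟨fun z hz => ?_, fun a ha => rfl, rfl, rfl, rfl⟩
      simp at hz; simp [hz]
    have hc4 : s4.r .c = s3.m .ID (b + s3.r .l) := by rw [← hs4]; simp [hb3]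
    have hv4 : s4.r .v = s3.r .v := hk34.r _ (by decide)
    have hclk4 : s4.clk = s3.clk + 3 := by rw [← hs4]; simp
    have hT4 : ETab B (s.r .k) δ tab s4 := hT.congr (fun a ha => by
        rw [hk34.m _ (by simp), hk.m _ ?_]
        revert a; decide) (by rw [hk34.r _ (by decide), hk.r _ (by decide)])
    have hD4 := (hI3.congr hk34 (by decide) (by decide)).dict
    have hcnt4 : s4.r .cnt = s3.r .cnt := hk34.r _ (by decide)
    refine wp_mono (hT4.wp_findE hv4 hc4 hM.pos hM.le (fun k hk => hD4.hf k (by omega))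
      (fun k hk => hD4.pr k (by omega))) ?_
    rintro s5 ⟨hk45, hne, hz, hclk5⟩
    have hk35 := hk34.trans hk45 (vs'' := [.xx, .c, .x, .kk, .y, .sd, .res, .kx]) (as'' := [])
    have hT5 : ETab B (s.r .k) δ tab s5 := hT4.congr (fun a ha => hk45.m a (by simp))
      (hk45.r _ (by decide))
    have hl5 : s5.r .l = s3.r .l := hk35.r _ (by decide)
    have hi5 : s5.r .i = s3.r .i := hk35.r _ (by decide)
    have hok5 : s5.r .ok = s3.r .ok := hk35.r _ (by decide)
    have hv5 : s5.r .v = s3.r .v := hk35.r _ (by decide)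
    have hb5 : s5.r .b = b := by rw [hk35.r _ (by decide), hb3]
    have hID5 : s5.m .ID = s3.m .ID := hk35.m _ (by simp)
    have hfp5 : s5.m .fp = s.m .fp := by rw [hk35.m _ (by simp), hk.m _ (by decide)]
    simp only [wp_ite, wp_seq, wp_asg, Ex.Bd, Ex.eval, Tst.Holds]
    refine ⟨fun hres => ⟨trivial, ?_, trivial, trivial, ?_⟩, fun hres => ⟨by omega, ?_, ?_⟩⟩
    · right; simp [hl5]; omega
    · obtain ⟨hδ, het⟩ := hT5.find_ne hM.pos hM.le (hne (by omega))
      have hM' := hS.inMatch_succ hM hG hδ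
      generalize hs6 : VS.set _ Var.s _ = s6
      have hk56 : Keep [.v, .l, .s] [] s5 s6 := by
        rw [← hs6]
        refine ⟨fun z hz => ?_, fun a ha => rfl, rfl, rfl, rfl⟩
        simp at hz; simp [hz]
      have hk36 := hk35.trans hk56 (vs'' := [.xx, .c, .x, .kk, .y, .sd, .res, .kx, .v, .l, .s])
        (as'' := [])
      have hv6 : s6.r .v = δ (s3.r .v) (s3.m .ID (b + s3.r .l)) := by rw [← hs6]; simp [het]
      have hl6 : s6.r .l = s3.r .l + 1 := by rw [← hs6]; simp [hl5]
      have hs6s : s6.r .s = s.m .fp (δ (s3.r .v) (s3.m .ID (b + s3.r .l))) - (s3.r .l + 1) := by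
        rw [← hs6]; simp [hl5, hfp5, het]
      have hi6 : s6.r .i = s3.r .i := hk36.r _ (by decide)
      have hb6 : s6.r .b = b := (hk36.r _ (by decide)).trans hb3
      have hclk6 : s6.clk = s5.clk + 5 := by rw [← hs6]; simp
      have hID6 : s6.m .ID = s3.m .ID := hk36.m _ (by simp)
      refine wp_mono (wp_need (hI3.congr hk36 (by decide) (by decide)) (by omega) hN) ?_
      rintro s7 ⟨hk67, hI7, hID7, hi7, hor, hclk7⟩
      rw [hi6] at hID7 hi7 hclk7
      rw [hi6, hb6, hl6] at hor
      rw [hID6] at hID7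
      have hl7 : s7.r .l = s3.r .l + 1 := by rw [hk67.r _ (by decide), hl6]
      have hv7 : s7.r .v = s6.r .v := hk67.r _ (by decide)
      have hs7 : s7.r .s = s6.r .s := hk67.r _ (by decide)
      have hset : Keep [.go] [] s7 (s7.set .go (s7.r .ok + 0)) := by
        refine ⟨fun z hz => ?_, fun a ha => rfl, rfl, rfl, rfl⟩
        simp at hz; simp [hz]
      have hcg : ∀ i < s3.r .l + 1, s7.m .ID (b + i) = s3.m .ID (b + i) :=
        fun i hi => hID7 _ (by omega)
      have hfple := hS.len_le_fp hM'.pos hM'.le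
      have hfpb := hS.fp_le hM'.pos hM'.le
      have hll := hM'.le_len
      refine ⟨?_, ?_, ?_⟩
      · simp
      · rw [hII]
        refine ⟨((hk.trans (hk36.toR.trans hk67 (vs'' := walkVars) (as'' := needArrs))
          (vs'' := walkVars) (as'' := needArrs)).trans hset.toR),
          hI7.congr hset (by decide) (by decide), fun j hj => ?_, ?_, ?_, ?_, ?_, ?_, ?_, ?_⟩
        · simp only [VS.set_m]; rw [hID7 j (by omega), hID j hj]
        · simp; omega
        · simp [hl7, hs7, hs6s]
          refine Leftmost.congr ⟨by omega, hM'.eq, fun q hq hw => hS.inMatch_min hM' hq hw⟩ hcg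
        · simp [hl7, hv7, hv6]
          exact hM'.congr hcg
        · simp; omega
        · simp [hl7]; omega
        · simp [hl7]; omega
        · simp [hl7]
          have : tE B * s7.r .ok ≤ tE B * 1 := Nat.mul_le_mul_left _ (by omega)
          have e : tE B * (s3.r .l + 1 + 1) = tE B * (s3.r .l + 1) + tE B := by ring
          omega
      · simp [hl7]; omega
    · have hres0 : s5.r .res = 0 := by omega
      have h0 := hT5.find_zero hM.pos hM.le hG (hz hres0).1
      have hset : Keep [.go] [] s5 (s5.tick.set .go 0) := by
        refine ⟨fun z hz => ?_, fun a ha => rfl, rfl, rfl, rfl⟩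
        simp at hz; simp [hz]
      rw [hII]
      have hk36 := hk35.trans hset (vs'' := [.xx, .c, .x, .kk, .y, .sd, .res, .kx, .go]) (as'' := [])
      have hs5 : s5.r .s = s3.r .s := hk35.r _ (by decide)
      refine ⟨hk.trans hk36.toR, hI3.congr hk36 (by decide) (by decide), fun j hj => ?_, ?_, ?_, ?_, ?_,
        ?_, ?_, ?_⟩
      · simp only [VS.set_m, VS.tick_m, hID5]; exact hID j hj
      · simp; omega
      · simp [hl5, hID5, hs5]; exact hL
      · simp [hl5, hID5, hv5]; exact hM
      · simp
      · simp
      · simp only [VS.set_r, VS.set_m, VS.tick_r, VS.tick_m, reduceCtorEq, if_false, hl5, hID5, hi5, hok5]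
        exact fun _ => .inr ⟨hok3, hi3', fun q hq => hS.inMatch_stop hM hG h0 hq⟩
      · simp [hl5, hi5]; omega
    · simp [hl5]; omega
  · intro s3 h3 hpos
    simp only [Tst.Holds, Nat.not_lt, Nat.le_zero] at hpos
    rw [hII] at h3
    obtain ⟨hk, hI3, hID, hi3, hL, hM, hgo, -, hgo0, hclk⟩ := h3
    rw [hQ]
    refine ⟨hk.tick, hI3.congr (vs := []) (as := []) ⟨fun _ _ => rfl, fun _ _ => rfl, rfl, rfl, rfl⟩
      (by simp) (by simp), hID, hi3, hL, hgo0 hpos, ?_⟩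
    rw [hpos] at hclk
    simp; omega

end

/-- A previous occurrence of the word of length `l` at `b` such that all positions before `b` that
belong to it satisfy `g`. -/
def Adm {α : Type u} (T : List α) (g : ℕ → Prop) (b l q : ℕ) : Prop :=
  b + l ≤ T.length ∧ q < b ∧ Eqv (T[·]?) b l q ∧ ∀ j, q ≤ j → j < b → j < q + l → g j

theorem Adm.mono {α : Type u} {T : List α} {g : ℕ → Prop} {b l l' q : ℕ} (h : Adm T g b l q)
    (hl : l' ≤ l) : Adm T g b l' q := by
  have h1 := h.1
  exact ⟨by omega, h.2.1, h.2.2.1.mono hl, fun j h1 h2 h3 => h.2.2.2 j h1 h2 (by omega)⟩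

/-- Find the next phrase. -/
def search : Cmd := walk ;; .ite (.pos .ok) overlap .skip

def searchVars : List Var :=
  [.l, .s, .v, .go, .xx, .c, .x, .kk, .y, .sd, .res, .kx, .j, .ok, .d, .cnt, .rt, .p, .e, .i,
    .q, .m, .t, .f, .yy, .g]

/-- The next phrase is given by `l` and `s`. -/
structure Next {α : Type u} [LinearOrder α] (T : List α) (g : ℕ → Prop) (b : ℕ) (s : VS α) :
    Prop where
  le : b + s.r .l ≤ T.length
  adm : 1 ≤ s.r .l → Adm T g b (s.r .l) (s.r .s)
  least : ∀ q < s.r .s, 1 ≤ s.r .l → ¬ Adm T g b (s.r .l) q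
  max : ∀ q, ¬ Adm T g b (s.r .l + 1) q

section
variable {α : Type u} [LinearOrder α] {N B : ℕ} {s s' : VS α} {T : List α} {w : ℕ → ℕ}
variable {g : ℕ → Prop} {b i : ℕ}

/-- The letters at forbidden positions are at least `2 ^ B`, larger than every symbol number, so a
match avoids them; elsewhere equal numbers mean equal symbols. This holds only for occurrences that
end at or before `b`, where `w` is defined by known heights. -/
theorem adm_iff (hD : Dict T i s) (hcnt : s.r .cnt < 2 ^ B)
    (hw : ∀ j < b, (g j → w j = s.m .ID j) ∧ (¬ g j → 2 ^ B ≤ w j)) {l q : ℕ}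
    (hq : q + l ≤ b) (hl : 1 ≤ l) (hi : b + l ≤ i) (hiT : i ≤ T.length) :
    (∀ i < l, w (q + i) = s.m .ID (b + i)) ↔ Adm T g b l q := by
  constructor
  · intro h
    have hg : ∀ j < l, g (q + j) := by
      intro j hj
      by_contra hc
      have h1 := (hw (q + j) (by omega)).2 hc
      have h2 := hD.id_le (b + j) (by omega)
      rw [h j hj] at h1
      omega
    refine ⟨by omega, by omega, fun j hj => ?_, fun j h1 h2 h3 => ?_⟩
    · refine (hD.id_eq (by omega) (by omega)).1 ?_
      rw [← h j hj, (hw (q + j) (by omega)).1 (hg j hj)]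
    · have := hg (j - q) (by omega)
      rwa [Nat.add_sub_cancel' h1] at this
  · rintro ⟨-, -, h2, h3⟩ j hj
    rw [(hw (q + j) (by omega)).1 (h3 _ (by omega) (by omega) (by omega))]
    exact (hD.id_eq (by omega) (by omega)).2 (h2 j hj)

/-- If the second search improves on the first, its result is leftmost because no candidate before
its window is admissible for the longer length. If not, the result of the walk is leftmost among all
occurrences: one that starts further left with the same length would also end before `b`. -/
theorem wp_search (hI : Inp T s) (hb : s.r .b = b) (hA : Aut w B b s)
    (hB : T.toFinset.card < 2 ^ B) (hN : 2 * T.length + 4 ≤ N)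
    (hi : s.r .i = b + 1) (hok : s.r .ok = 1) (ha : s.r .a ≤ b)
    (hga : ∀ j, s.r .a ≤ j → j < b → g j) (hgb : 0 < s.r .a → ¬ g (s.r .a - 1))
    (hw : ∀ j < b, (g j → w j = s.m .ID j) ∧ (¬ g j → 2 ^ B ≤ w j)) :
    wp N search s fun s' => KeepR searchVars ovArrs s s' ∧ Inp T s' ∧
      (∀ j < s.r .i, s'.m .ID j = s.m .ID j) ∧ s.r .i ≤ s'.r .i ∧ Next T g b s' ∧
      b + s'.r .l ≤ s'.r .i ∧ s'.r .i ≤ b + s'.r .l + 1 ∧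
      s'.clk + tS T * s.r .i ≤
        s.clk + tS T * s'.r .i + (tE B + 180) * (s'.r .l + 1) + 50 := by
  unfold search
  rw [wp_seq]
  refine wp_mono (wp_walk hI hb hA hB hN hi hok) ?_
  rintro s1 ⟨hk1, hI1, hID1, hi1, hL1, hor1, hclk1⟩
  have hiT1 := hI1.i_le
  have hcnt1 := hI1.dict.cnt_le hiT1
  have hw1 : ∀ j < b, (g j → w j = s1.m .ID j) ∧ (¬ g j → 2 ^ B ≤ w j) := by
    intro j hj; rw [hID1 j (by omega)]; exact hw j hj
  have hiff : ∀ {l q : ℕ}, q + l ≤ b → 1 ≤ l → b + l ≤ s1.r .i →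
      ((∀ i < l, w (q + i) = s1.m .ID (b + i)) ↔ Adm T g b l q) :=
    fun h1 h2 h3 => adm_iff hI1.dict (by omega) hw1 h1 h2 h3 hiT1
  have hbl : b + s1.r .l ≤ s1.r .i := by omega
  have hadm1 : 1 ≤ s1.r .l → Adm T g b (s1.r .l) (s1.r .s) :=
    fun h => (hiff hL1.1 h hbl).1 hL1.2.1
  have hleast1 : ∀ q < s1.r .s, 1 ≤ s1.r .l → ¬ Adm T g b (s1.r .l) q := by
    intro q hq hl h
    have h1 := hL1.1
    have := hL1.2.2 q (by omega) ((hiff (by omega) hl hbl).2 h)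
    omega
  have hmul : (tE B + 180) * (s1.r .l + 1) = tE B * (s1.r .l + 1) + 180 * (s1.r .l + 1) := by ring
  rw [wp_ite]
  simp only [Tst.Holds]
  refine ⟨fun hpos => ?_, fun hz => ?_⟩
  · obtain ⟨hok1, hi1', hleave⟩ : s1.r .ok = 1 ∧ s1.r .i = b + s1.r .l + 1 ∧
        ∀ q, q + (s1.r .l + 1) ≤ b → ¬ ∀ i < s1.r .l + 1, w (q + i) = s1.m .ID (b + i) := by
      rcases hor1 with h | h
      · exact absurd h.1 (by omega)
      · exact h
    have ha1 : s1.r .a = s.r .a := hk1.r _ (by decide)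
    -- Before the window, either the first `l + 1` symbols of the occurrence end by `b`, against the
    -- result of the walk, or the forbidden position `a - 1` belongs to it.
    have hfar : ∀ q l, s1.r .l + 1 ≤ l → q < max (s.r .a) (b - s1.r .l) → ¬ Adm T g b l q := by
      intro q l hl hq h
      rcases Nat.lt_or_ge q (b - s1.r .l) with h1 | h1
      · exact hleave q (by omega) ((hiff (by omega) (by omega) (by omega)).2 (h.mono hl))
      · exact hgb (by omega) (h.2.2.2 _ (by omega) (by omega) (by omega))
    have hb1 : s1.r .b = b := (hk1.r _ (by decide)).trans hb
    refine wp_mono (wp_overlap (hI1.congr (s' := s1.tick) (vs := []) (as := [])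
      ⟨fun _ _ => rfl, fun _ _ => rfl, rfl, rfl, rfl⟩ (by simp) (by simp)) hb1 hN hi1'
      (by simp; omega)) ?_
    simp only [VS.tick_r, VS.tick_m, VS.tick_clk, ha1]
    rintro s2 ⟨hk2, hI2, hID2, hi2, hF, hor2, hclk2⟩
    have hle := hF.le
    have heq := hF.eq
    have hlt := hF.lt
    simp only [VS.tick_r] at hle heq hlt
    have hiT2 := hI2.i_le
    have hmul2 : (tE B + 180) * (s2.r .l + 1) = tE B * (s2.r .l + 1) + 180 * (s2.r .l + 1) := by
      ring
    have hmul3 := Nat.mul_le_mul_left (tE B) (Nat.add_le_add_right hle 1)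
    refine ⟨⟨fun z hz => ?_, fun a ha => ?_, ?_⟩, hI2, fun j hj => ?_, by omega, ⟨by omega, ?_, ?_, ?_⟩,
      by omega, by omega, by omega⟩
    · simp [searchVars] at hz
      rw [hk2.r z (by simp [ovVars, hz]), VS.tick_r, hk1.r z (by simp [walkVars, hz])]
    · simp [ovArrs] at ha
      rw [hk2.m a (by simp [ovArrs, ha]), VS.tick_m, hk1.m a (by simp [needArrs, ha])]
    · rw [hk2.out, VS.tick_out, hk1.out]
    · rw [hID2 j (by omega), hID1 j hj]
    · intro hl
      rcases hle.eq_or_lt with h | h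
      · rw [heq h.symm, ← h]; exact hadm1 (by omega)
      · obtain ⟨h1, h2, h3, -⟩ := hlt h
        exact ⟨by omega, h2, h3, fun j h4 h5 h6 => hga j (by omega) h5⟩
    · intro q hq hl
      rcases hle.eq_or_lt with h | h
      · rw [heq h.symm] at hq; rw [← h] at hl ⊢; exact hleast1 q hq hl
      · obtain ⟨h1, h2, h3, h4⟩ := hlt h
        rcases Nat.lt_or_ge q (max (s.r .a) (b - s1.r .l)) with h5 | h5
        · exact hfar q _ (by omega) h5
        · exact fun h6 => h4 q h5 hq h6.2.2.1
    · intro q h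
      rcases Nat.lt_or_ge q (max (s.r .a) (b - s1.r .l)) with h5 | h5
      · exact hfar q _ (by omega) h5 h
      · have h6 := h.1
        rcases hor2 with ⟨h7, -⟩ | ⟨-, h7⟩
        · omega
        · exact h7 q h5 h.2.1 h.2.2.1
  -- The match already extends to the end of the text, so no longer phrase exists and the second
  -- search is omitted.
  · obtain ⟨hok1, hi1', hlen⟩ : s1.r .ok = 0 ∧ s1.r .i = b + s1.r .l ∧ T.length = b + s1.r .l := by
      rcases hor1 with h | h
      · exact h
      · exact absurd h.1 (by omega)
    rw [wp_skip]
    refine ⟨⟨fun z hz => ?_, fun a ha => ?_, hk1.out⟩, ?_, hID1, hi1, ⟨by simp; omega, hadm1, hleast1, ?_⟩,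
      hbl, ?_, ?_⟩
    · simp [searchVars] at hz
      exact hk1.r z (by simp [walkVars, hz])
    · simp [ovArrs] at ha
      exact hk1.m a (by simp [needArrs, ha])
    · exact hI1.congr (vs := []) (as := []) ⟨fun _ _ => rfl, fun _ _ => rfl, rfl, rfl, rfl⟩
        (by simp) (by simp)
    · intro q h
      have := h.1
      simp at this
      omega
    · simp; omega
    · simp; omega

end

/-! ### Properties of the greedy encoding -/

section
variable {α : Type u} {h b : ℕ} {T : List α} {H : List ℕ} {p : Phrase α} {E : List (Phrase α)}

theorem length_extendHeights : (extendHeights H p).length = H.length + p.len := by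
  cases p <;> simp [extendHeights, Phrase.len]

theorem heights_snoc : heights (E ++ [p]) = extendHeights (heights E) p := by
  simp [heights, List.foldl_append]

theorem coveredLen_snoc : coveredLen (E ++ [p]) = coveredLen E + p.len := by
  simp [coveredLen]

theorem length_heights (E : List (Phrase α)) : (heights E).length = coveredLen E := by
  induction E using List.reverseRecOn with
  | nil => rfl
  | append_singleton E p ih => rw [heights_snoc, length_extendHeights, coveredLen_snoc, ih]

theorem IsNextPhrase.isPhraseAt (hp : IsNextPhrase h T H p) : IsPhraseAt T H.length p := by
  obtain ⟨l, -, hp⟩ := hp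
  cases p with
  | lit c => exact hp.2
  | copy m s => obtain ⟨h1, rfl, h2⟩ := hp; exact ⟨h1, h2.1.1⟩

theorem IsNextPhrase.bounded (hp : IsNextPhrase h T H p) (hH : ∀ x ∈ H, x ≤ h) :
    ∀ x ∈ extendHeights H p, x ≤ h := by
  obtain ⟨l, -, hp⟩ := hp
  cases p with
  | lit c =>
    intro x hx
    simp only [extendHeights, List.mem_append, List.mem_singleton] at hx
    rcases hx with hx | rfl
    exacts [hH x hx, Nat.zero_le _]
  | copy m s =>
    obtain ⟨-, rfl, h2⟩ := hp
    intro x hx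
    simp only [extendHeights, List.mem_append, List.mem_map, List.mem_range] at hx
    rcases hx with hx | ⟨k, hk, rfl⟩
    exacts [hH x hx, h2.1.2 k hk]

/-- All phrases are chosen by the greedy rule. -/
def Greedy (h : ℕ) (T : List α) (E : List (Phrase α)) : Prop :=
  ∀ (j : ℕ) (p : Phrase α), E[j]? = some p → IsNextPhrase h T (heights (E.take j)) p

theorem Greedy.snoc (hE : Greedy h T E) (hp : IsNextPhrase h T (heights E) p) :
    Greedy h T (E ++ [p]) := by
  intro j q hq
  rcases lt_trichotomy j E.length with hj | rfl | hj
  · rw [List.getElem?_append_left hj] at hq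
    rw [List.take_append_of_le_length hj.le]
    exact hE j q hq
  · simp at hq ⊢
    subst hq; exact hp
  · rw [List.getElem?_eq_none (by simp; omega)] at hq
    simp at hq

theorem Greedy.of_snoc (hE : Greedy h T (E ++ [p])) :
    Greedy h T E ∧ IsNextPhrase h T (heights E) p := by
  constructor
  · intro j q hq
    have hj : j < E.length := (List.getElem?_eq_some_iff.1 hq).1
    have := hE j q (by rw [List.getElem?_append_left hj]; exact hq)
    rwa [List.take_append_of_le_length hj.le] at this
  · have := hE E.length p (by simp)
    simpa using this

theorem Greedy.isBounded (hE : Greedy h T E) : IsBounded h E := by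
  induction E using List.reverseRecOn with
  | nil => intro x hx; simp [heights] at hx
  | append_singleton E p ih =>
    unfold IsBounded
    rw [heights_snoc]
    exact hE.of_snoc.2.bounded (ih hE.of_snoc.1)

theorem Greedy.isLZEncoding (hE : Greedy h T E) (hc : coveredLen E = T.length) :
    IsLZEncoding T E :=
  ⟨hc, fun j p hp => by rw [← length_heights]; exact (hE j p hp).isPhraseAt⟩

/-- For offsets below `b - q` the reduction modulo `b - q` does nothing, and every other offset is
reduced to one of these. Hence the positions referred to are exactly those of the occurrence before
`b`. -/
theorem admissible_iff {g : ℕ → Prop} (hg : ∀ j < H.length, g j ↔ H.getD j 0 + 1 ≤ h) {l q : ℕ} :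
    Admissible h T H l q ↔ Adm T g H.length l q := by
  constructor
  · rintro ⟨⟨h1, h2, h3⟩, h4⟩
    refine ⟨h1, h2, h3, fun j h5 h6 h7 => (hg j h6).2 ?_⟩
    have := h4 (j - q) (by omega)
    rwa [Nat.mod_eq_of_lt (by omega), Nat.add_sub_cancel' h5] at this
  · rintro ⟨h1, h2, h3, h4⟩
    refine ⟨⟨h1, h2, h3⟩, fun k hk => ?_⟩
    have h5 := Nat.mod_lt k (show 0 < H.length - q by omega)
    have h6 := Nat.mod_le k (H.length - q)
    exact (hg _ (by omega)).1 (h4 _ (by omega) (by omega) (by omega))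

/-- Admissibility of a source is inherited by shorter lengths, so one occurrence of the maximal
length serves all `l'` in the greedy rule, and failure at the next length bounds all larger ones. -/
theorem Next.isNextPhrase [LinearOrder α] {s : VS α} {g : ℕ → Prop}
    (hg : ∀ j < H.length, g j ↔ H.getD j 0 + 1 ≤ h) (hs : Next T g H.length s)
    (hp : (s.r .l ≤ 1 ∧ ∃ c, p = .lit c ∧ T[H.length]? = some c) ∨
      (2 ≤ s.r .l ∧ p = .copy (s.r .l) (s.r .s))) : IsNextPhrase h T H p := by
  refine ⟨s.r .l, ⟨fun l' h1 h2 => ⟨s.r .s, (admissible_iff hg).2 ((hs.adm (by omega)).mono h2)⟩,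
    fun m hm => ?_⟩, ?_⟩
  · by_contra hc
    obtain ⟨q, hq⟩ := hm (s.r .l + 1) (by omega) (by omega)
    exact hs.max q ((admissible_iff hg).1 hq)
  · rcases hp with ⟨h1, c, rfl, h2⟩ | ⟨h1, rfl⟩
    · exact ⟨h1, h2⟩
    · refine ⟨h1, rfl, (admissible_iff hg).2 (hs.adm (by omega)), fun q hq => ?_⟩
      by_contra hc
      exact hs.least q (by omega) (by omega) ((admissible_iff hg).1 hq)

end

/-! ### The algorithm -/

/-- Output the phrase and store the heights of its positions. -/
def emitPhrase : Cmd :=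
  .t ::= .num 1 ;;
  .ite (.lt .t .l)
    (.outCopy .l .s ;; .q ::= .off .s 0 ;; .t ::= .off .b 0 ;; .e ::= .add .b .l ;;
      .while (.lt .t .e) (
        .x ::= .get .H .q ;; .x ::= .off .x 1 ;; .put .H .t .x ;; .t ::= .off .t 1 ;;
        .q ::= .off .q 1 ;; .ite (.eq .q .b) (.q ::= .off .s 0) .skip))
    (.outLit .b ;; .l ::= .num 1 ;; .x ::= .num 0 ;; .put .H .b .x)

theorem mod_succ_of_lt {k d : ℕ} (h : k % d + 1 < d) : (k + 1) % d = k % d + 1 := by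
  rw [Nat.add_mod, Nat.mod_eq_of_lt (show 1 < d by omega), Nat.mod_eq_of_lt h]

theorem mod_succ_of_eq {k d : ℕ} (h : k % d + 1 = d) : (k + 1) % d = 0 := by
  rcases Nat.lt_or_ge 1 d with h1 | h1
  · rw [Nat.add_mod, Nat.mod_eq_of_lt h1, h, Nat.mod_self]
  · obtain rfl : d = 1 := by omega
    exact Nat.mod_one _

section
variable {α : Type u} [LinearOrder α] {N B h b : ℕ} {s s' : VS α} {T : List α}

/-- Instead of a remainder, a source pointer runs cyclically through the positions from `s` to `b -
1`, and the heights read there are always those before the phrase. For found lengths `0` and `1` a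
literal is output and `l` is set to `1`, so afterwards `l` is the phrase length. -/
theorem wp_emitPhrase {H : List ℕ} (hI : Inp T s) (hb : s.r .b = b) (hHl : H.length = b)
    (hH : ∀ j < b, s.m .H j = H.getD j 0) (hHN : ∀ x ∈ H, x + 1 ≤ N) (hbi : b < s.r .i)
    (hs : 2 ≤ s.r .l → s.r .s < b) (hN : b + s.r .l + 1 ≤ N) :
    wp N emitPhrase s fun s' => ∃ p : Phrase α,
      ((s.r .l ≤ 1 ∧ ∃ c, p = .lit c ∧ T[b]? = some c) ∨
        (2 ≤ s.r .l ∧ p = .copy (s.r .l) (s.r .s))) ∧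
      Keep [.t, .q, .e, .x, .l] [.H] { s with out := s.out ++ [(p, s.r .i)] } s' ∧
      s'.r .l = p.len ∧ (∀ j < b + p.len, s'.m .H j = (extendHeights H p).getD j 0) ∧
      s'.clk ≤ s.clk + 10 * p.len + 10 := by
  have hiT := hI.i_le
  have htl : s.text.length = s.r .i := by rw [hI.text, List.length_take]; omega
  obtain ⟨Q, hQ⟩ : ∃ Q : VS α → Prop, Q = fun s' => ∃ p : Phrase α,
      ((s.r .l ≤ 1 ∧ ∃ c, p = .lit c ∧ T[b]? = some c) ∨
        (2 ≤ s.r .l ∧ p = .copy (s.r .l) (s.r .s))) ∧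
      Keep [.t, .q, .e, .x, .l] [.H] { s with out := s.out ++ [(p, s.r .i)] } s' ∧
      s'.r .l = p.len ∧ (∀ j < b + p.len, s'.m .H j = (extendHeights H p).getD j 0) ∧
      s'.clk ≤ s.clk + 10 * p.len + 10 := ⟨_, rfl⟩
  rw [← hQ]
  unfold emitPhrase
  simp only [wp_seq, wp_asg, wp_ite, Ex.Bd, Ex.eval, Tst.Holds]
  refine ⟨by omega, fun hlt => ?_, fun hge => ?_⟩
  · simp at hlt
    have hsb := hs hlt
    rw [wp_outCopy]
    refine ⟨by simp, by simp, by simp; omega, ?_⟩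
    obtain ⟨I, hII⟩ : ∃ I : VS α → Prop, I = fun s' =>
        Keep [.t, .q, .e, .x, .l] [.H]
          { s with out := s.out ++ [(.copy (s.r .l) (s.r .s), s.r .i)] } s' ∧
        s'.r .l = s.r .l ∧ s'.r .e = b + s.r .l ∧
        ∃ k, s'.r .t = b + k ∧ k ≤ s.r .l ∧ s'.r .q = s.r .s + k % (b - s.r .s) ∧
          (∀ j < b, s'.m .H j = H.getD j 0) ∧
          (∀ j < k, s'.m .H (b + j) = H.getD (s.r .s + j % (b - s.r .s)) 0 + 1) ∧
          s'.clk ≤ s.clk + 10 * k + 9 := ⟨_, rfl⟩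
    refine wp_while I (fun s' => b + s.r .l - s'.r .t) ?_ ?_ ?_
    · rw [hII]
      refine ⟨?_, by simp, by simp [hb], 0, by simp [hb], Nat.zero_le _, by simp, by simpa using hH,
        fun j hj => by omega, by simp⟩
      refine ⟨fun z hz => ?_, fun a ha => rfl, rfl, rfl, ?_⟩
      · simp at hz; simp [hz]
      · simp [htl]
    · intro s3 h3 hlt3
      rw [hII] at h3
      obtain ⟨hk, hl3, he3, k, ht3, hkl, hq3, hH1, hH2, hclk⟩ := h3
      simp only [Tst.Holds, ht3, he3] at hlt3
      have hmod := Nat.mod_lt k (show 0 < b - s.r .s by omega)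
      have hb3 : s3.r .b = b := (hk.r _ (by decide)).trans hb
      have hs3 : s3.r .s = s.r .s := hk.r _ (by decide)
      have hval : s3.m .H (s.r .s + k % (b - s.r .s)) = H.getD (s.r .s + k % (b - s.r .s)) 0 :=
        hH1 _ (by omega)
      have hvN : H.getD (s.r .s + k % (b - s.r .s)) 0 + 1 ≤ N := by
        rw [List.getD_eq_getElem _ _ (by omega)]
        exact hHN _ (List.getElem_mem _)
      simp [wp_seq, wp_asg, wp_put, wp_ite, wp_skip, Ex.Bd, Ex.eval, Tst.Holds, hb3, hs3, ht3, hq3,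
        hval]
      refine ⟨hvN, by omega, by omega, fun heq => ⟨?_, by omega⟩, fun hne => ⟨?_, by omega⟩⟩
      · rw [hII]
        refine ⟨hk.trans (vs' := [.x, .t, .q]) (as' := [.H]) (s'' := _) ?_, by simp [hl3],
          by simp [he3], k + 1, by simp; omega, by omega, ?_, fun j hj => ?_, fun j hj => ?_, ?_⟩
        · refine ⟨fun z hz => ?_, fun a ha => ?_, rfl, rfl, rfl⟩
          · simp at hz; simp [hz]
          · simp at ha; simp [ha]
        · rw [mod_succ_of_eq (by omega)]; simp
        · simp; rw [Function.update_of_ne (by omega)]; exact hH1 j hj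
        · simp
          rcases Nat.lt_succ_iff_lt_or_eq.1 hj with hj | rfl
          · rw [Function.update_of_ne (by omega)]; exact hH2 j hj
          · simp
        · simp; omega
      · rw [hII]
        refine ⟨hk.trans (vs' := [.x, .t, .q]) (as' := [.H]) (s'' := _) ?_, by simp [hl3],
          by simp [he3], k + 1, by simp; omega, by omega, ?_, fun j hj => ?_, fun j hj => ?_, ?_⟩
        · refine ⟨fun z hz => ?_, fun a ha => ?_, rfl, rfl, rfl⟩
          · simp at hz; simp [hz]
          · simp at ha; simp [ha]
        · rw [mod_succ_of_lt (by omega)]; simp; omega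
        · simp; rw [Function.update_of_ne (by omega)]; exact hH1 j hj
        · simp
          rcases Nat.lt_succ_iff_lt_or_eq.1 hj with hj | rfl
          · rw [Function.update_of_ne (by omega)]; exact hH2 j hj
          · simp
        · simp; omega
    · intro s3 h3 hlt3
      rw [hII] at h3
      obtain ⟨hk, hl3, he3, k, ht3, hkl, hq3, hH1, hH2, hclk⟩ := h3
      simp only [Tst.Holds, ht3, he3] at hlt3
      obtain rfl : k = s.r .l := by omega
      rw [hQ]
      refine ⟨.copy (s.r .l) (s.r .s), .inr ⟨hlt, rfl⟩, hk.trans (vs' := []) (as' := [])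
        ⟨fun _ _ => rfl, fun _ _ => rfl, rfl, rfl, rfl⟩, hl3, fun j hj => ?_, ?_⟩
      · simp only [VS.tick_m, extendHeights, hHl]
        rcases Nat.lt_or_ge j b with h1 | h1
        · rw [List.getD_append _ _ _ _ (by omega)]; exact hH1 j h1
        · rw [List.getD_append_right _ _ _ _ (by omega), hHl]
          simp only [Phrase.len] at hj
          rw [List.getD_eq_getElem _ _ (by simp; omega)]
          have := hH2 (j - b) (by omega)
          rw [Nat.add_sub_cancel' h1] at this
          simpa using this
      · simp [Phrase.len]; omega
  · simp at hge
    have hTb : b < T.length := by omega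
    have htb : s.text[b]? = some T[b] := by
      rw [hI.text, List.getElem?_take_of_lt hbi, List.getElem?_eq_getElem hTb]
    refine wp_outLit T[b] (by simp [hb, htb]) ?_
    refine ⟨by omega, by omega, ?_⟩
    rw [wp_put, hQ]
    refine ⟨.lit T[b], .inl ⟨hge, _, rfl, List.getElem?_eq_getElem hTb⟩, ⟨fun z hz => ?_,
      fun a ha => ?_, rfl, rfl, ?_⟩, by simp [Phrase.len], fun j hj => ?_, ?_⟩
    · simp at hz; simp [hz]
    · simp at ha; simp [ha]
    · simp [htl]
    · simp only [Phrase.len] at hj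
      simp [extendHeights, hb]
      rcases Nat.lt_succ_iff_lt_or_eq.1 hj with h1 | rfl
      · rw [Function.update_of_ne (by omega), hH j h1, List.getElem?_append_left (by omega)]
        simp
      · simp [← hHl]
    · simp [Phrase.len]

end

/-- The text in which the automaton searches: the positions where the height is too large are marked
by letters that occur only once. -/
def word {α : Type u} (h B : ℕ) (s : VS α) (j : ℕ) : ℕ :=
  if s.m .H j < h then s.m .ID j else 2 ^ B + j

/-- Extend the automaton by the positions of the phrase. -/
def insertLoop : Cmd :=
  .m ::= .add .b .l ;;
  .while (.lt .b .m) (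
    .t ::= .get .H .b ;;
    .ite (.lt .t .hh) extendGood (extendBad ;; .a ::= .off .b 1) ;;
    .b ::= .off .b 1)

def insertVars : List Var :=
  [.m, .t, .a, .b, .k, .cur, .y, .p, .c, .tgt, .go, .v, .x, .kk, .sd, .res, .kx, .ec, .q, .lq, .lp,
    .r, .e, .last]

/-- The positions from `a` to `b` satisfy `g`, and the position before them does not. -/
def GoodRun (g : ℕ → Prop) (b a : ℕ) : Prop :=
  a ≤ b ∧ (∀ j, a ≤ j → j < b → g j) ∧ (0 < a → ¬ g (a - 1))

section
variable {α : Type u} [LinearOrder α] {N B h b n : ℕ} {s s' : VS α} {T : List α} {w w' : ℕ → ℕ}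

/-- New heights and newly numbered symbols alter the word only from the phrase start on, whereas the
automaton stored so far depends on the letters before it. -/
theorem Aut.of_eq (hA : Aut w B n s) (hw : ∀ i < n, w i = w' i)
    (hv : ∀ v ∈ [Var.k, .last, .ec], s'.r v = s.r v)
    (ha : ∀ a ∈ [Arr.len, .fp, .link, .ek, .et, .eL, .eR, .enx, .tr, .head], s'.m a = s.m a) :
    Aut w' B n s' := by
  obtain ⟨δ, tab, hS, hT, hch, hlast, hk2⟩ := hA
  have e1 := hv .k (by decide)
  have e2 := hv .last (by decide)
  have e3 := ha .len (by decide)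
  have e4 := ha .fp (by decide)
  have e5 := ha .link (by decide)
  refine ⟨δ, tab, ?_, ?_, ?_, by rw [e2, e3, hlast], by rw [e1]; exact hk2⟩
  · rw [e1, e3, e4, e5]; exact hS.congr hw
  · rw [e1]
    exact hT.congr (fun a h => ha a (by revert a; decide)) (hv _ (by decide))
  · rw [e1, e2, e3, e4]
    exact ⟨hch.1, hch.2.1, Suf.congr hw (hS.fp_le hch.1 hch.2.1) le_rfl hch.2.2⟩

theorem Aut.congr (hA : Aut w B n s) (hw : ∀ i < n, w i = w' i) {vs : List Var} {as : List Arr}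
    (hk : KeepR vs as s s') (hv : ∀ v ∈ [Var.k, .last, .ec], v ∉ vs)
    (ha : ∀ a ∈ [Arr.len, .fp, .link, .ek, .et, .eL, .eR, .enx, .tr, .head], a ∉ as) :
    Aut w' B n s' :=
  hA.of_eq hw (fun v h => hk.r v (hv v h)) fun a h => hk.m a (ha a h)

theorem Aut.ec_le (hA : Aut w B n s) : s.r .ec ≤ 3 * n + 1 := by
  obtain ⟨δ, tab, hS, hT, -, -, hk⟩ := hA
  obtain ⟨E, hE1, hE2⟩ := hT.exists_finset
  have := hS.card_le E hE2
  omega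

theorem pot_congr (hw : ∀ i < n, w i = w' i) (m : ℕ) : pot w n m = pot w' n m := by
  unfold pot
  congr 1
  ext x
  simp only [Finset.mem_filter]
  exact and_congr_right fun _ => ⟨Nd.congr hw, Nd.congr fun i hi => (hw i hi).symm⟩

-- The potential, the edge count and the budget of each single extension telescope over the
-- positions of the phrase. At a forbidden position the run of permitted positions restarts behind
-- it, which is the value of `a` for the next search.
set_option maxHeartbeats 1000000 in
theorem wp_insertLoop (hI : Inp T s) (hb : s.r .b = b) (hwd : w = word h B s) (hA : Aut w B b s)
    (hB : T.toFinset.card < 2 ^ B) (hh : s.r .hh = h) (hN : 12 * T.length + 20 ≤ N)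
    (hbl : b + s.r .l ≤ s.r .i) (hR : GoodRun (fun j => s.m .H j < h) b (s.r .a)) :
    wp N insertLoop s fun s' => Keep insertVars extArrs s s' ∧ s'.r .b = b + s.r .l ∧
      Aut w B (b + s.r .l) s' ∧ GoodRun (fun j => s.m .H j < h) (b + s.r .l) (s'.r .a) ∧
      s'.clk + tE B * pot w (b + s.r .l) (b + s.r .l + 1) + tE B * s.r .ec ≤
        s.clk + tE B * pot w b (b + 1) + tE B * s'.r .ec + 7 * tE B * s.r .l + 5 := by
  have hiT := hI.i_le
  have hcnt := hI.dict.cnt_le hiT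
  have hKB : 12 * (B + 2) + 30 = tE B := rfl
  obtain ⟨Q, hQ⟩ : ∃ Q : VS α → Prop, Q = fun s' => Keep insertVars extArrs s s' ∧
      s'.r .b = b + s.r .l ∧
      Aut w B (b + s.r .l) s' ∧ GoodRun (fun j => s.m .H j < h) (b + s.r .l) (s'.r .a) ∧
      s'.clk + tE B * pot w (b + s.r .l) (b + s.r .l + 1) + tE B * s.r .ec ≤
        s.clk + tE B * pot w b (b + 1) + tE B * s'.r .ec + 7 * tE B * s.r .l + 5 := ⟨_, rfl⟩
  rw [← hQ]
  obtain ⟨I, hII⟩ : ∃ I : VS α → Prop, I = fun s' => Keep insertVars extArrs s s' ∧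
      s'.r .m = b + s.r .l ∧ ∃ d, d ≤ s.r .l ∧ s'.r .b = b + d ∧ Aut w B (b + d) s' ∧
      GoodRun (fun j => s.m .H j < h) (b + d) (s'.r .a) ∧
      s'.clk + tE B * pot w (b + d) (b + d + 1) + tE B * s.r .ec ≤
        s.clk + tE B * pot w b (b + 1) + tE B * s'.r .ec + 7 * tE B * d + 3 := ⟨_, rfl⟩
  unfold insertLoop
  simp only [wp_seq, wp_asg, Ex.Bd, Ex.eval]
  refine ⟨by omega, ?_⟩
  refine wp_while I (fun s' => b + s.r .l - s'.r .b) ?_ ?_ ?_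
  · rw [hII]
    have hset : Keep [.m] [] s (s.set .m (s.r .b + s.r .l)) := by
      refine ⟨fun z hz => ?_, fun a ha => rfl, rfl, rfl, rfl⟩
      simp at hz; simp [hz]
    refine ⟨hset.trans (Keep.refl [] [] _), by simp [hb], 0, Nat.zero_le _, by simp [hb], ?_, ?_, ?_⟩
    · exact hA.congr (fun _ _ => rfl) hset.toR (by decide) (by decide)
    · simpa using hR
    · simp; omega
  · intro s3 h3 hlt
    rw [hII] at h3
    obtain ⟨hk, hm3, d, hdl, hb3, hA3, hR3, hclk⟩ := h3
    simp only [Tst.Holds, hb3, hm3] at hlt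
    simp only [wp_seq, wp_asg, Ex.Bd, Ex.eval]
    refine ⟨trivial, ?_⟩
    generalize hs4 : VS.set _ Var.t _ = s4
    have hk34 : Keep [.t] [] s3 s4 := by
      rw [← hs4]
      refine ⟨fun z hz => ?_, fun a ha => rfl, rfl, rfl, rfl⟩
      simp at hz; simp [hz]
    have hk4 := hk.trans hk34 (vs'' := insertVars) (as'' := extArrs)
    have hH4 : s4.m .H = s.m .H := hk4.m _ (by decide)
    have hID4 : s4.m .ID = s.m .ID := hk4.m _ (by decide)
    have hhh4 : s4.r .hh = h := (hk4.r _ (by decide)).trans hh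
    have hone4 : s4.r .one = 1 := (hk4.r _ (by decide)).trans hI.one
    have ht4 : s4.r .t = s.m .H (b + d) := by
      rw [← hs4]; simp [hb3]; rw [hk.m _ (by decide)]
    have hb4 : s4.r .b = b + d := (hk34.r _ (by decide)).trans hb3
    have hm4 : s4.r .m = b + s.r .l := (hk34.r _ (by decide)).trans hm3
    have ha4 : s4.r .a = s3.r .a := hk34.r _ (by decide)
    have hec4 : s4.r .ec = s3.r .ec := hk34.r _ (by decide)
    have hclk4 : s4.clk = s3.clk + 2 := by rw [← hs4]; simp
    have hA4 : Aut w B (b + d) s4.tick := hA3.congr (fun _ _ => rfl) hk34.toR.tick (by decide) (by decide)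
    have hgood : ∀ j, s.m .H j < h → w j = s.m .ID j := fun j hj => by rw [hwd]; exact if_pos hj
    have hbad : ∀ j, ¬ s.m .H j < h → w j = 2 ^ B + j := fun j hj => by rw [hwd]; exact if_neg hj
    have hidB : ∀ j < s.r .i, s.m .ID j < 2 ^ B := fun j hj => by
      have := hI.dict.id_le j hj; omega
    have hmul : tE B * 7 = 7 * tE B := Nat.mul_comm _ _
    -- Both kinds of extension use at most six units `tE B` beyond potential and edges; the seventh
    -- covers the loop overhead.
    have step : ∀ s5 : VS α, Keep (.a :: extVars) extArrs s4 s5 → Aut w B (b + d + 1) s5 →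
        GoodRun (fun j => s.m .H j < h) (b + d + 1) (s5.r .a) →
        s5.clk + tE B * pot w (b + d + 1) (b + d + 2) + tE B * s4.r .ec ≤
          s4.clk + 2 + tE B * pot w (b + d) (b + d + 1) + tE B * s5.r .ec + 6 * tE B →
        (1 = 0 ∨ s5.r .b + 1 ≤ N) ∧ (I (s5.set .b (s5.r .b + 1)) ∧
          b + s.r .l - (s5.set .b (s5.r .b + 1)).r .b < b + s.r .l - s3.r .b) := by
      intro s5 hk5 hA5 hR5 hclk5
      have hb5 : s5.r .b = b + d := (hk5.r _ (by decide)).trans hb4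
      have hm5 : s5.r .m = b + s.r .l := (hk5.r _ (by decide)).trans hm4
      refine ⟨.inr (by omega), ?_, by simp [hb5, hb3]; omega⟩
      have hset : Keep [.b] [] s5 (s5.set .b (s5.r .b + 1)) := by
        refine ⟨fun z hz => ?_, fun a ha => rfl, rfl, rfl, rfl⟩
        simp at hz; simp [hz]
      rw [hII]
      refine ⟨(hk4.trans hk5 (vs'' := insertVars) (as'' := extArrs)).trans hset, by simp [hm5], d + 1,
        by omega, by simp [hb5]; omega, ?_, by simpa [Nat.add_assoc] using hR5, ?_⟩
      · exact hA5.congr (fun _ _ => rfl) hset.toR (by decide) (by decide)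
      · simp
        have e : 7 * tE B * (d + 1) = 7 * tE B * d + 7 * tE B := by ring
        rw [show b + (d + 1) = b + d + 1 by omega, e]
        rw [hec4] at hclk5
        rw [show b + d + 1 + 1 = b + d + 2 from rfl]
        omega
    rw [wp_ite]
    simp only [Tst.Holds, ht4, hhh4]
    refine ⟨fun hg => ?_, fun hg => ?_⟩
    · refine wp_mono (wp_extendGood hA4 hb4 hone4 ?_ ?_ ?_ (by omega)) ?_
      · rw [hgood _ hg]; exact hidB _ (by omega)
      · rw [VS.tick_m, hID4, hgood _ hg]
      · intro e he hwe k hke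
        have hge : s.m .H e < h := by
          by_contra hc
          rw [hbad e hc] at hwe; omega
        rw [hgood e hge] at hke
        have := hI.dict.id_le e (by omega)
        rw [VS.tick_m, hk4.m _ (by decide), hk4.m _ (by decide)]
        exact ⟨hI.dict.hf k (by omega), hI.dict.pr k (by omega)⟩
      · rintro s5 ⟨hk5, hA5, -, hclk5⟩
        have ha5 : s5.r .a = s3.r .a := (hk5.r _ (by decide)).trans ha4
        have hk45 : Keep (.a :: extVars) extArrs s4 s5 :=
          Keep.trans (vs := []) (as := []) (s' := s4.tick)
            ⟨fun _ _ => rfl, fun _ _ => rfl, rfl, rfl, rfl⟩ hk5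
        refine step s5 hk45 hA5 ?_ ?_
        · rw [ha5]
          refine ⟨by have := hR3.1; omega, fun j h1 h2 => ?_, hR3.2.2⟩
          rcases Nat.lt_succ_iff_lt_or_eq.1 h2 with h2 | rfl
          exacts [hR3.2.1 j h1 h2, hg]
        · simp at hclk5; omega
    · rw [wp_seq]
      refine wp_mono (wp_extendBad hA4 hb4 hone4 ?_ ?_ (by omega)) ?_
      · rw [hbad _ hg]; omega
      · intro e he
        rw [hbad _ hg]
        by_cases hge : s.m .H e < h
        · rw [hgood e hge]; have := hidB e (by omega); omega
        · rw [hbad e hge]; omega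
      · rintro s5 ⟨hk5, hA5, hec5, hclk5⟩
        have hb5 : s5.r .b = b + d := (hk5.r _ (by decide)).trans hb4
        have hset : Keep [.a] [] s5 (s5.set .a (s5.r .b + 1)) := by
          refine ⟨fun z hz => ?_, fun a ha => rfl, rfl, rfl, rfl⟩
          simp at hz; simp [hz]
        have hk45 : Keep (.a :: extVars) extArrs s4 (s5.set .a (s5.r .b + 1)) :=
          Keep.trans (vs := []) (as := []) (s' := s4.tick)
            ⟨fun _ _ => rfl, fun _ _ => rfl, rfl, rfl, rfl⟩
            (hk5.trans hset (vs'' := .a :: extVars) (as'' := extArrs))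
        rw [wp_asg]
        refine ⟨.inr (by omega), step _ hk45 (hA5.congr (fun _ _ => rfl) hset.toR (by decide) (by decide))
          ?_ ?_⟩
        · simp only [VS.set_r, if_true, Ex.eval, hb5]
          exact ⟨le_rfl, fun j h1 h2 => by omega, fun _ => hg⟩
        · simp at hclk5 hec5 ⊢; rw [hec5]; omega
  · intro s3 h3 hlt
    rw [hII] at h3
    obtain ⟨hk, hm3, d, hdl, hb3, hA3, hR3, hclk⟩ := h3
    simp only [Tst.Holds, hb3, hm3] at hlt
    obtain rfl : d = s.r .l := by omega
    rw [hQ]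
    have hset : Keep [] [] s3 s3.tick := ⟨fun _ _ => rfl, fun _ _ => rfl, rfl, rfl, rfl⟩
    refine ⟨hk.trans hset, hb3, hA3.congr (fun _ _ => rfl) hset.toR (by simp) (by simp), hR3, ?_⟩
    simp; omega

end

/-- Process one phrase. -/
def phraseStep : Cmd := search ;; emitPhrase ;; insertLoop ;; .l ::= .num 0

/-- The whole algorithm. -/
def lzhb (h : ℕ) : Cmd :=
  .one ::= .num 1 ;; .k ::= .num 1 ;; .last ::= .num 1 ;; .hh ::= .num h ;; need ;;
  .while (.pos .ok) (phraseStep ;; need)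

/-- The time per position. -/
def tP (B : ℕ) : ℕ := 9 * tE B + 500

/-- The encoding `E` of a prefix has been output. -/
structure Inv {α : Type u} [LinearOrder α] (T : List α) (h B c : ℕ) (s : VS α)
    (E : List (Phrase α)) : Prop where
  b : s.r .b = coveredLen E
  l : s.r .l = 0
  hh : s.r .hh = h
  out : s.out.map Prod.fst = E
  greedy : Greedy h T E
  onLine : ∀ (j : ℕ) (p : Phrase α) (m : ℕ), s.out[j]? = some (p, m) →
    m ≤ coveredLen (E.take (j + 1)) + 1
  H : ∀ j < coveredLen E, s.m .H j = (heights E).getD j 0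
  inp : Inp T s
  le_i : coveredLen E ≤ s.r .i
  i_le : s.r .i ≤ coveredLen E + 1
  aut : Aut (word h B s) B (coveredLen E) s
  run : GoodRun (fun j => s.m .H j < h) (coveredLen E) (s.r .a)
  clk : s.clk + tE B * pot (word h B s) (coveredLen E) (coveredLen E + 1) ≤
    tS T * s.r .i + tE B * s.r .ec + tP B * coveredLen E + c

section
variable {α : Type u} [LinearOrder α] {N B h c n : ℕ} {s s' : VS α} {T : List α}
variable {E : List (Phrase α)} {p : Phrase α} {H : List ℕ} {g g' : ℕ → Prop}

theorem GoodRun.congr {a b : ℕ} (hR : GoodRun g b a) (hg : ∀ j < b, g' j ↔ g j) :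
    GoodRun g' b a :=
  ⟨hR.1, fun j h1 h2 => (hg j h2).2 (hR.2.1 j h1 h2), fun h h' => hR.2.2 h
    ((hg _ (by have := hR.1; omega)).1 h')⟩

theorem extendHeights_getD {j : ℕ} (hj : j < H.length) :
    (extendHeights H p).getD j 0 = H.getD j 0 := by
  cases p <;> simp only [extendHeights] <;> exact List.getD_append _ _ _ _ hj

theorem Dict.empty (hm : ∀ a, s.m a = fun _ => 0) (h1 : s.r .rt = 0) (h2 : s.r .cnt = 0) :
    Dict T 0 s := by
  refine ⟨⟨.nil, 0, trivial, h1.symm, .nil, List.Pairwise.nil, fun x => ?_⟩, ?_, ?_, ?_, ?_, ?_, ?_, ?_,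
    ?_⟩
  · simp [h2]; omega
  all_goals simp [hm, h2]
  all_goals intros; omega

theorem Aut.empty {w : ℕ → ℕ} (hm : ∀ a, s.m a = fun _ => 0) (hk : s.r .k = 1)
    (hl : s.r .last = 1) (he : s.r .ec = 0) : Aut w B 0 s := by
  refine ⟨fun _ _ => 0, fun _ => .nil, by
    rw [hk]
    exact Sam.empty (congrFun (hm _) _) (congrFun (hm _) _) (congrFun (hm _) _) fun _ _ => rfl, ?_, ⟨by omega, by omega, ?_⟩, by rw [hm], by omega⟩
  · constructor
    · intros; trivial
    · intros; rw [hm]; rfl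
    · intros; trivial
    · intro v _ _ p hp; simp [Tr.ents] at hp
    · intros; simp
    · intros; simp [Tr.ents]
    · intro u v x _ _ _ _ hx; simp at hx
    · intro v c _ _ _ hc; exact absurd rfl hc
    · intros; omega
    · intros
      exact ⟨[], congrFun (hm _) _, List.nodup_nil, by simp⟩
  · rw [hm]; exact Suf.zero

/-- A number may be added at position `i` only, and `i` is at least the covered length, so the part
of the word stored in the automaton is the same. -/
theorem Inv.need (hI : Inv T h B c s E) (hN : 2 * T.length + 4 ≤ N) :
    wp N need s fun s' => Inv T h B (c + 10) s' E ∧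
      ((s'.r .ok = 1 ∧ s'.r .i = coveredLen E + 1) ∨
        (s'.r .ok = 0 ∧ T.length = coveredLen E)) := by
  have hb := hI.b
  have hl := hI.l
  have h1 := hI.le_i
  have h2 := hI.i_le
  refine wp_mono (wp_need hI.inp (by omega) hN) ?_
  rintro s1 ⟨hk, hI1, hID, hi, hor, hclk⟩
  rw [hb, hl] at hor
  have hH1 : s1.m .H = s.m .H := hk.m _ (by decide)
  have hw : ∀ j < coveredLen E, word h B s j = word h B s1 j := fun j hj => by
    unfold word; rw [hH1, hID j (by omega)]
  have hec : s1.r .ec = s.r .ec := hk.r _ (by decide)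
  refine ⟨⟨(hk.r _ (by decide)).trans hb, (hk.r _ (by decide)).trans hl,
    (hk.r _ (by decide)).trans hI.hh, by rw [hk.out]; exact hI.out, hI.greedy,
    by rw [hk.out]; exact hI.onLine, by rw [hH1]; exact hI.H, hI1, by omega, by omega,
    hI.aut.congr hw hk (by decide) (by decide), ?_, ?_⟩, by omega⟩
  · rw [hH1, hk.r _ (by decide)]; exact hI.run
  · have := hI.clk
    rw [← pot_congr hw, hec]
    omega

-- Each phrase has positive length and covers the found length, so `l + 1` is at most twice the
-- phrase length. The search then costs at most `2 * tE B` per position and the extension of the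
-- automaton `7 * tE B`, which makes up the `9 * tE B` in `tP`.
set_option maxHeartbeats 1000000 in
theorem Inv.phraseStep (hI : Inv T h B c s E) (hB : T.toFinset.card < 2 ^ B)
    (hN : 12 * T.length + h + 20 ≤ N) (hok : s.r .ok = 1) (hi : s.r .i = coveredLen E + 1)
    (hc : c ≤ tE B + 40) :
    wp N phraseStep s.tick fun s' => ∃ E', Inv T h B (tE B + 20) s' E' ∧ coveredLen E < coveredLen E' := by
  have hlen := length_heights E
  have hgl : ∀ j < (heights E).length, s.m .H j < h ↔ (heights E).getD j 0 + 1 ≤ h :=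
    fun j hj => by rw [hI.H j (by omega)]; exact Nat.lt_iff_add_one_le
  generalize hbE : coveredLen E = b at *
  have hInp : Inp T s.tick := hI.inp.congr (vs := []) (as := [])
    ⟨fun _ _ => rfl, fun _ _ => rfl, rfl, rfl, rfl⟩ (by simp) (by simp)
  have hA := hI.aut
  have hR := hI.run
  have hclk := hI.clk
  have hHs := hI.H
  rw [hbE] at hA hR hclk hHs
  unfold LZHB.phraseStep
  rw [wp_seq]
  refine wp_mono (wp_search (g := fun j => s.m .H j < h) hInp (hI.b.trans hbE)
    (hA.of_eq (fun _ _ => rfl) (fun _ _ => rfl) (fun _ _ => rfl)) hB (by omega) hi hok hR.1 hR.2.1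
    hR.2.2 fun j hj => ⟨fun hg => if_pos hg, fun hg => ?_⟩) ?_
  · unfold word; rw [if_neg hg]; omega
  simp only [VS.tick_r, VS.tick_m, VS.tick_clk]
  rintro s1 ⟨hk1, hI1, hID1, hi1, hNx, hbl1, hbl1', hclk1⟩
  have hH1 : s1.m .H = s.m .H := hk1.m _ (by decide)
  have hb1 : s1.r .b = b := (hk1.r _ (by decide)).trans (hI.b.trans hbE)
  have hle := hNx.le
  have hiT1 := hI1.i_le
  rw [wp_seq]
  refine wp_mono (wp_emitPhrase (H := heights E) hI1 hb1 hlen (by rw [hH1]; exact hHs)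
    (fun x hx => by have := hI.greedy.isBounded x hx; omega) (by omega)
    (fun h2 => (hNx.adm (by omega)).2.1) (by omega)) ?_
  rintro s2 ⟨p, hp, hk2, hl2, hH2, hclk2⟩
  have hnext : IsNextPhrase h T (heights E) p :=
    Next.isNextPhrase (s := s1) hgl (by rw [hlen]; exact hNx) (by rw [hlen]; exact hp)
  have hpl : p.len = max (s1.r .l) 1 := by
    rcases hp with ⟨h1, c, rfl, -⟩ | ⟨h1, rfl⟩ <;> simp only [Phrase.len] <;> omega
  have hpos : 1 ≤ p.len := by omega
  have hlow : ∀ j < b, s2.m .H j = s.m .H j := fun j hj => by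
    rw [hH2 j (by omega), extendHeights_getD (by omega), hHs j hj]
  have hID2 : s2.m .ID = s1.m .ID := hk2.m _ (by decide)
  have hw : ∀ j < b, word h B s j = word h B s2 j := fun j hj => by
    unfold word; rw [hlow j hj, hID2, hID1 j (by omega)]
  have hI1' : Inp T { s1 with out := s1.out ++ [(p, s1.r .i)] } :=
    ⟨hI1.i_le, hI1.text, hI1.rest, hI1.one, hI1.dict.congr (fun _ _ => rfl) rfl rfl⟩
  have hI2 : Inp T s2 := hI1'.congr hk2 (by decide) (by decide)
  have hA2 : Aut (word h B s2) B b s2 := by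
    refine hA.of_eq hw (fun v hv => ?_) fun a ha => ?_
    · rw [hk2.r v (by revert v; decide)]
      exact hk1.r v (by revert v; decide)
    · rw [hk2.m a (by revert a; decide)]
      exact hk1.m a (by revert a; decide)
  have hb2 : s2.r .b = b := (hk2.r _ (by decide)).trans hb1
  have hhh2 : s2.r .hh = h := (hk2.r _ (by decide)).trans ((hk1.r _ (by decide)).trans hI.hh)
  have ha2 : s2.r .a = s.r .a := (hk2.r _ (by decide)).trans (hk1.r _ (by decide))
  have hec2 : s2.r .ec = s.r .ec := (hk2.r _ (by decide)).trans (hk1.r _ (by decide))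
  have hi2 : s2.r .i = s1.r .i := hk2.r _ (by decide)
  have hout2 : s2.out = s.out ++ [(p, s1.r .i)] := by
    rw [hk2.out]; exact congrArg (· ++ _) hk1.out
  rw [wp_seq]
  refine wp_mono (wp_insertLoop hI2 hb2 rfl hA2 hB hhh2 (by omega) (by omega)
    (by rw [ha2]; exact hR.congr fun j hj => by rw [hlow j hj])) ?_
  rintro s3 ⟨hk3, hb3, hA3, hR3, hclk3⟩
  rw [hl2] at hb3 hA3 hR3 hclk3
  rw [wp_asg]
  refine ⟨Nat.zero_le _, ?_⟩
  have hset : Keep [.l] [] s3 (s3.set .l 0) := by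
    refine ⟨fun z hz => ?_, fun a ha => rfl, rfl, rfl, rfl⟩
    simp at hz; simp [hz]
  change ∃ E', Inv T h B (tE B + 20) (s3.set .l 0) E' ∧ _
  have hk4 := hk3.trans hset (vs'' := .l :: insertVars) (as'' := extArrs)
  generalize hs4 : s3.set .l 0 = s4 at *
  have hb4 : s4.r .b = b + p.len := (hset.r _ (by decide)).trans hb3
  have ha4 : s4.r .a = s3.r .a := hset.r _ (by decide)
  have hec4 : s4.r .ec = s3.r .ec := hset.r _ (by decide)
  have hi4 : s4.r .i = s1.r .i := (hk4.r _ (by decide)).trans hi2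
  have hH4 : s4.m .H = s2.m .H := hk4.m _ (by decide)
  have hw4 : word h B s4 = word h B s2 := by
    funext j; unfold word; rw [hH4, hk4.m .ID (by decide)]
  have hl4 : s4.r .l = 0 := by rw [← hs4]; simp
  have hclk4 : s4.clk = s3.clk + 1 := by rw [← hs4]; simp
  have hcov : coveredLen (E ++ [p]) = b + p.len := by rw [coveredLen_snoc, hbE]
  have hEl : E.length = s.out.length := by rw [← hI.out, List.length_map]
  refine ⟨E ++ [p], ⟨by rw [hcov, hb4], hl4, (hk4.r _ (by decide)).trans hhh2, ?_,
    hI.greedy.snoc hnext, ?_, ?_, hI2.congr hk4 (by decide) (by decide), by omega, by omega, ?_, ?_, ?_⟩,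
    by omega⟩
  · rw [hk4.out, hout2, List.map_append, hI.out]; rfl
  · intro j q m hq
    rw [hk4.out, hout2] at hq
    rcases lt_trichotomy j s.out.length with hj | hj | hj
    · rw [List.getElem?_append_left hj] at hq
      rw [List.take_append_of_le_length (by omega)]
      exact hI.onLine j q m hq
    · subst hj
      simp at hq
      obtain ⟨-, rfl⟩ := hq
      -- At the time of output `i` is at most `b + l + 1`, and the phrase covers at least `l`
      -- symbols.
      rw [List.take_of_length_le (by simp; omega), hcov]
      omega
    · rw [List.getElem?_eq_none (by simp; omega)] at hq
      simp at hq
  · rw [hcov, heights_snoc, hH4]; exact hH2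
  · rw [hcov, hw4]; exact hA3.congr (fun _ _ => rfl) hset.toR (by decide) (by decide)
  · rw [hcov, hH4, ha4]; exact hR3
  · rw [hcov, hw4, hi4, hec4, hclk4]
    rw [hec2, ← pot_congr hw] at hclk3
    have e1 : tP B * (b + p.len) = tP B * b + 9 * (tE B * p.len) + 500 * p.len := by
      unfold tP; ring
    have e2 : 7 * tE B * p.len = 7 * (tE B * p.len) := by ring
    have e3 : (tE B + 180) * (s1.r .l + 1) ≤ 2 * (tE B * p.len) + 360 * p.len := by
      calc _ ≤ (tE B + 180) * (2 * p.len) := Nat.mul_le_mul_left _ (by omega)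
        _ = _ := by ring
    omega

/-- The initial state. -/
def VS.init (T : List α) : VS α := ⟨fun _ => 0, fun _ _ => 0, [], T, [], 0⟩

/-- The additive constant in the invariant does not accumulate: `phraseStep` resets it to `tE B +
20`, each `need` adds 10, and the remaining allowance covers the final test. The loop stops only
when no symbol follows the covered part, so the output covers the whole text. -/
theorem wp_lzhb (hB : T.toFinset.card < 2 ^ B) (hN : 12 * T.length + h + 20 ≤ N) :
    wp N (lzhb h) (VS.init T) fun s' => Inv T h B (tE B + 40) s' (s'.out.map Prod.fst) ∧
      coveredLen (s'.out.map Prod.fst) = T.length := by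
  unfold lzhb
  simp only [wp_seq, wp_asg, Ex.Bd]
  refine ⟨by omega, by omega, by omega, by omega, ?_⟩
  generalize hs1 : VS.set _ Var.hh _ = s1
  have hm1 : ∀ a, s1.m a = fun _ => 0 := by intro a; rw [← hs1]; rfl
  have hI1 : Inv T h B (tE B + 20) s1 [] := by
    have hp := Nat.mul_le_mul_left (tE B) (pot_le (word h B s1) 0 1)
    have hD : Dict T 0 s1 := by rw [← hs1]; exact Dict.empty (fun _ => rfl) rfl rfl
    have hA : Aut (word h B s1) B 0 s1 := Aut.empty hm1 (by rw [← hs1]; rfl) (by rw [← hs1]; rfl)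
      (by rw [← hs1]; rfl)
    have hclk : s1.clk = 4 := by rw [← hs1]; rfl
    have hi : s1.r .i = 0 := by rw [← hs1]; rfl
    have ha : s1.r .a = 0 := by rw [← hs1]; rfl
    have hout : s1.out = [] := by rw [← hs1]; rfl
    have hcov : coveredLen ([] : List (Phrase α)) = 0 := rfl
    refine ⟨by rw [← hs1]; rfl, by rw [← hs1]; rfl, by rw [← hs1]; rfl, by rw [hout]; rfl,
      fun j p hp => by simp at hp, fun j p m hp => by simp [hout] at hp, fun j hj => by omega,
      ⟨by omega, by rw [← hs1]; rfl, by rw [← hs1]; rfl, by rw [← hs1]; rfl, by rw [hi]; exact hD⟩,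
      by omega, by omega, hA, ⟨by omega, fun j h1 h2 => by omega, by omega⟩, ?_⟩
    rw [hcov, hclk, Nat.zero_add]; omega
  refine wp_mono (hI1.need (by omega)) ?_
  rintro s2 ⟨hI2, hor2⟩
  refine wp_while (fun s => ∃ E, Inv T h B (tE B + 30) s E ∧
      ((s.r .ok = 1 ∧ s.r .i = coveredLen E + 1) ∨ (s.r .ok = 0 ∧ T.length = coveredLen E)))
    (fun s => T.length + 1 - s.r .b) ⟨[], hI2, hor2⟩ ?_ ?_
  · rintro s3 ⟨E, hI3, hor3⟩ hpos
    simp only [Tst.Holds] at hpos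
    obtain ⟨hok, hi⟩ : s3.r .ok = 1 ∧ s3.r .i = coveredLen E + 1 := by omega
    have hiT := hI3.inp.i_le
    rw [wp_seq]
    refine wp_mono (hI3.phraseStep hB hN hok hi (by omega)) ?_
    rintro s4 ⟨E', hI4, hlt⟩
    refine wp_mono (hI4.need (by omega)) ?_
    rintro s5 ⟨hI5, hor5⟩
    refine ⟨⟨E', hI5, hor5⟩, ?_⟩
    have e1 := hI3.b
    have e2 := hI5.b
    omega
  · rintro s3 ⟨E, hI3, hor3⟩ hpos
    simp only [Tst.Holds] at hpos
    have hout := hI3.out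
    obtain ⟨a1, a2, a3, a4, a5, a6, a7, a8, a9, a10, a11, a12, a13⟩ := hI3
    simp only [VS.tick_out, hout]
    refine ⟨⟨a1, a2, a3, a4, a5, a6, a7, ?_, a9, a10, ?_, a12, ?_⟩, by omega⟩
    · exact a8.congr (vs := []) (as := []) ⟨fun _ _ => rfl, fun _ _ => rfl, rfl, rfl, rfl⟩
        (by simp) (by simp)
    · exact a11.of_eq (fun _ _ => rfl) (fun _ _ => rfl) (fun _ _ => rfl)
    · have : word h B s3.tick = word h B s3 := rfl
      rw [this]; simp; omega

theorem Repr.init (N : ℕ) (T : List α) : Repr N (VS.init T) (State.init T) :=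
  ⟨fun _ => rfl, rfl, fun _ => Nat.zero_le _, fun _ _ => rfl, fun _ _ => Nat.zero_le _, rfl, rfl, rfl,
    Nat.zero_le _, Nat.zero_le _⟩

end
end LZHB

/-! ### The theorem -/

theorem mainTheorem6 (h : ℕ) :
    ∃ (P : LZHB.Prog) (C : ℕ), ∀ (α : Type u) [LinearOrder α] (T : List α),
      ∃ (S : LZHB.State α) (t : ℕ),
        LZHB.Exec P (LZHB.State.init T) S t ∧
        LZHB.IsLZEncoding T S.output ∧
        LZHB.IsBounded h S.output ∧
        LZHB.IsLZHB3 h T S.output ∧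
        S.OnLine ∧
        t ≤ C * (T.length * (Nat.log 2 T.toFinset.card + 1) + 1) ∧
        S.space ≤ C * (T.length + 1) ∧
        S.peak ≤ C * (T.length + 1) := by
  -- Stored heights are bounded by `h` and `N = 12 * n + h + 20`. The bound `20 * (N + 1)` on
  -- addresses and values therefore needs a multiple of `h` in the constant.
  refine ⟨(LZHB.lzhb h).comp, 10000 + 21 * h, fun α _ T => ?_⟩
  -- One bit more than the logarithm suffices for all symbol numbers; marker letters are the numbers
  -- from `2 ^ B` on.
  have hB : T.toFinset.card < 2 ^ (Nat.log 2 T.toFinset.card + 1) :=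
    Nat.lt_pow_succ_log_self (by omega) _
  obtain ⟨s, hrun, hI, hcov⟩ := LZHB.wp_lzhb (T := T) (h := h) hB le_rfl
  obtain ⟨S, t, hexec, hR, ht⟩ := hrun.exec (by omega) _ (LZHB.Repr.init _ T)
  have hout : S.output = s.out.map Prod.fst := by rw [LZHB.State.output, hR.out]
  have hL0 : T.length = 0 → Nat.log 2 T.toFinset.card = 0 := by
    intro h0
    rw [List.length_eq_zero_iff.1 h0]
    simp
  generalize hL : Nat.log 2 T.toFinset.card = L at *
  refine ⟨S, t, hexec, ?_, ?_, ⟨?_, ?_⟩, ?_, ?_, ?_, ?_⟩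
  · rw [hout]; exact hI.greedy.isLZEncoding hcov
  · rw [hout]; exact hI.greedy.isBounded
  · rw [hout]; exact hcov
  · rw [hout]; exact hI.greedy
  · intro j p m hj
    rw [hout]
    exact hI.onLine j p m (by rw [← hR.out]; exact hj)
  · have hc := hI.clk
    have hec := hI.aut.ec_le
    have hiT := hI.inp.i_le
    rw [hcov] at hc hec
    have h1 : LZHB.tS T * s.r .i ≤ LZHB.tS T * T.length := Nat.mul_le_mul_left _ hiT
    -- At most `3 * n + 1` edges exist at the end, so the part of the time charged to edges is also
    -- linear up to the logarithmic factor.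
    have h2 : LZHB.tE (L + 1) * s.r .ec ≤ LZHB.tE (L + 1) * (3 * T.length + 1) :=
      Nat.mul_le_mul_left _ hec
    -- The additive terms contain the logarithm alone; it vanishes for the empty text and is
    -- absorbed by the product otherwise.
    have h3 : L ≤ T.length * L := by
      rcases Nat.eq_zero_or_pos T.length with h0 | h0
      · rw [hL0 h0]; exact Nat.zero_le _
      · exact Nat.le_mul_of_pos_left _ h0
    have e1 : LZHB.tS T * T.length = 80 * (T.length * L) + 150 * T.length := by
      rw [LZHB.tS, hL]; ring
    have e2 : LZHB.tE (L + 1) * (3 * T.length + 1) =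
        36 * (T.length * L) + 198 * T.length + 12 * L + 66 := by
      rw [LZHB.tE]; ring
    have e3 : LZHB.tP (L + 1) * T.length = 108 * (T.length * L) + 1094 * T.length := by
      rw [LZHB.tP, LZHB.tE]; ring
    have e5 : LZHB.tE (L + 1) = 12 * L + 66 := by rw [LZHB.tE]; ring
    have e4 : (10000 + 21 * h) * (T.length * (L + 1) + 1) =
        10000 * (T.length * L) + 10000 * T.length + 10000 + 21 * h * (T.length * (L + 1) + 1) := by
      ring
    have h5 : s.clk ≤ LZHB.tS T * s.r .i + LZHB.tE (L + 1) * s.r .ec +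
        LZHB.tP (L + 1) * T.length + (LZHB.tE (L + 1) + 40) := le_trans (Nat.le_add_right _ _) hc
    have h6 : t ≤ 5 * s.clk := le_trans (Nat.le_add_right _ _) ht
    rw [e4]
    omega
  · have h1 := hR.top
    have h2 : S.text.length ≤ T.length := by
      rw [hR.text, hI.inp.text, List.length_take]; exact min_le_right _ _
    have e : (10000 + 21 * h) * (T.length + 1) =
        10000 * T.length + 10000 + 21 * h + 21 * h * T.length := by ring
    rw [LZHB.State.space, e]
    simp only [LZHB.numArr] at h1
    omega
  · have h1 := hR.peak
    have e : (10000 + 21 * h) * (T.length + 1) =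
        10000 * T.length + 10000 + 21 * h + 21 * h * T.length := by ring
    rw [e]
    simp only [LZHB.numArr] at h1
    omega
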